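/- **Setting.** Let $n\ge 1$ and let $\mathbb H^n=\mathbb R^n\times\mathbb R^n\times\mathbb R$ be the Heisenberg group, with points $p=(x,y,t)$, group law $$(x,y,t)\cdot(x',y',t')=\Big(x+x',\,y+y',\,t+t'+2\sum_{j=1}^n(x_j'y_j-x_jy_j')\Big),$$ Lebesgue measure, and the left-invariant frame $X_j=\partial_{x_j}+2y_j\partial_t$, $Y_j=\partial_{y_j}-2x_j\partial_t$ ($1\le j\le n$), $T=\partial_t$. Write $Z_1,\dots,Z_{2n+1}=X_1,\dots,X_n,Y_1,\dots,Y_n,T$. Let $\langle\cdot,\cdot\rangle$ be the Riemannian metric for which this frame is orthonormal and $|\cdot|$ its norm; for a vector field $b=\sum_j b_jZ_j$ one has $|b|^2=\sum_j b_j^2$ and $\langle b,\nabla\varphi\rangle=\sum_j b_jZ_j\varphi$, and $\operatorname{div}b$ is the distributional divergence, $\int\langle b,\nabla\varphi\rangle\,dp=-\int\varphi\operatorname{div}b\,dp$ for $\varphi\in C_c^\infty(\mathbb H^n)$. Let $d$ be the Carnot–Carathéodory distance: $d(p,q)$ is the infimum of the lengths of absolutely continuous curves from $p$ to $q$ that are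 tangent a.e. to $\operatorname{span}(X_1,\dots,X_n,Y_1,\dots,Y_n)$. For $q\in[1,\infty]$, $W^{2,q}_{\mathcal H}(\mathbb H^n)$ is the space of $f\in L^q(\mathbb H^n)$ whose distributional derivatives $Z_if$ and $Z_iZ_jf$, $1\le i,j\le 2n$, belong to $L^q(\mathbb H^n)$. For $\bar\tau\in(0,\infty]$, $L^\alpha(0,\bar\tau;L^\beta(\mathbb H^n))$ is the space of measurable functions $f$ on $(0,\bar\tau)\times\mathbb H^n$, modulo null sets, for which the $L^\alpha(0,\bar\tau)$ norm of $\tau\mapsto\|f(\tau,\cdot)\|_{L^\beta(\mathbb H^n)}$ is finite; $L^1(0,\bar\tau;W^{2,q}_{\mathcal H}(\mathbb H^n))$ consists of the $\psi$ such that $\psi$, $Z_i\psi$ and $Z_iZ_j\psi$ ($1\le i,j\le 2n$) belong to $L^1(0,\bar\tau;L^q(\mathbb H^n))$. **Theorem.** Let $\bar\tau\in(0,\infty]$, let $s\in[1,\infty]$ with Hölder conjugate $s'$, and let $u_0\in L^s(\mathbb H^n)$. Let $\psi\in L^1(0,\bar\tau;W^{2,s'}_{\mathcal H}(\mathbb H^n))$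 and let $b$ be the time-dependent contact vector field $$b=\sum_{j=1}^n\big(Y_j\psi\,X_j-X_j\psi\,Y_j\big)-4\psi\,T .$$ Assume that $c,\ \operatorname{div}b\in L^1(0,\bar\tau;L^\infty(\mathbb H^n))$ and that $$\frac{|b|}{1+d(p,0)}\in L^1(0,\bar\tau;L^1(\mathbb H^n))+L^1(0,\bar\tau;L^\infty(\mathbb H^n)).$$ Then there exists a unique $u\in L^\infty(0,\bar\tau;L^s(\mathbb H^n))$ that is a distributional solution of $$\partial_\tau u-\langle b,\nabla u\rangle+cu=0\ \text{ in }(0,\bar\tau)\times\mathbb H^n,\qquad u(0,\cdot)=u_0,$$ that is, such that $$-\int_{\mathbb H^n}u_0(p)\,\varphi(0,p)\,dp+\int_0^{\bar\tau}\!\!\int_{\mathbb H^n}u\,\big[-\partial_\tau\varphi+\langle b,\nabla\varphi\rangle+(c+\operatorname{div}b)\,\varphi\big]\,dp\,d\tau=0$$ for every $\varphi\in C_c^\infty([0,\bar\tau)\times\mathbb H^n)$. -/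

import Mathlib

open MeasureTheory Set Filter Topology
open scoped ENNReal

noncomputable section

/-! ## The Heisenberg group and its left-invariant frame -/

/-- The Heisenberg group `ℍⁿ` in the coordinates `(x, y, t) ∈ ℝⁿ × ℝⁿ × ℝ`. Its `volume` is the
Lebesgue measure of `ℝ²ⁿ⁺¹`. (The group law is `heisMul`, not the componentwise operations.) -/
abbrev Heis (n : ℕ) : Type := (Fin n → ℝ) × (Fin n → ℝ) × ℝ

/-- The group law of `ℍⁿ`. -/
def heisMul {n : ℕ} (p q : Heis n) : Heis n :=
  (p.1 + q.1, p.2.1 + q.2.1,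
    p.2.2 + q.2.2 + 2 * ∑ j, (q.1 j * p.2.1 j - p.1 j * q.2.1 j))

/-- Indices of the horizontal fields: `inl j` stands for `X_j`, `inr j` for `Y_j`. -/
abbrev HorIdx (n : ℕ) : Type := Fin n ⊕ Fin n

/-- Indices of the full frame: `inl i` is horizontal, `inr ()` stands for `T`. -/
abbrev FrameIdx (n : ℕ) : Type := HorIdx n ⊕ Unit

/-- The left-invariant frame `X_j = ∂_{x_j} + 2 y_j ∂_t`, `Y_j = ∂_{y_j} - 2 x_j ∂_t`, `T = ∂_t`,
orthonormal for the Riemannian metric of `ℍⁿ`. -/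
def heisZ {n : ℕ} : FrameIdx n → Heis n → Heis n
  | Sum.inl (Sum.inl j), p => (Pi.single j 1, 0, 2 * p.2.1 j)
  | Sum.inl (Sum.inr j), p => (0, Pi.single j 1, -(2 * p.1 j))
  | Sum.inr _, _ => (0, 0, 1)

/-- The frame consists of the left-invariant fields that extend the coordinate vectors at `0`. -/
theorem hasFDerivAt_heisMul_zero {n : ℕ} (p : Heis n) :
    ∃ L : Heis n →L[ℝ] Heis n, HasFDerivAt (fun q => heisMul p q) L 0 ∧
      ∀ i, L (heisZ i 0) = heisZ i p := by
  let L : Heis n →L[ℝ] Heis n := LinearMap.toContinuousLinearMap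
    { toFun := fun q => (q.1, q.2.1, q.2.2 + 2 * ∑ j, (q.1 j * p.2.1 j - p.1 j * q.2.1 j))
      map_add' := by
        intro q r
        simp only [Prod.fst_add, Prod.snd_add, Pi.add_apply, Prod.mk_add_mk, Prod.mk.injEq,
          true_and]
        rw [add_add_add_comm, ← mul_add, ← Finset.sum_add_distrib]
        congr 2
        exact Finset.sum_congr rfl fun j _ => by ring
      map_smul' := by
        intro a q
        simp only [Prod.smul_fst, Prod.smul_snd, Pi.smul_apply, smul_eq_mul, RingHom.id_apply,
          Prod.smul_mk, Prod.mk.injEq, true_and]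
        simp only [mul_add, Finset.mul_sum]
        congr 1
        exact Finset.sum_congr rfl fun j _ => by ring }
  have hL : (fun q => heisMul p q) = fun q => p + L q := by
    funext q
    simp [heisMul, L, Prod.ext_iff, add_assoc]
  refine ⟨L, hL ▸ L.hasFDerivAt.const_add p, ?_⟩
  rintro ((j | j) | j)
  · simp [L, heisZ, Pi.single_apply]
  · simp [L, heisZ, Pi.single_apply]
  · simp [L, heisZ]

/-- The derivative `Z_i φ` of a function along a field of the frame. -/
def frameDeriv {n : ℕ} (i : FrameIdx n) (φ : Heis n → ℝ) (p : Heis n) : ℝ :=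
  fderiv ℝ φ p (heisZ i p)

/-! ## The Carnot-Carathéodory distance -/

/-- Lengths of the absolutely continuous horizontal curves `γ : [0,1] → ℍⁿ` from `p` to `q`. Here
`h t` collects the coefficients of `γ'(t)` in the orthonormal horizontal frame at `γ(t)`, so that
`‖h t‖` is the Riemannian norm of `γ'(t)`. -/
def horizontalLengths {n : ℕ} (p q : Heis n) : Set ℝ :=
  {ℓ | ∃ (γ : ℝ → Heis n) (h : ℝ → EuclideanSpace ℝ (HorIdx n)),
    AbsolutelyContinuousOnInterval γ 0 1 ∧ γ 0 = p ∧ γ 1 = q ∧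
    (∀ᵐ t ∂(volume.restrict (Ioo (0 : ℝ) 1)),
      HasDerivAt γ (∑ i, h t i • heisZ (Sum.inl i) (γ t)) t) ∧
    ℓ = ∫ t in (0 : ℝ)..1, ‖h t‖}

/-- The Carnot-Carathéodory distance. -/
def ccDist {n : ℕ} (p q : Heis n) : ℝ := sInf (horizontalLengths p q)

/-! ## Time-dependent function spaces -/

/-- The open time interval `(0, τ̄)`, `τ̄ ∈ (0, ∞]`. -/
def timeInterval (T : EReal) : Set ℝ := {τ | 0 < τ ∧ (τ : EReal) < T}

/-- Lebesgue measure on `(0, τ̄)`. -/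
def timeMeasure (T : EReal) : Measure ℝ := volume.restrict (timeInterval T)

/-- Lebesgue measure on `(0, τ̄) × ℍⁿ`. -/
def spaceTimeMeasure (n : ℕ) (T : EReal) : Measure (ℝ × Heis n) :=
  (timeMeasure T).prod volume

/-- `f ∈ L^α(0, τ̄; L^β(ℍⁿ))`: `f` is measurable in `(τ, p)` and
the mixed norm `‖ τ ↦ ‖f(τ,·)‖_{L^β} ‖_{L^α(0,τ̄)}` is finite. -/
def MemMixed {n : ℕ} (T : EReal) (α β : ℝ≥0∞) (f : ℝ → Heis n → ℝ) : Prop :=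
  AEStronglyMeasurable (Function.uncurry f) (spaceTimeMeasure n T) ∧
    eLpNorm (fun τ => eLpNorm (f τ) β volume) α (timeMeasure T) < ∞

/-- `f ∈ L^α(0, τ̄; L^β_loc(ℍⁿ))`. -/
def MemMixedLoc {n : ℕ} (T : EReal) (α β : ℝ≥0∞) (f : ℝ → Heis n → ℝ) : Prop :=
  AEStronglyMeasurable (Function.uncurry f) (spaceTimeMeasure n T) ∧
    ∀ K : Set (Heis n), IsCompact K →
      eLpNorm (fun τ => eLpNorm (f τ) β (volume.restrict K)) α (timeMeasure T) < ∞

/-! ## Weak derivatives, horizontal Sobolev spaces, contact vector fields -/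

/-- `g` is the distributional derivative `Z_i u` of `u` on `ℍⁿ`. -/
def IsWeakFrameDeriv {n : ℕ} (i : FrameIdx n) (u g : Heis n → ℝ) : Prop :=
  LocallyIntegrable u volume ∧ LocallyIntegrable g volume ∧
    ∀ φ : Heis n → ℝ, ContDiff ℝ (⊤ : ℕ∞) φ → HasCompactSupport φ →
      ∫ p, u p * frameDeriv i φ p = -∫ p, g p * φ p

/-- `ψ ∈ L¹(0, τ̄; W^{2,q}_H(ℍⁿ))`: the functions `ψ`, `Z_i ψ`, `Z_i Z_j ψ`, with `i`, `j`
horizontal and derivatives in the weak sense at almost every time, lie in `L¹(0, τ̄; L^q(ℍⁿ))`. -/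
def MemL1HorSobolev2 {n : ℕ} (T : EReal) (q : ℝ≥0∞) (ψ : ℝ → Heis n → ℝ) : Prop :=
  MemMixed T 1 q ψ ∧
    ∃ (g : HorIdx n → ℝ → Heis n → ℝ) (h : HorIdx n → HorIdx n → ℝ → Heis n → ℝ),
      (∀ i, MemMixed T 1 q (g i)) ∧ (∀ i j, MemMixed T 1 q (h i j)) ∧
      ∀ᵐ τ ∂(timeMeasure T),
        (∀ i, IsWeakFrameDeriv (Sum.inl i) (ψ τ) (g i τ)) ∧
        (∀ i j, IsWeakFrameDeriv (Sum.inl i) (g j τ) (h i j τ))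

/-- A time-dependent vector field `b = ∑ b_j Z_j` on `ℍⁿ`, given by its coefficients in the
orthonormal frame; `‖b τ p‖` is its Riemannian norm. -/
abbrev HeisField (n : ℕ) : Type := ℝ → Heis n → EuclideanSpace ℝ (FrameIdx n)

/-- `b` is (measurable and) the contact vector field
`b = ∑_j (Y_j ψ X_j - X_j ψ Y_j) - 4 ψ T` generated by `ψ`. -/
def IsContactFieldOf {n : ℕ} (T : EReal) (b : HeisField n) (ψ : ℝ → Heis n → ℝ) : Prop :=
  AEStronglyMeasurable (Function.uncurry b) (spaceTimeMeasure n T) ∧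
    ∀ᵐ τ ∂(timeMeasure T),
      (∀ j : Fin n, IsWeakFrameDeriv (Sum.inl (Sum.inr j)) (ψ τ)
        (fun p => b τ p (Sum.inl (Sum.inl j)))) ∧
      (∀ j : Fin n, IsWeakFrameDeriv (Sum.inl (Sum.inl j)) (ψ τ)
        (fun p => -(b τ p (Sum.inl (Sum.inr j))))) ∧
      (∀ᵐ p, b τ p (Sum.inr ()) = -4 * ψ τ p)

/-- `div b = D`: at almost every time, `∫ dφ(b) dp = -∫ φ D dp` for all test functions `φ`. -/
def IsDivergence {n : ℕ} (T : EReal) (b : HeisField n) (D : ℝ → Heis n → ℝ) : Prop :=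
  ∀ᵐ τ ∂(timeMeasure T),
    LocallyIntegrable (b τ) volume ∧ LocallyIntegrable (D τ) volume ∧
    ∀ φ : Heis n → ℝ, ContDiff ℝ (⊤ : ℕ∞) φ → HasCompactSupport φ →
      ∫ p, ∑ i, b τ p i * frameDeriv i φ p = -∫ p, φ p * D τ p

/-- The growth condition `|b| / (1 + d(p,0)) ∈ L¹(0,τ̄;L¹(ℍⁿ)) + L¹(0,τ̄;L^∞(ℍⁿ))`. -/
def HasGrowth {n : ℕ} (T : EReal) (b : HeisField n) : Prop :=
  ∃ f g : ℝ → Heis n → ℝ, MemMixed T 1 1 f ∧ MemMixed T 1 ∞ g ∧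
    ∀ᵐ z ∂(spaceTimeMeasure n T),
      ‖b z.1 z.2‖ / (1 + ccDist z.2 0) = f z.1 z.2 + g z.1 z.2

/-! ## The transport equation -/

/-- Test functions `φ ∈ C_c^∞([0,τ̄) × ℍⁿ)`, as restrictions of smooth functions on `ℝ × ℍⁿ` with
compact support in `(-∞,τ̄) × ℍⁿ`. -/
def IsTestFunction {n : ℕ} (T : EReal) (φ : ℝ × Heis n → ℝ) : Prop :=
  ContDiff ℝ (⊤ : ℕ∞) φ ∧ HasCompactSupport φ ∧ tsupport φ ⊆ {z | (z.1 : EReal) < T}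

/-- `u ∈ L^∞(0,τ̄;L^s_loc(ℍⁿ))` (`u ∈ L^∞((0,τ̄) × ℍⁿ)` if `s = ∞`) is a distributional solution of
`∂_τ u - ⟨b, ∇u⟩ + c u = 0`, `u(0,·) = u₀`, where `D` is the divergence of `b`. The notion is meant
for `b ∈ L¹(L^{s'}_loc)`, `c, D ∈ L¹(L^{s'}_loc)`, `u₀ ∈ L^s_loc`, when all integrals converge. -/
def IsDistributionalSolution {n : ℕ} (T : EReal) (s : ℝ≥0∞) (b : HeisField n)
    (D c : ℝ → Heis n → ℝ) (u₀ : Heis n → ℝ) (u : ℝ → Heis n → ℝ) : Prop :=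
  MemMixedLoc T ∞ s u ∧ (s = ∞ → MemMixed T ∞ ∞ u) ∧
    ∀ φ : ℝ × Heis n → ℝ, IsTestFunction T φ →
      -(∫ p, u₀ p * φ (0, p)) +
        ∫ τ in timeInterval T, ∫ p, u τ p *
          (-(fderiv ℝ φ (τ, p) (1, 0))
            + ∑ i, b τ p i * frameDeriv i (fun q => φ (τ, q)) p
            + (c τ p + D τ p) * φ (τ, p)) = 0

end

noncomputable section

/-! ## Group structure -/

/-! Uniqueness follows DiPerna and Lions: distributional solutions are renormalized, and the growth
condition turns renormalization into a stability estimate. The obstacle is that only second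
horizontal derivatives of `ψ` are available. The horizontal coefficients of `b` have no controlled
derivative along `T`, so the Euclidean commutator estimate does not apply.

The mollification `u_ε(p) = ∫ ρ(w) u(p · δ_ε w) dw` averages over right translates, because `p` and
`p · δ_ε w` are joined by the left translate of a horizontal path. In the commutator `b·∇u_ε -
(b·∇u)_ε` the derivative in `p` acts on the kernel as a right-invariant field, which differs from
the left-invariant one by a multiple of `T`. For a contact field this discrepancy combines with the
increment of the vertical coefficient `-4ψ`: the factor of `ε⁻² Tρ` is `-4` times the second order
Taylor remainder `ψ(p · δ_ε w) - ψ(p) - ε ∑ w_j Z_jψ(p)`. The remaining terms are `ε⁻¹` times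
increments of the horizontal gradient. Both are integrals of `Z_k Z_j ψ` along the path
(`ae_taylor`, `ae_commutator_integrand`).

The commutator is therefore an average of products of translates of `u` and `Z_k Z_j ψ`, plus an
average of `u div b`. Hölder bounds it in `L¹_loc` uniformly in `ε`, and it converges to `u` times a
function that does not involve `u`. The commutator of the constant `1` vanishes by the definition of
the divergence, so this function is zero (`ae_commutator_limit_eq_zero`), without any computation of
moments. Hence `renormalized`.

The weights in the renormalized identity are built from `log (1 + |(x,y)|⁴ + t²)`, whose frame
derivatives are `O(1/(1+d))`. A cutoff that shrinks in time absorbs the `L¹(L^∞)` part of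
`|b|/(1+d)`; the `L¹(L¹)` part leaves an error that disappears as the cutoff is removed. This gives
`ae_lintegral_stability`, and uniqueness follows with a bounded `β` that vanishes only at `0`.

Existence is by duality. For test functions the same kind of estimate needs no mollification and
controls `‖φ(0,·)‖_{L¹}` by the `L¹` norm of the operator applied to `φ`
(`integral_abs_initial_le`). Hahn–Banach and the duality of `L¹` and `L^∞` give bounded solutions
for bounded data. For `s < ∞`, data in `C_c` are dense in `L^s`, and the stability estimate with `β`
tending to `|z|^s` makes the solutions a Cauchy sequence (`exists_solution`). -/

theorem heisMul_assoc {n : ℕ} (p q r : Heis n) :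
    heisMul (heisMul p q) r = heisMul p (heisMul q r) := by
  simp only [heisMul, Pi.add_apply, Prod.mk.injEq, add_assoc, true_and]
  have : ∑ j, ((q.1 j * p.2.1 j - p.1 j * q.2.1 j)) + ∑ j, (r.1 j * (p.2.1 j + q.2.1 j) -
      (p.1 j + q.1 j) * r.2.1 j) = ∑ j, (r.1 j * q.2.1 j - q.1 j * r.2.1 j) +
      ∑ j, ((q.1 j + r.1 j) * p.2.1 j - p.1 j * (q.2.1 j + r.2.1 j)) := by
    rw [← Finset.sum_add_distrib, ← Finset.sum_add_distrib]
    exact Finset.sum_congr rfl fun j _ => by ring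
  linarith

@[simp] theorem heisMul_zero {n : ℕ} (p : Heis n) : heisMul p 0 = p := by
  simp [heisMul]

@[simp] theorem zero_heisMul {n : ℕ} (p : Heis n) : heisMul 0 p = p := by
  simp [heisMul]

@[simp] theorem neg_heisMul_self {n : ℕ} (p : Heis n) : heisMul (-p) p = 0 := by
  simp [heisMul, Prod.ext_iff, mul_comm]

@[simp] theorem heisMul_neg_self {n : ℕ} (p : Heis n) : heisMul p (-p) = 0 := by
  simp [heisMul, Prod.ext_iff, mul_comm]

@[simp] theorem neg_heisMul_cancel_left {n : ℕ} (p q : Heis n) :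
    heisMul (-p) (heisMul p q) = q := by
  rw [← heisMul_assoc]; simp

@[simp] theorem heisMul_neg_cancel_left {n : ℕ} (p q : Heis n) :
    heisMul p (heisMul (-p) q) = q := by
  rw [← heisMul_assoc]; simp

@[simp] theorem heisMul_neg_cancel_right {n : ℕ} (p q : Heis n) :
    heisMul (heisMul p q) (-q) = p := by
  rw [heisMul_assoc]; simp

@[simp] theorem neg_heisMul_cancel_right {n : ℕ} (p q : Heis n) :
    heisMul (heisMul p (-q)) q = p := by
  rw [heisMul_assoc]; simp

theorem contDiff_heisMul {n : ℕ} {E : Type*} [NormedAddCommGroup E] [NormedSpace ℝ E]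
    {k : WithTop ℕ∞} {f g : E → Heis n} (hf : ContDiff ℝ k f) (hg : ContDiff ℝ k g) :
    ContDiff ℝ k (fun x => heisMul (f x) (g x)) := by
  unfold heisMul
  fun_prop

theorem continuous_heisMul {n : ℕ} {E : Type*} [TopologicalSpace E]
    {f g : E → Heis n} (hf : Continuous f) (hg : Continuous g) :
    Continuous (fun x => heisMul (f x) (g x)) := by
  unfold heisMul
  fun_prop

theorem measurable_heisMul {n : ℕ} {E : Type*} [MeasurableSpace E]
    {f g : E → Heis n} (hf : Measurable f) (hg : Measurable g) :
    Measurable (fun x => heisMul (f x) (g x)) := by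
  unfold heisMul
  fun_prop

/-- Affine shears of `ℝⁿ × ℝⁿ × ℝ` preserve Lebesgue measure. -/
theorem measurePreserving_shear {n : ℕ} (a b : Fin n → ℝ) (F : (Fin n → ℝ) → (Fin n → ℝ) → ℝ)
    (hF : Measurable (Function.uncurry F)) :
    MeasurePreserving (fun p : Heis n => (p.1 + a, p.2.1 + b, p.2.2 + F p.1 p.2.1))
      volume volume := by
  have h2 : ∀ x, MeasurePreserving (fun q : (Fin n → ℝ) × ℝ => (q.1 + b, q.2 + F x q.1))
      volume volume := fun x => by
    refine MeasurePreserving.skew_product (g := fun y t => t + F x y)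
      (measurePreserving_add_right volume b) ?_ ?_
    · have : Measurable (fun y => F x y) := hF.comp (by fun_prop : Measurable fun y => (x, y))
      fun_prop
    · exact .of_forall fun y => (measurePreserving_add_right volume (F x y)).map_eq
  refine MeasurePreserving.skew_product (g := fun x (q : (Fin n → ℝ) × ℝ) =>
    (q.1 + b, q.2 + F x q.1)) (measurePreserving_add_right volume a) ?_ ?_
  · have : Measurable (fun z : (Fin n → ℝ) × (Fin n → ℝ) × ℝ => F z.1 z.2.1) :=
      hF.comp (by fun_prop : Measurable fun z : (Fin n → ℝ) × (Fin n → ℝ) × ℝ => (z.1, z.2.1))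
    fun_prop
  · exact .of_forall fun x => (h2 x).map_eq

theorem measurePreserving_heisMul_right {n : ℕ} (a : Heis n) :
    MeasurePreserving (fun p : Heis n => heisMul p a) volume volume := by
  convert! measurePreserving_shear a.1 a.2.1
    (fun x y => a.2.2 + 2 * ∑ j, (a.1 j * y j - x j * a.2.1 j)) (by fun_prop) using 2 with p
  simp [heisMul, add_assoc]

theorem measurePreserving_heisMul_left {n : ℕ} (a : Heis n) :
    MeasurePreserving (fun p : Heis n => heisMul a p) volume volume := by
  convert! measurePreserving_shear a.1 a.2.1
    (fun x y => a.2.2 + 2 * ∑ j, (x j * a.2.1 j - a.1 j * y j)) (by fun_prop) using 2 with p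
  simp only [heisMul, Prod.mk.injEq]
  exact ⟨add_comm _ _, add_comm _ _, by ring⟩

/-- Left translation as a homeomorphism. -/
def heisMulLeft {n : ℕ} (a : Heis n) : Heis n ≃ₜ Heis n where
  toFun := heisMul a
  invFun := heisMul (-a)
  left_inv q := by simp
  right_inv q := by simp
  continuous_toFun := continuous_heisMul continuous_const continuous_id
  continuous_invFun := continuous_heisMul continuous_const continuous_id

/-- Right translation as a homeomorphism. -/
def heisMulRight {n : ℕ} (a : Heis n) : Heis n ≃ₜ Heis n where
  toFun p := heisMul p a
  invFun p := heisMul p (-a)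
  left_inv q := by simp
  right_inv q := by simp
  continuous_toFun := continuous_heisMul continuous_id continuous_const
  continuous_invFun := continuous_heisMul continuous_id continuous_const

theorem integral_heisMul_right {n : ℕ} (a : Heis n) (f : Heis n → ℝ) :
    ∫ p, f (heisMul p a) = ∫ p, f p :=
  (measurePreserving_heisMul_right a).integral_comp (heisMulRight a).measurableEmbedding f

theorem integral_heisMul_left {n : ℕ} (a : Heis n) (f : Heis n → ℝ) :
    ∫ p, f (heisMul a p) = ∫ p, f p :=
  (measurePreserving_heisMul_left a).integral_comp (heisMulLeft a).measurableEmbedding f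

/-- The dilations of `ℍⁿ`. -/
def heisDil {n : ℕ} (r : ℝ) : Heis n →ₗ[ℝ] Heis n where
  toFun p := (r • p.1, r • p.2.1, r ^ 2 * p.2.2)
  map_add' p q := by simp [mul_add]
  map_smul' c p := by
    simp only [Prod.smul_fst, Prod.smul_snd, RingHom.id_apply, Prod.smul_mk, smul_eq_mul,
      Prod.mk.injEq]
    exact ⟨smul_comm _ _ _, smul_comm _ _ _, by ring⟩

theorem heisDil_apply {n : ℕ} (r : ℝ) (p : Heis n) :
    heisDil r p = (r • p.1, r • p.2.1, r ^ 2 * p.2.2) := rfl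

theorem heisDil_heisDil {n : ℕ} (r s : ℝ) (p : Heis n) :
    heisDil r (heisDil s p) = heisDil (r * s) p := by
  simp [heisDil_apply, mul_smul, mul_pow, mul_assoc]

@[simp] theorem heisDil_one {n : ℕ} (p : Heis n) : heisDil 1 p = p := by
  simp [heisDil_apply]

theorem heisDil_inv_cancel {n : ℕ} {r : ℝ} (hr : r ≠ 0) (p : Heis n) :
    heisDil r⁻¹ (heisDil r p) = p := by
  simp [heisDil_heisDil, hr]

theorem heisDil_cancel_inv {n : ℕ} {r : ℝ} (hr : r ≠ 0) (p : Heis n) :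
    heisDil r (heisDil r⁻¹ p) = p := by
  simp [heisDil_heisDil, hr]

theorem contDiff_heisDil {n : ℕ} (r : ℝ) {k : WithTop ℕ∞} :
    ContDiff ℝ k (heisDil (n := n) r) := by
  change ContDiff ℝ k (fun p : Heis n => (r • p.1, r • p.2.1, r ^ 2 * p.2.2))
  fun_prop

/-- The Jacobian of a dilation. -/
def dilJac (n : ℕ) (r : ℝ) : ℝ := |LinearMap.det (heisDil (n := n) r)|

theorem det_heisDil_ne_zero {n : ℕ} {r : ℝ} (hr : r ≠ 0) :
    LinearMap.det (heisDil (n := n) r) ≠ 0 := by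
  have h : LinearMap.det (heisDil (n := n) r⁻¹) * LinearMap.det (heisDil (n := n) r) = 1 := by
    rw [← LinearMap.det_comp, ← LinearMap.det_id (A := ℝ) (M := Heis n)]
    congr 1
    exact LinearMap.ext fun p => heisDil_inv_cancel hr p
  exact right_ne_zero_of_mul_eq_one h

theorem dilJac_pos {n : ℕ} {r : ℝ} (hr : r ≠ 0) : 0 < dilJac n r :=
  abs_pos.2 (det_heisDil_ne_zero hr)

/-- Dilation as a homeomorphism. -/
def heisDilHomeo {n : ℕ} {r : ℝ} (hr : r ≠ 0) : Heis n ≃ₜ Heis n where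
  toFun := heisDil r
  invFun := heisDil r⁻¹
  left_inv := heisDil_inv_cancel hr
  right_inv := heisDil_cancel_inv hr
  continuous_toFun := (contDiff_heisDil (k := 0) r).continuous
  continuous_invFun := (contDiff_heisDil (k := 0) r⁻¹).continuous

instance isAddHaarMeasure_heis {n : ℕ} : (volume : Measure (Heis n)).IsAddHaarMeasure :=
  have : ((volume : Measure (Fin n → ℝ)).prod (volume : Measure ℝ)).IsAddHaarMeasure :=
    inferInstance
  Measure.prod.instIsAddHaarMeasure (volume : Measure (Fin n → ℝ))
    ((volume : Measure (Fin n → ℝ)).prod (volume : Measure ℝ))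

theorem map_heisDil {n : ℕ} {r : ℝ} (hr : r ≠ 0) :
    Measure.map (heisDil (n := n) r) volume = ENNReal.ofReal (dilJac n r)⁻¹ • volume := by
  rw [Measure.map_linearMap_addHaar_eq_smul_addHaar volume (det_heisDil_ne_zero hr), dilJac,
    abs_inv]

theorem integral_heisDil {n : ℕ} {r : ℝ} (hr : r ≠ 0) (f : Heis n → ℝ) :
    ∫ p, f (heisDil r p) = (dilJac n r)⁻¹ * ∫ p, f p := by
  have h : ∫ p, f (heisDil r p) = ∫ p, f p ∂(Measure.map (heisDil (n := n) r) volume) :=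
    ((heisDilHomeo hr).measurableEmbedding.integral_map f).symm
  rw [h, map_heisDil hr, integral_smul_measure,
    ENNReal.toReal_ofReal (inv_nonneg.2 (dilJac_pos hr).le), smul_eq_mul]

/-- Change of variables `q = p · δ_r w`. -/
theorem integral_heisMul_heisDil {n : ℕ} {r : ℝ} (hr : r ≠ 0) (p : Heis n) (f : Heis n → ℝ) :
    ∫ w, f (heisMul p (heisDil r w)) = (dilJac n r)⁻¹ * ∫ q, f q := by
  rw [integral_heisDil hr (fun w => f (heisMul p w)), integral_heisMul_left]

theorem integrable_heisMul_heisDil_iff {n : ℕ} {r : ℝ} (hr : r ≠ 0) (p : Heis n)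
    (f : Heis n → ℝ) :
    Integrable (fun w => f (heisMul p (heisDil r w))) ↔ Integrable f := by
  have h1 : Integrable (fun w => f (heisMul p (heisDil r w))) ↔
      Integrable (fun w => f (heisMul p w)) (Measure.map (heisDil (n := n) r) volume) :=
    ((heisDilHomeo hr).measurableEmbedding.integrable_map_iff
      (g := fun w => f (heisMul p w))).symm
  rw [h1, map_heisDil hr, integrable_smul_measure
    (by simpa using dilJac_pos hr) ENNReal.ofReal_ne_top]
  exact (measurePreserving_heisMul_left p).integrable_comp_emb
    (heisMulLeft p).measurableEmbedding

/-! ## The frame -/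

/-- The identity is exact and not only of first order in `h`. Frame derivatives are thus derivatives
along right translation by one-parameter subgroups, which makes left invariance a consequence of
associativity. -/
theorem heisMul_smul_heisZ {n : ℕ} (p : Heis n) (i : FrameIdx n) (h : ℝ) :
    heisMul p (h • heisZ i 0) = p + h • heisZ i p := by
  rcases i with (j | j) | j
  · simp [heisMul, heisZ, Prod.ext_iff, Pi.single_apply]; ring
  · simp [heisMul, heisZ, Prod.ext_iff, Pi.single_apply]; ring
  · simp [heisMul, heisZ, Prod.ext_iff]

theorem hasDerivAt_frameDeriv {n : ℕ} {φ : Heis n → ℝ} {p : Heis n} (hφ : DifferentiableAt ℝ φ p)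
    (i : FrameIdx n) :
    HasDerivAt (fun h : ℝ => φ (heisMul p (h • heisZ i 0))) (frameDeriv i φ p) 0 := by
  have h1 : HasDerivAt (fun h : ℝ => p + h • heisZ i p) (heisZ i p) 0 := by
    simpa using ((hasDerivAt_id (0 : ℝ)).smul_const (heisZ i p)).const_add p
  have h2 : HasFDerivAt φ (fderiv ℝ φ p) (p + (0 : ℝ) • heisZ i p) := by
    simpa using hφ.hasFDerivAt
  simpa [heisMul_smul_heisZ, frameDeriv, Function.comp_def] using h2.comp_hasDerivAt 0 h1

theorem frameDeriv_heisMul_left {n : ℕ} {φ : Heis n → ℝ} (hφ : Differentiable ℝ φ)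
    (i : FrameIdx n) (a p : Heis n) :
    frameDeriv i (fun q => φ (heisMul a q)) p = frameDeriv i φ (heisMul a p) := by
  have hd : Differentiable ℝ (fun q => φ (heisMul a q)) :=
    hφ.comp ((contDiff_heisMul contDiff_const contDiff_id (k := 1)).differentiable one_ne_zero)
  have h1 := hasDerivAt_frameDeriv (hd p) i
  have h2 := hasDerivAt_frameDeriv (hφ (heisMul a p)) i
  simp only [heisMul_assoc] at h2
  exact h1.unique h2

theorem heisZ_continuous {n : ℕ} (i : FrameIdx n) : Continuous (heisZ (n := n) i) := by
  rcases i with (j | j) | j <;> · unfold heisZ; fun_prop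

theorem continuous_frameDeriv {n : ℕ} {φ : Heis n → ℝ} (hφ : ContDiff ℝ 1 φ) (i : FrameIdx n) :
    Continuous (frameDeriv i φ) :=
  (hφ.continuous_fderiv one_ne_zero).clm_apply (heisZ_continuous i)

theorem support_frameDeriv_subset {n : ℕ} {φ : Heis n → ℝ} (i : FrameIdx n) :
    tsupport (frameDeriv i φ) ⊆ tsupport φ := by
  refine closure_minimal (fun p hp => ?_) (isClosed_tsupport φ)
  by_contra h
  refine hp ?_
  have := image_eq_zero_of_notMem_tsupport (fun h' => h (tsupport_fderiv_subset ℝ h'))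
  simp [frameDeriv, this]

theorem hasCompactSupport_frameDeriv {n : ℕ} {φ : Heis n → ℝ} (hφ : HasCompactSupport φ)
    (i : FrameIdx n) : HasCompactSupport (frameDeriv i φ) :=
  hφ.of_isClosed_subset (isClosed_tsupport _) (support_frameDeriv_subset i)

theorem frameDeriv_heisDil {n : ℕ} {φ : Heis n → ℝ} (hφ : Differentiable ℝ φ) (r : ℝ)
    (p : Heis n) (i : HorIdx n) :
    frameDeriv (Sum.inl i) (fun q => φ (heisDil r q)) p =
      r * frameDeriv (Sum.inl i) φ (heisDil r p) := by
  have hd : HasFDerivAt (fun q => φ (heisDil r q))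
      ((fderiv ℝ φ (heisDil r p)).comp (heisDil (n := n) r).toContinuousLinearMap) p :=
    (hφ _).hasFDerivAt.comp p (heisDil (n := n) r).toContinuousLinearMap.hasFDerivAt
  rw [frameDeriv, hd.fderiv, frameDeriv, ← smul_eq_mul, ← map_smul]
  simp only [ContinuousLinearMap.comp_apply, LinearMap.coe_toContinuousLinearMap']
  congr 1
  rcases i with j | j <;>
  · simp only [heisZ, heisDil_apply, Prod.smul_mk, Prod.mk.injEq, smul_zero, Pi.smul_apply,
      smul_eq_mul, true_and]
    ring

theorem frameDeriv_heisDil_vert {n : ℕ} {φ : Heis n → ℝ} (hφ : Differentiable ℝ φ) (r : ℝ)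
    (p : Heis n) :
    frameDeriv (Sum.inr ()) (fun q => φ (heisDil r q)) p =
      r ^ 2 * frameDeriv (Sum.inr ()) φ (heisDil r p) := by
  have hd : HasFDerivAt (fun q => φ (heisDil r q))
      ((fderiv ℝ φ (heisDil r p)).comp (heisDil (n := n) r).toContinuousLinearMap) p :=
    (hφ _).hasFDerivAt.comp p (heisDil (n := n) r).toContinuousLinearMap.hasFDerivAt
  rw [frameDeriv, hd.fderiv, frameDeriv, ← smul_eq_mul, ← map_smul]
  simp only [ContinuousLinearMap.comp_apply, LinearMap.coe_toContinuousLinearMap']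
  congr 1
  simp [heisZ, heisDil_apply]

/-- Horizontal coordinates of a point. -/
def horCoord {n : ℕ} (p : Heis n) : HorIdx n → ℝ := Sum.elim p.1 p.2.1

theorem sum_smul_heisZ {n : ℕ} (c : HorIdx n → ℝ) (p : Heis n) :
    ∑ i, c i • heisZ (Sum.inl i) p = (fun j => c (Sum.inl j), fun j => c (Sum.inr j),
      2 * ∑ j, (c (Sum.inl j) * p.2.1 j - c (Sum.inr j) * p.1 j)) := by
  rw [Fintype.sum_sum_type]
  simp only [heisZ, Prod.smul_mk, smul_zero, smul_eq_mul, Prod.ext_iff, Prod.fst_add, Prod.fst_sum,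
    Prod.snd_add, Prod.snd_sum, Finset.sum_const_zero, add_zero, zero_add]
  refine ⟨?_, ?_, ?_⟩
  · funext j; simp [Finset.sum_apply, Pi.single_apply]
  · funext j; simp [Finset.sum_apply, Pi.single_apply]
  · rw [← Finset.sum_add_distrib, Finset.mul_sum]
    exact Finset.sum_congr rfl fun j _ => by ring

/-! ## Horizontal paths -/

/-- A polynomial horizontal path from `0` to `(a, b, 2 μ ν / 35)`: a straight line in the horizontal
coordinates, to which a closed loop in the plane of index `i₀` is added. -/
def loopPath {n : ℕ} (i₀ : Fin n) (a b : Fin n → ℝ) (μ ν s : ℝ) : Heis n :=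
  (fun j => s * a j + μ * (s - 3 * s ^ 2 + 2 * s ^ 3) * (Pi.single i₀ 1 : Fin n → ℝ) j,
   fun j => s * b j + ν * (s - 6 * s ^ 2 + 10 * s ^ 3 - 5 * s ^ 4) *
    (Pi.single i₀ 1 : Fin n → ℝ) j,
   2 * (a i₀ * ν * (2 * s ^ 3 - 5 * s ^ 4 + 3 * s ^ 5) + b i₀ * μ * (s ^ 4 - s ^ 3) +
    μ * ν * (s ^ 3 - 4 * s ^ 4 + 33 / 5 * s ^ 5 - 5 * s ^ 6 + 10 / 7 * s ^ 7)))

/-- The coefficients of the velocity of `loopPath` in the horizontal frame. -/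
def loopVel {n : ℕ} (i₀ : Fin n) (a b : Fin n → ℝ) (μ ν s : ℝ) : HorIdx n → ℝ :=
  Sum.elim (fun j => a j + μ * (1 - 6 * s + 6 * s ^ 2) * (Pi.single i₀ 1 : Fin n → ℝ) j)
    (fun j => b j + ν * (1 - 12 * s + 30 * s ^ 2 - 20 * s ^ 3) *
      (Pi.single i₀ 1 : Fin n → ℝ) j)

theorem loopPath_zero {n : ℕ} (i₀ : Fin n) (a b : Fin n → ℝ) (μ ν : ℝ) :
    loopPath i₀ a b μ ν 0 = 0 := by
  simp [loopPath, Prod.ext_iff, funext_iff]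

/-- The profiles `s(1-s)(1-2s)` and `s(1-s)(1-5s+5s²)` vanish at both ends and have mean zero. The
mixed terms in `a ν` and `b μ` therefore drop out at `s = 1`, and only the area enclosed by the
loop, a multiple of `μ ν`, is left in the vertical coordinate. -/
theorem loopPath_one {n : ℕ} (i₀ : Fin n) (a b : Fin n → ℝ) (μ ν : ℝ) :
    loopPath i₀ a b μ ν 1 = (a, b, 2 * μ * ν / 35) := by
  simp only [loopPath, Prod.mk.injEq, funext_iff]
  refine ⟨fun j => by ring, fun j => by ring, by ring⟩

theorem hasDerivAt_loopPath {n : ℕ} (i₀ : Fin n) (a b : Fin n → ℝ) (μ ν s : ℝ) :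
    HasDerivAt (loopPath i₀ a b μ ν)
      (∑ i, loopVel i₀ a b μ ν s i • heisZ (Sum.inl i) (loopPath i₀ a b μ ν s)) s := by
  rw [sum_smul_heisZ]
  have hp : ∀ k : ℕ, HasDerivAt (fun s : ℝ => s ^ k) (k * s ^ (k - 1)) s := fun k =>
    hasDerivAt_pow k s
  refine HasDerivAt.prodMk ?_ (HasDerivAt.prodMk ?_ ?_)
  · refine hasDerivAt_pi.2 fun j => ?_
    have := ((hasDerivAt_id s).mul_const (a j)).add (((((hasDerivAt_id s).sub
      ((hp 2).const_mul 3)).add ((hp 3).const_mul 2)).const_mul μ).mul_const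
        ((Pi.single i₀ 1 : Fin n → ℝ) j))
    convert! this using 1
    simp only [loopVel, Sum.elim_inl]; norm_num; left; left; ring
  · refine hasDerivAt_pi.2 fun j => ?_
    have := ((hasDerivAt_id s).mul_const (b j)).add ((((((hasDerivAt_id s).sub
      ((hp 2).const_mul 6)).add ((hp 3).const_mul 10)).sub ((hp 4).const_mul 5)).const_mul
        ν).mul_const ((Pi.single i₀ 1 : Fin n → ℝ) j))
    convert! this using 1
    simp only [loopVel, Sum.elim_inr]; norm_num; left; left; ring
  · have h1 := ((((hp 3).const_mul 2).sub ((hp 4).const_mul 5)).add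
      ((hp 5).const_mul 3)).const_mul (a i₀ * ν)
    have h2 := ((hp 4).sub (hp 3)).const_mul (b i₀ * μ)
    have h3 := (((((hp 3).sub ((hp 4).const_mul 4)).add ((hp 5).const_mul (33 / 5))).sub
      ((hp 6).const_mul 5)).add ((hp 7).const_mul (10 / 7))).const_mul (μ * ν)
    convert! ((h1.add h2).add h3).const_mul 2 using 1
    rw [← Finset.sum_subset (Finset.subset_univ {i₀})]
    · simp only [loopVel, loopPath, Sum.elim_inl, Sum.elim_inr, Finset.sum_singleton,
        Pi.single_eq_same]
      norm_num
      ring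
    · intro j _ hj
      have hj' : j ≠ i₀ := by simpa using hj
      simp only [loopVel, loopPath, Sum.elim_inl, Sum.elim_inr, Pi.single_eq_of_ne hj']
      ring

theorem contDiff_loopPath {n : ℕ} (i₀ : Fin n) (a b : Fin n → ℝ) (μ ν : ℝ)
    {k : WithTop ℕ∞} : ContDiff ℝ k (loopPath i₀ a b μ ν) := by
  unfold loopPath
  fun_prop

theorem continuous_loopVel {n : ℕ} (i₀ : Fin n) (a b : Fin n → ℝ) (μ ν : ℝ) (i : HorIdx n) :
    Continuous fun s => loopVel i₀ a b μ ν s i := by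
  rcases i with j | j <;> · simp only [loopVel, Sum.elim_inl, Sum.elim_inr]; fun_prop

theorem hasDerivAt_heis_components {n : ℕ} {γ : ℝ → Heis n} {v : Heis n} {s : ℝ}
    (h : HasDerivAt γ v s) : HasDerivAt (fun s => (γ s).1) v.1 s ∧
      HasDerivAt (fun s => (γ s).2.1) v.2.1 s ∧ HasDerivAt (fun s => (γ s).2.2) v.2.2 s :=
  have aux : ∀ (E F : Type) [NormedAddCommGroup E] [NormedSpace ℝ E] [NormedAddCommGroup F]
      [NormedSpace ℝ F] (g : ℝ → E × F) (w : E × F), HasDerivAt g w s →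
      HasDerivAt (fun s => (g s).1) w.1 s ∧ HasDerivAt (fun s => (g s).2) w.2 s :=
    fun E F _ _ _ _ _ _ h => ⟨(ContinuousLinearMap.fst ℝ E F).hasFDerivAt.comp_hasDerivAt s h,
      (ContinuousLinearMap.snd ℝ E F).hasFDerivAt.comp_hasDerivAt s h⟩
  have h1 := aux _ _ _ _ h
  have h2 := aux _ _ _ _ h1.2
  ⟨h1.1, h2.1, h2.2⟩

/-- Left translation of horizontal curves. -/
theorem hasDerivAt_heisMul_left {n : ℕ} {γ : ℝ → Heis n} {c : HorIdx n → ℝ} {s : ℝ}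
    (hγ : HasDerivAt γ (∑ i, c i • heisZ (Sum.inl i) (γ s)) s) (p : Heis n) :
    HasDerivAt (fun s => heisMul p (γ s))
      (∑ i, c i • heisZ (Sum.inl i) (heisMul p (γ s))) s := by
  rw [sum_smul_heisZ] at hγ ⊢
  obtain ⟨h1, h2, h3⟩ := hasDerivAt_heis_components hγ
  refine HasDerivAt.prodMk (h1.const_add _) (HasDerivAt.prodMk (h2.const_add _) ?_)
  have h4 : HasDerivAt (fun s => ∑ j, ((γ s).1 j * p.2.1 j - p.1 j * (γ s).2.1 j))
      (∑ j, (c (Sum.inl j) * p.2.1 j - p.1 j * c (Sum.inr j))) s :=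
    HasDerivAt.fun_sum fun j _ => ((hasDerivAt_pi.1 h1 j).mul_const _).sub
      ((hasDerivAt_pi.1 h2 j).const_mul _)
  refine ((h3.const_add p.2.2).fun_add (h4.const_mul 2)).congr_deriv ?_
  simp only [heisMul, Pi.add_apply]
  rw [← mul_add, ← Finset.sum_add_distrib]
  congr 1
  exact Finset.sum_congr rfl fun j _ => by ring

/-- Differentiation of `φ (q · γ(s)⁻¹)` along a horizontal curve `γ`. -/
theorem hasDerivAt_comp_heisMul_neg {n : ℕ} {γ : ℝ → Heis n} {c : HorIdx n → ℝ} {s : ℝ}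
    (hγ : HasDerivAt γ (∑ i, c i • heisZ (Sum.inl i) (γ s)) s) (q : Heis n) {φ : Heis n → ℝ}
    (hφ : Differentiable ℝ φ) :
    HasDerivAt (fun s => φ (heisMul q (-γ s)))
      (-∑ i, c i * frameDeriv (Sum.inl i) (fun q => φ (heisMul q (-γ s))) q) s := by
  -- To first order `γ(s+h)⁻¹ = (-h v) · γ(s)⁻¹` with `v` the left-trivialized velocity, so `q ·
  -- γ(s+h)⁻¹` is the right translate by `γ(s)⁻¹` of `q · (-h v)`. This is why left-invariant
  -- derivatives of the translated function appear at `q`. The coordinate formula for the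
  -- differential of right translation makes it precise.
  have hR : ∀ v, fderiv ℝ (fun q => φ (heisMul q (-γ s))) q v =
      fderiv ℝ φ (heisMul q (-γ s)) (v.1, v.2.1,
        v.2.2 + 2 * ∑ j, ((-γ s).1 j * v.2.1 j - v.1 j * (-γ s).2.1 j)) := by
    intro v
    have hd : Differentiable ℝ (fun q => heisMul q (-γ s)) :=
      (contDiff_heisMul contDiff_id contDiff_const (k := 1)).differentiable one_ne_zero
    have h1 : HasDerivAt (fun h : ℝ => heisMul (q + h • v) (-γ s))
        (fderiv ℝ (fun q => heisMul q (-γ s)) q v) 0 := by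
      have h2 : HasDerivAt (fun h : ℝ => q + h • v) v 0 := by
        simpa using ((hasDerivAt_id (0 : ℝ)).smul_const v).const_add q
      have h3 : HasFDerivAt (fun q => heisMul q (-γ s))
          (fderiv ℝ (fun q => heisMul q (-γ s)) q) (q + (0 : ℝ) • v) := by
        simpa using (hd q).hasFDerivAt
      exact h3.comp_hasDerivAt 0 h2
    have h4 : HasDerivAt (fun h : ℝ => heisMul (q + h • v) (-γ s)) (v.1, v.2.1,
        v.2.2 + 2 * ∑ j, ((-γ s).1 j * v.2.1 j - v.1 j * (-γ s).2.1 j)) 0 := by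
      have : (fun h : ℝ => heisMul (q + h • v) (-γ s)) = fun h => heisMul q (-γ s) + h •
        ((v.1, v.2.1, v.2.2 + 2 * ∑ j, ((-γ s).1 j * v.2.1 j - v.1 j * (-γ s).2.1 j)) :
          Heis n) := by
        funext h
        simp only [heisMul, Prod.fst_add, Prod.snd_add, Prod.smul_fst, Prod.smul_snd, Prod.smul_mk,
          Prod.mk_add_mk, Prod.mk.injEq, Pi.add_apply, Pi.smul_apply, smul_eq_mul]
        refine ⟨by abel, by abel, ?_⟩
        simp only [mul_add, add_mul, Finset.sum_sub_distrib, Finset.sum_add_distrib, mul_sub,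
          Finset.mul_sum]
        have e1 : ∀ x y z : Fin n → ℝ, ∑ j, 2 * (x j * (h * y j)) = ∑ j, h * (2 * (x j * y j)) :=
          fun x y z => Finset.sum_congr rfl fun j _ => by ring
        have e2 : ∀ x y z : Fin n → ℝ, ∑ j, 2 * (h * x j * y j) = ∑ j, h * (2 * (x j * y j)) :=
          fun x y z => Finset.sum_congr rfl fun j _ => by ring
        rw [e1 _ _ v.1, e2 _ _ v.1]
        ring
      rw [this]
      exact (((hasDerivAt_id (0 : ℝ)).smul_const _).const_add (heisMul q (-γ s))).congr_deriv
        (one_smul _ _)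
    have h5 : fderiv ℝ (fun q => φ (heisMul q (-γ s))) q =
        (fderiv ℝ φ (heisMul q (-γ s))).comp (fderiv ℝ (fun q => heisMul q (-γ s)) q) :=
      fderiv_comp q (hφ _) (hd q)
    rw [h5, ContinuousLinearMap.comp_apply, h1.unique h4]
  have hsum : -∑ i, c i * frameDeriv (Sum.inl i) (fun q => φ (heisMul q (-γ s))) q =
      fderiv ℝ (fun q => φ (heisMul q (-γ s))) q (-∑ i, c i • heisZ (Sum.inl i) q) := by
    simp only [frameDeriv, map_neg, map_sum, map_smul, smul_eq_mul]
  rw [hsum, hR, sum_smul_heisZ]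
  rw [sum_smul_heisZ] at hγ
  obtain ⟨h1, h2, h3⟩ := hasDerivAt_heis_components hγ
  refine (hφ _).hasFDerivAt.comp_hasDerivAt s (HasDerivAt.prodMk ?_ (HasDerivAt.prodMk ?_ ?_))
  · exact h1.fun_neg.const_add _
  · exact h2.fun_neg.const_add _
  · have h4 : HasDerivAt (fun s => ∑ j, ((-γ s).1 j * q.2.1 j - q.1 j * (-γ s).2.1 j))
        (∑ j, (-c (Sum.inl j) * q.2.1 j - q.1 j * -c (Sum.inr j))) s :=
      HasDerivAt.fun_sum fun j _ => (((hasDerivAt_pi.1 h1 j).fun_neg).mul_const _).fun_sub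
        (((hasDerivAt_pi.1 h2 j).fun_neg).const_mul _)
    refine ((h3.fun_neg.const_add q.2.2).fun_add (h4.const_mul 2)).congr_deriv ?_
    simp only [Prod.snd_neg, Prod.fst_neg, Pi.neg_apply, Finset.mul_sum, ← Finset.sum_neg_distrib,
      ← Finset.sum_add_distrib]
    exact Finset.sum_congr rfl fun j _ => by ring

/-! ## The Carnot-Carathéodory distance to the origin -/

theorem ccDist_le_of_mem {n : ℕ} {p q : Heis n} {ℓ : ℝ} (h : ℓ ∈ horizontalLengths p q) :
    ccDist p q ≤ ℓ := by
  refine csInf_le ⟨0, ?_⟩ h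
  rintro _ ⟨γ, h, -, -, -, -, rfl⟩
  exact intervalIntegral.integral_nonneg zero_le_one fun t _ => norm_nonneg _

theorem ccDist_nonneg {n : ℕ} (p q : Heis n) : 0 ≤ ccDist p q := by
  refine Real.sInf_nonneg ?_
  rintro _ ⟨γ, h, -, -, -, -, rfl⟩
  exact intervalIntegral.integral_nonneg zero_le_one fun t _ => norm_nonneg _

theorem norm_euclidean_le_sum {ι : Type*} [Fintype ι] (v : EuclideanSpace ℝ ι) :
    ‖v‖ ≤ ∑ i, |v i| := by
  rw [EuclideanSpace.norm_eq]
  refine Real.sqrt_le_iff.2 ⟨Finset.sum_nonneg fun i _ => abs_nonneg _, ?_⟩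
  simp only [Real.norm_eq_abs]
  exact Finset.sum_sq_le_sq_sum_of_nonneg fun i _ => abs_nonneg _

/-- A competitor is the left translate by `p` of a `loopPath` from `0` to `p⁻¹ = -p`. Splitting the
height evenly, up to constants, between the two loop amplitudes makes the length of order `√|t|`,
the homogeneous size of the vertical coordinate. -/
theorem ccDist_zero_le {n : ℕ} (hn : 1 ≤ n) (p : Heis n) :
    ccDist p 0 ≤ ∑ j, |p.1 j| + ∑ j, |p.2.1 j| + 1200 * √|p.2.2| := by
  let i₀ : Fin n := ⟨0, hn⟩
  -- The factor `35 / 2` cancels the area constant `2 / 35` of the loop; the sign of `ν` takes care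
  -- of the sign of the height.
  obtain ⟨μ, ν, hμ, hν, hμν⟩ : ∃ μ ν : ℝ, |μ| ≤ √|p.2.2| ∧ |ν| ≤ 35 / 2 * √|p.2.2| ∧
      2 * μ * ν / 35 = -p.2.2 := by
    have h0 := Real.sqrt_nonneg |p.2.2|
    have hm := Real.mul_self_sqrt (abs_nonneg p.2.2)
    rcases le_total 0 p.2.2 with h | h
    · refine ⟨√|p.2.2|, -(35 / 2 * √|p.2.2|), by rw [abs_of_nonneg h0],
        by rw [abs_neg, abs_of_nonneg (by positivity)], ?_⟩
      rw [abs_of_nonneg h] at hm ⊢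
      linarith
    · refine ⟨√|p.2.2|, 35 / 2 * √|p.2.2|, by rw [abs_of_nonneg h0],
        by rw [abs_of_nonneg (by positivity)], ?_⟩
      rw [abs_of_nonpos h] at hm ⊢
      linarith
  let γ := loopPath i₀ (-p.1) (-p.2.1) μ ν
  let v : ℝ → EuclideanSpace ℝ (HorIdx n) := fun s =>
    WithLp.toLp 2 (loopVel i₀ (-p.1) (-p.2.1) μ ν s)
  have hmem : ∫ s in (0 : ℝ)..1, ‖v s‖ ∈ horizontalLengths p 0 := by
    refine ⟨fun s => heisMul p (γ s), v, ?_, ?_, ?_, ?_, rfl⟩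
    · exact (contDiff_heisMul contDiff_const
        (contDiff_loopPath i₀ _ _ μ ν)).contDiffOn.absolutelyContinuousOnInterval
    · simp [γ, loopPath_zero]
    · simp only [γ, loopPath_one, hμν]
      exact heisMul_neg_self p
    · exact .of_forall fun s => hasDerivAt_heisMul_left (hasDerivAt_loopPath i₀ _ _ μ ν s) p
  refine (ccDist_le_of_mem hmem).trans ?_
  have hcont : Continuous v := by
    refine (PiLp.continuous_toLp 2 _).comp (continuous_pi fun i => continuous_loopVel _ _ _ _ _ i)
  have hb : ∀ s ∈ Icc (0 : ℝ) 1, ‖v s‖ ≤ ∑ j, |p.1 j| + ∑ j, |p.2.1 j| + 1200 * √|p.2.2| := by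
    intro s hs
    refine (norm_euclidean_le_sum _).trans ?_
    rw [Fintype.sum_sum_type]
    have hsum : ∀ (a : Fin n → ℝ) (κ B : ℝ), |κ| ≤ B →
        ∑ j, |(-a) j + κ * (Pi.single i₀ 1 : Fin n → ℝ) j| ≤ ∑ j, |a j| + B := by
      intro a κ B hB
      have : ∑ j, |κ * (Pi.single i₀ 1 : Fin n → ℝ) j| = |κ| := by
        rw [Finset.sum_eq_single i₀]
        · simp
        · intro j _ hj; simp [Pi.single_eq_of_ne hj]
        · simp
      calc _ ≤ ∑ j, (|a j| + |κ * (Pi.single i₀ 1 : Fin n → ℝ) j|) :=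
            Finset.sum_le_sum fun j _ => (abs_add_le _ _).trans (by simp)
        _ = ∑ j, |a j| + |κ| := by rw [Finset.sum_add_distrib, this]
        _ ≤ _ := by gcongr
    obtain ⟨h0, h1⟩ := hs
    have hs2 : s ^ 2 ≤ 1 := pow_le_one₀ h0 h1
    have hs3 : s ^ 3 ≤ 1 := pow_le_one₀ h0 h1
    have hs2' := pow_nonneg h0 2
    have hs3' := pow_nonneg h0 3
    -- Here `13 = 1 + 6 + 6` and `63 = 1 + 12 + 30 + 20` bound the derivatives of the two profiles
    -- on `[0, 1]`, and `13 + 63 · 35/2` is less than `1200`.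
    have hx := hsum p.1 (μ * (1 - 6 * s + 6 * s ^ 2)) (√|p.2.2| * 13) (by
      rw [abs_mul]; gcongr
      rw [abs_le]; constructor <;> linarith)
    have hy := hsum p.2.1 (ν * (1 - 12 * s + 30 * s ^ 2 - 20 * s ^ 3))
      (35 / 2 * √|p.2.2| * 63) (by
      rw [abs_mul]; gcongr
      rw [abs_le]; constructor <;> linarith)
    have h0 := Real.sqrt_nonneg |p.2.2|
    simp only [v, loopVel, Sum.elim_inl, Sum.elim_inr]
    linarith
  calc _ ≤ ∫ s in (0 : ℝ)..1, (∑ j, |p.1 j| + ∑ j, |p.2.1 j| + 1200 * √|p.2.2|) :=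
        intervalIntegral.integral_mono_on zero_le_one hcont.norm.continuousOn.intervalIntegrable
          (by simp) hb
    _ = _ := by simp

/-! ## A logarithmic exhaustion function -/

/-- `log (1 + |(x,y)|⁴ + t²)`. -/
def heisLog {n : ℕ} (p : Heis n) : ℝ :=
  Real.log (1 + (∑ j, (p.1 j ^ 2 + p.2.1 j ^ 2)) ^ 2 + p.2.2 ^ 2)

theorem contDiff_heisLog {n : ℕ} {k : WithTop ℕ∞} : ContDiff ℝ k (heisLog (n := n)) := by
  unfold heisLog
  refine ContDiff.log (by fun_prop) fun p => by positivity

/-- Let `E = 1 + |(x,y)|⁴ + t²` and `k = E^{1/4}`. Then `|x_j|, |y_j| ≤ k` and `|t| ≤ k²`, so the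
frame derivatives of `E` are at most `8 k³`, while `1 + d(p,0)` is at most a constant times `k`.
Dividing by `E = k⁴` leaves `1/k`. Consequently `|b|/(1+d)` controls `b` applied to `heisLog`, which
is how the growth condition enters. -/
theorem abs_frameDeriv_heisLog_le {n : ℕ} (hn : 1 ≤ n) (p : Heis n) (i : FrameIdx n) :
    |frameDeriv i heisLog p| ≤ 8 * (1201 + 2 * n) / (1 + ccDist p 0) := by
  set S : ℝ := ∑ j, (p.1 j ^ 2 + p.2.1 j ^ 2) with hS
  have hS0 : 0 ≤ S := Finset.sum_nonneg fun j _ => by positivity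
  set E : ℝ := 1 + S ^ 2 + p.2.2 ^ 2 with hE
  have hE1 : 1 ≤ E := by rw [hE]; nlinarith [sq_nonneg S, sq_nonneg p.2.2]
  obtain ⟨k, hk1, hkE⟩ : ∃ k : ℝ, 1 ≤ k ∧ k ^ 4 = E := by
    refine ⟨E ^ (1 / 4 : ℝ), Real.one_le_rpow hE1 (by norm_num), ?_⟩
    rw [← Real.rpow_natCast, ← Real.rpow_mul (by linarith)]; norm_num
  have hSk : S ≤ k ^ 2 := by
    refine le_of_sq_le_sq ?_ (by positivity)
    rw [← pow_mul, hkE, hE]; nlinarith [sq_nonneg p.2.2]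
  have htk : |p.2.2| ≤ k ^ 2 := by
    refine abs_le_of_sq_le_sq ?_ (by positivity)
    rw [← pow_mul, hkE, hE]; nlinarith [sq_nonneg S]
  have hxk : ∀ j, |p.1 j| ≤ k := fun j => by
    refine abs_le_of_sq_le_sq (le_trans ?_ hSk) (by positivity)
    refine le_trans ?_ (Finset.single_le_sum (f := fun j => p.1 j ^ 2 + p.2.1 j ^ 2)
      (fun j _ => by positivity) (Finset.mem_univ j))
    simp [sq_nonneg]
  have hyk : ∀ j, |p.2.1 j| ≤ k := fun j => by
    refine abs_le_of_sq_le_sq (le_trans ?_ hSk) (by positivity)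
    refine le_trans ?_ (Finset.single_le_sum (f := fun j => p.1 j ^ 2 + p.2.1 j ^ 2)
      (fun j _ => by positivity) (Finset.mem_univ j))
    simp [sq_nonneg]
  have hd : 1 + ccDist p 0 ≤ (1201 + 2 * n) * k := by
    have h1 := ccDist_zero_le hn p
    have h2 : ∑ j, |p.1 j| ≤ n * k := (Finset.sum_le_sum fun j _ => hxk j).trans (by simp)
    have h3 : ∑ j, |p.2.1 j| ≤ n * k := (Finset.sum_le_sum fun j _ => hyk j).trans (by simp)
    have h4 : √|p.2.2| ≤ k := Real.sqrt_le_iff.2 ⟨by positivity, htk⟩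
    nlinarith
  have hd0 : 0 < 1 + ccDist p 0 := by linarith [ccDist_nonneg p 0]
  -- the derivative along `v`
  have hder : ∀ v : Heis n, HasDerivAt (fun h : ℝ => heisLog (p + h • v))
      ((4 * S * ∑ j, (p.1 j * v.1 j + p.2.1 j * v.2.1 j) + 2 * p.2.2 * v.2.2) / E) 0 := by
    intro v
    have h1 : HasDerivAt (fun h : ℝ => ∑ j, ((p + h • v).1 j ^ 2 + (p + h • v).2.1 j ^ 2))
        (∑ j, (2 * p.1 j * v.1 j + 2 * p.2.1 j * v.2.1 j)) 0 := by
      refine HasDerivAt.fun_sum fun j _ => ?_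
      have e1 : HasDerivAt (fun h : ℝ => (p + h • v).1 j) (v.1 j) 0 := by
        simpa using ((hasDerivAt_id (0 : ℝ)).mul_const (v.1 j)).const_add (p.1 j)
      have e2 : HasDerivAt (fun h : ℝ => (p + h • v).2.1 j) (v.2.1 j) 0 := by
        simpa using ((hasDerivAt_id (0 : ℝ)).mul_const (v.2.1 j)).const_add (p.2.1 j)
      simpa using (e1.fun_pow 2).fun_add (e2.fun_pow 2)
    have h2 : HasDerivAt (fun h : ℝ => (p + h • v).2.2) v.2.2 0 := by
      simpa using ((hasDerivAt_id (0 : ℝ)).mul_const v.2.2).const_add p.2.2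
    have h3 := (((h1.pow 2).const_add 1).add (h2.pow 2)).log (by simp; positivity)
    convert! h3 using 1
    have : ∑ j, (2 * p.1 j * v.1 j + 2 * p.2.1 j * v.2.1 j) =
        2 * ∑ j, (p.1 j * v.1 j + p.2.1 j * v.2.1 j) := by
      rw [Finset.mul_sum]; exact Finset.sum_congr rfl fun j _ => by ring
    rw [this]
    simp [hE, hS]
    ring
  have hfd : frameDeriv i heisLog p = (4 * S * ∑ j, (p.1 j * (heisZ i p).1 j +
      p.2.1 j * (heisZ i p).2.1 j) + 2 * p.2.2 * (heisZ i p).2.2) / E := by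
    have h1 := hasDerivAt_frameDeriv ((contDiff_heisLog (n := n) (k := 1)).differentiable
      one_ne_zero p) i
    simp only [heisMul_smul_heisZ] at h1
    exact h1.unique (hder _)
  have hE0 : 0 < E := by linarith
  have hk0 : 0 < k := by linarith
  have key : |4 * S * ∑ j, (p.1 j * (heisZ i p).1 j +
      p.2.1 j * (heisZ i p).2.1 j) + 2 * p.2.2 * (heisZ i p).2.2| ≤ 8 * k ^ 3 := by
    have b1 : ∀ x : ℝ, |x| ≤ k → |4 * S * x| ≤ 4 * k ^ 3 := fun x hx => by
      rw [abs_mul, abs_of_nonneg (by positivity : (0 : ℝ) ≤ 4 * S)]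
      calc 4 * S * |x| ≤ 4 * k ^ 2 * k := by gcongr
        _ = 4 * k ^ 3 := by ring
    have b2 : ∀ x : ℝ, |x| ≤ k → |2 * p.2.2 * (2 * x)| ≤ 4 * k ^ 3 := fun x hx => by
      rw [abs_mul, abs_mul, abs_mul]
      simp only [abs_two]
      calc 2 * |p.2.2| * (2 * |x|) ≤ 2 * k ^ 2 * (2 * k) := by gcongr
        _ = 4 * k ^ 3 := by ring
    rcases i with (j | j) | j
    · have e : ∑ l, (p.1 l * (heisZ (Sum.inl (Sum.inl j)) p).1 l +
          p.2.1 l * (heisZ (Sum.inl (Sum.inl j)) p).2.1 l) = p.1 j := by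
        simp [heisZ, Pi.single_apply]
      rw [e]
      refine (abs_add_le _ _).trans ?_
      have := b1 _ (hxk j)
      have := b2 _ (hyk j)
      simp only [heisZ]
      linarith
    · have e : ∑ l, (p.1 l * (heisZ (Sum.inl (Sum.inr j)) p).1 l +
          p.2.1 l * (heisZ (Sum.inl (Sum.inr j)) p).2.1 l) = p.2.1 j := by
        simp [heisZ, Pi.single_apply]
      rw [e]
      refine (abs_add_le _ _).trans ?_
      have := b1 _ (hyk j)
      have := b2 (-p.1 j) (by rw [abs_neg]; exact hxk j)
      simp only [heisZ]
      rw [show -(2 * p.1 j) = 2 * -p.1 j by ring]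
      linarith
    · simp only [heisZ, Pi.zero_apply, mul_zero, add_zero, Finset.sum_const_zero, zero_add, mul_one]
      rw [abs_mul, abs_two]
      nlinarith [pow_le_pow_right₀ hk1 (show 2 ≤ 3 by norm_num)]
  rw [hfd, abs_div, abs_of_pos hE0, le_div_iff₀ hd0, div_mul_eq_mul_div, div_le_iff₀ hE0, ← hkE]
  calc _ ≤ 8 * k ^ 3 * ((1201 + 2 * n) * k) := by gcongr
    _ = _ := by ring

theorem abs_sum_mul_frameDeriv_heisLog_le {n : ℕ} (hn : 1 ≤ n) :
    ∃ C : ℝ, 0 ≤ C ∧ ∀ (p : Heis n) (v : EuclideanSpace ℝ (FrameIdx n)),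
      |∑ i, v i * frameDeriv i heisLog p| ≤ C * (‖v‖ / (1 + ccDist p 0)) := by
  refine ⟨Fintype.card (FrameIdx n) * (8 * (1201 + 2 * n)), by positivity, fun p v => ?_⟩
  have hd0 : 0 < 1 + ccDist p 0 := by linarith [ccDist_nonneg p 0]
  calc _ ≤ ∑ i, |v i * frameDeriv i heisLog p| := Finset.abs_sum_le_sum_abs _ _
    _ ≤ ∑ _i : FrameIdx n, ‖v‖ * (8 * (1201 + 2 * n) / (1 + ccDist p 0)) := by
        refine Finset.sum_le_sum fun i _ => ?_
        rw [abs_mul]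
        exact mul_le_mul (PiLp.norm_apply_le v i) (abs_frameDeriv_heisLog_le hn p i)
          (abs_nonneg _) (norm_nonneg _)
    _ = _ := by
        rw [Finset.sum_const, Finset.card_univ, nsmul_eq_mul]; ring

theorem isCompact_heisLog_le {n : ℕ} (R : ℝ) : IsCompact {p : Heis n | heisLog p ≤ R} := by
  refine Metric.isCompact_of_isClosed_isBounded
    (isClosed_le (contDiff_heisLog (k := 0)).continuous continuous_const) ?_
  refine (Metric.isBounded_closedBall (x := 0) (r := Real.exp R)).subset fun p hp => ?_
  have hS0 : ∀ j, 0 ≤ p.1 j ^ 2 + p.2.1 j ^ 2 := fun j => by positivity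
  set S : ℝ := ∑ j, (p.1 j ^ 2 + p.2.1 j ^ 2) with hS
  have h1 : 1 + S ^ 2 + p.2.2 ^ 2 ≤ Real.exp R :=
    (Real.log_le_iff_le_exp (by positivity)).1 hp
  have hSj : ∀ j, p.1 j ^ 2 + p.2.1 j ^ 2 ≤ S := fun j =>
    Finset.single_le_sum (fun j _ => hS0 j) (Finset.mem_univ j)
  have hR : (0 : ℝ) ≤ Real.exp R := (Real.exp_pos R).le
  have aux : ∀ x : ℝ, x ^ 2 ≤ S → |x| ≤ Real.exp R := fun x hx => by
    have hS1 : S ≤ Real.exp R := by nlinarith [sq_nonneg (S - 1), sq_nonneg p.2.2]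
    rw [abs_le]
    constructor <;> nlinarith [sq_nonneg p.2.2, sq_nonneg (S - 1), sq_nonneg (x - 1),
      sq_nonneg (x + 1)]
  rw [mem_closedBall_zero_iff, Prod.norm_def, Prod.norm_def]
  refine max_le ?_ (max_le ?_ ?_)
  · exact (pi_norm_le_iff_of_nonneg hR).2 fun j =>
      aux _ (by linarith [hSj j, sq_nonneg (p.2.1 j)])
  · exact (pi_norm_le_iff_of_nonneg hR).2 fun j =>
      aux _ (by linarith [hSj j, sq_nonneg (p.1 j)])
  · rw [Real.norm_eq_abs, abs_le]
    constructor <;> nlinarith [sq_nonneg S, sq_nonneg (p.2.2 - 1), sq_nonneg (p.2.2 + 1)]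

/-! ## Translations in Lebesgue spaces -/

theorem eLpNorm_comp_heisMul_right {n : ℕ} {f : Heis n → ℝ} {p : ℝ≥0∞}
    (hf : AEStronglyMeasurable f volume) (a : Heis n) :
    eLpNorm (fun q => f (heisMul q a)) p volume = eLpNorm f p volume :=
  eLpNorm_comp_measurePreserving hf (measurePreserving_heisMul_right a)

theorem tendsto_eLpNorm_translate {n : ℕ} {f : Heis n → ℝ} {p : ℝ≥0∞} (hp1 : 1 ≤ p)
    (hp : p ≠ ∞) (hf : MemLp f p volume) :
    Tendsto (fun a => eLpNorm (fun q => f (heisMul q a) - f q) p volume) (𝓝 0) (𝓝 0) := by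
  have : Fact (1 ≤ p) := ⟨hp1⟩
  let g : Heis n → C(Heis n, Heis n) := fun a =>
    ⟨fun q => heisMul q a, (heisMulRight a).continuous⟩
  have hg : Continuous g := ContinuousMap.continuous_of_continuous_uncurry g
    (continuous_heisMul continuous_snd continuous_fst)
  have hgm : ∀ a, MeasurePreserving (g a) (volume : Measure (Heis n)) volume :=
    measurePreserving_heisMul_right
  have hc := (continuous_const (y := hf.toLp f)).compMeasurePreservingLp hg hgm hp
  have h0 := hc.tendsto 0
  simp only [Lp.toLp_compMeasurePreserving] at h0
  rw [Lp.tendsto_Lp_iff_tendsto_eLpNorm''] at h0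
  refine h0.congr fun a => eLpNorm_congr_ae (.of_forall fun q => ?_)
  change f (heisMul q a) - f (heisMul q 0) = _
  rw [heisMul_zero]

theorem lintegral_enorm_mul_le {α : Type*} [MeasurableSpace α] {μ : Measure α} {u H : α → ℝ}
    {s s' : ℝ≥0∞} [ENNReal.HolderConjugate s s'] (hu : AEStronglyMeasurable u μ)
    (hH : AEStronglyMeasurable H μ) :
    ∫⁻ p, ‖u p * H p‖ₑ ∂μ ≤ eLpNorm u s μ * eLpNorm H s' μ := by
  have h := eLpNorm_smul_le_mul_eLpNorm (p := s) (q := s') (r := 1) hH hu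
  rwa [eLpNorm_one_eq_lintegral_enorm] at h

theorem lintegral_enorm_translate_mul_le {n : ℕ} {u H : Heis n → ℝ} {s s' : ℝ≥0∞}
    [ENNReal.HolderConjugate s s'] (hu : AEStronglyMeasurable u volume)
    (hH : AEStronglyMeasurable H volume) (a b : Heis n) :
    ∫⁻ p, ‖u (heisMul p a) * H (heisMul p b)‖ₑ ≤ eLpNorm u s volume * eLpNorm H s' volume := by
  rw [← eLpNorm_comp_heisMul_right hu a, ← eLpNorm_comp_heisMul_right hH b]
  exact lintegral_enorm_mul_le
    (hu.comp_measurePreserving (measurePreserving_heisMul_right a))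
    (hH.comp_measurePreserving (measurePreserving_heisMul_right b))

/-- Translations are continuous on `L^{s'}` but possibly not on `L^s`, since `s = ∞` is allowed. No
difference of translates of `u` alone is therefore formed: `H` is compared with its translates by
`b` and by `a`, at the cost of the norm of `u`, and what remains is the translate by `a` of the
product `u H`, which is a function in `L¹`. -/
theorem tendsto_lintegral_translate_mul_of_ne_top {n : ℕ} {u H : Heis n → ℝ} {s s' : ℝ≥0∞}
    [hss : ENNReal.HolderConjugate s s'] (hs' : s' ≠ ∞) (hu : MemLp u s volume)
    (hH : MemLp H s' volume) :
    Tendsto (fun ab : Heis n × Heis n =>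
      ∫⁻ p, ‖u (heisMul p ab.1) * H (heisMul p ab.2) - u p * H p‖ₑ) (𝓝 0) (𝓝 0) := by
  have h1s' : 1 ≤ s' := ENNReal.HolderConjugate.one_le s' s
  have huH : MemLp (fun p => u p * H p) 1 volume := hH.mul hu
  have t1 := tendsto_eLpNorm_translate h1s' hs' hH
  have t2 := tendsto_eLpNorm_translate le_rfl ENNReal.one_ne_top huH
  have hm : ∀ {f : Heis n → ℝ} (_ : AEStronglyMeasurable f volume) (a : Heis n),
      AEStronglyMeasurable (fun p => f (heisMul p a)) volume := fun hf a =>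
    hf.comp_measurePreserving (measurePreserving_heisMul_right a)
  have key : ∀ ab : Heis n × Heis n,
      ∫⁻ p, ‖u (heisMul p ab.1) * H (heisMul p ab.2) - u p * H p‖ₑ ≤
      eLpNorm u s volume * (eLpNorm (fun q => H (heisMul q ab.2) - H q) s' volume +
        eLpNorm (fun q => H (heisMul q ab.1) - H q) s' volume) +
        eLpNorm (fun q => u (heisMul q ab.1) * H (heisMul q ab.1) - u q * H q) 1 volume := by
    rintro ⟨a, b⟩
    have e : ∀ p, ‖u (heisMul p a) * H (heisMul p b) - u p * H p‖ₑ ≤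
        ‖u (heisMul p a) * (H (heisMul p b) - H p)‖ₑ +
        ‖u (heisMul p a) * (H (heisMul p a) - H p)‖ₑ +
        ‖u (heisMul p a) * H (heisMul p a) - u p * H p‖ₑ := fun p => by
      have : u (heisMul p a) * H (heisMul p b) - u p * H p =
        (u (heisMul p a) * (H (heisMul p b) - H p) -
        u (heisMul p a) * (H (heisMul p a) - H p)) +
        (u (heisMul p a) * H (heisMul p a) - u p * H p) := by ring
      rw [this]
      refine (enorm_add_le _ _).trans ?_
      gcongr
      exact enorm_sub_le
    refine (lintegral_mono e).trans ?_
    have m1 := ((hm hu.1 a).mul ((hm hH.1 b).sub hH.1)).enorm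
    have m2 := ((hm hu.1 a).mul ((hm hH.1 a).sub hH.1)).enorm
    simp only [Pi.mul_def, Pi.sub_def] at m1 m2
    have m12 : AEMeasurable (fun x => ‖u (heisMul x a) * (H (heisMul x b) - H x)‖ₑ +
      ‖u (heisMul x a) * (H (heisMul x a) - H x)‖ₑ) volume := m1.add m2
    rw [lintegral_add_left' m12, lintegral_add_left' m1, eLpNorm_one_eq_lintegral_enorm]
    gcongr
    rw [mul_add, ← eLpNorm_comp_heisMul_right hu.1 a]
    gcongr
    · exact lintegral_enorm_mul_le (hm hu.1 a) ((hm hH.1 b).sub hH.1)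
    · exact lintegral_enorm_mul_le (hm hu.1 a) ((hm hH.1 a).sub hH.1)
  refine tendsto_of_tendsto_of_tendsto_of_le_of_le tendsto_const_nhds ?_ (fun _ => zero_le)
    key
  have f1 : Tendsto (Prod.fst : Heis n × Heis n → Heis n) (𝓝 0) (𝓝 0) :=
    continuous_fst.tendsto' _ _ rfl
  have f2 : Tendsto (Prod.snd : Heis n × Heis n → Heis n) (𝓝 0) (𝓝 0) :=
    continuous_snd.tendsto' _ _ rfl
  have := (ENNReal.Tendsto.const_mul ((t1.comp f2).add (t1.comp f1))
    (Or.inr hu.2.ne) (a := eLpNorm u s volume)).add (t2.comp f1)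
  simpa using this

theorem tendsto_lintegral_translate_mul {n : ℕ} {u H : Heis n → ℝ} {s s' : ℝ≥0∞}
    [hss : ENNReal.HolderConjugate s s'] (hu : MemLp u s volume) (hH : MemLp H s' volume) :
    Tendsto (fun ab : Heis n × Heis n =>
      ∫⁻ p, ‖u (heisMul p ab.1) * H (heisMul p ab.2) - u p * H p‖ₑ) (𝓝 0) (𝓝 0) := by
  -- In this case `s = 1`, and the previous lemma applies with the two factors exchanged.
  by_cases hs' : s' = ∞
  · have hs : s ≠ ∞ := by
      rintro rfl
      have := (ENNReal.holderConjugate_iff.1 hss)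
      simp [hs'] at this
    have : ENNReal.HolderConjugate s' s := ENNReal.HolderConjugate.symm
    have h := tendsto_lintegral_translate_mul_of_ne_top hs hH hu
    have hsw : Tendsto (Prod.swap : Heis n × Heis n → Heis n × Heis n) (𝓝 0) (𝓝 0) :=
      continuous_swap.tendsto' _ _ rfl
    simpa only [Function.comp_def, Prod.fst_swap, Prod.snd_swap, mul_comm] using h.comp hsw
  · exact tendsto_lintegral_translate_mul_of_ne_top hs' hu hH

/-! ## Averages of translates -/

section Averaging

variable {n : ℕ} {X : Type*} [MeasurableSpace X] {ν : Measure X} [SFinite ν]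

/-- As `f` is only a.e. measurable, the substitution must pull null sets back to null sets. The skew
map `(x, q) ↦ (x, q · a(x))` preserves the product measure, so it does. -/
theorem aestronglyMeasurable_translate {f : Heis n → ℝ} (hf : AEStronglyMeasurable f volume)
    {a : X → Heis n} (ha : Measurable a) :
    AEStronglyMeasurable (fun z : Heis n × X => f (heisMul z.1 (a z.2)))
      ((volume : Measure (Heis n)).prod ν) := by
  have hmeas : Measurable (fun z : X × Heis n => heisMul z.2 (a z.1)) :=
    measurable_heisMul measurable_snd (ha.comp measurable_fst)
  have h1 : MeasurePreserving (fun z : X × Heis n => (z.1, heisMul z.2 (a z.1)))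
      (ν.prod volume) (ν.prod volume) :=
    MeasurePreserving.skew_product (g := fun x q => heisMul q (a x)) (MeasurePreserving.id ν)
      hmeas (.of_forall fun x => (measurePreserving_heisMul_right (a x)).map_eq)
  have h2 : Measure.QuasiMeasurePreserving (fun z : X × Heis n => heisMul z.2 (a z.1))
      (ν.prod volume) volume := Measure.quasiMeasurePreserving_snd.comp h1.quasiMeasurePreserving
  have h3 := hf.comp_quasiMeasurePreserving h2
  exact h3.comp_measurePreserving (Measure.measurePreserving_swap (μ := volume) (ν := ν))

theorem aestronglyMeasurable_translate_mul {u H : Heis n → ℝ} {m : X → ℝ}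
    (hu : AEStronglyMeasurable u volume) (hH : AEStronglyMeasurable H volume)
    (hm : AEStronglyMeasurable m ν) {a b : X → Heis n} (ha : Measurable a) (hb : Measurable b) :
    AEStronglyMeasurable
      (fun z : Heis n × X => m z.2 * (u (heisMul z.1 (a z.2)) * H (heisMul z.1 (b z.2))))
      ((volume : Measure (Heis n)).prod ν) :=
  (hm.comp_snd).mul
    ((aestronglyMeasurable_translate hu ha).mul (aestronglyMeasurable_translate hH hb))

variable {u H : Heis n → ℝ} {s s' : ℝ≥0∞} [hss : ENNReal.HolderConjugate s s'] {m : X → ℝ}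

/-- After the integrals are exchanged, Hölder applies for each parameter, with norms that do not see
the translations. The resulting bound is uniform in `a` and `b`, hence later in the scale of the
mollification. -/
theorem lintegral_lintegral_translate_mul_le (hu : AEStronglyMeasurable u volume)
    (hH : AEStronglyMeasurable H volume) (hm : AEStronglyMeasurable m ν) {a b : X → Heis n}
    (ha : Measurable a) (hb : Measurable b) :
    ∫⁻ p, ∫⁻ x, ‖m x * (u (heisMul p (a x)) * H (heisMul p (b x)))‖ₑ ∂ν ≤
      (∫⁻ x, ‖m x‖ₑ ∂ν) * (eLpNorm u s volume * eLpNorm H s' volume) := by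
  rw [lintegral_lintegral_swap (aestronglyMeasurable_translate_mul hu hH hm ha hb).enorm,
    ← lintegral_mul_const'' _ hm.enorm]
  refine lintegral_mono fun x => ?_
  simp only [enorm_mul (m x)]
  rw [lintegral_const_mul' _ _ enorm_ne_top]
  gcongr
  exact lintegral_enorm_translate_mul_le hu hH _ _

theorem ae_integrable_translate_mul (hu : MemLp u s volume) (hH : MemLp H s' volume)
    (hm : Integrable m ν) {a b : X → Heis n} (ha : Measurable a) (hb : Measurable b) :
    ∀ᵐ p, Integrable (fun x => m x * (u (heisMul p (a x)) * H (heisMul p (b x)))) ν := by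
  have h1 := aestronglyMeasurable_translate_mul hu.1 hH.1 hm.1 ha hb
  have hfin : ∫⁻ p, ∫⁻ x, ‖m x * (u (heisMul p (a x)) * H (heisMul p (b x)))‖ₑ ∂ν ≠ ∞ :=
    ne_top_of_le_ne_top (ENNReal.mul_ne_top hm.2.ne (ENNReal.mul_ne_top hu.2.ne hH.2.ne))
      (lintegral_lintegral_translate_mul_le (s := s) (s' := s') hu.1 hH.1 hm.1 ha hb)
  filter_upwards [h1.prodMk_left, ae_lt_top' h1.enorm.lintegral_prod_right' hfin] with p hp1 hp2
  exact ⟨hp1, hp2⟩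

/-- By Minkowski the `L¹` distance is at most `∫ |m(x)| Θ(a_k(x), b_k(x))`, where `Θ` is the `L¹`
modulus of continuity of the translated products. It is bounded by `2 ‖u‖ ‖H‖` and tends to `0` at
the origin, so dominated convergence in `x` only requires pointwise convergence of the translations.
-/
theorem tendsto_average_translate_mul (hu : MemLp u s volume) (hH : MemLp H s' volume)
    (hm : Integrable m ν) {a b : ℕ → X → Heis n} (ha : ∀ k, Measurable (a k))
    (hb : ∀ k, Measurable (b k)) (ha0 : ∀ x, Tendsto (fun k => a k x) atTop (𝓝 0))
    (hb0 : ∀ x, Tendsto (fun k => b k x) atTop (𝓝 0)) :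
    Tendsto (fun k => ∫⁻ p, ‖(∫ x, m x * (u (heisMul p (a k x)) * H (heisMul p (b k x))) ∂ν) -
      (∫ x, m x ∂ν) * (u p * H p)‖ₑ) atTop (𝓝 0) := by
  let Θ : Heis n × Heis n → ℝ≥0∞ := fun ab =>
      ∫⁻ p, ‖u (heisMul p ab.1) * H (heisMul p ab.2) - u p * H p‖ₑ
  have hΘ : Tendsto Θ (𝓝 0) (𝓝 0) := tendsto_lintegral_translate_mul hu hH
  have hmeas : ∀ k, AEStronglyMeasurable (fun z : Heis n × X => m z.2 *
      (u (heisMul z.1 (a k z.2)) * H (heisMul z.1 (b k z.2)) - u z.1 * H z.1))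
      ((volume : Measure (Heis n)).prod ν) := fun k =>
    (hm.1.comp_snd).mul (((aestronglyMeasurable_translate hu.1 (ha k)).mul
      (aestronglyMeasurable_translate hH.1 (hb k))).sub ((hu.1.mul hH.1).comp_fst))
  have hle : ∀ k, ∫⁻ p, ‖(∫ x, m x * (u (heisMul p (a k x)) * H (heisMul p (b k x))) ∂ν) -
      (∫ x, m x ∂ν) * (u p * H p)‖ₑ ≤ ∫⁻ x, ‖m x‖ₑ * Θ (a k x, b k x) ∂ν := by
    intro k
    have h1 : ∀ᵐ p, ‖(∫ x, m x * (u (heisMul p (a k x)) * H (heisMul p (b k x))) ∂ν) -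
        (∫ x, m x ∂ν) * (u p * H p)‖ₑ ≤
        ∫⁻ x, ‖m x * (u (heisMul p (a k x)) * H (heisMul p (b k x)) - u p * H p)‖ₑ ∂ν := by
      filter_upwards [ae_integrable_translate_mul hu hH hm (ha k) (hb k)] with p hp
      rw [← integral_mul_const, ← integral_sub hp (hm.mul_const _)]
      simp only [← mul_sub]
      exact enorm_integral_le_lintegral_enorm _
    refine (lintegral_mono_ae h1).trans ?_
    rw [lintegral_lintegral_swap (hmeas k).enorm]
    refine lintegral_mono fun x => ?_
    simp only [enorm_mul (m x)]
    rw [lintegral_const_mul' _ _ enorm_ne_top]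
  refine tendsto_of_tendsto_of_tendsto_of_le_of_le tendsto_const_nhds ?_ (fun _ => zero_le)
    hle
  have hΘle : ∀ ab, Θ ab ≤ 2 * (eLpNorm u s volume * eLpNorm H s' volume) := by
    rintro ⟨a, b⟩
    have h0 := lintegral_enorm_translate_mul_le (s := s) (s' := s') hu.1 hH.1 0 0
    simp only [heisMul_zero] at h0
    have ma : AEMeasurable (fun p => ‖u (heisMul p a) * H (heisMul p b)‖ₑ) volume :=
      ((hu.1.comp_measurePreserving (measurePreserving_heisMul_right a)).mul
        (hH.1.comp_measurePreserving (measurePreserving_heisMul_right b))).enorm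
    calc Θ (a, b) ≤ ∫⁻ p, (‖u (heisMul p a) * H (heisMul p b)‖ₑ + ‖u p * H p‖ₑ) :=
          lintegral_mono fun p => enorm_sub_le
      _ = _ := lintegral_add_left' ma _
      _ ≤ _ := by
          rw [two_mul]; gcongr; exact lintegral_enorm_translate_mul_le hu.1 hH.1 a b
  have hfin : ∫⁻ x, ‖m x‖ₑ * (2 * (eLpNorm u s volume * eLpNorm H s' volume)) ∂ν ≠ ∞ := by
    rw [lintegral_mul_const'' _ hm.1.enorm]
    exact ENNReal.mul_ne_top hm.2.ne (ENNReal.mul_ne_top (by simp)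
      (ENNReal.mul_ne_top hu.2.ne hH.2.ne))
  have := tendsto_lintegral_of_dominated_convergence' (μ := ν)
    (F := fun k x => ‖m x‖ₑ * Θ (a k x, b k x)) (f := fun _ => 0) _
    (fun k => ?_) (fun k => .of_forall fun x => mul_le_mul_right (hΘle _) _) hfin
    (.of_forall fun x => ?_)
  · simpa using this
  · have h := (hmeas k).enorm.lintegral_prod_left'
    refine h.congr (.of_forall fun x => ?_)
    simp only [enorm_mul (m x)]
    rw [lintegral_const_mul' _ _ enorm_ne_top]
  · have h2 : Tendsto (fun k => Θ (a k x, b k x)) atTop (𝓝 0) :=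
      hΘ.comp ((ha0 x).prodMk_nhds (hb0 x))
    simpa using ENNReal.Tendsto.const_mul h2 (Or.inr enorm_ne_top) (a := ‖m x‖ₑ)

end Averaging

/-! ## Integrals depending on a parameter -/

section Parameter

variable {n : ℕ} {E : Type*} [NormedAddCommGroup E] [NormedSpace ℝ E]

/-- The integral is the Euclidean convolution of `f` with `y ↦ Ψ(x, -y)`, evaluated at `0`.
Smoothness in the parameter is then that of convolutions with parameters, which asks for supports
that are locally uniformly compact. -/
theorem contDiff_integral_mul_param {f : Heis n → ℝ} (hf : LocallyIntegrable f volume)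
    {Ψ : E × Heis n → ℝ} (hΨ : ContDiff ℝ (⊤ : ℕ∞) Ψ)
    (hsupp : ∀ x₀ : E, ∃ U : Set E, IsOpen U ∧ x₀ ∈ U ∧ ∃ K : Set (Heis n), IsCompact K ∧
      ∀ x ∈ U, ∀ q ∉ K, Ψ (x, q) = 0) :
    ContDiff ℝ (⊤ : ℕ∞) fun x => ∫ q, f q * Ψ (x, q) := by
  rw [contDiff_iff_contDiffAt]
  intro x₀
  obtain ⟨U, hU, hxU, K, hK, hz⟩ := hsupp x₀
  have h := contDiffOn_convolution_right_with_param_comp (𝕜 := ℝ) (n := (⊤ : ℕ∞))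
    (μ := (volume : Measure (Heis n))) (ContinuousLinearMap.mul ℝ ℝ) (s := U)
    (v := fun _ => (0 : Heis n)) contDiffOn_const (f := f) (g := fun x y => Ψ (x, -y))
    (k := -K) hU hK.neg (fun x y hx hy => hz x hx _ (by simpa using hy)) hf
    (hΨ.comp (contDiff_fst.prodMk contDiff_snd.neg)).contDiffOn
  have h2 := (h x₀ hxU).contDiffAt (hU.mem_nhds hxU)
  simpa [convolution] using h2

theorem hasFDerivAt_integral_mul_param [FiniteDimensional ℝ E] {f : Heis n → ℝ}
    (hf : LocallyIntegrable f volume)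
    {Ψ : E × Heis n → ℝ} (hΨ : ContDiff ℝ 1 Ψ) {x₀ : E}
    (hsupp : ∃ U : Set E, IsOpen U ∧ x₀ ∈ U ∧ ∃ K : Set (Heis n), IsCompact K ∧
      ∀ x ∈ U, ∀ q ∉ K, Ψ (x, q) = 0) (v : E) :
    fderiv ℝ (fun x => ∫ q, f q * Ψ (x, q)) x₀ v = ∫ q, f q * fderiv ℝ Ψ (x₀, q) (v, 0) ∧
      DifferentiableAt ℝ (fun x => ∫ q, f q * Ψ (x, q)) x₀ := by
  obtain ⟨U, hU, hxU, K, hK, hz⟩ := hsupp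
  obtain ⟨r, hr, hrU⟩ := Metric.nhds_basis_closedBall.mem_iff.1 (hU.mem_nhds hxU)
  have : ProperSpace E := FiniteDimensional.proper ℝ E
  let D : E × Heis n → E →L[ℝ] ℝ := fun z =>
    (fderiv ℝ Ψ z).comp (ContinuousLinearMap.inl ℝ E (Heis n))
  have hD : Continuous D := (hΨ.continuous_fderiv one_ne_zero).clm_comp continuous_const
  have hder : ∀ x q, HasFDerivAt (fun x => Ψ (x, q)) (D (x, q)) x := fun x q =>
    ((hΨ.differentiable one_ne_zero) (x, q)).hasFDerivAt.comp x (hasFDerivAt_prodMk_left x q)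
  have hzero : ∀ x ∈ Metric.ball x₀ r, ∀ q ∉ K, D (x, q) = 0 := fun x hx q hq => by
    have h1 : (fun x => Ψ (x, q)) =ᶠ[𝓝 x] fun _ => 0 := by
      filter_upwards [Metric.isOpen_ball.mem_nhds hx] with y hy
      exact hz y (hrU (Metric.ball_subset_closedBall hy)) q hq
    exact (hder x q).unique ((hasFDerivAt_const (0 : ℝ) x).congr_of_eventuallyEq h1)
  obtain ⟨M, hM⟩ := (((isCompact_closedBall x₀ r).prod hK).image hD).isBounded.exists_norm_le
  have hfK : IntegrableOn f K volume := hf.integrableOn_isCompact hK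
  have hcont : ∀ x, Continuous fun q => Ψ (x, q) := fun x =>
    hΨ.continuous.comp (by fun_prop)
  have hmain := hasFDerivAt_integral_of_dominated_of_fderiv_le (𝕜 := ℝ) (μ := volume)
    (F := fun x q => f q * Ψ (x, q)) (F' := fun x q => f q • D (x, q)) (x₀ := x₀)
    (s := Metric.ball x₀ r) (bound := K.indicator fun q => |f q| * M)
    (Metric.ball_mem_nhds x₀ hr)
    (.of_forall fun x => hf.aestronglyMeasurable.mul (hcont x).aestronglyMeasurable) ?_
    (hf.aestronglyMeasurable.smul (hD.comp (by fun_prop)).aestronglyMeasurable)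
    (.of_forall fun q x hx => ?_) ?_ (.of_forall fun q x _ => (hder x q).const_mul _)
  · refine ⟨?_, hmain.differentiableAt⟩
    rw [hmain.fderiv, ContinuousLinearMap.integral_apply]
    · simp [D]
    · have : Integrable (K.indicator fun q => |f q| * M) volume :=
        (integrable_indicator_iff hK.measurableSet).2 (hfK.abs.mul_const M)
      refine this.mono' (hf.aestronglyMeasurable.smul
        (hD.comp (by fun_prop)).aestronglyMeasurable) (.of_forall fun q => ?_)
      by_cases hq : q ∈ K
      · rw [indicator_of_mem hq, norm_smul, Real.norm_eq_abs]
        gcongr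
        exact hM _ ⟨(x₀, q), ⟨Metric.mem_closedBall_self hr.le, hq⟩, rfl⟩
      · rw [hzero x₀ (Metric.mem_ball_self hr) q hq, indicator_of_notMem hq]; simp
  · have h2 : (fun q => f q * Ψ (x₀, q)) = fun q => Ψ (x₀, q) • f q := by
      funext q; simp [mul_comm]
    rw [h2]
    refine hf.integrable_smul_left_of_hasCompactSupport (hcont x₀) ?_
    exact HasCompactSupport.intro hK fun q hq => hz x₀ hxU q hq
  · by_cases hq : q ∈ K
    · rw [indicator_of_mem hq, norm_smul, Real.norm_eq_abs]
      gcongr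
      exact hM _ ⟨(x, q), ⟨Metric.ball_subset_closedBall hx, hq⟩, rfl⟩
    · rw [hzero x hx q hq, indicator_of_notMem hq]; simp
  · exact (integrable_indicator_iff hK.measurableSet).2 (hfK.abs.mul_const M)

end Parameter

/-! ## Weak derivatives along horizontal paths -/

theorem isCompact_image_heisMul {n : ℕ} {K Γ : Set (Heis n)} (hK : IsCompact K)
    (hΓ : IsCompact Γ) : IsCompact ((fun z : Heis n × Heis n => heisMul z.1 z.2) '' (K ×ˢ Γ)) :=
  (hK.prod hΓ).image (continuous_heisMul continuous_fst continuous_snd)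

section LocalTranslate

variable {n : ℕ} {X : Type*} [MeasurableSpace X] {ν : Measure X} [SFinite ν]

/-- For base points in `K` and translations in `Γ` only the values of `f` on the compact set `K · Γ`
matter. After truncation to that set the global estimate applies with exponents `1` and `∞`. -/
theorem integrable_translate_restrict {f : Heis n → ℝ} (hf : LocallyIntegrable f volume)
    {m : X → ℝ} (hm : Integrable m ν) {γ : X → Heis n} (hγ : Measurable γ) {Γ : Set (Heis n)}
    (hΓ : IsCompact Γ) (hγΓ : ∀ᵐ x ∂ν, γ x ∈ Γ) {K : Set (Heis n)} (hK : IsCompact K) :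
    Integrable (fun z : Heis n × X => m z.2 * f (heisMul z.1 (γ z.2)))
      ((volume.restrict K).prod ν) := by
  set L := (fun z : Heis n × Heis n => heisMul z.1 z.2) '' (K ×ˢ Γ) with hL
  have hLc : IsCompact L := isCompact_image_heisMul hK hΓ
  have hu : MemLp (L.indicator f) 1 volume := memLp_one_iff_integrable.2
    ((integrable_indicator_iff hLc.measurableSet).2 (hf.integrableOn_isCompact hLc))
  have hone : MemLp (fun _ : Heis n => (1 : ℝ)) ∞ volume := memLp_top_const 1
  have : ENNReal.HolderConjugate 1 ∞ := inferInstance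
  have h1 : Integrable (fun z : Heis n × X => m z.2 * (L.indicator f (heisMul z.1 (γ z.2)) * 1))
      ((volume : Measure (Heis n)).prod ν) := by
    refine ⟨aestronglyMeasurable_translate_mul hu.1 hone.1 hm.1 hγ hγ, ?_⟩
    rw [HasFiniteIntegral, lintegral_prod _
      (aestronglyMeasurable_translate_mul hu.1 hone.1 hm.1 hγ hγ).enorm]
    refine (lintegral_lintegral_translate_mul_le (s := 1) (s' := ∞) hu.1 hone.1 hm.1 hγ
      hγ).trans_lt ?_
    exact ENNReal.mul_lt_top hm.2 (ENNReal.mul_lt_top hu.2 hone.2)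
  have h2 : Integrable (fun z : Heis n × X => m z.2 * (L.indicator f (heisMul z.1 (γ z.2)) * 1))
      ((volume.restrict K).prod ν) :=
    h1.mono_measure (Measure.prod_mono Measure.restrict_le_self le_rfl)
  refine h2.congr ?_
  have hKae : ∀ᵐ z ∂((volume.restrict K).prod ν), z.1 ∈ K :=
    Measure.quasiMeasurePreserving_fst.ae (ae_restrict_mem hK.measurableSet)
  have hΓae : ∀ᵐ z ∂((volume.restrict K).prod ν), γ z.2 ∈ Γ :=
    Measure.quasiMeasurePreserving_snd.ae hγΓ
  filter_upwards [hKae, hΓae] with z h3 h4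
  have : heisMul z.1 (γ z.2) ∈ L := ⟨(z.1, γ z.2), ⟨h3, h4⟩, rfl⟩
  rw [indicator_of_mem this, mul_one]

theorem ae_of_forall_isCompact_ae_restrict {P : Heis n → Prop}
    (h : ∀ K : Set (Heis n), IsCompact K → ∀ᵐ q ∂(volume.restrict K), P q) :
    ∀ᵐ q : Heis n, P q := by
  have h1 : ∀ᵐ q ∂(volume.restrict (⋃ k, compactCovering (Heis n) k)), P q := by
    rw [ae_restrict_iUnion_iff]
    exact fun k => h _ (isCompact_compactCovering _ k)
  rwa [iUnion_compactCovering, Measure.restrict_univ] at h1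

theorem ae_integrable_translate {f : Heis n → ℝ} (hf : LocallyIntegrable f volume)
    {m : X → ℝ} (hm : Integrable m ν) {γ : X → Heis n} (hγ : Measurable γ) {Γ : Set (Heis n)}
    (hΓ : IsCompact Γ) (hγΓ : ∀ᵐ x ∂ν, γ x ∈ Γ) :
    ∀ᵐ q, Integrable (fun x => m x * f (heisMul q (γ x))) ν :=
  ae_of_forall_isCompact_ae_restrict fun _ hK =>
    (integrable_translate_restrict hf hm hγ hΓ hγΓ hK).prod_right_ae

theorem locallyIntegrable_integral_translate {f : Heis n → ℝ} (hf : LocallyIntegrable f volume)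
    {m : X → ℝ} (hm : Integrable m ν) {γ : X → Heis n} (hγ : Measurable γ) {Γ : Set (Heis n)}
    (hΓ : IsCompact Γ) (hγΓ : ∀ᵐ x ∂ν, γ x ∈ Γ) :
    LocallyIntegrable (fun q => ∫ x, m x * f (heisMul q (γ x)) ∂ν) volume := by
  rw [locallyIntegrable_iff]
  intro K hK
  exact (integrable_translate_restrict hf hm hγ hΓ hγΓ hK).integral_prod_left

theorem integral_translate_mul_swap {f : Heis n → ℝ} (hf : LocallyIntegrable f volume)
    {m : X → ℝ} (hm : Integrable m ν) {γ : X → Heis n} (hγ : Measurable γ) {Γ : Set (Heis n)}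
    (hΓ : IsCompact Γ) (hγΓ : ∀ᵐ x ∂ν, γ x ∈ Γ) {φ : Heis n → ℝ} (hφ : Continuous φ)
    (hφc : HasCompactSupport φ) :
    ∫ q, φ q * ∫ x, m x * f (heisMul q (γ x)) ∂ν =
      ∫ x, m x * (∫ q, f q * φ (heisMul q (-γ x))) ∂ν := by
  have h1 := integrable_translate_restrict hf hm hγ hΓ hγΓ hφc
  have h2 : Integrable (fun z : Heis n × X => φ z.1 * (m z.2 * f (heisMul z.1 (γ z.2))))
      ((volume.restrict (tsupport φ)).prod ν) := by
    obtain ⟨C, hC⟩ := hφc.exists_bound_of_continuous hφ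
    exact h1.bdd_mul (hφ.measurable.comp measurable_fst).aestronglyMeasurable (.of_forall fun z => hC z.1)
  have e1 : ∫ q, φ q * ∫ x, m x * f (heisMul q (γ x)) ∂ν =
      ∫ q in tsupport φ, ∫ x, φ q * (m x * f (heisMul q (γ x))) ∂ν := by
    rw [setIntegral_eq_integral_of_forall_compl_eq_zero fun q hq => by
      simp [image_eq_zero_of_notMem_tsupport hq]]
    exact integral_congr_ae (.of_forall fun q => (integral_const_mul _ _).symm)
  rw [e1, integral_integral_swap h2]
  refine integral_congr_ae (.of_forall fun x => ?_)
  simp only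
  rw [setIntegral_eq_integral_of_forall_compl_eq_zero fun q hq => by
      simp [image_eq_zero_of_notMem_tsupport hq], ← integral_const_mul,
      ← integral_heisMul_right (γ x) (fun q => m x * (f q * φ (heisMul q (-γ x))))]
  exact integral_congr_ae (.of_forall fun q => by simp; ring)

end LocalTranslate

/-- The fundamental theorem of calculus along a horizontal path, for functions with weak horizontal
derivatives, with a smooth weight. -/
theorem ae_integral_weakDeriv_path {n : ℕ} {f : Heis n → ℝ} {g : HorIdx n → Heis n → ℝ}
    (hfg : ∀ i, IsWeakFrameDeriv (Sum.inl i) f (g i)) {γ : ℝ → Heis n}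
    {c : ℝ → HorIdx n → ℝ} (hγ : ContDiff ℝ (⊤ : ℕ∞) γ)
    (hc : ∀ i, Continuous fun s => c s i)
    (hγc : ∀ s, HasDerivAt γ (∑ i, c s i • heisZ (Sum.inl i) (γ s)) s) {a a' : ℝ → ℝ}
    (ha : ∀ s, HasDerivAt a (a' s) s) (ha' : Continuous a') (hf : LocallyIntegrable f volume) :
    ∀ᵐ q, a 1 * f (heisMul q (γ 1)) - a 0 * f (heisMul q (γ 0)) =
      (∫ s in Ioc (0 : ℝ) 1, a' s * f (heisMul q (γ s))) +
        ∑ i, ∫ s in Ioc (0 : ℝ) 1, (a s * c s i) * g i (heisMul q (γ s)) := by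
  have hg : ∀ i, LocallyIntegrable (g i) volume := fun i => (hfg i).2.1
  have hac : Continuous a := continuous_iff_continuousAt.2 fun s => (ha s).continuousAt
  have hacc : ∀ i, Continuous fun s => a s * c s i := fun i => hac.mul (hc i)
  have hi : ∀ {m : ℝ → ℝ}, Continuous m → Integrable m (volume.restrict (Ioc (0 : ℝ) 1)) :=
    fun hm => (hm.integrableOn_Icc).mono_set Ioc_subset_Icc_self
  have hΓ : IsCompact (γ '' Icc (0 : ℝ) 1) := isCompact_Icc.image hγ.continuous
  have hγΓ : ∀ᵐ s ∂(volume.restrict (Ioc (0 : ℝ) 1)), γ s ∈ γ '' Icc (0 : ℝ) 1 :=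
    (ae_restrict_mem measurableSet_Ioc).mono fun s hs => ⟨s, Ioc_subset_Icc_self hs, rfl⟩
  have hγm : Measurable γ := hγ.continuous.measurable
  have htr : ∀ s, LocallyIntegrable (fun q => f (heisMul q (γ s))) volume := fun s => by
    have := locallyIntegrable_integral_translate (ν := Measure.dirac ()) hf (m := fun _ => 1)
      (integrable_const 1) (γ := fun _ => γ s) measurable_const (isCompact_singleton (x := γ s))
      (.of_forall fun _ => rfl)
    simpa using this
  refine ae_eq_of_integral_contDiff_smul_eq (((htr 1).smul (a 1)).sub ((htr 0).smul (a 0)))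
    ((locallyIntegrable_integral_translate hf (hi ha') hγm hΓ hγΓ).add
      (locallyIntegrable_finsetSum _ fun i _ =>
        locallyIntegrable_integral_translate (hg i) (hi (hacc i)) hγm hΓ hγΓ)) ?_
  intro φ hφ hφc
  have hφ' : Differentiable ℝ φ := hφ.differentiable (by simp)
  have hΨ : ContDiff ℝ (⊤ : ℕ∞) fun z : ℝ × Heis n => φ (heisMul z.2 (-γ z.1)) :=
    hφ.comp (contDiff_heisMul contDiff_snd (hγ.comp contDiff_fst).neg)
  have hsupp : ∀ x₀ : ℝ, ∃ U : Set ℝ, IsOpen U ∧ x₀ ∈ U ∧ ∃ K : Set (Heis n), IsCompact K ∧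
      ∀ x ∈ U, ∀ q ∉ K, φ (heisMul q (-γ x)) = 0 := fun x₀ => by
    refine ⟨Metric.ball x₀ 1, Metric.isOpen_ball, Metric.mem_ball_self one_pos, _,
      isCompact_image_heisMul hφc ((isCompact_closedBall x₀ 1).image hγ.continuous), ?_⟩
    intro x hx q hq
    refine image_eq_zero_of_notMem_tsupport fun h => hq
      ⟨(heisMul q (-γ x), γ x), ⟨h, x, Metric.ball_subset_closedBall hx, rfl⟩, by simp⟩
  -- Right translation preserves the measure, so it can be moved from `f` to the test function. This
  -- turns an a.e. statement about `f` along a path into calculus for the smooth function `J f`.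
  -- Since `γ` is horizontal, `hJd` needs only the horizontal weak derivatives of `f`, and the claim
  -- becomes the fundamental theorem of calculus for `a · J f`.
  let J : (Heis n → ℝ) → ℝ → ℝ := fun f s => ∫ q, f q * φ (heisMul q (-γ s))
  have hJ : ∀ {f}, LocallyIntegrable f volume → Continuous (J f) := fun hf =>
    (contDiff_integral_mul_param hf hΨ hsupp).continuous
  have hφs : ∀ s, ContDiff ℝ (⊤ : ℕ∞) fun q => φ (heisMul q (-γ s)) := fun s =>
    hφ.comp (contDiff_heisMul contDiff_id contDiff_const)
  have hφsc : ∀ s, HasCompactSupport fun q => φ (heisMul q (-γ s)) := fun s =>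
    hφc.comp_homeomorph (heisMulRight (-γ s))
  have hJd : ∀ s, HasDerivAt (J f) (∑ i, c s i * J (g i) s) s := by
    intro s
    obtain ⟨h1, h2⟩ := hasFDerivAt_integral_mul_param hf (hΨ.of_le (by simp)) (hsupp s) (1 : ℝ)
    have h3 : HasDerivAt (J f) (fderiv ℝ (fun x => ∫ q, f q * φ (heisMul q (-γ x))) s 1) s :=
      h2.hasFDerivAt.hasDerivAt
    refine h3.congr_deriv ?_
    rw [h1]
    have h4 : ∀ q, fderiv ℝ (fun z : ℝ × Heis n => φ (heisMul z.2 (-γ z.1))) (s, q) (1, 0) =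
        -∑ i, c s i * frameDeriv (Sum.inl i) (fun q => φ (heisMul q (-γ s))) q := fun q => by
      have h5 := ((hΨ.differentiable (by simp)) (s, q)).hasFDerivAt.comp_hasDerivAt s
        ((hasDerivAt_id s).prodMk (hasDerivAt_const s q))
      exact h5.unique (hasDerivAt_comp_heisMul_neg (hγc s) q hφ')
    simp only [h4]
    have h6 : ∀ i, Integrable fun q => f q *
        (c s i * frameDeriv (Sum.inl i) (fun q => φ (heisMul q (-γ s))) q) := fun i => by
      have := (hf.integrable_smul_left_of_hasCompactSupport
        (continuous_frameDeriv ((hφs s).of_le (by simp)) (Sum.inl i))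
        (hasCompactSupport_frameDeriv (hφsc s) _)).const_mul (c s i)
      refine this.congr (.of_forall fun q => ?_)
      simp only [smul_eq_mul]; ring
    simp only [mul_neg, Finset.mul_sum]
    rw [integral_neg, integral_finsetSum _ fun i _ => h6 i, ← Finset.sum_neg_distrib]
    refine Finset.sum_congr rfl fun i _ => ?_
    have h7 := (hfg i).2.2 _ (hφs s) (hφsc s)
    have h8 : ∀ q, f q * (c s i * frameDeriv (Sum.inl i) (fun q => φ (heisMul q (-γ s))) q) =
        c s i * (f q * frameDeriv (Sum.inl i) (fun q => φ (heisMul q (-γ s))) q) := fun q => by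
      ring
    simp only [h8]
    rw [integral_const_mul, h7]
    simp [J]
  have hFTC : ∫ s in (0 : ℝ)..1, (a' s * J f s + a s * ∑ i, c s i * J (g i) s) =
      a 1 * J f 1 - a 0 * J f 0 := by
    refine intervalIntegral.integral_eq_sub_of_hasDerivAt (f := fun s => a s * J f s)
      (fun s _ => (ha s).mul (hJd s)) (Continuous.intervalIntegrable ?_ _ _)
    exact (ha'.mul (hJ hf)).add (hac.mul (continuous_finsetSum _ fun i _ =>
      (hc i).mul (hJ (hg i))))
  have hint : ∀ {F : Heis n → ℝ}, LocallyIntegrable F volume → Integrable fun q => φ q * F q :=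
    fun hF => hF.integrable_smul_left_of_hasCompactSupport hφ.continuous hφc
  simp only [smul_eq_mul, mul_sub, mul_add, Finset.mul_sum]
  have i1 : ∀ s, Integrable fun q => φ q * (a s * f (heisMul q (γ s))) := fun s =>
    hint ((htr s).smul (a s))
  have i2 := hint (locallyIntegrable_integral_translate hf (hi ha') hγm hΓ hγΓ)
  have i3 := fun i => hint (locallyIntegrable_integral_translate (hg i)
    (hi (hacc i)) hγm hΓ hγΓ)
  have e1 : ∀ s, ∫ q, φ q * (a s * f (heisMul q (γ s))) = a s * J f s := fun s => by
    simp only [J]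
    rw [← integral_const_mul,
      ← integral_heisMul_right (γ s) (fun q => a s * (f q * φ (heisMul q (-γ s))))]
    exact integral_congr_ae (.of_forall fun q => by simp; ring)
  rw [integral_sub (i1 1) (i1 0), e1, e1, ← hFTC, integral_add i2
    (integrable_finsetSum _ fun i _ => i3 i), integral_finsetSum _ fun i _ => i3 i,
    integral_translate_mul_swap hf (hi ha') hγm hΓ hγΓ hφ.continuous hφc,
    intervalIntegral.integral_of_le zero_le_one]
  have c1 : Continuous fun s => a' s * J f s := ha'.mul (hJ hf)
  have c2 : ∀ i, Continuous fun s => a s * (c s i * J (g i) s) := fun i =>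
    hac.mul ((hc i).mul (hJ (hg i)))
  simp only [Finset.mul_sum]
  rw [integral_add (hi c1) (integrable_finsetSum _ fun i _ => hi (c2 i)),
    integral_finsetSum _ fun i _ => hi (c2 i)]
  congr 1
  refine Finset.sum_congr rfl fun i _ => ?_
  rw [integral_translate_mul_swap (hg i) (hi (hacc i)) hγm hΓ hγΓ hφ.continuous hφc]
  exact integral_congr_ae (.of_forall fun s => (mul_assoc _ _ _).symm)

/-! ## Mollification on the Heisenberg group -/

/-- Mollification by averages over right translates. -/
def heisMoll {n : ℕ} (ρ : Heis n → ℝ) (ε : ℝ) (u : Heis n → ℝ) (p : Heis n) : ℝ :=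
  ∫ w, ρ w * u (heisMul p (heisDil ε w))

/-- The integral kernel of `heisMoll`. -/
def heisKer {n : ℕ} (ρ : Heis n → ℝ) (ε : ℝ) (p q : Heis n) : ℝ :=
  (dilJac n ε)⁻¹ * ρ (heisDil ε⁻¹ (heisMul (-p) q))

section Kernel

variable {n : ℕ} {ρ : Heis n → ℝ} {ε : ℝ}

theorem contDiff_heisKer_uncurry (hρ : ContDiff ℝ (⊤ : ℕ∞) ρ) :
    ContDiff ℝ (⊤ : ℕ∞) fun z : Heis n × Heis n => heisKer ρ ε z.1 z.2 :=
  contDiff_const.mul (hρ.comp ((contDiff_heisDil _).comp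
    (contDiff_heisMul contDiff_fst.neg contDiff_snd)))

theorem contDiff_heisKer (hρ : ContDiff ℝ (⊤ : ℕ∞) ρ) (p : Heis n) :
    ContDiff ℝ (⊤ : ℕ∞) (heisKer ρ ε p) :=
  (contDiff_heisKer_uncurry hρ).comp (contDiff_const.prodMk contDiff_id)

theorem heisKer_heisMul_heisDil (hε : ε ≠ 0) (p w : Heis n) :
    heisKer ρ ε p (heisMul p (heisDil ε w)) = (dilJac n ε)⁻¹ * ρ w := by
  simp [heisKer, heisDil_inv_cancel hε]

theorem heisMul_heisDil_inv (hε : ε ≠ 0) (p q : Heis n) :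
    heisMul p (heisDil ε (heisDil ε⁻¹ (heisMul (-p) q))) = q := by
  rw [heisDil_cancel_inv hε]; simp

/-- The points reached from `K` by `δ_ε` of the support of `ρ`. -/
def heisEnlarge (ρ : Heis n → ℝ) (ε : ℝ) (K : Set (Heis n)) : Set (Heis n) :=
  (fun z : Heis n × Heis n => heisMul z.1 z.2) '' (K ×ˢ (heisDil ε '' tsupport ρ))

theorem isCompact_heisEnlarge (hρc : HasCompactSupport ρ) {K : Set (Heis n)} (hK : IsCompact K) :
    IsCompact (heisEnlarge ρ ε K) :=
  isCompact_image_heisMul hK (hρc.image (contDiff_heisDil (k := 0) ε).continuous)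

theorem heisKer_eq_zero (hε : ε ≠ 0) {K : Set (Heis n)} {p q : Heis n} (hp : p ∈ K)
    (hq : q ∉ heisEnlarge ρ ε K) : heisKer ρ ε p q = 0 := by
  have h : ρ (heisDil ε⁻¹ (heisMul (-p) q)) = 0 :=
    image_eq_zero_of_notMem_tsupport fun h => hq
      ⟨(p, heisMul (-p) q), ⟨hp, _, h, heisDil_cancel_inv hε _⟩, by simp⟩
  rw [heisKer, h, mul_zero]

theorem hasCompactSupport_heisKer (hρc : HasCompactSupport ρ) (hε : ε ≠ 0) (p : Heis n) :
    HasCompactSupport (heisKer ρ ε p) :=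
  HasCompactSupport.intro (isCompact_heisEnlarge hρc (isCompact_singleton (x := p)))
    fun _ hq => heisKer_eq_zero hε (mem_singleton p) hq

theorem heisMoll_eq_integral_heisKer (hε : ε ≠ 0) (u : Heis n → ℝ) (p : Heis n) :
    heisMoll ρ ε u p = ∫ q, u q * heisKer ρ ε p q := by
  have h := integral_heisMul_heisDil hε p (fun q => u q * (dilJac n ε * heisKer ρ ε p q))
  have hJ := (dilJac_pos (n := n) hε).ne'
  simp only [heisKer_heisMul_heisDil hε] at h
  rw [heisMoll, ← integral_const_mul] at *
  calc _ = ∫ w, u (heisMul p (heisDil ε w)) * (dilJac n ε * ((dilJac n ε)⁻¹ * ρ w)) :=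
        integral_congr_ae (.of_forall fun w => by simp only; field_simp)
    _ = _ := h
    _ = _ := integral_congr_ae (.of_forall fun q => by simp only; field_simp)

theorem heisKer_param_support (hρc : HasCompactSupport ρ) (hε : ε ≠ 0) (p₀ : Heis n) :
    ∃ U : Set (Heis n), IsOpen U ∧ p₀ ∈ U ∧ ∃ K : Set (Heis n), IsCompact K ∧
      ∀ p ∈ U, ∀ q ∉ K, heisKer ρ ε p q = 0 :=
  ⟨Metric.ball p₀ 1, Metric.isOpen_ball, Metric.mem_ball_self one_pos, _,
    isCompact_heisEnlarge (ε := ε) hρc (isCompact_closedBall p₀ 1), fun _ hp _ hq =>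
      heisKer_eq_zero hε (Metric.ball_subset_closedBall hp) hq⟩

theorem contDiff_heisMoll (hρ : ContDiff ℝ (⊤ : ℕ∞) ρ) (hρc : HasCompactSupport ρ) (hε : ε ≠ 0)
    {u : Heis n → ℝ} (hu : LocallyIntegrable u volume) :
    ContDiff ℝ (⊤ : ℕ∞) (heisMoll ρ ε u) := by
  have := contDiff_integral_mul_param hu (contDiff_heisKer_uncurry (ε := ε) hρ)
    (heisKer_param_support hρc hε)
  rwa [show heisMoll ρ ε u = _ from funext fun p => heisMoll_eq_integral_heisKer hε u p]

/-- The difference between the left- and the right-invariant frames is a multiple of `T`. -/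
def rightCorr : FrameIdx n → Heis n → ℝ
  | Sum.inl (Sum.inl j), w => -4 * w.2.1 j
  | Sum.inl (Sum.inr j), w => 4 * w.1 j
  | Sum.inr _, _ => 0

/-- Left multiplication by a one-parameter subgroup follows a right-invariant field, here written in
the left-invariant frame. The motion is affine in `h`, so no remainder has to be estimated. -/
theorem neg_smul_heisZ_heisMul (i : FrameIdx n) (h : ℝ) (w : Heis n) :
    heisMul (-(h • heisZ i 0)) w =
      w + h • -(heisZ i w + rightCorr i w • heisZ (Sum.inr ()) w) := by
  rcases i with (j | j) | j
  · simp only [heisMul, heisZ, rightCorr, Prod.ext_iff]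
    refine ⟨?_, ?_, ?_⟩
    · funext l; simp; ring
    · funext l; simp
    · simp [Pi.single_apply]; ring
  · simp only [heisMul, heisZ, rightCorr, Prod.ext_iff]
    refine ⟨?_, ?_, ?_⟩
    · funext l; simp
    · funext l; simp; ring
    · simp [Pi.single_apply]; ring
  · simp [heisMul, heisZ, rightCorr, Prod.ext_iff]; ring

theorem neg_heisMul_rev (p q : Heis n) : -heisMul p q = heisMul (-q) (-p) := by
  simp only [heisMul, Prod.neg_mk, Prod.mk.injEq, Prod.fst_neg, Prod.snd_neg, Pi.neg_apply]
  refine ⟨by abel, by abel, ?_⟩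
  have : ∑ j, (-p.1 j * -q.2.1 j - -q.1 j * -p.2.1 j) =
      -∑ j, (q.1 j * p.2.1 j - p.1 j * q.2.1 j) := by
    rw [← Finset.sum_neg_distrib]; exact Finset.sum_congr rfl fun j _ => by ring
  rw [this]; ring

/-- The kernel depends on `p⁻¹ q`, and `(p · hZ)⁻¹ q = (-hZ) · (p⁻¹ q)`. Differentiation in the
first variable is therefore right-invariant differentiation of the rescaled `ρ` and produces the
extra term with `rightCorr`. -/
theorem fderiv_heisKer_fst (hρ : ContDiff ℝ (⊤ : ℕ∞) ρ) (p w : Heis n)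
    (i : FrameIdx n) :
    fderiv ℝ (fun z : Heis n × Heis n => heisKer ρ ε z.1 z.2) (p, heisMul p (heisDil ε w))
      (heisZ i p, 0) = -((dilJac n ε)⁻¹ * (frameDeriv i (fun v => ρ (heisDil ε⁻¹ v)) (heisDil ε w) +
        rightCorr i (heisDil ε w) *
          frameDeriv (Sum.inr ()) (fun v => ρ (heisDil ε⁻¹ v)) (heisDil ε w))) := by
  set q := heisMul p (heisDil ε w) with hq
  set w' := heisDil ε w with hw'
  set ρ' : Heis n → ℝ := fun v => ρ (heisDil ε⁻¹ v) with hρ'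
  have hd : Differentiable ℝ ρ' := (hρ.comp (contDiff_heisDil _)).differentiable (by simp)
  have h1 : HasDerivAt (fun h : ℝ => (p + h • heisZ i p, q)) (heisZ i p, (0 : Heis n)) 0 := by
    refine HasDerivAt.prodMk ?_ (hasDerivAt_const _ _)
    simpa using ((hasDerivAt_id (0 : ℝ)).smul_const (heisZ i p)).const_add p
  have h2 : HasFDerivAt (fun z : Heis n × Heis n => heisKer ρ ε z.1 z.2)
      (fderiv ℝ (fun z : Heis n × Heis n => heisKer ρ ε z.1 z.2) (p, q))
      (p + (0 : ℝ) • heisZ i p, q) := by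
    simpa using (((contDiff_heisKer_uncurry (ε := ε) hρ).differentiable (by simp))
      (p, q)).hasFDerivAt
  have h3 := h2.comp_hasDerivAt (0 : ℝ) h1
  have h4 : HasDerivAt (fun h : ℝ => w' + h • -(heisZ i w' + rightCorr i w' •
      heisZ (Sum.inr ()) w')) (-(heisZ i w' + rightCorr i w' • heisZ (Sum.inr ()) w')) 0 :=
    (((hasDerivAt_id (0 : ℝ)).smul_const _).const_add w').congr_deriv (one_smul _ _)
  have h5 : HasFDerivAt ρ' (fderiv ℝ ρ' w') (w' + (0 : ℝ) • -(heisZ i w' + rightCorr i w' •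
      heisZ (Sum.inr ()) w')) := by simpa using (hd w').hasFDerivAt
  have h6 := (h5.comp_hasDerivAt (0 : ℝ) h4).const_mul (dilJac n ε)⁻¹
  have h7 : (fun h : ℝ => (dilJac n ε)⁻¹ * (ρ' ∘ fun h : ℝ => w' + h • -(heisZ i w' +
      rightCorr i w' • heisZ (Sum.inr ()) w')) h) =
      ((fun z : Heis n × Heis n => heisKer ρ ε z.1 z.2) ∘ fun h : ℝ => (p + h • heisZ i p, q)) := by
    funext h
    simp only [Function.comp_apply, heisKer, ← heisMul_smul_heisZ, neg_heisMul_rev,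
      heisMul_assoc, hq, neg_heisMul_cancel_left, hρ']
    rw [← neg_smul_heisZ_heisMul]
  rw [h7] at h6
  rw [h3.unique h6]
  simp only [frameDeriv, map_neg, map_add, map_smul, smul_eq_mul]
  ring

/-- Integrals against the kernel, in the variable `w = δ_{1/ε} (p⁻¹ q)`. -/
theorem integral_mul_dil (hε : ε ≠ 0) (p : Heis n) (F G : Heis n → ℝ) :
    ∫ q, F q * ((dilJac n ε)⁻¹ * G (heisDil ε⁻¹ (heisMul (-p) q))) =
      ∫ w, F (heisMul p (heisDil ε w)) * G w := by
  have h := integral_heisMul_heisDil hε p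
    (fun q => F q * G (heisDil ε⁻¹ (heisMul (-p) q)))
  simp only [neg_heisMul_cancel_left, heisDil_inv_cancel hε] at h
  rw [h, ← integral_const_mul]
  exact integral_congr_ae (.of_forall fun q => by simp only; ring)

/-- The powers of `ε` produced by a derivative along the frame. -/
def frameScale (ε : ℝ) : FrameIdx n → ℝ
  | Sum.inl _ => ε⁻¹
  | Sum.inr _ => (ε⁻¹) ^ 2

theorem frameDeriv_dil (hρ : Differentiable ℝ ρ) (i : FrameIdx n) (v : Heis n) :
    frameDeriv i (fun v => ρ (heisDil ε⁻¹ v)) v =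
      frameScale ε i * frameDeriv i ρ (heisDil ε⁻¹ v) := by
  rcases i with i | ⟨⟩
  · exact frameDeriv_heisDil hρ _ _ _
  · exact frameDeriv_heisDil_vert hρ _ _

theorem frameDeriv_heisKer (hρ : ContDiff ℝ (⊤ : ℕ∞) ρ) (p q : Heis n) (i : FrameIdx n) :
    frameDeriv i (heisKer ρ ε p) q =
      (dilJac n ε)⁻¹ * (frameScale ε i * frameDeriv i ρ (heisDil ε⁻¹ (heisMul (-p) q))) := by
  have hd : Differentiable ℝ (fun v => ρ (heisDil ε⁻¹ v)) :=
    (hρ.comp (contDiff_heisDil _)).differentiable (by simp)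
  have h1 := frameDeriv_heisMul_left hd i (-p) q
  rw [frameDeriv_dil (hρ.differentiable (by simp))] at h1
  rw [← h1]
  simp only [frameDeriv]
  have h2 : DifferentiableAt ℝ (fun q => ρ (heisDil ε⁻¹ (heisMul (-p) q))) q :=
    (hd.comp ((contDiff_heisMul contDiff_const contDiff_id (k := 1)).differentiable
      one_ne_zero)) q
  have h3 : heisKer ρ ε p = fun q => (dilJac n ε)⁻¹ • ρ (heisDil ε⁻¹ (heisMul (-p) q)) := rfl
  rw [h3, fderiv_fun_const_smul h2]
  rfl

/-- Homogeneity of degree one reduces the factor `ε⁻²` of the vertical derivative to `ε⁻¹` in the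
correction term. -/
theorem rightCorr_heisDil (i : FrameIdx n) (w : Heis n) :
    rightCorr i (heisDil ε w) = ε * rightCorr i w := by
  rcases i with (j | j) | j <;> simp [rightCorr, heisDil_apply] <;> ring

theorem frameDeriv_heisMoll (hρ : ContDiff ℝ (⊤ : ℕ∞) ρ) (hρc : HasCompactSupport ρ)
    (hε : ε ≠ 0) {u : Heis n → ℝ} (hu : LocallyIntegrable u volume) (p : Heis n)
    (i : FrameIdx n) :
    frameDeriv i (heisMoll ρ ε u) p = -∫ w, u (heisMul p (heisDil ε w)) *
      (frameScale ε i * frameDeriv i ρ w +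
        ε⁻¹ * rightCorr i w * frameDeriv (Sum.inr ()) ρ w) := by
  have h1 := (hasFDerivAt_integral_mul_param hu
    ((contDiff_heisKer_uncurry (ε := ε) hρ).of_le (by simp))
    (heisKer_param_support hρc hε p) (heisZ i p)).1
  have h2 : heisMoll ρ ε u = fun p => ∫ q, u q * heisKer ρ ε p q :=
    funext fun p => heisMoll_eq_integral_heisKer hε u p
  rw [frameDeriv, h2, h1, ← integral_neg]
  have h3 : ∀ q, fderiv ℝ (fun z : Heis n × Heis n => heisKer ρ ε z.1 z.2) (p, q)
      (heisZ i p, 0) = (dilJac n ε)⁻¹ * (fun w => -(frameScale ε i * frameDeriv i ρ w +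
        ε⁻¹ * rightCorr i w * frameDeriv (Sum.inr ()) ρ w))
          (heisDil ε⁻¹ (heisMul (-p) q)) := fun q => by
    have h4 := fderiv_heisKer_fst (ε := ε) hρ p (heisDil ε⁻¹ (heisMul (-p) q)) i
    rw [heisMul_heisDil_inv hε] at h4
    rw [h4, frameDeriv_dil (hρ.differentiable (by simp)),
      frameDeriv_dil (hρ.differentiable (by simp)), rightCorr_heisDil, heisDil_inv_cancel hε]
    simp only [frameScale]
    field_simp
  simp only [h3]
  refine (integral_mul_dil hε p u fun w => -(frameScale ε i * frameDeriv i ρ w +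
    ε⁻¹ * rightCorr i w * frameDeriv (Sum.inr ()) ρ w)).trans ?_
  exact integral_congr_ae (.of_forall fun w => by simp only; ring)

theorem integrable_comp_dil_mul (hε : ε ≠ 0) {F : Heis n → ℝ} (hF : LocallyIntegrable F volume)
    {G : Heis n → ℝ} (hG : Continuous G) (hGc : HasCompactSupport G) (p : Heis n) :
    Integrable fun w => F (heisMul p (heisDil ε w)) * G w := by
  have h1 : Continuous fun q => G (heisDil ε⁻¹ (heisMul (-p) q)) :=
    hG.comp ((contDiff_heisDil (k := 0) _).continuous.comp
      (continuous_heisMul continuous_const continuous_id))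
  have h2 : HasCompactSupport fun q => G (heisDil ε⁻¹ (heisMul (-p) q)) :=
    hGc.comp_homeomorph ((heisMulLeft (-p)).trans (heisDilHomeo (inv_ne_zero hε)))
  have h3 := hF.integrable_smul_left_of_hasCompactSupport h1 h2
  have h4 := (integrable_heisMul_heisDil_iff hε p
    (fun q => G (heisDil ε⁻¹ (heisMul (-p) q)) • F q)).2 h3
  refine h4.congr (.of_forall fun w => ?_)
  simp only [neg_heisMul_cancel_left, heisDil_inv_cancel hε, smul_eq_mul]
  ring

end Kernel

/-! ## The commutator of a field and the mollification -/

/-- The commutator of the mollification and the derivation along `b`; `D` is the divergence. -/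
def heisComm {n : ℕ} (ρ : Heis n → ℝ) (ε : ℝ) (b : FrameIdx n → Heis n → ℝ) (D u : Heis n → ℝ)
    (p : Heis n) : ℝ :=
  (∫ q, u q * (∑ i, b i q * frameDeriv i (heisKer ρ ε p) q + D q * heisKer ρ ε p q)) +
    ∑ i, b i p * frameDeriv i (heisMoll ρ ε u) p

/-- In the variable `w = δ_{1/ε}(p⁻¹ q)` both halves of the commutator contain the same derivatives
of `ρ`, once with the coefficients at `p · δ_ε w` and once with the coefficients frozen at `p`. Only
increments of the coefficients, the correction of the frame and the divergence term are left. -/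
theorem heisComm_eq {n : ℕ} {ρ : Heis n → ℝ} {ε : ℝ} (hρ : ContDiff ℝ (⊤ : ℕ∞) ρ)
    (hρc : HasCompactSupport ρ) (hε : ε ≠ 0) {b : FrameIdx n → Heis n → ℝ} {D u : Heis n → ℝ}
    (hu : LocallyIntegrable u volume) (hub : ∀ i, LocallyIntegrable (fun q => u q * b i q) volume)
    (huD : LocallyIntegrable (fun q => u q * D q) volume) (p : Heis n) :
    heisComm ρ ε b D u p = ∫ w, u (heisMul p (heisDil ε w)) *
      (∑ i, ((b i (heisMul p (heisDil ε w)) - b i p) * (frameScale ε i * frameDeriv i ρ w) -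
        b i p * (ε⁻¹ * rightCorr i w * frameDeriv (Sum.inr ()) ρ w)) +
        D (heisMul p (heisDil ε w)) * ρ w) := by
  have hc : ∀ i, Continuous (frameDeriv i ρ) := fun i => continuous_frameDeriv
    (hρ.of_le (by simp)) i
  have hcs : ∀ i, HasCompactSupport (frameDeriv i ρ) := fun i => hasCompactSupport_frameDeriv hρc i
  have hrc : ∀ i, Continuous (rightCorr (n := n) i) := by
    rintro ((j | j) | j) <;> · unfold rightCorr; fun_prop
  have hG : ∀ i, Continuous fun w => frameScale ε i * frameDeriv i ρ w +
      ε⁻¹ * rightCorr i w * frameDeriv (Sum.inr ()) ρ w := fun i =>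
    (continuous_const.mul (hc i)).add ((continuous_const.mul (hrc i)).mul (hc _))
  have hGc : ∀ i, HasCompactSupport fun w => frameScale ε i * frameDeriv i ρ w +
      ε⁻¹ * rightCorr i w * frameDeriv (Sum.inr ()) ρ w := fun i =>
    HasCompactSupport.add ((hcs i).mul_left) ((hcs _).mul_left)
  have i1 : ∀ i, Integrable fun w => u (heisMul p (heisDil ε w)) * b i (heisMul p (heisDil ε w)) *
      (frameScale ε i * frameDeriv i ρ w) := fun i =>
    integrable_comp_dil_mul hε (hub i) (continuous_const.mul (hc i)) ((hcs i).mul_left) p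
  have i2 : Integrable fun w => u (heisMul p (heisDil ε w)) * D (heisMul p (heisDil ε w)) * ρ w :=
    integrable_comp_dil_mul hε huD hρ.continuous hρc p
  have i3 : ∀ i, Integrable fun w => b i p * (u (heisMul p (heisDil ε w)) *
      (frameScale ε i * frameDeriv i ρ w +
        ε⁻¹ * rightCorr i w * frameDeriv (Sum.inr ()) ρ w)) := fun i =>
    (integrable_comp_dil_mul hε hu (hG i) (hGc i) p).const_mul _
  have e1 : ∫ q, u q * (∑ i, b i q * frameDeriv i (heisKer ρ ε p) q + D q * heisKer ρ ε p q) =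
      ∫ w, (∑ i, u (heisMul p (heisDil ε w)) * b i (heisMul p (heisDil ε w)) *
        (frameScale ε i * frameDeriv i ρ w) +
        u (heisMul p (heisDil ε w)) * D (heisMul p (heisDil ε w)) * ρ w) := by
    have h := integral_heisMul_heisDil hε p (fun q => u q * (∑ i, b i q *
      (frameScale ε i * frameDeriv i ρ (heisDil ε⁻¹ (heisMul (-p) q))) +
      D q * ρ (heisDil ε⁻¹ (heisMul (-p) q))))
    simp only [neg_heisMul_cancel_left, heisDil_inv_cancel hε] at h
    simp only [frameDeriv_heisKer hρ, heisKer]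
    rw [← integral_const_mul] at h
    calc _ = _ := integral_congr_ae (.of_forall fun q => by
              simp only [mul_add, Finset.mul_sum]
              congr 1
              · exact Finset.sum_congr rfl fun i _ => by ring
              · ring)
      _ = _ := h.symm
      _ = _ := integral_congr_ae (.of_forall fun w => by
              simp only [mul_add, Finset.mul_sum]
              congr 1
              · exact Finset.sum_congr rfl fun i _ => by ring
              · ring)
  rw [heisComm, e1]
  simp only [frameDeriv_heisMoll hρ hρc hε hu, mul_neg, ← integral_const_mul]
  have i4 : Integrable fun w => ∑ i, u (heisMul p (heisDil ε w)) * b i (heisMul p (heisDil ε w)) *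
      (frameScale ε i * frameDeriv i ρ w) +
      u (heisMul p (heisDil ε w)) * D (heisMul p (heisDil ε w)) * ρ w :=
    (integrable_finsetSum _ fun i _ => i1 i).add i2
  rw [Finset.sum_neg_distrib, ← integral_finsetSum _ fun i _ => i3 i, ← sub_eq_add_neg,
    ← integral_sub i4 (integrable_finsetSum _ fun i _ => i3 i)]
  refine integral_congr_ae (.of_forall fun w => ?_)
  simp only [mul_add, Finset.mul_sum]
  rw [add_sub_right_comm, ← Finset.sum_sub_distrib]
  congr 1
  · exact Finset.sum_congr rfl fun i _ => by ring
  · ring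

/-- The Taylor formulas hold for every `w` at almost every `p`, but the integral over `w` needs them
at almost every `p` for almost every `w`. Joint measurability and Tonelli exchange the quantifiers.
-/
theorem ae_ae_eq_swap {α β : Type*} [MeasurableSpace α] [MeasurableSpace β] {μ : Measure α}
    {ν : Measure β} [SFinite μ] [SFinite ν] {F G : α × β → ℝ}
    (hF : AEStronglyMeasurable F (μ.prod ν)) (hG : AEStronglyMeasurable G (μ.prod ν))
    (h : ∀ᵐ y ∂ν, ∀ᵐ x ∂μ, F (x, y) = G (x, y)) : ∀ᵐ x ∂μ, ∀ᵐ y ∂ν, F (x, y) = G (x, y) := by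
  have hm : AEMeasurable (fun z => ‖F z - G z‖ₑ) (μ.prod ν) := (hF.sub hG).enorm
  have h0 : ∫⁻ z, ‖F z - G z‖ₑ ∂(μ.prod ν) = 0 := by
    rw [lintegral_prod_symm _ hm]
    refine (lintegral_congr_ae ?_).trans lintegral_zero
    filter_upwards [h] with y hy
    refine (lintegral_congr_ae ?_).trans lintegral_zero
    filter_upwards [hy] with x hx
    simp [hx]
  have h1 := Measure.ae_ae_of_ae_prod ((lintegral_eq_zero_iff' hm).1 h0)
  filter_upwards [h1] with x hx
  filter_upwards [hx] with y hy
  simpa [sub_eq_zero] using hy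

/-- The coefficients of the contact field of `ψ`, where `g` is the horizontal gradient of `ψ`. -/
def contactCoeff {n : ℕ} (ψ : Heis n → ℝ) (g : HorIdx n → Heis n → ℝ) : FrameIdx n → Heis n → ℝ
  | Sum.inl (Sum.inl j), p => g (Sum.inr j) p
  | Sum.inl (Sum.inr j), p => -g (Sum.inl j) p
  | Sum.inr _, p => -4 * ψ p

/-! ### Horizontal paths from the origin and the weights of the commutator -/

section Path

variable {n : ℕ} (i₀ : Fin n)

/-- A horizontal path from `0` to `w`. -/
def unitPath (w : Heis n) (s : ℝ) : Heis n := loopPath i₀ w.1 w.2.1 1 (35 / 2 * w.2.2) s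

/-- The velocity of `unitPath`. -/
def unitVel (w : Heis n) (s : ℝ) : HorIdx n → ℝ := loopVel i₀ w.1 w.2.1 1 (35 / 2 * w.2.2) s

theorem unitPath_zero (w : Heis n) : unitPath i₀ w 0 = 0 := loopPath_zero _ _ _ _ _

/-- The choice `μ = 1`, `ν = (35/2) t` reaches the height `t` with polynomial dependence on `w`. The
length of the path is irrelevant here, whereas continuity of the weights in `w` is needed. -/
theorem unitPath_one (w : Heis n) : unitPath i₀ w 1 = w := by
  rw [unitPath, loopPath_one]
  ext <;> simp
  ring

theorem continuous_unitPath : Continuous fun x : Heis n × ℝ => unitPath i₀ x.1 x.2 := by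
  unfold unitPath loopPath
  fun_prop

theorem continuous_unitVel (k : HorIdx n) :
    Continuous fun x : Heis n × ℝ => unitVel i₀ x.1 x.2 k := by
  rcases k with j | j <;> · simp only [unitVel, loopVel, Sum.elim_inl, Sum.elim_inr]; fun_prop

theorem hasDerivAt_unitPath (w : Heis n) (s : ℝ) : HasDerivAt (unitPath i₀ w)
    (∑ i, unitVel i₀ w s i • heisZ (Sum.inl i) (unitPath i₀ w s)) s :=
  hasDerivAt_loopPath _ _ _ _ _ _

theorem hasDerivAt_heisDil_unitPath (ε : ℝ) (w : Heis n) (s : ℝ) :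
    HasDerivAt (fun s => heisDil ε (unitPath i₀ w s))
      (∑ i, (ε * unitVel i₀ w s i) • heisZ (Sum.inl i) (heisDil ε (unitPath i₀ w s))) s := by
  have h := (heisDil (n := n) ε).toContinuousLinearMap.hasFDerivAt.comp_hasDerivAt s
    (hasDerivAt_unitPath i₀ w s)
  refine h.congr_deriv ?_
  rw [sum_smul_heisZ, sum_smul_heisZ]
  simp only [LinearMap.coe_toContinuousLinearMap', heisDil_apply, Prod.mk.injEq]
  refine ⟨rfl, rfl, ?_⟩
  simp only [Finset.mul_sum, Pi.smul_apply, smul_eq_mul]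
  exact Finset.sum_congr rfl fun j _ => by ring

theorem hasDerivAt_horCoord_unitPath (w : Heis n) (s : ℝ) (k : HorIdx n) :
    HasDerivAt (fun s => horCoord (unitPath i₀ w s) k) (unitVel i₀ w s k) s := by
  have h := hasDerivAt_unitPath i₀ w s
  rw [sum_smul_heisZ] at h
  obtain ⟨h1, h2, -⟩ := hasDerivAt_heis_components h
  rcases k with j | j
  · exact hasDerivAt_pi.1 h1 j
  · exact hasDerivAt_pi.1 h2 j

theorem contDiff_heisDil_unitPath (ε : ℝ) (w : Heis n) :
    ContDiff ℝ (⊤ : ℕ∞) fun s => heisDil ε (unitPath i₀ w s) :=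
  (contDiff_heisDil ε).comp (contDiff_loopPath _ _ _ _ _)

theorem continuous_horCoord (k : HorIdx n) : Continuous fun p : Heis n => horCoord p k := by
  rcases k with j | j <;> · simp only [horCoord, Sum.elim_inl, Sum.elim_inr]; fun_prop

/-- The rotated gradient of the mollifier. -/
def rotGrad (ρ : Heis n → ℝ) : HorIdx n → Heis n → ℝ
  | Sum.inl j, w => -frameDeriv (Sum.inl (Sum.inr j)) ρ w
  | Sum.inr j, w => frameDeriv (Sum.inl (Sum.inl j)) ρ w

/-- The weights with which second derivatives enter the commutator. -/
def commWeight (ρ : Heis n → ℝ) (k j : HorIdx n) (x : Heis n × ℝ) : ℝ :=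
  unitVel i₀ x.1 x.2 k * rotGrad ρ j x.1 -
    4 * ((horCoord x.1 j - horCoord (unitPath i₀ x.1 x.2) j) * unitVel i₀ x.1 x.2 k) *
      frameDeriv (Sum.inr ()) ρ x.1

variable {i₀} {ρ : Heis n → ℝ}

theorem continuous_rotGrad (hρ : ContDiff ℝ (⊤ : ℕ∞) ρ) (j : HorIdx n) :
    Continuous (rotGrad ρ j) := by
  have := fun i => continuous_frameDeriv (hρ.of_le (by simp) : ContDiff ℝ 1 ρ) i
  rcases j with j | j
  · exact (this _).neg
  · exact this _

theorem continuous_commWeight (hρ : ContDiff ℝ (⊤ : ℕ∞) ρ) (k j : HorIdx n) :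
    Continuous (commWeight i₀ ρ k j) := by
  have h1 := continuous_frameDeriv (hρ.of_le (by simp) : ContDiff ℝ 1 ρ) (Sum.inr ())
  exact ((continuous_unitVel i₀ k).mul ((continuous_rotGrad hρ j).comp continuous_fst)).sub
    ((continuous_const.mul ((((continuous_horCoord j).comp continuous_fst).sub
      ((continuous_horCoord j).comp (continuous_unitPath i₀))).mul (continuous_unitVel i₀ k))).mul
      (h1.comp continuous_fst))

theorem frameDeriv_eq_zero_of_notMem {w : Heis n} (hw : w ∉ tsupport ρ) (i : FrameIdx n) :
    frameDeriv i ρ w = 0 :=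
  image_eq_zero_of_notMem_tsupport fun h => hw (support_frameDeriv_subset i h)

theorem commWeight_eq_zero {x : Heis n × ℝ} (hx : x.1 ∉ tsupport ρ) (k j : HorIdx n) :
    commWeight i₀ ρ k j x = 0 := by
  have h := fun i => frameDeriv_eq_zero_of_notMem hx i
  rcases j with j | j <;> simp [commWeight, rotGrad, h]

/-- The parameter measure for the mollification along paths. -/
def pathMeasure (n : ℕ) : Measure (Heis n × ℝ) :=
  (volume : Measure (Heis n)).prod (volume.restrict (Ioc (0 : ℝ) 1))

instance sfinite_pathMeasure : SFinite (pathMeasure n) := by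
  unfold pathMeasure; infer_instance

theorem integrable_commWeight (hρ : ContDiff ℝ (⊤ : ℕ∞) ρ) (hρc : HasCompactSupport ρ)
    (k j : HorIdx n) : Integrable (commWeight i₀ ρ k j) (pathMeasure n) := by
  have h1 : IntegrableOn (commWeight i₀ ρ k j) (tsupport ρ ×ˢ Icc (0 : ℝ) 1)
      ((volume : Measure (Heis n)).prod volume) :=
    (continuous_commWeight hρ k j).continuousOn.integrableOn_compact (hρc.prod isCompact_Icc)
  have h2 : IntegrableOn (commWeight i₀ ρ k j) ((univ : Set (Heis n)) ×ˢ Ioc (0 : ℝ) 1)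
      ((volume : Measure (Heis n)).prod volume) := by
    refine h1.of_forall_sdiff_eq_zero (MeasurableSet.univ.prod measurableSet_Ioc) ?_
    rintro x ⟨hx1, hx2⟩
    refine commWeight_eq_zero (fun h => hx2 ⟨h, Ioc_subset_Icc_self hx1.2⟩) k j
  rw [IntegrableOn, ← Measure.prod_restrict, Measure.restrict_univ] at h2
  exact h2

end Path

/-! ### Taylor expansion of the generator and cancellation in the commutator -/

section Commutator

variable {n : ℕ} {i₀ : Fin n} {ψ : Heis n → ℝ} {g : HorIdx n → Heis n → ℝ}
  {H : HorIdx n → HorIdx n → Heis n → ℝ}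

theorem ae_integrable_path {F : Heis n → ℝ} (hF : LocallyIntegrable F volume) {m : ℝ → ℝ}
    (hm : Continuous m) (ε : ℝ) (w : Heis n) :
    ∀ᵐ p, Integrable (fun s => m s * F (heisMul p (heisDil ε (unitPath i₀ w s))))
      (volume.restrict (Ioc (0 : ℝ) 1)) := by
  have hγ := (contDiff_heisDil_unitPath i₀ ε w).continuous
  exact ae_integrable_translate hF ((hm.integrableOn_Icc).mono_set Ioc_subset_Icc_self)
    hγ.measurable (isCompact_Icc.image hγ (s := Icc (0 : ℝ) 1))
    ((ae_restrict_mem measurableSet_Ioc).mono fun s hs => ⟨s, Ioc_subset_Icc_self hs, rfl⟩)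

/-- Taylor expansion along the dilated path from `0` to `δ_ε w`: to first order for the horizontal
gradient and to second order for `ψ`, with integral remainders that contain only second horizontal
derivatives. The vertical displacement `ε² t` does not require `Tψ` separately, because the path
itself is horizontal. -/
theorem ae_taylor (hg : ∀ i, IsWeakFrameDeriv (Sum.inl i) ψ (g i))
    (hH : ∀ i j, IsWeakFrameDeriv (Sum.inl i) (g j) (H i j)) (ε : ℝ) (w : Heis n) :
    ∀ᵐ p, (∀ j, g j (heisMul p (heisDil ε w)) - g j p = ε * ∑ k, ∫ s in Ioc (0 : ℝ) 1,
        unitVel i₀ w s k * H k j (heisMul p (heisDil ε (unitPath i₀ w s)))) ∧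
      ψ (heisMul p (heisDil ε w)) - ψ p - ε * ∑ j, horCoord w j * g j p =
        ε ^ 2 * ∑ k, ∑ j, ∫ s in Ioc (0 : ℝ) 1,
          ((horCoord w j - horCoord (unitPath i₀ w s) j) * unitVel i₀ w s k) *
            H k j (heisMul p (heisDil ε (unitPath i₀ w s))) := by
  have hv : ∀ i, Continuous fun s => ε * unitVel i₀ w s i := fun i =>
    continuous_const.mul ((continuous_unitVel i₀ i).comp (by fun_prop : Continuous fun s => (w, s)))
  have hv' : ∀ i, Continuous fun s => unitVel i₀ w s i := fun i =>
    (continuous_unitVel i₀ i).comp (by fun_prop : Continuous fun s => (w, s))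
  have hγ := contDiff_heisDil_unitPath i₀ ε w
  have hd := hasDerivAt_heisDil_unitPath i₀ ε w
  have t1 : ∀ j, ∀ᵐ p, g j (heisMul p (heisDil ε w)) - g j p = ε * ∑ k, ∫ s in Ioc (0 : ℝ) 1,
        unitVel i₀ w s k * H k j (heisMul p (heisDil ε (unitPath i₀ w s))) := fun j => by
    filter_upwards [ae_integral_weakDeriv_path (fun i => hH i j) hγ hv hd (a := fun _ => 1)
      (fun s => hasDerivAt_const s 1) continuous_const (hH (Sum.inl i₀) j).1] with p hp
    simp only [unitPath_one, unitPath_zero, map_zero, heisMul_zero, one_mul, zero_mul,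
      integral_zero, zero_add, mul_assoc, integral_const_mul, ← Finset.mul_sum] at hp
    exact hp
  have t2 : ∀ᵐ p, ψ (heisMul p (heisDil ε w)) - ψ p = ε * ∑ k, ∫ s in Ioc (0 : ℝ) 1,
        unitVel i₀ w s k * g k (heisMul p (heisDil ε (unitPath i₀ w s))) := by
    filter_upwards [ae_integral_weakDeriv_path hg hγ hv hd (a := fun _ => 1)
      (fun s => hasDerivAt_const s 1) continuous_const (hg (Sum.inl i₀)).1] with p hp
    simp only [unitPath_one, unitPath_zero, map_zero, heisMul_zero, one_mul, zero_mul,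
      integral_zero, zero_add, mul_assoc, integral_const_mul, ← Finset.mul_sum] at hp
    exact hp
  -- Integration by parts along the path. The weight `w_j - γ_j(s)` has derivative minus the
  -- velocity, vanishes at `s = 1` and equals `w_j` at `s = 0`, so the boundary term is the linear
  -- term of the expansion.
  have t3 : ∀ j, ∀ᵐ p, horCoord w j * g j p = (∫ s in Ioc (0 : ℝ) 1,
        unitVel i₀ w s j * g j (heisMul p (heisDil ε (unitPath i₀ w s)))) -
      ε * ∑ k, ∫ s in Ioc (0 : ℝ) 1,
          ((horCoord w j - horCoord (unitPath i₀ w s) j) * unitVel i₀ w s k) *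
            H k j (heisMul p (heisDil ε (unitPath i₀ w s))) := fun j => by
    filter_upwards [ae_integral_weakDeriv_path (fun i => hH i j) hγ hv hd
      (a := fun s => horCoord w j - horCoord (unitPath i₀ w s) j)
      (fun s => (hasDerivAt_horCoord_unitPath i₀ w s j).const_sub _) (hv' j).neg
      (hH (Sum.inl i₀) j).1] with p hp
    have e0 : horCoord (0 : Heis n) j = 0 := by rcases j with j | j <;> simp [horCoord]
    simp only [unitPath_one, unitPath_zero, map_zero, heisMul_zero, sub_self, zero_mul, e0,
      sub_zero, neg_mul, integral_neg, zero_sub] at hp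
    have e1 : ∀ k, ∫ s in Ioc (0 : ℝ) 1, ((horCoord w j - horCoord (unitPath i₀ w s) j) *
        (ε * unitVel i₀ w s k)) * H k j (heisMul p (heisDil ε (unitPath i₀ w s))) =
        ε * ∫ s in Ioc (0 : ℝ) 1, ((horCoord w j - horCoord (unitPath i₀ w s) j) *
          unitVel i₀ w s k) * H k j (heisMul p (heisDil ε (unitPath i₀ w s))) := fun k => by
      rw [← integral_const_mul]
      exact integral_congr_ae (.of_forall fun s => by simp only; ring)
    simp only [e1, ← Finset.mul_sum] at hp
    linarith
  filter_upwards [ae_all_iff.2 t1, t2, ae_all_iff.2 t3] with p h1 h2 h3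
  refine ⟨h1, ?_⟩
  rw [h2]
  simp only [h3]
  rw [Finset.sum_sub_distrib, mul_sub, sub_sub_cancel, ← Finset.mul_sum, Finset.sum_comm]
  ring

/-- The contact structure is used here. The horizontal coefficients of `b` are rotated derivatives
of `ψ`, so their correction terms add up to `4 ε⁻¹ Tρ ∑ w_j Z_jψ(p)`. Together with the increment of
`-4ψ` times `ε⁻² Tρ` this is `-4 ε⁻² Tρ` times the second order Taylor remainder. All negative
powers of `ε` cancel. -/
theorem ae_commutator_integrand (hg : ∀ i, IsWeakFrameDeriv (Sum.inl i) ψ (g i))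
    (hH : ∀ i j, IsWeakFrameDeriv (Sum.inl i) (g j) (H i j)) {ε : ℝ} (hε : ε ≠ 0)
    (ρ : Heis n → ℝ) (w : Heis n) :
    ∀ᵐ p, ∑ i, ((contactCoeff ψ g i (heisMul p (heisDil ε w)) - contactCoeff ψ g i p) *
        (frameScale ε i * frameDeriv i ρ w) - contactCoeff ψ g i p *
          (ε⁻¹ * rightCorr i w * frameDeriv (Sum.inr ()) ρ w)) =
      ∑ k, ∑ j, ∫ s in Ioc (0 : ℝ) 1, commWeight i₀ ρ k j (w, s) *
        H k j (heisMul p (heisDil ε (unitPath i₀ w s))) := by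
  have hv' : ∀ i, Continuous fun s => unitVel i₀ w s i := fun i =>
    (continuous_unitVel i₀ i).comp (by fun_prop : Continuous fun s => (w, s))
  have hq : ∀ j, Continuous fun s => horCoord w j - horCoord (unitPath i₀ w s) j := fun j =>
    continuous_const.sub ((continuous_horCoord j).comp
      ((continuous_unitPath i₀).comp (by fun_prop : Continuous fun s => (w, s))))
  have j1 := fun k j => ae_integrable_path (i₀ := i₀) (hH k j).2.1 (hv' k) ε w
  have hqv : ∀ k j, Continuous fun s =>
      (horCoord w j - horCoord (unitPath i₀ w s) j) * unitVel i₀ w s k :=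
    fun k j => (hq j).mul (hv' k)
  have j2 := fun k j => ae_integrable_path (i₀ := i₀) (hH k j).2.1 (hqv k j) ε w
  filter_upwards [ae_taylor (i₀ := i₀) hg hH ε w, ae_all_iff.2 fun k => ae_all_iff.2 (j1 k),
    ae_all_iff.2 fun k => ae_all_iff.2 (j2 k)] with p ⟨h1, h2⟩ i1 i2
  have e1 : ∀ k j, ∫ s in Ioc (0 : ℝ) 1, commWeight i₀ ρ k j (w, s) *
        H k j (heisMul p (heisDil ε (unitPath i₀ w s))) =
      rotGrad ρ j w * (∫ s in Ioc (0 : ℝ) 1,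
        unitVel i₀ w s k * H k j (heisMul p (heisDil ε (unitPath i₀ w s)))) -
      4 * frameDeriv (Sum.inr ()) ρ w * ∫ s in Ioc (0 : ℝ) 1,
          ((horCoord w j - horCoord (unitPath i₀ w s) j) * unitVel i₀ w s k) *
            H k j (heisMul p (heisDil ε (unitPath i₀ w s))) := fun k j => by
    rw [← integral_const_mul, ← integral_const_mul,
      ← integral_sub ((i1 k j).const_mul _) ((i2 k j).const_mul _)]
    refine integral_congr_ae (.of_forall fun s => ?_)
    simp only [commWeight]; ring
  simp only [e1, Finset.sum_sub_distrib, ← Finset.mul_sum]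
  set S := ∑ k, ∑ j, ∫ s in Ioc (0 : ℝ) 1,
          ((horCoord w j - horCoord (unitPath i₀ w s) j) * unitVel i₀ w s k) *
            H k j (heisMul p (heisDil ε (unitPath i₀ w s))) with hS
  rw [Finset.sum_comm (f := fun k j => rotGrad ρ j w * _)]
  simp only [← Finset.mul_sum]
  have h3 : ∀ j, (∑ k, ∫ s in Ioc (0 : ℝ) 1,
      unitVel i₀ w s k * H k j (heisMul p (heisDil ε (unitPath i₀ w s)))) =
      ε⁻¹ * (g j (heisMul p (heisDil ε w)) - g j p) := fun j => by
    rw [h1 j]; field_simp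
  simp only [h3]
  have h4 : S = (ε⁻¹) ^ 2 * (ψ (heisMul p (heisDil ε w)) - ψ p -
      ε * ∑ j, horCoord w j * g j p) := by rw [h2]; field_simp
  rw [h4]
  simp only [Fintype.sum_sum_type, contactCoeff, frameScale, rightCorr, rotGrad, horCoord,
    Sum.elim_inl, Sum.elim_inr, Finset.univ_unique, Finset.sum_singleton]
  have h5 : ε⁻¹ ^ 2 * ε = ε⁻¹ := by field_simp
  have h6 : ∀ x : ℝ, 4 * frameDeriv (Sum.inr ()) ρ w * (ε⁻¹ ^ 2 *
      (ψ (heisMul p (heisDil ε w)) - ψ p - ε * x)) = 4 * frameDeriv (Sum.inr ()) ρ w *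
      (ε⁻¹ ^ 2 * (ψ (heisMul p (heisDil ε w)) - ψ p)) -
      4 * ε⁻¹ * frameDeriv (Sum.inr ()) ρ w * x := fun x => by
    rw [mul_sub (ε⁻¹ ^ 2), ← mul_assoc (ε⁻¹ ^ 2) ε x, h5]; ring
  rw [h6, mul_add, Finset.mul_sum, Finset.mul_sum]
  have r1 : ∑ j : Fin n, ((g (Sum.inr j) (heisMul p (heisDil ε w)) - g (Sum.inr j) p) *
      (ε⁻¹ * frameDeriv (Sum.inl (Sum.inl j)) ρ w) -
      g (Sum.inr j) p * (ε⁻¹ * (-4 * w.2.1 j) * frameDeriv (Sum.inr ()) ρ w)) =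
      ∑ j, frameDeriv (Sum.inl (Sum.inl j)) ρ w *
        (ε⁻¹ * (g (Sum.inr j) (heisMul p (heisDil ε w)) - g (Sum.inr j) p)) +
      ∑ j, 4 * ε⁻¹ * frameDeriv (Sum.inr ()) ρ w * (w.2.1 j * g (Sum.inr j) p) := by
    rw [← Finset.sum_add_distrib]; exact Finset.sum_congr rfl fun j _ => by ring
  have r2 : ∑ j : Fin n, ((-g (Sum.inl j) (heisMul p (heisDil ε w)) - -g (Sum.inl j) p) *
      (ε⁻¹ * frameDeriv (Sum.inl (Sum.inr j)) ρ w) -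
      -g (Sum.inl j) p * (ε⁻¹ * (4 * w.1 j) * frameDeriv (Sum.inr ()) ρ w)) =
      ∑ j, -frameDeriv (Sum.inl (Sum.inr j)) ρ w *
        (ε⁻¹ * (g (Sum.inl j) (heisMul p (heisDil ε w)) - g (Sum.inl j) p)) +
      ∑ j, 4 * ε⁻¹ * frameDeriv (Sum.inr ()) ρ w * (w.1 j * g (Sum.inl j) p) := by
    rw [← Finset.sum_add_distrib]; exact Finset.sum_congr rfl fun j _ => by ring
  rw [Finset.sum_sub_distrib] at r1 r2
  simp only [PUnit.default_eq_unit]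
  linear_combination r1 + r2

end Commutator

/-! ### Uniform bound and limit of the commutator -/

section CommutatorLimit

variable {n : ℕ} {i₀ : Fin n} {ψ : Heis n → ℝ} {g : HorIdx n → Heis n → ℝ}
  {H : HorIdx n → HorIdx n → Heis n → ℝ} {ρ : Heis n → ℝ} {D u : Heis n → ℝ} {s s' : ℝ≥0∞}

theorem measurable_fst_heisDil (ε : ℝ) : Measurable fun x : Heis n × ℝ => heisDil ε x.1 :=
  (contDiff_heisDil (k := 0) ε).continuous.measurable.comp measurable_fst

theorem measurable_heisDil_unitPath (ε : ℝ) :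
    Measurable fun x : Heis n × ℝ => heisDil ε (unitPath i₀ x.1 x.2) :=
  ((contDiff_heisDil (k := 0) ε).continuous.comp (continuous_unitPath i₀)).measurable

theorem aestronglyMeasurable_contactCoeff (hψ : AEStronglyMeasurable ψ volume)
    (hg : ∀ i, AEStronglyMeasurable (g i) volume) (i : FrameIdx n) :
    AEStronglyMeasurable (contactCoeff ψ g i) volume := by
  rcases i with (j | j) | j
  · exact hg _
  · exact (hg _).neg
  · exact hψ.const_mul (-4)

theorem continuous_rightCorr (i : FrameIdx n) : Continuous (rightCorr (n := n) i) := by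
  rcases i with (j | j) | j <;> · unfold rightCorr; fun_prop

/-- The average of `u H` along the paths issuing from `p`, weighted by `commWeight`. -/
def pathAverage (i₀ : Fin n) (ρ : Heis n → ℝ) (H : HorIdx n → HorIdx n → Heis n → ℝ) (ε : ℝ)
    (u : Heis n → ℝ) (k j : HorIdx n) (p : Heis n) : ℝ :=
  ∫ x, commWeight i₀ ρ k j x * (u (heisMul p (heisDil ε x.1)) *
    H k j (heisMul p (heisDil ε (unitPath i₀ x.1 x.2)))) ∂(pathMeasure n)

variable [hss : ENNReal.HolderConjugate s s']

/-- This form contains only averages of products of translates, to which the averaging lemmas apply.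
The factor `1` puts the divergence term into the same form, with `u D` in `L¹` and a constant in
`L^∞`. -/
theorem ae_heisComm_eq (hg : ∀ i, IsWeakFrameDeriv (Sum.inl i) ψ (g i))
    (hH : ∀ i j, IsWeakFrameDeriv (Sum.inl i) (g j) (H i j))
    (hHm : ∀ i j, MemLp (H i j) s' volume) (hu : MemLp u s volume)
    (hub : ∀ i, LocallyIntegrable (fun q => u q * contactCoeff ψ g i q) volume)
    (huD : Integrable (fun q => u q * D q))
    (hρ : ContDiff ℝ (⊤ : ℕ∞) ρ) (hρc : HasCompactSupport ρ) {ε : ℝ} (hε : ε ≠ 0) :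
    ∀ᵐ p, heisComm ρ ε (contactCoeff ψ g) D u p = (∑ k, ∑ j, pathAverage i₀ ρ H ε u k j p) +
      ∫ w, ρ w * (u (heisMul p (heisDil ε w)) * D (heisMul p (heisDil ε w)) * 1) := by
  have hul : LocallyIntegrable u volume := hu.locallyIntegrable (ENNReal.HolderConjugate.one_le s s')
  have hdm : Measurable fun w : Heis n => heisDil ε w :=
    (contDiff_heisDil (k := 0) ε).continuous.measurable
  have hum := aestronglyMeasurable_translate (ν := (volume : Measure (Heis n))) hu.1 hdm
  have hcm := aestronglyMeasurable_contactCoeff (hg (Sum.inl i₀)).1.aestronglyMeasurable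
    fun i => (hg i).2.1.aestronglyMeasurable
  have hcm' := fun i => aestronglyMeasurable_translate (ν := (volume : Measure (Heis n)))
    (hcm i) hdm
  have hfd : ∀ i, Continuous (frameDeriv i ρ) := fun i => continuous_frameDeriv
    (hρ.of_le (by simp)) i
  have m2 : ∀ i, AEStronglyMeasurable (fun z : Heis n × Heis n => frameScale ε i *
      frameDeriv i ρ z.2) (volume.prod volume) := fun i =>
    (continuous_const.mul ((hfd i).comp continuous_snd)).aestronglyMeasurable
  have m3 : ∀ i, AEStronglyMeasurable (fun z : Heis n × Heis n => ε⁻¹ * rightCorr i z.2 *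
      frameDeriv (Sum.inr ()) ρ z.2) (volume.prod volume) := fun i =>
    ((continuous_const.mul ((continuous_rightCorr i).comp continuous_snd)).mul
      ((hfd _).comp continuous_snd)).aestronglyMeasurable
  have mF : AEStronglyMeasurable (fun z : Heis n × Heis n =>
      ∑ i, ((contactCoeff ψ g i (heisMul z.1 (heisDil ε z.2)) - contactCoeff ψ g i z.1) *
        (frameScale ε i * frameDeriv i ρ z.2) - contactCoeff ψ g i z.1 *
          (ε⁻¹ * rightCorr i z.2 * frameDeriv (Sum.inr ()) ρ z.2))) (volume.prod volume) :=
    Finset.aestronglyMeasurable_fun_sum _ fun i _ =>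
      (((hcm' i).sub (hcm i).comp_fst).mul (m2 i)).sub ((hcm i).comp_fst.mul (m3 i))
  have mG : AEStronglyMeasurable (fun z : Heis n × Heis n =>
      ∑ k, ∑ j, ∫ s in Ioc (0 : ℝ) 1, commWeight i₀ ρ k j (z.2, s) *
        H k j (heisMul z.1 (heisDil ε (unitPath i₀ z.2 s)))) (volume.prod volume) := by
    refine Finset.aestronglyMeasurable_fun_sum _ fun k _ =>
      Finset.aestronglyMeasurable_fun_sum _ fun j _ => ?_
    have h1 := aestronglyMeasurable_translate (ν := pathMeasure n) (hHm k j).1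
      (measurable_heisDil_unitPath (i₀ := i₀) ε)
    have h2 : AEStronglyMeasurable (fun z : Heis n × (Heis n × ℝ) => commWeight i₀ ρ k j z.2)
        (volume.prod (pathMeasure n)) :=
      ((continuous_commWeight hρ k j).comp continuous_snd).aestronglyMeasurable
    have h3 := (h2.mul h1).comp_measurePreserving (measurePreserving_prodAssoc
      (volume : Measure (Heis n)) (volume : Measure (Heis n)) (volume.restrict (Ioc (0 : ℝ) 1)))
    exact h3.integral_prod_right'
  have key := ae_ae_eq_swap mF mG
    (.of_forall fun w => ae_commutator_integrand (i₀ := i₀) hg hH hε ρ w)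
  have hint : ∀ᵐ p, ∀ k j, Integrable (fun x => commWeight i₀ ρ k j x *
      (u (heisMul p (heisDil ε x.1)) * H k j (heisMul p (heisDil ε (unitPath i₀ x.1 x.2)))))
      (pathMeasure n) := ae_all_iff.2 fun k => ae_all_iff.2 fun j =>
    ae_integrable_translate_mul hu (hHm k j) (integrable_commWeight hρ hρc k j)
      (measurable_fst_heisDil ε) (measurable_heisDil_unitPath ε)
  filter_upwards [key, hint] with p hp hi
  rw [heisComm_eq hρ hρc hε hul hub huD.locallyIntegrable p]
  have i2 : Integrable fun w => ρ w * (u (heisMul p (heisDil ε w)) *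
      D (heisMul p (heisDil ε w)) * 1) :=
    (integrable_comp_dil_mul hε huD.locallyIntegrable hρ.continuous hρc p).congr
      (.of_forall fun w => by simp only; ring)
  have e : ∀ k j, pathAverage i₀ ρ H ε u k j p = ∫ w, ∫ s in Ioc (0 : ℝ) 1,
      commWeight i₀ ρ k j (w, s) * (u (heisMul p (heisDil ε w)) *
        H k j (heisMul p (heisDil ε (unitPath i₀ w s)))) := fun k j =>
    integral_prod _ (hi k j)
  have hi' : ∀ k j, Integrable fun w => ∫ s in Ioc (0 : ℝ) 1,
      commWeight i₀ ρ k j (w, s) * (u (heisMul p (heisDil ε w)) *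
        H k j (heisMul p (heisDil ε (unitPath i₀ w s)))) := fun k j =>
    (hi k j).integral_prod_left
  simp only [e]
  simp only [← integral_finsetSum _ fun j _ => hi' _ j]
  rw [← integral_finsetSum _ fun k _ => integrable_finsetSum _ fun j _ => hi' k j,
    ← integral_add (integrable_finsetSum _ fun k _ => integrable_finsetSum _ fun j _ => hi' k j) i2]
  refine integral_congr_ae ?_
  filter_upwards [hp] with w hw
  rw [hw, mul_add, Finset.mul_sum]
  congr 1
  · refine Finset.sum_congr rfl fun k _ => ?_
    rw [Finset.mul_sum]
    refine Finset.sum_congr rfl fun j _ => ?_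
    rw [← integral_const_mul]
    exact integral_congr_ae (.of_forall fun s => by simp only; ring)
  · ring

theorem aestronglyMeasurable_pathAverage (hHm : ∀ i j, AEStronglyMeasurable (H i j) volume)
    (hu : AEStronglyMeasurable u volume) (hρ : ContDiff ℝ (⊤ : ℕ∞) ρ) (ε : ℝ) (k j : HorIdx n) :
    AEStronglyMeasurable (pathAverage i₀ ρ H ε u k j) volume :=
  (aestronglyMeasurable_translate_mul hu (hHm k j)
    (continuous_commWeight hρ k j).aestronglyMeasurable (measurable_fst_heisDil ε)
    (measurable_heisDil_unitPath ε) (ν := pathMeasure n)).integral_prod_right'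

/-- The right-hand side does not contain `ε`; it supplies the dominating function in time when the
limit is taken. -/
theorem lintegral_heisComm_le (hg : ∀ i, IsWeakFrameDeriv (Sum.inl i) ψ (g i))
    (hH : ∀ i j, IsWeakFrameDeriv (Sum.inl i) (g j) (H i j))
    (hHm : ∀ i j, MemLp (H i j) s' volume) (hu : MemLp u s volume)
    (hub : ∀ i, LocallyIntegrable (fun q => u q * contactCoeff ψ g i q) volume)
    (huD : Integrable (fun q => u q * D q))
    (hρ : ContDiff ℝ (⊤ : ℕ∞) ρ) (hρc : HasCompactSupport ρ) {ε : ℝ} (hε : ε ≠ 0) :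
    ∫⁻ p, ‖heisComm ρ ε (contactCoeff ψ g) D u p‖ₑ ≤
      (∑ k, ∑ j, (∫⁻ x, ‖commWeight i₀ ρ k j x‖ₑ ∂(pathMeasure n)) *
        (eLpNorm u s volume * eLpNorm (H k j) s' volume)) +
      (∫⁻ w, ‖ρ w‖ₑ) * ∫⁻ p, ‖u p * D p‖ₑ := by
  rw [lintegral_congr_ae ((ae_heisComm_eq (i₀ := i₀) (s := s) (s' := s') hg hH hHm hu hub huD
    hρ hρc hε).mono fun p hp => congrArg (‖·‖ₑ) hp)]
  have m1 : ∀ k j, AEMeasurable (fun p => ‖pathAverage i₀ ρ H ε u k j p‖ₑ) volume := fun k j =>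
    (aestronglyMeasurable_pathAverage (fun i j => (hHm i j).1) hu.1 hρ ε k j).enorm
  calc _ ≤ ∫⁻ p, ((∑ k, ∑ j, ‖pathAverage i₀ ρ H ε u k j p‖ₑ) +
        ‖∫ w, ρ w * (u (heisMul p (heisDil ε w)) * D (heisMul p (heisDil ε w)) * 1)‖ₑ) :=
        lintegral_mono fun p => (enorm_add_le _ _).trans (add_le_add_left
          ((enorm_sum_le _ _).trans (Finset.sum_le_sum fun k _ => enorm_sum_le _ _)) _)
    _ = (∑ k, ∑ j, ∫⁻ p, ‖pathAverage i₀ ρ H ε u k j p‖ₑ) +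
        ∫⁻ p, ‖∫ w, ρ w * (u (heisMul p (heisDil ε w)) * D (heisMul p (heisDil ε w)) * 1)‖ₑ := by
        rw [lintegral_add_left' (Finset.aemeasurable_fun_sum _ fun k _ =>
          Finset.aemeasurable_fun_sum _ fun j _ => m1 k j),
          lintegral_finsetSum' _ fun k _ => Finset.aemeasurable_fun_sum _ fun j _ => m1 k j]
        simp only [lintegral_finsetSum' _ fun j _ => m1 _ j]
    _ ≤ _ := by
        refine add_le_add (Finset.sum_le_sum fun k _ => Finset.sum_le_sum fun j _ => ?_) ?_
        · exact (lintegral_mono fun p => enorm_integral_le_lintegral_enorm _).trans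
            (lintegral_lintegral_translate_mul_le hu.1 (hHm k j).1
              (integrable_commWeight hρ hρc k j).1 (measurable_fst_heisDil ε)
              (measurable_heisDil_unitPath ε))
        · refine (lintegral_mono fun p => enorm_integral_le_lintegral_enorm _).trans
            ((lintegral_lintegral_translate_mul_le (s := 1) (s' := ∞) huD.1
              (aestronglyMeasurable_const (b := (1 : ℝ))) hρ.continuous.aestronglyMeasurable
              (contDiff_heisDil (k := 0) ε).continuous.measurable
              (measurable_const (a := (0 : Heis n)))).trans ?_)
          rw [eLpNorm_one_eq_lintegral_enorm]
          have : eLpNorm (fun _ : Heis n => (1 : ℝ)) ∞ volume ≤ 1 := by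
            refine (eLpNorm_le_of_ae_bound (C := 1) (.of_forall fun _ => by simp)).trans (by simp)
          calc _ ≤ (∫⁻ w, ‖ρ w‖ₑ) * ((∫⁻ p, ‖u p * D p‖ₑ) * 1) := by gcongr
            _ = _ := by rw [mul_one]

/-- As `ε → 0` all translations shrink to the identity and each average tends to the total mass of
its weight times the untranslated product. In the limit `u` is a mere factor. -/
theorem tendsto_lintegral_heisComm (hg : ∀ i, IsWeakFrameDeriv (Sum.inl i) ψ (g i))
    (hH : ∀ i j, IsWeakFrameDeriv (Sum.inl i) (g j) (H i j))
    (hHm : ∀ i j, MemLp (H i j) s' volume) (hu : MemLp u s volume)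
    (hub : ∀ i, LocallyIntegrable (fun q => u q * contactCoeff ψ g i q) volume)
    (huD : Integrable (fun q => u q * D q))
    (hρ : ContDiff ℝ (⊤ : ℕ∞) ρ) (hρc : HasCompactSupport ρ) {ε : ℕ → ℝ} (hε : ∀ k, ε k ≠ 0)
    (hε0 : Tendsto ε atTop (𝓝 0)) :
    Tendsto (fun m => ∫⁻ p, ‖heisComm ρ (ε m) (contactCoeff ψ g) D u p -
      u p * ((∑ k, ∑ j, (∫ x, commWeight i₀ ρ k j x ∂(pathMeasure n)) * H k j p) +
        (∫ w, ρ w) * D p)‖ₑ) atTop (𝓝 0) := by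
  have hdil : ∀ w : Heis n, Tendsto (fun m => heisDil (ε m) w) atTop (𝓝 0) := fun w => by
    have h : Continuous fun r : ℝ => heisDil r w := by
      simp only [heisDil_apply]; fun_prop
    have h0 : heisDil 0 w = 0 := by simp [heisDil_apply]
    exact h0 ▸ (h.tendsto 0).comp hε0
  have t1 : ∀ k j, Tendsto (fun m => ∫⁻ p, ‖pathAverage i₀ ρ H (ε m) u k j p -
      (∫ x, commWeight i₀ ρ k j x ∂(pathMeasure n)) * (u p * H k j p)‖ₑ) atTop (𝓝 0) :=
    fun k j => tendsto_average_translate_mul hu (hHm k j) (integrable_commWeight hρ hρc k j)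
      (fun m => measurable_fst_heisDil (ε m)) (fun m => measurable_heisDil_unitPath (ε m))
      (fun x => hdil x.1) (fun x => hdil _)
  have t2 : Tendsto (fun m => ∫⁻ p, ‖(∫ w, ρ w * (u (heisMul p (heisDil (ε m) w)) *
      D (heisMul p (heisDil (ε m) w)) * 1)) - (∫ w, ρ w) * (u p * D p * 1)‖ₑ) atTop (𝓝 0) := by
    have h1 : MemLp (fun _ : Heis n => (1 : ℝ)) ∞ volume :=
      memLp_top_of_bound aestronglyMeasurable_const 1 (.of_forall fun _ => by simp)
    exact tendsto_average_translate_mul (s := 1) (s' := ∞) (memLp_one_iff_integrable.2 huD) h1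
      (hρ.continuous.integrable_of_hasCompactSupport hρc) (b := fun _ _ => 0)
      (fun m => (contDiff_heisDil (k := 0) (ε m)).continuous.measurable)
      (fun m => measurable_const) hdil (fun x => tendsto_const_nhds)
  have t3 := (tendsto_finsetSum Finset.univ fun k _ =>
    tendsto_finsetSum Finset.univ fun j _ => t1 k j).add t2
  simp only [Finset.sum_const_zero, add_zero] at t3
  refine tendsto_of_tendsto_of_tendsto_of_le_of_le tendsto_const_nhds t3 (fun _ => zero_le)
    fun m => ?_
  have m1 : ∀ k j, AEMeasurable (fun p => ‖pathAverage i₀ ρ H (ε m) u k j p -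
      (∫ x, commWeight i₀ ρ k j x ∂(pathMeasure n)) * (u p * H k j p)‖ₑ) volume := fun k j =>
    ((aestronglyMeasurable_pathAverage (fun i j => (hHm i j).1) hu.1 hρ (ε m) k j).sub
      ((hu.1.mul (hHm k j).1).const_mul _)).enorm
  simp only
  simp only [← lintegral_finsetSum' _ fun j _ => m1 _ j]
  rw [← lintegral_finsetSum' _ fun k _ => Finset.aemeasurable_fun_sum _ fun j _ => m1 k j,
    ← lintegral_add_left' (Finset.aemeasurable_fun_sum _ fun k _ =>
          Finset.aemeasurable_fun_sum _ fun j _ => m1 k j)]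
  refine lintegral_mono_ae ?_
  filter_upwards [ae_heisComm_eq (i₀ := i₀) (s := s) (s' := s') hg hH hHm hu hub huD
    hρ hρc (hε m)] with p hp
  rw [hp]
  have : (∑ k, ∑ j, pathAverage i₀ ρ H (ε m) u k j p) + (∫ w, ρ w * (u (heisMul p (heisDil (ε m) w)) *
      D (heisMul p (heisDil (ε m) w)) * 1)) - u p * ((∑ k, ∑ j, (∫ x, commWeight i₀ ρ k j x ∂(pathMeasure n)) * H k j p) +
        (∫ w, ρ w) * D p) = (∑ k, ∑ j, (pathAverage i₀ ρ H (ε m) u k j p -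
      (∫ x, commWeight i₀ ρ k j x ∂(pathMeasure n)) * (u p * H k j p))) +
      ((∫ w, ρ w * (u (heisMul p (heisDil (ε m) w)) *
      D (heisMul p (heisDil (ε m) w)) * 1)) - (∫ w, ρ w) * (u p * D p * 1)) := by
    simp only [Finset.sum_sub_distrib, mul_add, Finset.mul_sum, mul_left_comm (u p)]
    ring
  rw [this]
  exact (enorm_add_le _ _).trans (add_le_add_left
          ((enorm_sum_le _ _).trans (Finset.sum_le_sum fun k _ => enorm_sum_le _ _)) _)

end CommutatorLimit

/-- Membership in `L^s_loc`. -/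
def MemLpLoc {n : ℕ} (u : Heis n → ℝ) (s : ℝ≥0∞) : Prop :=
  ∀ K : Set (Heis n), IsCompact K → MemLp u s (volume.restrict K)

/-- A contact vector field at a fixed time, together with the derivatives of its generator `ψ` and
its divergence `D`. -/
structure IsContactSlice {n : ℕ} (s' : ℝ≥0∞) (ψ : Heis n → ℝ) (g : HorIdx n → Heis n → ℝ)
    (H : HorIdx n → HorIdx n → Heis n → ℝ) (b : FrameIdx n → Heis n → ℝ) (D : Heis n → ℝ) :
    Prop where
  deriv : ∀ i, IsWeakFrameDeriv (Sum.inl i) ψ (g i)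
  deriv₂ : ∀ i j, IsWeakFrameDeriv (Sum.inl i) (g j) (H i j)
  memLp : MemLp ψ s' volume
  memLp_deriv : ∀ i, MemLp (g i) s' volume
  memLp_deriv₂ : ∀ i j, MemLp (H i j) s' volume
  coeff : ∀ i, b i =ᵐ[volume] contactCoeff ψ g i
  memLp_div : MemLp D ∞ volume
  integral_div : ∀ φ : Heis n → ℝ, ContDiff ℝ (⊤ : ℕ∞) φ → HasCompactSupport φ →
    ∫ p, ∑ i, b i p * frameDeriv i φ p = -∫ p, φ p * D p

/-- A compact set that contains all points used by the mollifications on `K` at scales at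
most one. -/
def heisHull {n : ℕ} (ρ : Heis n → ℝ) (K : Set (Heis n)) : Set (Heis n) :=
  K ∪ (fun z : ℝ × Heis n × Heis n => heisMul z.2.1 (heisDil z.1 z.2.2)) ''
    (Icc (0 : ℝ) 1 ×ˢ K ×ˢ tsupport ρ)

theorem continuous_heisDil_uncurry {n : ℕ} :
    Continuous fun z : ℝ × Heis n => heisDil z.1 z.2 := by
  simp only [heisDil_apply]; fun_prop

theorem isCompact_heisHull {n : ℕ} {ρ : Heis n → ℝ} (hρc : HasCompactSupport ρ)
    {K : Set (Heis n)} (hK : IsCompact K) : IsCompact (heisHull ρ K) :=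
  hK.union ((isCompact_Icc.prod (hK.prod hρc)).image (continuous_heisMul
    (continuous_fst.comp continuous_snd) (continuous_heisDil_uncurry.comp
      (continuous_fst.prodMk (continuous_snd.comp continuous_snd)))))

theorem subset_heisHull {n : ℕ} {ρ : Heis n → ℝ} {K : Set (Heis n)} : K ⊆ heisHull ρ K :=
  subset_union_left

theorem mem_heisHull {n : ℕ} {ρ : Heis n → ℝ} {K : Set (Heis n)} {p w : Heis n} (hp : p ∈ K)
    (hw : w ∈ tsupport ρ) {ε : ℝ} (hε : ε ∈ Icc (0 : ℝ) 1) :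
    heisMul p (heisDil ε w) ∈ heisHull ρ K :=
  Or.inr ⟨(ε, p, w), ⟨hε, hp, hw⟩, rfl⟩

/-! ### The commutator at a fixed time for locally integrable functions -/

section Slice

variable {n : ℕ} {s s' : ℝ≥0∞} {ψ : Heis n → ℝ} {g : HorIdx n → Heis n → ℝ}
  {H : HorIdx n → HorIdx n → Heis n → ℝ} {b : FrameIdx n → Heis n → ℝ} {D u : Heis n → ℝ}
  {ρ : Heis n → ℝ}

theorem memLpLoc_of_memLp {u : Heis n → ℝ} (hu : MemLp u s volume) : MemLpLoc u s :=
  fun _ _ => hu.restrict _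

theorem MemLpLoc.locallyIntegrable (hs : 1 ≤ s) (hu : MemLpLoc u s) :
    LocallyIntegrable u volume :=
  locallyIntegrable_iff.2 fun K hK => by
    have : IsFiniteMeasure ((volume : Measure (Heis n)).restrict K) :=
      ⟨by simpa using hK.measure_lt_top⟩
    exact (hu K hK).integrable hs

theorem MemLpLoc.indicator (hu : MemLpLoc u s) {K : Set (Heis n)} (hK : IsCompact K) :
    MemLp (K.indicator u) s volume :=
  (memLp_indicator_iff_restrict hK.measurableSet).2 (hu K hK)

variable [hss : ENNReal.HolderConjugate s s']

theorem MemLpLoc.locallyIntegrable_mul {F : Heis n → ℝ} (hu : MemLpLoc u s)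
    (hF : MemLpLoc F s') : LocallyIntegrable (fun p => u p * F p) volume :=
  locallyIntegrable_iff.2 fun K hK => memLp_one_iff_integrable.1 ((hF K hK).mul (hu K hK))

theorem memLp_contactCoeff (hψ : MemLp ψ s' volume) (hg : ∀ i, MemLp (g i) s' volume)
    (i : FrameIdx n) : MemLp (contactCoeff ψ g i) s' volume := by
  rcases i with (j | j) | j
  · exact hg _
  · exact (hg _).neg
  · exact hψ.const_mul (-4)

theorem IsContactSlice.memLp_coeff (hb : IsContactSlice s' ψ g H b D) (i : FrameIdx n) :
    MemLp (b i) s' volume :=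
  (memLp_congr_ae (hb.coeff i)).2 (memLp_contactCoeff hb.memLp hb.memLp_deriv i)

theorem ae_heisComm_congr_coeff {b' : FrameIdx n → Heis n → ℝ} (h : ∀ i, b i =ᵐ[volume] b' i)
    (ρ : Heis n → ℝ) (ε : ℝ) (D u : Heis n → ℝ) :
    ∀ᵐ p, heisComm ρ ε b D u p = heisComm ρ ε b' D u p := by
  have h' := ae_all_iff.2 h
  filter_upwards [h'] with p hp
  simp only [heisComm, hp]
  congr 1
  exact integral_congr_ae (h'.mono fun q hq => by simp only [hq])

/-- At scales at most one the commutator on `K` sees `u` only on the compact hull. Truncation to the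
hull reduces `L^s_loc` to `L^s`. -/
theorem heisComm_congr_on (hρ : ContDiff ℝ (⊤ : ℕ∞) ρ) (hρc : HasCompactSupport ρ)
    (hb : IsContactSlice s' ψ g H b D) {v : Heis n → ℝ} (hu : MemLpLoc u s) (hv : MemLpLoc v s)
    {K : Set (Heis n)} (huv : ∀ p ∈ heisHull ρ K, u p = v p) {ε : ℝ} (hε : ε ∈ Ioc (0 : ℝ) 1)
    {p : Heis n} (hp : p ∈ K) : heisComm ρ ε b D u p = heisComm ρ ε b D v p := by
  have h1 : 1 ≤ s := ENNReal.HolderConjugate.one_le s s'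
  have key : ∀ {u : Heis n → ℝ}, MemLpLoc u s → (∀ i, LocallyIntegrable (fun q => u q * b i q)
      volume) ∧ LocallyIntegrable (fun q => u q * D q) volume := fun {u} hu =>
    ⟨fun i => hu.locallyIntegrable_mul (memLpLoc_of_memLp (hb.memLp_coeff i)),
      locallyIntegrable_iff.2 fun K hK => by
        have : IsFiniteMeasure ((volume : Measure (Heis n)).restrict K) :=
          ⟨by simpa using hK.measure_lt_top⟩
        exact memLp_one_iff_integrable.1 ((hb.memLp_div.restrict K).mul (p := 1) (r := 1)
          ((hu K hK).mono_exponent h1))⟩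
  rw [heisComm_eq hρ hρc hε.1.ne' (hu.locallyIntegrable h1) (key hu).1 (key hu).2,
    heisComm_eq hρ hρc hε.1.ne' (hv.locallyIntegrable h1) (key hv).1 (key hv).2]
  refine integral_congr_ae (.of_forall fun w => ?_)
  by_cases hw : w ∈ tsupport ρ
  · simp only [huv _ (mem_heisHull hp hw ⟨hε.1.le, hε.2⟩)]
  · simp only [frameDeriv_eq_zero_of_notMem hw, image_eq_zero_of_notMem_tsupport hw, mul_zero,
      sub_zero, Finset.sum_const_zero, add_zero]

/-- The mollification of a constant is constant, and what remains is the definition of the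
divergence tested with the kernel. -/
theorem heisComm_one (hρ : ContDiff ℝ (⊤ : ℕ∞) ρ) (hρc : HasCompactSupport ρ)
    (hb : IsContactSlice s' ψ g H b D) (hbl : ∀ i, LocallyIntegrable (b i) volume) {ε : ℝ}
    (hε : ε ≠ 0) (p : Heis n) :
    heisComm ρ ε b D (fun _ => 1) p = 0 := by
  have hk := contDiff_heisKer (ε := ε) hρ p
  have hkc := hasCompactSupport_heisKer hρc hε p
  have h1 := hb.integral_div _ hk hkc
  have h2 : heisMoll ρ ε (fun _ => 1) = fun _ : Heis n => ∫ w, ρ w := by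
    funext p; simp [heisMoll]
  have i1 : Integrable fun q => ∑ i, b i q * frameDeriv i (heisKer ρ ε p) q :=
    integrable_finsetSum _ fun i _ => by
      have := (hbl i).integrable_smul_left_of_hasCompactSupport
        (continuous_frameDeriv (hk.of_le (by simp)) i) (hasCompactSupport_frameDeriv hkc i)
      exact this.congr (.of_forall fun q => by simp [mul_comm])
  have i2 : Integrable fun q => D q * heisKer ρ ε p q := by
    have h3 : LocallyIntegrable D volume := hb.memLp_div.locallyIntegrable le_top
    have := h3.integrable_smul_left_of_hasCompactSupport hk.continuous hkc
    exact this.congr (.of_forall fun q => by simp [mul_comm])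
  rw [heisComm, h2]
  have h3 : ∀ i, frameDeriv i (fun _ : Heis n => ∫ w, ρ w) p = 0 := fun i => by simp [frameDeriv]
  simp only [h3, mul_zero, Finset.sum_const_zero, add_zero, one_mul]
  rw [integral_add i1 i2, h1]
  simp only [mul_comm (D _), neg_add_cancel]

theorem integrable_indicator_mul_div (hb : IsContactSlice s' ψ g H b D) (hu : MemLpLoc u s)
    {K : Set (Heis n)} (hK : IsCompact K) : Integrable fun q => K.indicator u q * D q := by
  have : IsFiniteMeasure ((volume : Measure (Heis n)).restrict K) :=
    ⟨by simpa using hK.measure_lt_top⟩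
  have h1 : MemLp (K.indicator u) 1 volume := (memLp_indicator_iff_restrict hK.measurableSet).2
    ((hu K hK).mono_exponent (ENNReal.HolderConjugate.one_le s s'))
  exact memLp_one_iff_integrable.1 (hb.memLp_div.mul (p := 1) (r := 1) h1)

theorem locallyIntegrable_mul_contactCoeff (hb : IsContactSlice s' ψ g H b D)
    (hu : MemLpLoc u s) (i : FrameIdx n) :
    LocallyIntegrable (fun q => u q * contactCoeff ψ g i q) volume :=
  hu.locallyIntegrable_mul (memLpLoc_of_memLp (memLp_contactCoeff hb.memLp hb.memLp_deriv i))

variable (s s') in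
/-- The commutator is bounded in `L¹_loc`, uniformly in the scale. -/
theorem exists_lintegral_heisComm_le (hn : 1 ≤ n) (hρ : ContDiff ℝ (⊤ : ℕ∞) ρ)
    (hρc : HasCompactSupport ρ) {K : Set (Heis n)} (hK : IsCompact K) :
    ∃ C : ℝ≥0∞, C ≠ ∞ ∧ ∀ (ψ : Heis n → ℝ) (g : HorIdx n → Heis n → ℝ)
      (H : HorIdx n → HorIdx n → Heis n → ℝ) (b : FrameIdx n → Heis n → ℝ) (D u : Heis n → ℝ),
      IsContactSlice s' ψ g H b D → MemLpLoc u s → ∀ ε ∈ Ioc (0 : ℝ) 1,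
      ∫⁻ p in K, ‖heisComm ρ ε b D u p‖ₑ ≤ C * (eLpNorm u s (volume.restrict (heisHull ρ K)) *
        ((∑ k, ∑ j, eLpNorm (H k j) s' volume) + eLpNorm D ∞ volume)) := by
  have hh := isCompact_heisHull hρc hK
  let i₀ : Fin n := ⟨0, hn⟩
  have hs1 : 1 ≤ s := ENNReal.HolderConjugate.one_le s s'
  -- The Hölder constant of `L^s ⊂ L¹` on the hull. It is needed because `D` lies in `L^∞` rather
  -- than in `L^{s'}`.
  set a : ℝ≥0∞ := volume (heisHull ρ K) ^ (1 / (1 : ℝ≥0∞).toReal - 1 / s.toReal)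
  have ha : a ≠ ∞ := by
    refine ENNReal.rpow_ne_top_of_nonneg ?_ hh.measure_lt_top.ne
    rw [ENNReal.toReal_one, div_one, one_div, sub_nonneg]
    by_cases h : s = ∞
    · rw [h]; norm_num
    · exact inv_le_one_of_one_le₀ (by simpa only [ENNReal.toReal_one] using ENNReal.toReal_mono h hs1)
  set W : ℝ≥0∞ := ∑ k, ∑ j, ∫⁻ x, ‖commWeight i₀ ρ k j x‖ₑ ∂(pathMeasure n)
  have hW : W ≠ ∞ := ENNReal.sum_ne_top.2 fun k _ => ENNReal.sum_ne_top.2 fun j _ =>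
    (integrable_commWeight hρ hρc k j).2.ne
  have hR : ∫⁻ w, ‖ρ w‖ₑ ≠ ∞ := (hρ.continuous.integrable_of_hasCompactSupport hρc).2.ne
  refine ⟨W + (∫⁻ w, ‖ρ w‖ₑ) * a, ENNReal.add_ne_top.2 ⟨hW, ENNReal.mul_ne_top hR ha⟩, ?_⟩
  intro ψ g H b D u hb hu ε hε
  set v := (heisHull ρ K).indicator u with hv
  have hvm : MemLp v s volume := hu.indicator hh
  have e1 : ∫⁻ p in K, ‖heisComm ρ ε b D u p‖ₑ ≤ ∫⁻ p, ‖heisComm ρ ε (contactCoeff ψ g) D v p‖ₑ := by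
    have h1 : ∫⁻ p in K, ‖heisComm ρ ε b D u p‖ₑ = ∫⁻ p in K, ‖heisComm ρ ε b D v p‖ₑ :=
      setLIntegral_congr_fun hK.measurableSet fun p hp => by
        rw [heisComm_congr_on hρ hρc hb hu (memLpLoc_of_memLp hvm)
          (fun q hq => (indicator_of_mem hq u).symm) hε hp]
    rw [h1]
    refine (setLIntegral_le_lintegral _ _).trans (lintegral_mono_ae ?_)
    exact (ae_heisComm_congr_coeff hb.coeff ρ ε D v).mono fun p hp => (congrArg (‖·‖ₑ) hp).le
  have e2 : eLpNorm v s volume = eLpNorm u s (volume.restrict (heisHull ρ K)) :=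
    eLpNorm_indicator_eq_eLpNorm_restrict hh.measurableSet
  have e3 : ∫⁻ p, ‖v p * D p‖ₑ ≤ eLpNorm u s (volume.restrict (heisHull ρ K)) * a *
      eLpNorm D ∞ volume := by
    have h1 := eLpNorm_le_eLpNorm_mul_rpow_measure_univ hs1 (hu _ hh).1
    rw [Measure.restrict_apply_univ] at h1
    refine (lintegral_enorm_mul_le (s := 1) (s' := ∞) hvm.1 hb.memLp_div.1).trans ?_
    gcongr
    rw [eLpNorm_indicator_eq_eLpNorm_restrict hh.measurableSet]
    exact h1
  refine e1.trans ((lintegral_heisComm_le (i₀ := i₀) (s := s) (s' := s') hb.deriv hb.deriv₂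
    hb.memLp_deriv₂ hvm (locallyIntegrable_mul_contactCoeff hb (memLpLoc_of_memLp hvm))
    (integrable_indicator_mul_div (s := s) hb hu hh) hρ hρc hε.1.ne').trans ?_)
  rw [e2]
  set N := eLpNorm u s (volume.restrict (heisHull ρ K))
  set S := ∑ k, ∑ j, eLpNorm (H k j) s' volume with hS
  calc _ ≤ (∑ k, ∑ j, (∫⁻ x, ‖commWeight i₀ ρ k j x‖ₑ ∂(pathMeasure n)) * (N * S)) +
        (∫⁻ w, ‖ρ w‖ₑ) * (N * a * eLpNorm D ∞ volume) := by
        gcongr with k _ j _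
        rw [hS]
        exact (Finset.single_le_sum (f := fun j => eLpNorm (H k j) s' volume)
          (fun _ _ => zero_le) (Finset.mem_univ j)).trans (Finset.single_le_sum
            (f := fun k => ∑ j, eLpNorm (H k j) s' volume) (fun _ _ => zero_le)
              (Finset.mem_univ k))
    _ = W * (N * S) + (∫⁻ w, ‖ρ w‖ₑ) * a * (N * eLpNorm D ∞ volume) := by
        simp only [← Finset.sum_mul, W]
        ring
    _ ≤ _ := by
        rw [add_mul]
        gcongr
        · exact le_self_add
        · exact le_add_self

/-- The function in question is the limit factor of the commutator and does not depend on `u`. With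
the constant `1`, truncated to the hull, the commutators vanish on `K` at every scale, so the factor
is zero there. The moments of the weights need not be evaluated. -/
theorem ae_commutator_limit_eq_zero (s : ℝ≥0∞) [hss : ENNReal.HolderConjugate s s'] (hn : 1 ≤ n) (hρ : ContDiff ℝ (⊤ : ℕ∞) ρ)
    (hρc : HasCompactSupport ρ) (hb : IsContactSlice s' ψ g H b D) :
    ∀ᵐ p, (∑ k, ∑ j, (∫ x, commWeight ⟨0, hn⟩ ρ k j x ∂(pathMeasure n)) * H k j p) +
        (∫ w, ρ w) * D p = 0 := by
  have hss' : ENNReal.HolderConjugate s s' := hss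
  have hs1' : 1 ≤ s' := by
    have : ENNReal.HolderConjugate s' s := ENNReal.HolderConjugate.symm
    exact ENNReal.HolderConjugate.one_le s' s
  refine ae_of_forall_isCompact_ae_restrict fun K hK => ?_
  have hh := isCompact_heisHull hρc hK
  have h1 : MemLpLoc (fun _ : Heis n => (1 : ℝ)) s := fun K hK => by
    have : IsFiniteMeasure ((volume : Measure (Heis n)).restrict K) :=
      ⟨by simpa using hK.measure_lt_top⟩
    exact memLp_const 1
  have hv := h1.indicator hh
  let ε : ℕ → ℝ := fun m => 1 / ((m : ℝ) + 1)
  have hε : ∀ m, ε m ∈ Ioc (0 : ℝ) 1 := fun m =>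
    ⟨by positivity, by
      have : (0 : ℝ) ≤ m := m.cast_nonneg
      exact (div_le_one (by positivity)).2 (by linarith)⟩
  have t := tendsto_lintegral_heisComm (i₀ := ⟨0, hn⟩) (s := s) (s' := s') hb.deriv hb.deriv₂
    hb.memLp_deriv₂ hv (locallyIntegrable_mul_contactCoeff hb (memLpLoc_of_memLp hv))
    (integrable_indicator_mul_div (s := s) hb h1 hh) hρ hρc (fun m => (hε m).1.ne')
    tendsto_one_div_add_atTop_nhds_zero_nat
  set L : Heis n → ℝ := fun p => (∑ k, ∑ j, (∫ x, commWeight ⟨0, hn⟩ ρ k j x ∂(pathMeasure n)) *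
    H k j p) + (∫ w, ρ w) * D p with hL
  have hle : ∀ m, ∫⁻ p in K, ‖L p‖ₑ ≤ ∫⁻ p, ‖heisComm ρ (ε m) (contactCoeff ψ g) D
      ((heisHull ρ K).indicator fun _ => 1) p - (heisHull ρ K).indicator (fun _ => 1) p *
        L p‖ₑ := fun m => by
    refine le_trans ?_ (setLIntegral_le_lintegral K _)
    refine lintegral_mono_ae ?_
    filter_upwards [ae_restrict_mem hK.measurableSet, ae_restrict_of_ae
      (ae_heisComm_congr_coeff hb.coeff ρ (ε m) D ((heisHull ρ K).indicator fun _ => 1))] with p hp hp'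
    rw [← hp', ← heisComm_congr_on hρ hρc hb h1 (memLpLoc_of_memLp hv)
      (fun q hq => (indicator_of_mem hq fun _ => (1 : ℝ)).symm) (hε m) hp,
      heisComm_one hρ hρc hb (fun i => (hb.memLp_coeff i).locallyIntegrable hs1') (hε m).1.ne',
      indicator_of_mem (subset_heisHull hp), one_mul, zero_sub, enorm_neg]
  have h0 : ∫⁻ p in K, ‖L p‖ₑ = 0 := le_antisymm (ge_of_tendsto' t hle) zero_le
  have hLm : AEStronglyMeasurable L (volume.restrict K) := by
    refine ((Finset.aestronglyMeasurable_fun_sum _ fun k _ =>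
      Finset.aestronglyMeasurable_fun_sum _ fun j _ => (hb.memLp_deriv₂ k j).1.const_mul _).add
        (hb.memLp_div.1.const_mul _)).restrict
  exact ((lintegral_eq_zero_iff' hLm.enorm).1 h0).mono fun p hp => enorm_eq_zero.1 hp

/-- The commutator vanishes in `L¹_loc` in the limit. -/
theorem tendsto_lintegral_heisComm_zero (hn : 1 ≤ n) (hρ : ContDiff ℝ (⊤ : ℕ∞) ρ)
    (hρc : HasCompactSupport ρ) (hb : IsContactSlice s' ψ g H b D) (hu : MemLpLoc u s)
    {K : Set (Heis n)} (hK : IsCompact K) {ε : ℕ → ℝ} (hε : ∀ k, ε k ∈ Ioc (0 : ℝ) 1)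
    (hε0 : Tendsto ε atTop (𝓝 0)) :
    Tendsto (fun m => ∫⁻ p in K, ‖heisComm ρ (ε m) b D u p‖ₑ) atTop (𝓝 0) := by
  have hh := isCompact_heisHull hρc hK
  have hv := hu.indicator hh
  have t := tendsto_lintegral_heisComm (i₀ := ⟨0, hn⟩) (s := s) (s' := s') hb.deriv hb.deriv₂
    hb.memLp_deriv₂ hv (locallyIntegrable_mul_contactCoeff hb (memLpLoc_of_memLp hv))
    (integrable_indicator_mul_div (s := s) hb hu hh) hρ hρc (fun m => (hε m).1.ne') hε0
  refine tendsto_of_tendsto_of_tendsto_of_le_of_le tendsto_const_nhds t (fun _ => zero_le)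
    fun m => ?_
  refine le_trans ?_ (setLIntegral_le_lintegral K _)
  refine lintegral_mono_ae ?_
  filter_upwards [ae_restrict_mem hK.measurableSet, ae_restrict_of_ae
    (ae_heisComm_congr_coeff hb.coeff ρ (ε m) D ((heisHull ρ K).indicator u)),
    ae_restrict_of_ae (ae_commutator_limit_eq_zero s hn hρ hρc hb)] with p hp hp' h0
  rw [h0, mul_zero, sub_zero, ← hp', ← heisComm_congr_on hρ hρc hb hu (memLpLoc_of_memLp hv)
      (fun q hq => (indicator_of_mem hq _).symm) (hε m) hp]

end Slice

/-! ## Mixed norms -/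

section Mixed

variable {α β : Type*} [MeasurableSpace α] [MeasurableSpace β] {μ : Measure α} {ν : Measure β}
  [SFinite ν]

/-- The essential supremum is not an integral, so Tonelli does not apply directly. But it is at most
`a` exactly when the section of `{|f| > a}` is null, and measures of sections are measurable. -/
theorem measurable_eLpNormEssSup_section {f : α × β → ℝ} (hf : StronglyMeasurable f) :
    Measurable fun x => eLpNormEssSup (fun y => f (x, y)) ν := by
  refine measurable_of_Iic fun a => ?_
  have h1 : MeasurableSet {z : α × β | a < ‖f z‖ₑ} :=
    measurableSet_lt measurable_const hf.measurable.enorm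
  have h2 : (fun x => eLpNormEssSup (fun y => f (x, y)) ν) ⁻¹' Iic a =
      (fun x => ν (Prod.mk x ⁻¹' {z : α × β | a < ‖f z‖ₑ})) ⁻¹' {0} := by
    ext x
    simp only [mem_preimage, mem_Iic, mem_singleton_iff]
    constructor
    · intro h
      have h3 : ∀ᵐ y ∂ν, ‖f (x, y)‖ₑ ≤ a :=
        (ENNReal.ae_le_essSup _).mono fun y hy => hy.trans h
      refine measure_mono_null (fun y hy => ?_) (ae_iff.1 h3)
      simpa using hy
    · intro h
      refine essSup_le_of_ae_le a (ae_iff.2 ?_)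
      refine measure_mono_null (fun y hy => ?_) h
      simpa using hy
  rw [h2]
  exact measurable_measure_prodMk_left h1 (measurableSet_singleton 0)

theorem aemeasurable_eLpNorm_section {f : α → β → ℝ}
    (hf : AEStronglyMeasurable (Function.uncurry f) (μ.prod ν)) (q : ℝ≥0∞) :
    AEMeasurable (fun x => eLpNorm (f x) q ν) μ := by
  obtain ⟨g, hg, hfg⟩ := hf
  have h1 : ∀ᵐ x ∂μ, eLpNorm (fun y => g (x, y)) q ν = eLpNorm (f x) q ν := by
    filter_upwards [Measure.ae_ae_of_ae_prod hfg] with x hx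
    exact (eLpNorm_congr_ae hx).symm
  refine AEMeasurable.congr ?_ h1
  refine Measurable.aemeasurable ?_
  by_cases h0 : q = 0
  · simp [h0]
  by_cases ht : q = ∞
  · simp only [ht, eLpNorm_exponent_top]
    exact measurable_eLpNormEssSup_section hg
  · simp only [eLpNorm_eq_lintegral_rpow_enorm_toReal h0 ht]
    exact ((hg.measurable.enorm.pow_const _).lintegral_prod_right').pow_const _

end Mixed

/-! ## Absolutely continuous functions of time -/

/-- `f` is absolutely continuous on `[0, T₀]` with derivative `f'`. -/
def HasACDeriv (T₀ : ℝ) (f f' : ℝ → ℝ) : Prop :=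
  AbsolutelyContinuousOnInterval f 0 T₀ ∧ ∀ᵐ x, x ∈ uIcc 0 T₀ → HasDerivAt f (f' x) x

namespace HasACDeriv

variable {T₀ : ℝ} {f f' g g' : ℝ → ℝ}

theorem intervalIntegrable (h : HasACDeriv T₀ f f') : IntervalIntegrable f' volume 0 T₀ := by
  refine h.1.intervalIntegrable_deriv.congr_ae ?_
  rw [EventuallyEq, ae_restrict_iff' measurableSet_uIoc]
  filter_upwards [h.2] with x hx hx'
  exact (hx (uIoc_subset_uIcc hx')).deriv

theorem integral_eq (h : HasACDeriv T₀ f f') : ∫ x in (0 : ℝ)..T₀, f' x = f T₀ - f 0 := by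
  rw [← h.1.integral_deriv_eq_sub]
  refine intervalIntegral.integral_congr_ae ?_
  filter_upwards [h.2] with x hx hx'
  exact (hx (uIoc_subset_uIcc hx')).deriv.symm

theorem mul (hf : HasACDeriv T₀ f f') (hg : HasACDeriv T₀ g g') :
    HasACDeriv T₀ (fun x => f x * g x) fun x => f' x * g x + f x * g' x :=
  ⟨hf.1.fun_mul hg.1, by
    filter_upwards [hf.2, hg.2] with x h1 h2 hx using (h1 hx).fun_mul (h2 hx)⟩

theorem continuousOn (hf : HasACDeriv T₀ f f') : ContinuousOn f (uIcc 0 T₀) := hf.1.continuousOn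

/-- The range of `f` lies in a compact interval, on which `F` is Lipschitz, and this suffices for
absolute continuity. -/
theorem comp {F : ℝ → ℝ} (hF : ContDiff ℝ 1 F) (hf : HasACDeriv T₀ f f') :
    HasACDeriv T₀ (fun x => F (f x)) fun x => deriv F (f x) * f' x := by
  refine ⟨?_, by
    filter_upwards [hf.2] with x h1 hx
    exact ((hF.differentiable one_ne_zero).differentiableAt.hasDerivAt).comp x (h1 hx)⟩
  obtain ⟨C, hC⟩ := hf.1.exists_bound
  obtain ⟨L, hL⟩ := (hF.contDiffOn (s := Icc (-C) C)).exists_lipschitzOnWith one_ne_zero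
    (convex_Icc _ _) isCompact_Icc
  have hmem : ∀ x ∈ uIcc 0 T₀, f x ∈ Icc (-C) C := fun x hx => abs_le.1 (hC x hx)
  have h0 := hf.1
  rw [absolutelyContinuousOnInterval_iff] at h0 ⊢
  intro ε hε
  -- Division by `L + 1` instead of `L` covers the case `L = 0` and keeps the final inequality
  -- strict.
  obtain ⟨δ, hδ, h⟩ := h0 (ε / (L + 1)) (by positivity)
  refine ⟨δ, hδ, fun E hE hlt => ?_⟩
  have h1 := h E hE hlt
  calc _ ≤ ∑ i ∈ Finset.range E.1, L * dist (f (E.2 i).1) (f (E.2 i).2) := by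
        refine Finset.sum_le_sum fun i hi => ?_
        have hm := hE.1 i hi
        exact hL.dist_le_mul _ (hmem _ hm.1) _ (hmem _ hm.2)
    _ ≤ (L + 1) * ∑ i ∈ Finset.range E.1, dist (f (E.2 i).1) (f (E.2 i).2) := by
        rw [← Finset.mul_sum]
        have : (0 : ℝ) ≤ ∑ i ∈ Finset.range E.1, dist (f (E.2 i).1) (f (E.2 i).2) :=
          Finset.sum_nonneg fun _ _ => dist_nonneg
        nlinarith
    _ < (L + 1) * (ε / (L + 1)) := by gcongr
    _ = ε := by field_simp

theorem of_integral (a : ℝ) (h : IntervalIntegrable f' volume 0 T₀) :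
    HasACDeriv T₀ (fun x => a + ∫ y in (0 : ℝ)..x, f' y) f' := by
  constructor
  · have h1 : AbsolutelyContinuousOnInterval (fun _ : ℝ => a) 0 T₀ :=
      contDiffOn_const.absolutelyContinuousOnInterval
    exact h1.fun_add (h.absolutelyContinuousOnInterval_intervalIntegral (by simp))
  · filter_upwards [h.ae_hasDerivAt_integral] with x hx hx'
    exact (hx hx' 0 (by simp)).const_add a

theorem of_contDiff (hf : ContDiff ℝ 1 f) : HasACDeriv T₀ f (deriv f) :=
  ⟨hf.contDiffOn.absolutelyContinuousOnInterval, .of_forall fun _ _ =>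
    (hf.differentiable one_ne_zero).differentiableAt.hasDerivAt⟩

end HasACDeriv

theorem contDiff_integral_of_contDiff {η : ℝ → ℝ} (hη : ContDiff ℝ (⊤ : ℕ∞) η) (a : ℝ) :
    ContDiff ℝ (⊤ : ℕ∞) (fun x => ∫ y in a..x, η y) ∧
      ∀ x, HasDerivAt (fun x => ∫ y in a..x, η y) (η x) x := by
  have h : ∀ x, HasDerivAt (fun x => ∫ y in a..x, η y) (η x) x := fun x =>
    intervalIntegral.integral_hasDerivAt_right (hη.continuous.intervalIntegrable _ _)
      (hη.continuous.stronglyMeasurableAtFilter _ _) hη.continuous.continuousAt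
  refine ⟨?_, h⟩
  rw [contDiff_infty_iff_deriv]
  exact ⟨fun x => (h x).differentiableAt, by rwa [show deriv _ = η from funext fun x => (h x).deriv]⟩

theorem measurableSet_timeInterval (T : EReal) : MeasurableSet (timeInterval T) :=
  measurableSet_Ioi.inter (measurable_coe_real_ereal measurableSet_Iio)

theorem Ioc_subset_timeInterval {T : EReal} {T₁ : ℝ} (h : (T₁ : EReal) < T) :
    Ioc 0 T₁ ⊆ timeInterval T := fun _ hx =>
  ⟨hx.1, (EReal.coe_le_coe_iff.2 hx.2).trans_lt h⟩

/-- A weak solution of `U' = -V`, `U(0) = U₀` agrees with the primitive. -/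
theorem ae_eq_primitive_of_weak {T : EReal} {U V : ℝ → ℝ} {U₀ : ℝ} {T₁ : ℝ}
    (h0 : 0 < T₁) (h1 : (T₁ : EReal) < T) (hU : IntegrableOn U (Ioc 0 T₁))
    (hV : IntegrableOn V (Ioc 0 T₁))
    (h : ∀ χ : ℝ → ℝ, ContDiff ℝ (⊤ : ℕ∞) χ → HasCompactSupport χ → tsupport χ ⊆ Iic T₁ →
      -(U₀ * χ 0) + ∫ τ in timeInterval T, (-deriv χ τ * U τ + χ τ * V τ) = 0) :
    ∀ᵐ τ ∂(volume.restrict (Ioc 0 T₁)), U τ = U₀ + ∫ x in (0 : ℝ)..τ, -V x := by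
  have hVi : IntervalIntegrable (fun x => -V x) volume 0 T₁ :=
    (intervalIntegrable_iff_integrableOn_Ioc_of_le h0.le).2 hV.neg
  set W : ℝ → ℝ := fun τ => U₀ + ∫ x in (0 : ℝ)..τ, -V x with hWdef
  have hW : HasACDeriv T₁ W fun x => -V x := HasACDeriv.of_integral U₀ hVi
  have hWi : IntegrableOn W (Ioc 0 T₁) := by
    have := hW.continuousOn
    rw [uIcc_of_le h0.le] at this
    exact (this.integrableOn_Icc).mono_set Ioc_subset_Icc_self
  -- The lemma of du Bois-Reymond: it suffices that `W - U` is orthogonal to every `η` in `C_c^∞(0,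
  -- T₁)`. The test function in time is the primitive of `η`.
  have key := isOpen_Ioo.ae_eq_zero_of_integral_contDiff_smul_eq_zero
    (U := Ioo 0 T₁) (f := fun τ => W τ - U τ) (μ := volume)
    (((hWi.sub hU).mono_set Ioo_subset_Ioc_self).locallyIntegrableOn) ?_
  · rw [ae_restrict_iff' measurableSet_Ioc]
    have hne : ∀ᵐ τ : ℝ, τ ≠ T₁ := Measure.ae_ne volume T₁
    filter_upwards [key, hne] with τ h2 h3 h4
    have := h2 ⟨h4.1, lt_of_le_of_ne h4.2 h3⟩
    linarith
  intro η hη hηc hηs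
  obtain ⟨hχ₀, hd⟩ := contDiff_integral_of_contDiff hη T₁
  set χ₀ : ℝ → ℝ := fun x => ∫ y in T₁..x, η y with hχ₀def
  have hη0 : ∀ x, T₁ ≤ x → η x = 0 := fun x hx =>
    image_eq_zero_of_notMem_tsupport fun h => absurd (hηs h).2 (not_lt.2 hx)
  have hχ₀0 : ∀ x, T₁ ≤ x → χ₀ x = 0 := fun x hx =>
    intervalIntegral.integral_zero_ae (.of_forall fun y hy => hη0 y (by
      rw [uIoc_of_le hx] at hy; exact hy.1.le))
  -- The primitive `χ₀` vanishes beyond `T₁` but is only constant for negative times. The bump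
  -- equals `1` near `[0, T₁]` and makes the product compactly supported without changing it on the
  -- relevant interval.
  let κ : ContDiffBump (0 : ℝ) := ⟨T₁ + 1, T₁ + 2, by linarith, by linarith⟩
  have hκ1 : ∀ x ∈ Icc 0 T₁, (κ : ℝ → ℝ) =ᶠ[𝓝 x] fun _ => 1 := fun x hx => by
    refine κ.eventuallyEq_one_of_mem_ball ?_
    rw [mem_ball_zero_iff, Real.norm_eq_abs, abs_of_nonneg hx.1]
    show x < T₁ + 1
    linarith [hx.2]
  have hs : tsupport (fun x => κ x * χ₀ x) ⊆ Iic T₁ := by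
    refine closure_minimal (fun x hx => ?_) isClosed_Iic
    by_contra h4
    exact hx (by simp only [hχ₀0 x (not_le.1 h4).le, mul_zero])
  have h2 := h (fun x => κ x * χ₀ x) (κ.contDiff.mul hχ₀) (κ.hasCompactSupport.mul_right) hs
  have e1 : ∀ τ ∈ timeInterval T, -deriv (fun x => κ x * χ₀ x) τ * U τ + κ τ * χ₀ τ * V τ =
      (Ioc 0 T₁).indicator (fun τ => -(η τ * U τ) + χ₀ τ * V τ) τ := fun τ hτ => by
    by_cases h5 : τ ≤ T₁
    · have h6 : (fun x => κ x * χ₀ x) =ᶠ[𝓝 τ] χ₀ := by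
        filter_upwards [hκ1 τ ⟨hτ.1.le, h5⟩] with x hx
        rw [hx, one_mul]
      rw [indicator_of_mem (show τ ∈ Ioc 0 T₁ from ⟨hτ.1, h5⟩), h6.deriv_eq, (hd τ).deriv,
        (hκ1 τ ⟨hτ.1.le, h5⟩).eq_of_nhds]
      ring
    · have h6 : (fun x => κ x * χ₀ x) =ᶠ[𝓝 τ] fun _ => 0 := by
        filter_upwards [Ioi_mem_nhds (not_le.1 h5)] with x hx
        rw [hχ₀0 x (le_of_lt hx), mul_zero]
      rw [indicator_of_notMem (fun h7 => h5 h7.2), h6.deriv_eq, hχ₀0 τ (not_le.1 h5).le]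
      simp
  rw [setIntegral_congr_fun (measurableSet_timeInterval T) e1,
    setIntegral_indicator measurableSet_Ioc,
    inter_eq_self_of_subset_right (Ioc_subset_timeInterval h1)] at h2
  have hχa : HasACDeriv T₁ χ₀ η := by
    have := HasACDeriv.of_contDiff (T₀ := T₁) (f := χ₀) (hχ₀.of_le (by simp))
    rwa [show deriv χ₀ = η from funext fun x => (hd x).deriv] at this
  have h3 := (hχa.mul hW).integral_eq
  have hW0 : W 0 = U₀ := by simp [hWdef]
  have hκ0 : κ 0 = 1 := (hκ1 0 ⟨le_rfl, h0.le⟩).eq_of_nhds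
  rw [intervalIntegral.integral_of_le h0.le, hχ₀0 T₁ le_rfl, hW0] at h3
  have cη : ContinuousOn η (Icc 0 T₁) := hη.continuous.continuousOn
  have cχ : ContinuousOn χ₀ (Icc 0 T₁) := hχ₀.continuous.continuousOn
  have mulI : ∀ {a F : ℝ → ℝ}, ContinuousOn a (Icc 0 T₁) → IntegrableOn F (Ioc 0 T₁) →
      IntegrableOn (fun x => a x * F x) (Ioc 0 T₁) := fun {a F} ha hF => by
    have := ((intervalIntegrable_iff_integrableOn_Ioc_of_le h0.le).2 hF).continuousOn_mul
      (by rwa [uIcc_of_le h0.le])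
    exact (intervalIntegrable_iff_integrableOn_Ioc_of_le h0.le).1 this
  have i1 := mulI cη hWi
  have i2 := mulI cη hU
  have i3 := mulI cχ hV
  have i4 := mulI cχ hV.neg
  have e2 : ∫ x, η x • (W x - U x) = ∫ x in Ioc 0 T₁, η x * (W x - U x) := by
    symm
    refine setIntegral_eq_integral_of_forall_compl_eq_zero fun x hx => ?_
    have : η x = 0 := image_eq_zero_of_notMem_tsupport fun h => hx (Ioo_subset_Ioc_self (hηs h))
    rw [this, zero_mul]
  rw [e2]
  simp only [hκ0, one_mul] at h2
  have e3 : ∫ x in Ioc 0 T₁, η x * (W x - U x) =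
      (∫ x in Ioc 0 T₁, (η x * W x + χ₀ x * -V x)) +
      ∫ x in Ioc 0 T₁, (-(η x * U x) + χ₀ x * V x) := by
    have i5 : IntegrableOn (fun x => η x * W x + χ₀ x * -V x) (Ioc 0 T₁) := i1.add i4
    have i6 : IntegrableOn (fun x => -(η x * U x) + χ₀ x * V x) (Ioc 0 T₁) := i2.neg.add i3
    rw [← integral_add i5 i6]
    exact integral_congr_ae (.of_forall fun x => by simp only; ring)
  rw [e3, h3]
  linarith

/-! ## Mollification in space of functions on space-time -/

section Mollify

variable {n : ℕ} {ρ : Heis n → ℝ} {K : Set (Heis n)}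

theorem heisMoll_congr_on {u v : Heis n → ℝ} (huv : ∀ p ∈ heisHull ρ K, u p = v p) {ε : ℝ}
    (hε : ε ∈ Ioc (0 : ℝ) 1) {p : Heis n} (hp : p ∈ K) :
    heisMoll ρ ε u p = heisMoll ρ ε v p := by
  refine integral_congr_ae (.of_forall fun w => ?_)
  by_cases hw : w ∈ tsupport ρ
  · simp only [huv _ (mem_heisHull hp hw ⟨hε.1.le, hε.2⟩)]
  · simp only [image_eq_zero_of_notMem_tsupport hw, zero_mul]

theorem eLpNorm_one_top_le (n : ℕ) :
    eLpNorm (fun _ : Heis n => (1 : ℝ)) ∞ volume ≤ 1 :=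
  (eLpNorm_le_of_ae_bound (C := 1) (.of_forall fun _ => by simp)).trans (by simp)

theorem heisMoll_eq_average (ε : ℝ) (f : Heis n → ℝ) (p : Heis n) :
    heisMoll ρ ε f p = ∫ w, ρ w * (f (heisMul p (heisDil ε w)) * (fun _ => 1) (heisMul p 0)) := by
  simp [heisMoll]

theorem lintegral_heisMoll_le (hρ : Continuous ρ) (hρc : HasCompactSupport ρ) (hK : IsCompact K)
    {f : Heis n → ℝ} (hf : IntegrableOn f (heisHull ρ K)) {ε : ℝ} (hε : ε ∈ Ioc (0 : ℝ) 1) :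
    ∫⁻ p in K, ‖heisMoll ρ ε f p‖ₑ ≤ (∫⁻ w, ‖ρ w‖ₑ) * ∫⁻ p in heisHull ρ K, ‖f p‖ₑ := by
  have hh := (isCompact_heisHull hρc hK).measurableSet
  set v := (heisHull ρ K).indicator f with hv
  have hvi : Integrable v := (integrable_indicator_iff hh).2 hf
  have e1 : ∫⁻ p in K, ‖heisMoll ρ ε f p‖ₑ = ∫⁻ p in K, ‖heisMoll ρ ε v p‖ₑ :=
    setLIntegral_congr_fun hK.measurableSet fun p hp => by
      rw [heisMoll_congr_on (fun q hq => (indicator_of_mem hq f).symm) hε hp]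
  rw [e1]
  refine (setLIntegral_le_lintegral _ _).trans ?_
  simp only [heisMoll_eq_average]
  refine (lintegral_mono fun p => enorm_integral_le_lintegral_enorm _).trans
    ((lintegral_lintegral_translate_mul_le (s := 1) (s' := ∞) hvi.1
      (aestronglyMeasurable_const (b := (1 : ℝ))) hρ.aestronglyMeasurable
      (contDiff_heisDil (k := 0) ε).continuous.measurable
      (measurable_const (a := (0 : Heis n)))).trans ?_)
  have h1 := eLpNorm_one_top_le n
  calc _ ≤ (∫⁻ w, ‖ρ w‖ₑ) * (eLpNorm v 1 volume * 1) := by gcongr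
    _ = _ := by
      rw [mul_one, hv, eLpNorm_indicator_eq_eLpNorm_restrict hh, eLpNorm_one_eq_lintegral_enorm]

theorem tendsto_heisDil {ε : ℕ → ℝ} (hε0 : Tendsto ε atTop (𝓝 0)) (w : Heis n) :
    Tendsto (fun m => heisDil (ε m) w) atTop (𝓝 0) := by
  have h : Continuous fun r : ℝ => heisDil r w :=
    continuous_heisDil_uncurry.comp (by fun_prop : Continuous fun r : ℝ => (r, w))
  have h0 : heisDil 0 w = 0 := by simp [heisDil_apply]
  exact h0 ▸ (h.tendsto 0).comp hε0

theorem tendsto_lintegral_heisMoll (hρ : Continuous ρ) (hρc : HasCompactSupport ρ)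
    (hρ1 : ∫ w, ρ w = 1) (hK : IsCompact K) {f : Heis n → ℝ}
    (hf : IntegrableOn f (heisHull ρ K)) {ε : ℕ → ℝ} (hε : ∀ m, ε m ∈ Ioc (0 : ℝ) 1)
    (hε0 : Tendsto ε atTop (𝓝 0)) :
    Tendsto (fun m => ∫⁻ p in K, ‖heisMoll ρ (ε m) f p - f p‖ₑ) atTop (𝓝 0) := by
  have hh := (isCompact_heisHull hρc hK).measurableSet
  set v := (heisHull ρ K).indicator f with hv
  have hvi : Integrable v := (integrable_indicator_iff hh).2 hf
  have h1 : MemLp (fun _ : Heis n => (1 : ℝ)) ∞ volume :=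
    memLp_top_of_bound aestronglyMeasurable_const 1 (.of_forall fun _ => by simp)
  have t := tendsto_average_translate_mul (s := 1) (s' := ∞) (memLp_one_iff_integrable.2 hvi) h1
      (hρ.integrable_of_hasCompactSupport hρc (μ := volume)) (b := fun _ _ => 0)
      (fun m => (contDiff_heisDil (k := 0) (ε m)).continuous.measurable)
      (fun m => measurable_const) (fun w => tendsto_heisDil hε0 w) (fun x => tendsto_const_nhds)
  refine tendsto_of_tendsto_of_tendsto_of_le_of_le tendsto_const_nhds t (fun _ => zero_le)
    fun m => ?_
  refine le_trans ?_ (setLIntegral_le_lintegral K _)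
  refine (setLIntegral_congr_fun hK.measurableSet fun p hp => ?_).le
  rw [← heisMoll_eq_average, hρ1, one_mul, mul_one, hv, indicator_of_mem (subset_heisHull hp),
    heisMoll_congr_on (fun q hq => (indicator_of_mem hq f).symm) (hε m) hp]

end Mollify

/-! ### Kernels and mollification on space-time slabs -/

section SpaceTime

variable {n : ℕ} {μ : Measure ℝ} {K L : Set (Heis n)}

theorem integrable_prod_of_lintegral {ν : Measure (Heis n)} [SFinite ν] {F : ℝ → Heis n → ℝ}
    (hF : AEStronglyMeasurable (Function.uncurry F) (μ.prod ν))
    (h : ∫⁻ τ, ∫⁻ p, ‖F τ p‖ₑ ∂ν ∂μ ≠ ∞) : Integrable (Function.uncurry F) (μ.prod ν) := by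
  refine ⟨hF, ?_⟩
  rw [HasFiniteIntegral, lintegral_prod _ hF.enorm]
  exact h.lt_top

variable [SFinite μ]

theorem integrable_kernel_prod (hK : IsCompact K) (hL : IsCompact L) {F : ℝ → Heis n → ℝ}
    (hF : Integrable (Function.uncurry F) (μ.prod (volume.restrict L))) {k : Heis n → Heis n → ℝ}
    (hk : Continuous (Function.uncurry k)) :
    Integrable (fun z : (ℝ × Heis n) × Heis n => F z.1.1 z.2 * k z.1.2 z.2)
      ((μ.prod (volume.restrict K)).prod (volume.restrict L)) := by
  have : IsFiniteMeasure ((volume : Measure (Heis n)).restrict K) :=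
      ⟨by simpa using hK.measure_lt_top⟩
  have hq : Measure.QuasiMeasurePreserving (fun z : (ℝ × Heis n) × Heis n => (z.1.1, z.2))
      ((μ.prod (volume.restrict K)).prod (volume.restrict L)) (μ.prod (volume.restrict L)) :=
    MeasureTheory.QuasiMeasurePreserving.prodMap
      (Measure.quasiMeasurePreserving_fst (μ := μ) (ν := (volume.restrict K)))
      (Measure.QuasiMeasurePreserving.id _)
  have h1 : AEStronglyMeasurable (fun z : (ℝ × Heis n) × Heis n => F z.1.1 z.2)
      ((μ.prod (volume.restrict K)).prod (volume.restrict L)) :=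
    hF.1.comp_quasiMeasurePreserving hq
  have h2 : Integrable (fun z : (ℝ × Heis n) × Heis n => F z.1.1 z.2)
      ((μ.prod (volume.restrict K)).prod (volume.restrict L)) := by
    refine ⟨h1, ?_⟩
    rw [HasFiniteIntegral, lintegral_prod _ h1.enorm]
    have hm : AEMeasurable (fun z : ℝ × Heis n => ∫⁻ q in L, ‖F z.1 q‖ₑ)
        (μ.prod (volume.restrict K)) := h1.enorm.lintegral_prod_right'
    simp only
    rw [lintegral_prod _ hm]
    simp only [lintegral_const]
    have h3 := hF.2
    rw [HasFiniteIntegral, lintegral_prod _ hF.1.enorm] at h3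
    rw [lintegral_mul_const' _ _ (by simpa using hK.measure_lt_top.ne)]
    exact ENNReal.mul_lt_top h3 (by simpa using hK.measure_lt_top)
  obtain ⟨C, hC⟩ := (hK.prod hL).exists_bound_of_continuousOn hk.continuousOn
  refine h2.mul_bdd (c := C) (hk.comp (by fun_prop : Continuous
    fun z : (ℝ × Heis n) × Heis n => (z.1.2, z.2))).aestronglyMeasurable ?_
  have e : (μ.prod (volume.restrict K)).prod ((volume : Measure (Heis n)).restrict L) =
      ((μ.prod volume).prod volume).restrict ((univ ×ˢ K) ×ˢ L) := by
    rw [← Measure.prod_restrict, ← Measure.prod_restrict, Measure.restrict_univ]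
  rw [e]
  filter_upwards [ae_restrict_mem ((MeasurableSet.univ.prod hK.measurableSet).prod
    hL.measurableSet)] with z hz
  exact hC (z.1.2, z.2) ⟨hz.1.2, hz.2⟩

theorem integrable_integral_kernel (hK : IsCompact K) (hL : IsCompact L) {F : ℝ → Heis n → ℝ}
    (hF : Integrable (Function.uncurry F) (μ.prod (volume.restrict L))) {k : Heis n → Heis n → ℝ}
    (hk : Continuous (Function.uncurry k)) (hk0 : ∀ p ∈ K, ∀ q ∉ L, k p q = 0) :
    Integrable (Function.uncurry fun τ p => ∫ q, F τ q * k p q) (μ.prod (volume.restrict K)) := by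
  have h1 := (integrable_kernel_prod hK hL hF hk).integral_prod_left
  refine h1.congr ?_
  have e : μ.prod ((volume : Measure (Heis n)).restrict K) =
      (μ.prod volume).restrict (univ ×ˢ K) := by
    rw [← Measure.prod_restrict, Measure.restrict_univ]
  rw [e]
  filter_upwards [ae_restrict_mem (MeasurableSet.univ.prod hK.measurableSet)] with z hz
  exact setIntegral_eq_integral_of_forall_compl_eq_zero fun q hq => by
    rw [hk0 _ hz.2 q hq, mul_zero]

theorem integrable_time_integral_kernel (hL : IsCompact L) {F : ℝ → Heis n → ℝ}
    (hF : Integrable (Function.uncurry F) (μ.prod (volume.restrict L))) {k : Heis n → ℝ}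
    (hk : Continuous k) (hk0 : ∀ q ∉ L, k q = 0) :
    Integrable (fun τ => ∫ q, F τ q * k q) μ := by
  obtain ⟨C, hC⟩ := hL.exists_bound_of_continuousOn hk.continuousOn
  have h2 : Integrable (fun z : ℝ × Heis n => F z.1 z.2 * k z.2)
      (μ.prod (volume.restrict L)) := by
    refine hF.mul_bdd (c := C) (hk.comp continuous_snd).aestronglyMeasurable ?_
    have e : μ.prod ((volume : Measure (Heis n)).restrict L) =
        (μ.prod volume).restrict (univ ×ˢ L) := by
      rw [← Measure.prod_restrict, Measure.restrict_univ]
    rw [e]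
    filter_upwards [ae_restrict_mem (MeasurableSet.univ.prod hL.measurableSet)] with z hz
    exact hC _ hz.2
  refine h2.integral_prod_left.congr (.of_forall fun τ => ?_)
  exact setIntegral_eq_integral_of_forall_compl_eq_zero fun q hq => by
    rw [hk0 q hq, mul_zero]

variable {ρ : Heis n → ℝ}

theorem integrable_heisMoll (hρ : ContDiff ℝ (⊤ : ℕ∞) ρ) (hρc : HasCompactSupport ρ)
    (hK : IsCompact K) {F : ℝ → Heis n → ℝ}
    (hF : Integrable (Function.uncurry F) (μ.prod (volume.restrict (heisHull ρ K)))) {ε : ℝ}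
    (hε : ε ∈ Ioc (0 : ℝ) 1) : Integrable (Function.uncurry fun τ => heisMoll ρ ε (F τ))
      (μ.prod (volume.restrict K)) := by
  have h := integrable_integral_kernel hK (isCompact_heisHull hρc hK) hF
    (k := heisKer ρ ε) (contDiff_heisKer_uncurry hρ).continuous fun p hp q hq =>
      heisKer_eq_zero hε.1.ne' hp fun ⟨z, hz, hzq⟩ => by
        obtain ⟨hz1, w, hw, hw'⟩ := hz
        simp only [← hzq, ← hw'] at hq
        exact hq (mem_heisHull hz1 hw ⟨hε.1.le, hε.2⟩)
  refine h.congr (.of_forall fun z => ?_)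
  exact (heisMoll_eq_integral_heisKer hε.1.ne' (F z.1) z.2).symm

/-- Convergence holds at almost every time, and `(‖ρ‖₁ + 1)` times the `L¹` norm of `F(τ)` on the
hull dominates, so dominated convergence in time applies. -/
theorem tendsto_lintegral_heisMoll_prod (hρ : ContDiff ℝ (⊤ : ℕ∞) ρ) (hρc : HasCompactSupport ρ)
    (hρ1 : ∫ w, ρ w = 1) (hK : IsCompact K) {F : ℝ → Heis n → ℝ}
    (hF : Integrable (Function.uncurry F) (μ.prod (volume.restrict (heisHull ρ K))))
    {ε : ℕ → ℝ} (hε : ∀ m, ε m ∈ Ioc (0 : ℝ) 1) (hε0 : Tendsto ε atTop (𝓝 0)) :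
    Tendsto (fun m => ∫⁻ z, ‖heisMoll ρ (ε m) (F z.1) z.2 - F z.1 z.2‖ₑ
      ∂(μ.prod (volume.restrict K))) atTop (𝓝 0) := by
  have hFK : Integrable (Function.uncurry F) (μ.prod (volume.restrict K)) :=
    hF.mono_measure (Measure.prod_mono le_rfl (Measure.restrict_mono subset_heisHull le_rfl))
  have hm : ∀ m, AEMeasurable (fun z : ℝ × Heis n =>
      ‖heisMoll ρ (ε m) (F z.1) z.2 - F z.1 z.2‖ₑ) (μ.prod (volume.restrict K)) := fun m =>
    ((integrable_heisMoll hρ hρc hK hF (hε m)).1.sub hFK.1).enorm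
  have h1 : ∀ m, ∫⁻ z, ‖heisMoll ρ (ε m) (F z.1) z.2 - F z.1 z.2‖ₑ
      ∂(μ.prod (volume.restrict K)) = ∫⁻ τ, (∫⁻ p in K, ‖heisMoll ρ (ε m) (F τ) p - F τ p‖ₑ) ∂μ :=
    fun m => lintegral_prod _ (hm m)
  simp only [h1]
  have hR : ∫⁻ w, ‖ρ w‖ₑ ≠ ∞ := (hρ.continuous.integrable_of_hasCompactSupport hρc).2.ne
  have h3 := hF.2
  rw [HasFiniteIntegral, lintegral_prod _ hF.1.enorm] at h3
  have hsec : ∀ᵐ τ ∂μ, IntegrableOn (F τ) (heisHull ρ K) := hF.prod_right_ae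
  rw [← lintegral_zero (μ := μ)]
  refine tendsto_lintegral_of_dominated_convergence'
    (fun τ => ((∫⁻ w, ‖ρ w‖ₑ) + 1) * ∫⁻ p in heisHull ρ K, ‖F τ p‖ₑ)
    (fun m => (hm m).lintegral_prod_right') (fun m => ?_) ?_ ?_
  · filter_upwards [hsec] with τ hτ
    have hτK : IntegrableOn (F τ) K := hτ.mono_set subset_heisHull
    calc _ ≤ ∫⁻ p in K, (‖heisMoll ρ (ε m) (F τ) p‖ₑ + ‖F τ p‖ₑ) :=
          lintegral_mono fun p => enorm_sub_le
      _ = (∫⁻ p in K, ‖heisMoll ρ (ε m) (F τ) p‖ₑ) + ∫⁻ p in K, ‖F τ p‖ₑ :=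
          lintegral_add_right' _ hτK.1.enorm
      _ ≤ _ := by
          rw [add_mul, one_mul]
          exact add_le_add (lintegral_heisMoll_le hρ.continuous hρc hK hτ (hε m))
            (lintegral_mono_set subset_heisHull)
  · rw [lintegral_const_mul' _ _ (ENNReal.add_ne_top.2 ⟨hR, ENNReal.one_ne_top⟩)]
    exact ENNReal.mul_ne_top (ENNReal.add_ne_top.2 ⟨hR, ENNReal.one_ne_top⟩) h3.ne
  · filter_upwards [hsec] with τ hτ
    exact tendsto_lintegral_heisMoll hρ.continuous hρc hρ1 hK hτ hε hε0

end SpaceTime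

/-! ## Data of the transport equation -/

/-- The field `b`, its divergence `D` and the coefficient `c` of the transport equation. -/
structure IsTransportData {n : ℕ} (T : EReal) (s' : ℝ≥0∞) (b : HeisField n)
    (D c : ℝ → Heis n → ℝ) : Prop where
  slice : ∃ (ψ : ℝ → Heis n → ℝ) (g : HorIdx n → ℝ → Heis n → ℝ)
    (H : HorIdx n → HorIdx n → ℝ → Heis n → ℝ), (∀ i j, MemMixed T 1 s' (H i j)) ∧
    ∀ᵐ τ ∂(timeMeasure T), IsContactSlice s' (ψ τ) (fun i => g i τ) (fun i j => H i j τ)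
      (fun i p => b τ p i) (D τ)
  coeff : ∀ i, MemMixed T 1 s' fun τ p => b τ p i
  div : MemMixed T 1 ∞ D
  zeroth : MemMixed T 1 ∞ c

/-- The integral identity that defines distributional solutions. -/
def IsWeakSolution {n : ℕ} (T : EReal) (b : HeisField n) (D c : ℝ → Heis n → ℝ)
    (u₀ : Heis n → ℝ) (u : ℝ → Heis n → ℝ) : Prop :=
  ∀ φ : ℝ × Heis n → ℝ, IsTestFunction T φ →
    -(∫ p, u₀ p * φ (0, p)) +
      ∫ τ in timeInterval T, ∫ p, u τ p *
        (-(fderiv ℝ φ (τ, p) (1, 0))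
          + ∑ i, b τ p i * frameDeriv i (fun q => φ (τ, q)) p
          + (c τ p + D τ p) * φ (τ, p)) = 0

/-! ### Integrability of the products in the transport equation -/

section Integrability

variable {n : ℕ} {T : EReal} {s s' : ℝ≥0∞} {u f : ℝ → Heis n → ℝ} {K : Set (Heis n)}

instance sfinite_timeMeasure (T : EReal) : SFinite (timeMeasure T) := by
  unfold timeMeasure; infer_instance

theorem prod_restrict_le_spaceTimeMeasure (K : Set (Heis n)) :
    (timeMeasure T).prod (volume.restrict K) ≤ spaceTimeMeasure n T :=
  Measure.prod_mono le_rfl Measure.restrict_le_self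

theorem MemMixed.lintegral_lt_top (hf : MemMixed T 1 s f) :
    ∫⁻ τ, eLpNorm (f τ) s volume ∂(timeMeasure T) < ∞ := by
  have := hf.2
  simpa only [eLpNorm_one_eq_lintegral_enorm, enorm_eq_self] using this

theorem MemMixed.ae_memLp (hf : MemMixed T 1 s f) :
    ∀ᵐ τ ∂(timeMeasure T), MemLp (f τ) s volume := by
  have h2 := ae_lt_top' (aemeasurable_eLpNorm_section hf.1 s) hf.lintegral_lt_top.ne
  filter_upwards [hf.1.prodMk_left, h2] with τ h3 h4 using ⟨h3, h4⟩

theorem MemMixedLoc.exists_bound (hu : MemMixedLoc T ∞ s u) (hK : IsCompact K) :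
    ∃ M : ℝ≥0∞, M ≠ ∞ ∧ ∀ᵐ τ ∂(timeMeasure T), eLpNorm (u τ) s (volume.restrict K) ≤ M := by
  refine ⟨_, (hu.2 K hK).ne, ?_⟩
  rw [eLpNorm_exponent_top]
  exact enorm_ae_le_eLpNormEssSup (fun τ => eLpNorm (u τ) s (volume.restrict K)) _

/-- The exceptional set of times must not depend on the compact set; balls of integer radius
suffice. -/
theorem MemMixedLoc.ae_memLpLoc (hu : MemMixedLoc T ∞ s u) :
    ∀ᵐ τ ∂(timeMeasure T), MemLpLoc (u τ) s := by
  choose M hM hb using fun m : ℕ => hu.exists_bound (isCompact_closedBall (0 : Heis n) m)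
  filter_upwards [ae_all_iff.2 hb, hu.1.prodMk_left] with τ h1 h2 K hK
  obtain ⟨r, hr⟩ := hK.isBounded.subset_closedBall (0 : Heis n)
  obtain ⟨m, hm⟩ := exists_nat_ge r
  refine ⟨h2.restrict, ((eLpNorm_mono_measure _ (Measure.restrict_mono
    (hr.trans (Metric.closedBall_subset_closedBall hm)) le_rfl)).trans (h1 m)).trans_lt
      (hM m).lt_top⟩

theorem MemMixedLoc.one (hs : 1 ≤ s) (hu : MemMixedLoc T ∞ s u) : MemMixedLoc T ∞ 1 u := by
  refine ⟨hu.1, fun K hK => ?_⟩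
  obtain ⟨M, hM, hb⟩ := hu.exists_bound hK
  set a : ℝ≥0∞ := volume K ^ (1 / (1 : ℝ≥0∞).toReal - 1 / s.toReal)
  have ha : a ≠ ∞ := by
    refine ENNReal.rpow_ne_top_of_nonneg ?_ hK.measure_lt_top.ne
    rw [ENNReal.toReal_one, div_one, one_div, sub_nonneg]
    by_cases h : s = ∞
    · rw [h]; norm_num
    · have h1 := ENNReal.toReal_mono h hs
      rw [ENNReal.toReal_one] at h1
      exact inv_le_one_of_one_le₀ h1
  rw [eLpNorm_exponent_top]
  refine (essSup_le_of_ae_le (M * a) ?_).trans_lt (ENNReal.mul_lt_top hM.lt_top ha.lt_top)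
  filter_upwards [hb, hu.1.prodMk_left] with τ h1 h2
  rw [enorm_eq_self]
  have h3 := eLpNorm_le_eLpNorm_mul_rpow_measure_univ hs (h2.restrict (s := K))
  rw [Measure.restrict_apply_univ] at h3
  exact h3.trans (mul_le_mul_left h1 a)

theorem MemMixedLoc.integrable_mul [ENNReal.HolderConjugate s s'] (hu : MemMixedLoc T ∞ s u)
    (hf : MemMixed T 1 s' f) (hK : IsCompact K) :
    Integrable (Function.uncurry fun τ p => u τ p * f τ p)
      ((timeMeasure T).prod (volume.restrict K)) := by
  obtain ⟨M, hM, hb⟩ := hu.exists_bound hK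
  refine integrable_prod_of_lintegral ((hu.1.mul hf.1).mono_measure
    (prod_restrict_le_spaceTimeMeasure K)) (ne_top_of_le_ne_top
      (ENNReal.mul_ne_top hM hf.lintegral_lt_top.ne) ?_)
  rw [← lintegral_const_mul' _ _ hM]
  refine lintegral_mono_ae ?_
  filter_upwards [hb, hu.1.prodMk_left, hf.1.prodMk_left] with τ h1 h2 h3
  have h4 : ∫⁻ p in K, ‖u τ p * f τ p‖ₑ ≤ eLpNorm (u τ) s (volume.restrict K) *
      eLpNorm (f τ) s' (volume.restrict K) := lintegral_enorm_mul_le h2.restrict h3.restrict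
  exact h4.trans (mul_le_mul' h1 (eLpNorm_mono_measure (f τ) Measure.restrict_le_self))

theorem MemMixedLoc.integrable (hs : 1 ≤ s) (hu : MemMixedLoc T ∞ s u) (hK : IsCompact K)
    {T₁ : ℝ} (hT : (T₁ : EReal) < T) :
    Integrable (Function.uncurry u) ((volume.restrict (Ioc 0 T₁)).prod (volume.restrict K)) := by
  obtain ⟨M, hM, hb⟩ := (hu.one hs).exists_bound hK
  have hle : volume.restrict (Ioc 0 T₁) ≤ timeMeasure T :=
    Measure.restrict_mono (Ioc_subset_timeInterval hT) le_rfl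
  refine integrable_prod_of_lintegral ((hu.1.mono_measure
    (prod_restrict_le_spaceTimeMeasure K)).mono_measure (Measure.prod_mono hle le_rfl)) ?_
  have hb' : ∀ᵐ τ ∂(volume.restrict (Ioc 0 T₁)), eLpNorm (u τ) 1 (volume.restrict K) ≤ M :=
    ae_mono hle hb
  have h1 : ∫⁻ τ in Ioc 0 T₁, ∫⁻ p in K, ‖u τ p‖ₑ ≤ ∫⁻ _ in Ioc 0 T₁, M :=
    lintegral_mono_ae (hb'.mono fun τ h => by rwa [eLpNorm_one_eq_lintegral_enorm] at h)
  refine ne_top_of_le_ne_top ?_ h1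
  rw [lintegral_const]
  exact ENNReal.mul_ne_top hM (by simp)

end Integrability

/-! ## Mollified solutions -/

/-- The time derivative of the mollified solution, up to sign. -/
def mollRate {n : ℕ} (ρ : Heis n → ℝ) (ε : ℝ) (b : HeisField n) (D c u : ℝ → Heis n → ℝ)
    (τ : ℝ) (p : Heis n) : ℝ :=
  ∫ q, u τ q * (∑ i, b τ q i * frameDeriv i (heisKer ρ ε p) q +
    (c τ q + D τ q) * heisKer ρ ε p q)

theorem isTestFunction_mul {n : ℕ} {T : EReal} {T₁ : ℝ} (hT : (T₁ : EReal) < T) {χ : ℝ → ℝ}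
    {k : Heis n → ℝ} (hχ : ContDiff ℝ (⊤ : ℕ∞) χ) (hχc : HasCompactSupport χ)
    (hχs : tsupport χ ⊆ Iic T₁) (hk : ContDiff ℝ (⊤ : ℕ∞) k) (hkc : HasCompactSupport k) :
    IsTestFunction T fun z : ℝ × Heis n => χ z.1 * k z.2 := by
  have h0 : ∀ z : ℝ × Heis n, z ∉ tsupport χ ×ˢ tsupport k → χ z.1 * k z.2 = 0 := fun z hz => by
    by_cases h : z.1 ∈ tsupport χ
    · rw [image_eq_zero_of_notMem_tsupport fun h' => hz ⟨h, h'⟩, mul_zero]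
    · rw [image_eq_zero_of_notMem_tsupport h, zero_mul]
  refine ⟨(hχ.comp contDiff_fst).mul (hk.comp contDiff_snd),
    HasCompactSupport.intro (hχc.prod hkc) h0, ?_⟩
  have h1 : tsupport (fun z : ℝ × Heis n => χ z.1 * k z.2) ⊆ tsupport χ ×ˢ tsupport k :=
    closure_minimal (fun z hz => by_contra fun h => hz (h0 z h))
      ((isClosed_tsupport _).prod (isClosed_tsupport _))
  exact fun z hz => (EReal.coe_le_coe_iff.2 (hχs (h1 hz).1)).trans_lt hT

theorem frameDeriv_const_mul {n : ℕ} {k : Heis n → ℝ} (hk : Differentiable ℝ k) (a : ℝ)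
    (i : FrameIdx n) (p : Heis n) :
    frameDeriv i (fun q => a * k q) p = a * frameDeriv i k p := by
  rw [frameDeriv, fderiv_const_mul hk.differentiableAt]
  rfl

theorem notMem_heisEnlarge_of_notMem_heisHull {n : ℕ} {ρ : Heis n → ℝ} {K : Set (Heis n)} {ε : ℝ}
    (hε : ε ∈ Ioc (0 : ℝ) 1) {q : Heis n} (hq : q ∉ heisHull ρ K) : q ∉ heisEnlarge ρ ε K := by
  rintro ⟨⟨p, w'⟩, ⟨hp, w, hw, rfl⟩, rfl⟩
  exact hq (mem_heisHull hp hw ⟨hε.1.le, hε.2⟩)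

theorem frameDeriv_heisKer_eq_zero {n : ℕ} {ρ : Heis n → ℝ} (hρ : ContDiff ℝ (⊤ : ℕ∞) ρ)
    {K : Set (Heis n)} {ε : ℝ} (hε : ε ≠ 0) {p q : Heis n} (hp : p ∈ K)
    (hq : q ∉ heisEnlarge ρ ε K) (i : FrameIdx n) : frameDeriv i (heisKer ρ ε p) q = 0 := by
  rw [frameDeriv_heisKer hρ, frameDeriv_eq_zero_of_notMem (fun h => hq
      ⟨(p, heisMul (-p) q), ⟨hp, _, h, heisDil_cancel_inv hε _⟩, by simp⟩)]
  simp

theorem continuous_frameDeriv_heisKer {n : ℕ} {ρ : Heis n → ℝ} (hρ : ContDiff ℝ (⊤ : ℕ∞) ρ)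
    (ε : ℝ) (i : FrameIdx n) :
    Continuous (Function.uncurry fun p q => frameDeriv i (heisKer ρ ε p) q) := by
  have h1 := continuous_frameDeriv (hρ.of_le (by simp) : ContDiff ℝ 1 ρ) i
  have h2 : Continuous fun z : Heis n × Heis n => heisDil ε⁻¹ (heisMul (-z.1) z.2) :=
    (contDiff_heisDil (k := 0) _).continuous.comp
      (continuous_heisMul continuous_fst.neg continuous_snd)
  simp only [Function.uncurry_def, frameDeriv_heisKer hρ]
  fun_prop

theorem integrable_mul_of_hasCompactSupport {n : ℕ} {F k : Heis n → ℝ}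
    (hF : LocallyIntegrable F volume) (hk : Continuous k) (hkc : HasCompactSupport k) :
    Integrable fun q => F q * k q :=
  (hF.integrable_smul_left_of_hasCompactSupport hk hkc).congr
    (.of_forall fun q => by simp [mul_comm])

section Moll

variable {n : ℕ} {T : EReal} {s s' : ℝ≥0∞} {b : HeisField n} {D c u : ℝ → Heis n → ℝ}
  {u₀ : Heis n → ℝ} {ρ : Heis n → ℝ} {ε : ℝ} {T₁ : ℝ} {K : Set (Heis n)}

/-- The products occurring in the transport equation are locally integrable at the time `τ`. -/
def IsRegularTime (b : HeisField n) (D c u : ℝ → Heis n → ℝ) (τ : ℝ) : Prop :=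
  LocallyIntegrable (u τ) volume ∧ (∀ i, LocallyIntegrable (fun q => u τ q * b τ q i) volume) ∧
    LocallyIntegrable (fun q => u τ q * c τ q) volume ∧
    LocallyIntegrable (fun q => u τ q * D τ q) volume

theorem ae_isRegularTime [hss : ENNReal.HolderConjugate s s'] (hd : IsTransportData T s' b D c)
    (hu : MemMixedLoc T ∞ s u) : ∀ᵐ τ ∂(timeMeasure T), IsRegularTime b D c u τ := by
  have h1 : 1 ≤ s := ENNReal.HolderConjugate.one_le s s'
  filter_upwards [hu.ae_memLpLoc, (hu.one h1).ae_memLpLoc,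
    ae_all_iff.2 fun i => (hd.coeff i).ae_memLp, hd.div.ae_memLp, hd.zeroth.ae_memLp]
    with τ h2 h3 h4 h5 h6
  exact ⟨h2.locallyIntegrable h1, fun i => h2.locallyIntegrable_mul (memLpLoc_of_memLp (h4 i)),
    h3.locallyIntegrable_mul (s' := ∞) (memLpLoc_of_memLp h6),
    h3.locallyIntegrable_mul (s' := ∞) (memLpLoc_of_memLp h5)⟩

theorem IsRegularTime.integrable_rate {τ : ℝ} (h : IsRegularTime b D c u τ) {k : Heis n → ℝ}
    (hk : ContDiff ℝ (⊤ : ℕ∞) k) (hkc : HasCompactSupport k) :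
    (∀ i, Integrable fun q => u τ q * b τ q i * frameDeriv i k q) ∧
    Integrable (fun q => u τ q * c τ q * k q) ∧ Integrable (fun q => u τ q * D τ q * k q) ∧
    Integrable fun q => u τ q * k q :=
  ⟨fun i => integrable_mul_of_hasCompactSupport (h.2.1 i)
    (continuous_frameDeriv (hk.of_le (by simp)) i) (hasCompactSupport_frameDeriv hkc i),
    integrable_mul_of_hasCompactSupport h.2.2.1 hk.continuous hkc,
    integrable_mul_of_hasCompactSupport h.2.2.2 hk.continuous hkc,
    integrable_mul_of_hasCompactSupport h.1 hk.continuous hkc⟩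

theorem IsRegularTime.integral_rate {τ : ℝ} (h : IsRegularTime b D c u τ) {k : Heis n → ℝ}
    (hk : ContDiff ℝ (⊤ : ℕ∞) k) (hkc : HasCompactSupport k) :
    Integrable (fun q => u τ q * (∑ i, b τ q i * frameDeriv i k q + (c τ q + D τ q) * k q)) ∧
    ∫ q, u τ q * (∑ i, b τ q i * frameDeriv i k q + (c τ q + D τ q) * k q) =
      (∑ i, ∫ q, u τ q * b τ q i * frameDeriv i k q) + ((∫ q, u τ q * c τ q * k q) +
        ∫ q, u τ q * D τ q * k q) := by
  obtain ⟨h1, h2, h3, -⟩ := h.integrable_rate hk hkc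
  have e : (fun q => u τ q * (∑ i, b τ q i * frameDeriv i k q + (c τ q + D τ q) * k q)) =
      fun q => (∑ i, u τ q * b τ q i * frameDeriv i k q) +
        (u τ q * c τ q * k q + u τ q * D τ q * k q) := by
    funext q
    rw [mul_add, Finset.mul_sum]
    congr 1
    · exact Finset.sum_congr rfl fun i _ => by ring
    · ring
  have i1 : Integrable fun q => ∑ i, u τ q * b τ q i * frameDeriv i k q :=
    integrable_finsetSum _ fun i _ => h1 i
  have i2 : Integrable fun q => u τ q * c τ q * k q + u τ q * D τ q * k q := h2.add h3
  rw [e]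
  exact ⟨i1.add i2, by
    rw [integral_add i1 i2, integral_finsetSum _ fun i _ => h1 i, integral_add h2 h3]⟩

theorem restrict_Ioc_le_timeMeasure (hT : (T₁ : EReal) < T) :
    volume.restrict (Ioc 0 T₁) ≤ timeMeasure T :=
  Measure.restrict_mono (Ioc_subset_timeInterval hT) le_rfl

theorem integrable_slab_of_timeMeasure (hT : (T₁ : EReal) < T) {F : ℝ × Heis n → ℝ}
    (hF : Integrable F ((timeMeasure T).prod (volume.restrict K))) :
    Integrable F ((volume.restrict (Ioc 0 T₁)).prod (volume.restrict K)) :=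
  hF.mono_measure (Measure.prod_mono (restrict_Ioc_le_timeMeasure hT) le_rfl)

variable [hss : ENNReal.HolderConjugate s s']

theorem integrable_slab_mul_coeff (hd : IsTransportData T s' b D c)
    (hu : MemMixedLoc T ∞ s u) (hK : IsCompact K) (hT : (T₁ : EReal) < T) (i : FrameIdx n) :
    Integrable (Function.uncurry fun τ p => u τ p * b τ p i)
      ((volume.restrict (Ioc 0 T₁)).prod (volume.restrict K)) :=
  integrable_slab_of_timeMeasure hT (hu.integrable_mul (hd.coeff i) hK)

theorem integrable_slab_mul_zeroth (hd : IsTransportData T s' b D c)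
    (hu : MemMixedLoc T ∞ s u) (hK : IsCompact K) (hT : (T₁ : EReal) < T) :
    Integrable (Function.uncurry fun τ p => u τ p * c τ p)
      ((volume.restrict (Ioc 0 T₁)).prod (volume.restrict K)) :=
  integrable_slab_of_timeMeasure hT ((hu.one (ENNReal.HolderConjugate.one_le s s')).integrable_mul
    (s' := ∞) hd.zeroth hK)

theorem integrable_slab_mul_div (hd : IsTransportData T s' b D c)
    (hu : MemMixedLoc T ∞ s u) (hK : IsCompact K) (hT : (T₁ : EReal) < T) :
    Integrable (Function.uncurry fun τ p => u τ p * D τ p)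
      ((volume.restrict (Ioc 0 T₁)).prod (volume.restrict K)) :=
  integrable_slab_of_timeMeasure hT ((hu.one (ENNReal.HolderConjugate.one_le s s')).integrable_mul
    (s' := ∞) hd.div hK)

theorem mollRate_eq (hρ : ContDiff ℝ (⊤ : ℕ∞) ρ) (hρc : HasCompactSupport ρ) (hε : ε ≠ 0)
    {τ : ℝ} (h : IsRegularTime b D c u τ) (p : Heis n) :
    mollRate ρ ε b D c u τ p = (∑ i, ∫ q, u τ q * b τ q i * frameDeriv i (heisKer ρ ε p) q) +
      ((∫ q, u τ q * c τ q * heisKer ρ ε p q) + ∫ q, u τ q * D τ q * heisKer ρ ε p q) :=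
  (h.integral_rate (contDiff_heisKer hρ p) (hasCompactSupport_heisKer hρc hε p)).2

theorem integrable_mollRate (hd : IsTransportData T s' b D c) (hu : MemMixedLoc T ∞ s u)
    (hρ : ContDiff ℝ (⊤ : ℕ∞) ρ) (hρc : HasCompactSupport ρ) (hε : ε ∈ Ioc (0 : ℝ) 1)
    (hK : IsCompact K) (hT : (T₁ : EReal) < T) :
    Integrable (Function.uncurry (mollRate ρ ε b D c u))
      ((volume.restrict (Ioc 0 T₁)).prod (volume.restrict K)) := by
  have hh := isCompact_heisHull hρc hK
  have hc := (contDiff_heisKer_uncurry (ε := ε) hρ).continuous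
  have h0 : ∀ p ∈ K, ∀ q ∉ heisHull ρ K, heisKer ρ ε p q = 0 := fun p hp q hq =>
    heisKer_eq_zero hε.1.ne' hp (notMem_heisEnlarge_of_notMem_heisHull hε hq)
  have i1 := fun i => integrable_integral_kernel hK hh (integrable_slab_mul_coeff hd hu hh hT i)
    (continuous_frameDeriv_heisKer hρ ε i) fun p hp q hq => frameDeriv_heisKer_eq_zero hρ hε.1.ne'
      hp (notMem_heisEnlarge_of_notMem_heisHull hε hq) i
  have i2 := integrable_integral_kernel hK hh (integrable_slab_mul_zeroth hd hu hh hT)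
    (k := heisKer ρ ε) hc h0
  have i3 := integrable_integral_kernel hK hh (integrable_slab_mul_div hd hu hh hT)
    (k := heisKer ρ ε) hc h0
  refine ((integrable_finsetSum Finset.univ fun i _ => i1 i).add (i2.add i3)).congr ?_
  have h1 : ∀ᵐ τ ∂(volume.restrict (Ioc 0 T₁)), IsRegularTime b D c u τ :=
    ae_mono (restrict_Ioc_le_timeMeasure hT) (ae_isRegularTime hd hu)
  filter_upwards [(Measure.quasiMeasurePreserving_fst (μ := volume.restrict (Ioc 0 T₁))
    (ν := (volume : Measure (Heis n)).restrict K)).ae h1] with z hz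
  simp only [Function.uncurry_def, Pi.add_apply,
    mollRate_eq hρ hρc hε.1.ne' hz]

theorem integrable_time_mollRate (hd : IsTransportData T s' b D c) (hu : MemMixedLoc T ∞ s u)
    (hρ : ContDiff ℝ (⊤ : ℕ∞) ρ) (hρc : HasCompactSupport ρ) (hε : ε ∈ Ioc (0 : ℝ) 1)
    (hT : (T₁ : EReal) < T) (p : Heis n) :
    Integrable (fun τ => mollRate ρ ε b D c u τ p) (volume.restrict (Ioc 0 T₁)) ∧
    Integrable (fun τ => heisMoll ρ ε (u τ) p) (volume.restrict (Ioc 0 T₁)) := by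
  have hh := isCompact_heisHull hρc (isCompact_singleton (x := p))
  have hk := contDiff_heisKer (ε := ε) hρ p
  have h0 : ∀ q ∉ heisHull ρ {p}, heisKer ρ ε p q = 0 := fun q hq =>
    heisKer_eq_zero hε.1.ne' (mem_singleton p) (notMem_heisEnlarge_of_notMem_heisHull hε hq)
  have i1 := fun i => integrable_time_integral_kernel hh (integrable_slab_mul_coeff hd hu hh hT i)
    (continuous_frameDeriv (hk.of_le (by simp)) i) fun q hq => frameDeriv_heisKer_eq_zero hρ
      hε.1.ne' (mem_singleton p) (notMem_heisEnlarge_of_notMem_heisHull hε hq) i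
  have i2 := integrable_time_integral_kernel hh (integrable_slab_mul_zeroth hd hu hh hT)
    hk.continuous h0
  have i3 := integrable_time_integral_kernel hh (integrable_slab_mul_div hd hu hh hT)
    hk.continuous h0
  have i4 := integrable_time_integral_kernel hh
    (hu.integrable (ENNReal.HolderConjugate.one_le s s') hh hT) hk.continuous h0
  constructor
  · refine ((integrable_finsetSum Finset.univ fun i _ => i1 i).add (i2.add i3)).congr ?_
    have h1 : ∀ᵐ τ ∂(volume.restrict (Ioc 0 T₁)), IsRegularTime b D c u τ :=
      ae_mono (restrict_Ioc_le_timeMeasure hT) (ae_isRegularTime hd hu)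
    filter_upwards [h1] with τ hτ
    simp only [Pi.add_apply, mollRate_eq hρ hρc hε.1.ne' hτ]
  · simpa only [heisMoll_eq_integral_heisKer hε.1.ne'] using i4

/-- With `p` fixed, the products `χ(τ) · heisKer ρ ε p q` are admissible test functions, and the
weak formulation becomes an ordinary differential equation in time for `u_ε(τ, p)`. The exceptional
times depend on `p`, which is harmless because the integral over `τ` is taken first. -/
theorem ae_heisMoll_eq_primitive (hd : IsTransportData T s' b D c) (hu : MemMixedLoc T ∞ s u)
    (hw : IsWeakSolution T b D c u₀ u) (hρ : ContDiff ℝ (⊤ : ℕ∞) ρ) (hρc : HasCompactSupport ρ)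
    (hε : ε ∈ Ioc (0 : ℝ) 1) (h0 : 0 < T₁) (hT : (T₁ : EReal) < T) (p : Heis n) :
    ∀ᵐ τ ∂(volume.restrict (Ioc 0 T₁)), heisMoll ρ ε (u τ) p =
      heisMoll ρ ε u₀ p + ∫ x in (0 : ℝ)..τ, -mollRate ρ ε b D c u x p := by
  obtain ⟨iV, iU⟩ := integrable_time_mollRate hd hu hρ hρc hε hT p
  refine ae_eq_primitive_of_weak h0 hT iU iV fun χ hχ hχc hχs => ?_
  have hk := contDiff_heisKer (ε := ε) hρ p
  have hkc := hasCompactSupport_heisKer hρc hε.1.ne' p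
  have h1 := hw _ (isTestFunction_mul hT hχ hχc hχs hk hkc)
  have hkd : Differentiable ℝ (heisKer ρ ε p) := hk.differentiable (by simp)
  have e1 : ∫ q, u₀ q * (χ 0 * heisKer ρ ε p q) = heisMoll ρ ε u₀ p * χ 0 := by
    rw [heisMoll_eq_integral_heisKer hε.1.ne', ← integral_mul_const]
    exact integral_congr_ae (.of_forall fun q => by simp only; ring)
  have e2 : ∀ τ q, fderiv ℝ (fun z : ℝ × Heis n => χ z.1 * heisKer ρ ε p z.2) (τ, q) (1, 0) =
      deriv χ τ * heisKer ρ ε p q := fun τ q => by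
    have d1 : HasFDerivAt (fun z : ℝ × Heis n => χ z.1)
        ((fderiv ℝ χ τ).comp (ContinuousLinearMap.fst ℝ ℝ (Heis n))) (τ, q) :=
      ((hχ.differentiable (by simp)) τ).hasFDerivAt.comp (τ, q) hasFDerivAt_fst
    have d2 : HasFDerivAt (fun z : ℝ × Heis n => heisKer ρ ε p z.2)
        ((fderiv ℝ (heisKer ρ ε p) q).comp (ContinuousLinearMap.snd ℝ ℝ (Heis n))) (τ, q) :=
      HasFDerivAt.comp (g := heisKer ρ ε p) (f := Prod.snd) (τ, q) (hkd q).hasFDerivAt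
        hasFDerivAt_snd
    rw [(d1.fun_mul d2).fderiv]
    simp [mul_comm]
  refine Eq.trans ?_ h1
  rw [e1]
  congr 1
  refine integral_congr_ae ?_
  filter_upwards [ae_isRegularTime hd hu] with τ hτ
  obtain ⟨i1, -⟩ := hτ.integral_rate hk hkc
  obtain ⟨-, -, -, i2⟩ := hτ.integrable_rate hk hkc
  rw [heisMoll_eq_integral_heisKer hε.1.ne', mollRate, ← integral_const_mul, ← integral_const_mul,
    ← integral_add (i2.const_mul _) (i1.const_mul _)]
  refine integral_congr_ae (.of_forall fun q => ?_)
  simp only [e2, frameDeriv_const_mul hkd]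
  have : ∑ i, b τ q i * (χ τ * frameDeriv i (heisKer ρ ε p) q) =
      χ τ * ∑ i, b τ q i * frameDeriv i (heisKer ρ ε p) q := by
    rw [Finset.mul_sum]; exact Finset.sum_congr rfl fun i _ => by ring
  rw [this]
  ring

end Moll

/-! ## Weights that are absolutely continuous in time -/

/-- Lebesgue measure on `(0, T₁] × K`. -/
abbrev slab {n : ℕ} (T₁ : ℝ) (K : Set (Heis n)) : Measure (ℝ × Heis n) :=
  (volume.restrict (Ioc 0 T₁)).prod (volume.restrict K)

/-- The function `χ(τ) Φ(p, G(τ))` is an admissible weight on `[0, T₁] × K`. -/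
structure IsWeight {n : ℕ} (T₁ : ℝ) (K : Set (Heis n)) (χ χ' G G' : ℝ → ℝ)
    (Φ : Heis n × ℝ → ℝ) : Prop where
  pos : 0 < T₁
  compact : IsCompact K
  time : HasACDeriv T₁ χ χ'
  shift : HasACDeriv T₁ G G'
  final : χ T₁ = 0
  smooth : ContDiff ℝ (⊤ : ℕ∞) Φ
  support : ∀ τ ∈ Icc 0 T₁, ∀ p ∉ K, Φ (p, G τ) = 0

/-- The derivative of `Φ` in the last variable. -/
def shiftDeriv {n : ℕ} (Φ : Heis n × ℝ → ℝ) (z : Heis n × ℝ) : ℝ := fderiv ℝ Φ z (0, 1)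

/-- The derivatives of `Φ` along the frame. -/
def frameDerivFst {n : ℕ} (Φ : Heis n × ℝ → ℝ) (i : FrameIdx n) (z : Heis n × ℝ) : ℝ :=
  fderiv ℝ Φ z (heisZ i z.1, 0)

/-- The time derivative of the weight. -/
def weightRate {n : ℕ} (χ χ' G G' : ℝ → ℝ) (Φ : Heis n × ℝ → ℝ) (τ : ℝ) (p : Heis n) : ℝ :=
  χ' τ * Φ (p, G τ) + χ τ * (shiftDeriv Φ (p, G τ) * G' τ)

section Weight

variable {n : ℕ} {T₁ : ℝ} {K : Set (Heis n)} {χ χ' G G' : ℝ → ℝ} {Φ : Heis n × ℝ → ℝ}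

theorem ae_slab {P : ℝ × Heis n → Prop} (hK : IsCompact K)
    (h : ∀ τ ∈ Ioc 0 T₁, ∀ p ∈ K, P (τ, p)) : ∀ᵐ z ∂(slab T₁ K), P z := by
  rw [slab, Measure.prod_restrict]
  filter_upwards [ae_restrict_mem (measurableSet_Ioc.prod hK.measurableSet)] with z hz
  exact h z.1 hz.1 z.2 hz.2

theorem continuous_shiftDeriv (hΦ : ContDiff ℝ (⊤ : ℕ∞) Φ) : Continuous (shiftDeriv Φ) :=
  (hΦ.continuous_fderiv (by simp)).clm_apply continuous_const

theorem continuous_frameDerivFst (hΦ : ContDiff ℝ (⊤ : ℕ∞) Φ) (i : FrameIdx n) :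
    Continuous (frameDerivFst Φ i) :=
  (hΦ.continuous_fderiv (by simp)).clm_apply
    (((heisZ_continuous i).comp continuous_fst).prodMk continuous_const)

theorem hasDerivAt_shift (hΦ : ContDiff ℝ (⊤ : ℕ∞) Φ) (p : Heis n) (r : ℝ) :
    HasDerivAt (fun r => Φ (p, r)) (shiftDeriv Φ (p, r)) r :=
  ((hΦ.differentiable (by simp)) (p, r)).hasFDerivAt.comp_hasDerivAt r
    ((hasDerivAt_const r p).prodMk (hasDerivAt_id r))

theorem frameDeriv_fst (hΦ : ContDiff ℝ (⊤ : ℕ∞) Φ) (p : Heis n) (r : ℝ) (i : FrameIdx n) :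
    frameDeriv i (fun q => Φ (q, r)) p = frameDerivFst Φ i (p, r) := by
  have h1 : HasFDerivAt (fun q : Heis n => (q, r)) (ContinuousLinearMap.inl ℝ (Heis n) ℝ) p :=
    hasFDerivAt_prodMk_left p r
  have h2 := ((hΦ.differentiable (by simp)) (p, r)).hasFDerivAt.comp p h1
  rw [frameDeriv]
  erw [h2.fderiv]
  simp [frameDerivFst]

theorem HasACDeriv.bounded_slab (hG : HasACDeriv T₁ G G') (h0 : 0 < T₁) (hK : IsCompact K)
    {Ψ : Heis n × ℝ → ℝ} (hΨ : Continuous Ψ) :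
    (∃ C, ∀ τ ∈ Icc 0 T₁, ∀ p ∈ K, ‖Ψ (p, G τ)‖ ≤ C) ∧
      AEStronglyMeasurable (fun z : ℝ × Heis n => Ψ (z.2, G z.1)) (slab T₁ K) := by
  have hc := hG.continuousOn
  rw [uIcc_of_le h0.le] at hc
  constructor
  · obtain ⟨C, hC⟩ := (hK.prod (isCompact_Icc.image_of_continuousOn hc)).exists_bound_of_continuousOn
      hΨ.continuousOn
    exact ⟨C, fun τ hτ p hp => hC (p, G τ) ⟨hp, mem_image_of_mem G hτ⟩⟩
  · have h1 : AEStronglyMeasurable G (volume.restrict (Ioc 0 T₁)) :=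
      (hc.mono Ioc_subset_Icc_self).aestronglyMeasurable measurableSet_Ioc
    have h2 : AEStronglyMeasurable (fun z : ℝ × Heis n => z.2) (slab T₁ K) :=
      measurable_snd.aestronglyMeasurable
    exact hΨ.comp_aestronglyMeasurable (h2.prodMk h1.comp_fst)

theorem HasACDeriv.integrableOn (hG : HasACDeriv T₁ G G') (h0 : 0 < T₁) :
    Integrable G' (volume.restrict (Ioc 0 T₁)) :=
  (intervalIntegrable_iff_integrableOn_Ioc_of_le h0.le).1 hG.intervalIntegrable

theorem integrable_slab_time {f : ℝ → ℝ} (hf : Integrable f (volume.restrict (Ioc 0 T₁)))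
    (hK : IsCompact K) : Integrable (fun z : ℝ × Heis n => f z.1) (slab T₁ K) := by
  have : IsFiniteMeasure ((volume : Measure (Heis n)).restrict K) :=
    ⟨by simpa using hK.measure_lt_top⟩
  simpa using hf.mul_prod (integrable_const (1 : ℝ) (μ := (volume : Measure (Heis n)).restrict K))

theorem IsWeight.bounded (hw : IsWeight T₁ K χ χ' G G' Φ) {Ψ : Heis n × ℝ → ℝ}
    (hΨ : Continuous Ψ) : (∃ C, ∀ τ ∈ Icc 0 T₁, ∀ p ∈ K, ‖χ τ * Ψ (p, G τ)‖ ≤ C) ∧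
      AEStronglyMeasurable (fun z : ℝ × Heis n => χ z.1 * Ψ (z.2, G z.1)) (slab T₁ K) := by
  obtain ⟨⟨C, hC⟩, h1⟩ := hw.shift.bounded_slab hw.pos hw.compact hΨ
  obtain ⟨⟨B, hB⟩, h2⟩ := hw.time.bounded_slab hw.pos hw.compact
    (Ψ := fun z : Heis n × ℝ => z.2) continuous_snd
  refine ⟨⟨B * C, fun τ hτ p hp => ?_⟩, h2.mul h1⟩
  rw [norm_mul]
  exact mul_le_mul (hB τ hτ p hp) (hC τ hτ p hp) (norm_nonneg _)
    ((norm_nonneg _).trans (hB τ hτ p hp))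

/-- Multiplication with the weight preserves integrability. -/
theorem IsWeight.integrable_mul (hw : IsWeight T₁ K χ χ' G G' Φ) {Ψ : Heis n × ℝ → ℝ}
    (hΨ : Continuous Ψ) {F : ℝ × Heis n → ℝ} (hF : Integrable F (slab T₁ K)) :
    Integrable (fun z => χ z.1 * Ψ (z.2, G z.1) * F z) (slab T₁ K) := by
  obtain ⟨⟨C, hC⟩, h1⟩ := hw.bounded hΨ
  exact hF.bdd_mul h1 (c := C) (ae_slab hw.compact fun τ hτ p hp =>
    hC τ (Ioc_subset_Icc_self hτ) p hp)

theorem IsWeight.integrable_rate (hw : IsWeight T₁ K χ χ' G G' Φ) :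
    Integrable (Function.uncurry (weightRate χ χ' G G' Φ)) (slab T₁ K) := by
  obtain ⟨⟨C, hC⟩, h1⟩ := hw.shift.bounded_slab hw.pos hw.compact hw.smooth.continuous
  have i1 : Integrable (fun z : ℝ × Heis n => χ' z.1 * Φ (z.2, G z.1)) (slab T₁ K) :=
    (integrable_slab_time (hw.time.integrableOn hw.pos) hw.compact).mul_bdd (c := C) h1
      (ae_slab hw.compact fun τ hτ p hp => hC τ (Ioc_subset_Icc_self hτ) p hp)
  have i2 := hw.integrable_mul (continuous_shiftDeriv hw.smooth)
    (integrable_slab_time (hw.shift.integrableOn hw.pos) hw.compact)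
  exact (i1.add i2).congr (.of_forall fun z => by
    simp only [Function.uncurry_def, weightRate, Pi.add_apply]; ring)

theorem IsWeight.hasACDeriv (hw : IsWeight T₁ K χ χ' G G' Φ) (p : Heis n) :
    HasACDeriv T₁ (fun τ => χ τ * Φ (p, G τ)) fun τ => weightRate χ χ' G G' Φ τ p := by
  have h1 : ContDiff ℝ 1 fun r : ℝ => Φ (p, r) :=
    (hw.smooth.comp (contDiff_const.prodMk contDiff_id)).of_le (by simp)
  have h2 := hw.time.mul (hw.shift.comp h1)
  simp only [(hasDerivAt_shift hw.smooth p _).deriv] at h2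
  exact h2

theorem IsWeight.frameDerivFst_eq_zero (hw : IsWeight T₁ K χ χ' G G' Φ) {τ : ℝ}
    (hτ : τ ∈ Icc 0 T₁) {p : Heis n} (hp : p ∉ K) (i : FrameIdx n) :
    frameDerivFst Φ i (p, G τ) = 0 := by
  rw [← frameDeriv_fst hw.smooth, frameDeriv]
  have : (fun q => Φ (q, G τ)) =ᶠ[𝓝 p] fun _ => 0 := by
    filter_upwards [hw.compact.isClosed.isOpen_compl.mem_nhds hp] with q hq
    exact hw.support τ hτ q hq
  rw [this.fderiv_eq]
  simp

end Weight

/-! ### Integrated identities for the mollified solution -/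

section Renorm

variable {n : ℕ} {T : EReal} {s s' : ℝ≥0∞} {b : HeisField n} {D c u : ℝ → Heis n → ℝ}
  {u₀ : Heis n → ℝ} {ρ : Heis n → ℝ} {ε : ℝ} {T₁ : ℝ} {K : Set (Heis n)}
  {χ χ' G G' : ℝ → ℝ} {Φ : Heis n × ℝ → ℝ} {β : ℝ → ℝ} {B : ℝ}

theorem Integrable.bounded_comp {F w : ℝ × Heis n → ℝ} {μ : Measure (ℝ × Heis n)}
    {γ : ℝ → ℝ} (hF : Integrable F μ) (hw : AEStronglyMeasurable w μ) (hγ : Continuous γ)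
    (hB : ∀ x, |γ x| ≤ B) : Integrable (fun z => γ (w z) * F z) μ :=
  hF.bdd_mul (hγ.comp_aestronglyMeasurable hw) (.of_forall fun _ => hB _)

variable [hss : ENNReal.HolderConjugate s s']

/-- For fixed `p` both the weight and `β(u_ε)` agree a.e. in time with absolutely continuous
functions, so their product can be integrated over `[0, T₁]`. The boundary term at `T₁` vanishes
because the weight does. -/
theorem integral_weightRate_mul (hd : IsTransportData T s' b D c) (hu : MemMixedLoc T ∞ s u)
    (hsol : IsWeakSolution T b D c u₀ u) (hρ : ContDiff ℝ (⊤ : ℕ∞) ρ) (hρc : HasCompactSupport ρ)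
    (hε : ε ∈ Ioc (0 : ℝ) 1) (hT : (T₁ : EReal) < T) (hw : IsWeight T₁ K χ χ' G G' Φ)
    (hβ : ContDiff ℝ (⊤ : ℕ∞) β) (p : Heis n) :
    ∫ τ in Ioc 0 T₁, (weightRate χ χ' G G' Φ τ p * β (heisMoll ρ ε (u τ) p) -
      χ τ * Φ (p, G τ) * (deriv β (heisMoll ρ ε (u τ) p) * mollRate ρ ε b D c u τ p)) =
      -(χ 0 * Φ (p, G 0) * β (heisMoll ρ ε u₀ p)) := by
  obtain ⟨iV, -⟩ := integrable_time_mollRate hd hu hρ hρc hε hT p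
  have hW := HasACDeriv.of_integral (heisMoll ρ ε u₀ p)
    ((intervalIntegrable_iff_integrableOn_Ioc_of_le hw.pos.le).2 iV.neg)
  have h1 := ((hw.hasACDeriv p).mul (hW.comp (hβ.of_le (by simp)))).integral_eq
  rw [intervalIntegral.integral_of_le hw.pos.le, hw.final] at h1
  simp only [zero_mul, zero_sub, intervalIntegral.integral_same, add_zero] at h1
  rw [← h1]
  refine integral_congr_ae ?_
  filter_upwards [ae_heisMoll_eq_primitive hd hu hsol hρ hρc hε hw.pos hT p] with τ hτ
  simp only [Pi.neg_apply] at *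
  rw [← hτ]
  ring

theorem integrable_weight_mollRate (hd : IsTransportData T s' b D c) (hu : MemMixedLoc T ∞ s u)
    (hρ : ContDiff ℝ (⊤ : ℕ∞) ρ) (hρc : HasCompactSupport ρ)
    (hε : ε ∈ Ioc (0 : ℝ) 1) (hT : (T₁ : EReal) < T) (hw : IsWeight T₁ K χ χ' G G' Φ)
    (hβ : ContDiff ℝ (⊤ : ℕ∞) β) (hB : ∀ x, |β x| ≤ B) (hB' : ∀ x, |deriv β x| ≤ B) :
    Integrable (fun z : ℝ × Heis n =>
      weightRate χ χ' G G' Φ z.1 z.2 * β (heisMoll ρ ε (u z.1) z.2) -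
      χ z.1 * Φ (z.2, G z.1) * (deriv β (heisMoll ρ ε (u z.1) z.2) *
        mollRate ρ ε b D c u z.1 z.2)) (slab T₁ K) := by
  have hs1 := ENNReal.HolderConjugate.one_le s s'
  have mU := (integrable_heisMoll hρ hρc hw.compact
    (hu.integrable hs1 (isCompact_heisHull hρc hw.compact) hT) hε).1
  have iV := integrable_mollRate hd hu hρ hρc hε hw.compact hT
  have i1 := Integrable.bounded_comp (hw.integrable_rate) mU hβ.continuous hB
  have i2 := hw.integrable_mul hw.smooth.continuous
    (Integrable.bounded_comp iV mU (hβ.continuous_deriv (by simp)) hB')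
  exact (i1.sub i2).congr (.of_forall fun z => by
    simp only [Function.uncurry_def, Pi.sub_apply]; ring)

theorem integral_slab_mollRate (hd : IsTransportData T s' b D c) (hu : MemMixedLoc T ∞ s u)
    (hsol : IsWeakSolution T b D c u₀ u) (hρ : ContDiff ℝ (⊤ : ℕ∞) ρ) (hρc : HasCompactSupport ρ)
    (hε : ε ∈ Ioc (0 : ℝ) 1) (hT : (T₁ : EReal) < T) (hw : IsWeight T₁ K χ χ' G G' Φ)
    (hβ : ContDiff ℝ (⊤ : ℕ∞) β) (hB : ∀ x, |β x| ≤ B) (hB' : ∀ x, |deriv β x| ≤ B) :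
    ∫ z, (weightRate χ χ' G G' Φ z.1 z.2 * β (heisMoll ρ ε (u z.1) z.2) -
      χ z.1 * Φ (z.2, G z.1) * (deriv β (heisMoll ρ ε (u z.1) z.2) *
        mollRate ρ ε b D c u z.1 z.2)) ∂(slab T₁ K) =
      -∫ p in K, χ 0 * Φ (p, G 0) * β (heisMoll ρ ε u₀ p) := by
  rw [integral_prod_symm _ (integrable_weight_mollRate hd hu hρ hρc hε hT hw hβ hB hB'),
    ← integral_neg]
  exact integral_congr_ae (.of_forall fun p =>
    integral_weightRate_mul hd hu hsol hρ hρc hε hT hw hβ p)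

/-- The divergence identity for the weight times a function of the mollified solution. -/
theorem integral_div_weight (hw : IsWeight T₁ K χ χ' G G' Φ) {τ : ℝ} (hτ : τ ∈ Icc 0 T₁)
    {ψ : Heis n → ℝ} {g : HorIdx n → Heis n → ℝ} {H : HorIdx n → HorIdx n → Heis n → ℝ}
    {a : FrameIdx n → Heis n → ℝ} {d : Heis n → ℝ}
    (hb : IsContactSlice s' ψ g H a d) (ha : ∀ i, LocallyIntegrable (a i) volume)
    {w : Heis n → ℝ} (hwc : ContDiff ℝ (⊤ : ℕ∞) w) (hβ : ContDiff ℝ (⊤ : ℕ∞) β) :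
    ∫ p in K, (χ τ * Φ (p, G τ) * (deriv β (w p) * ∑ i, a i p * frameDeriv i w p) +
      β (w p) * (∑ i, a i p * (χ τ * frameDerivFst Φ i (p, G τ)) +
        d p * (χ τ * Φ (p, G τ)))) = 0 := by
  have hΦτ : ContDiff ℝ (⊤ : ℕ∞) fun p => Φ (p, G τ) :=
    hw.smooth.comp (contDiff_id.prodMk contDiff_const)
  set φ : Heis n → ℝ := fun p => χ τ * Φ (p, G τ) * β (w p) with hφdef
  have hφ : ContDiff ℝ (⊤ : ℕ∞) φ := (contDiff_const.mul hΦτ).mul (hβ.comp hwc)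
  have hφ0 : ∀ p ∉ K, φ p = 0 := fun p hp => by
    simp only [hφdef, hw.support τ hτ p hp, mul_zero, zero_mul]
  have hφc : HasCompactSupport φ := HasCompactSupport.intro hw.compact hφ0
  have h1 := hb.integral_div φ hφ hφc
  have hder : ∀ i p, frameDeriv i φ p = χ τ * Φ (p, G τ) * (deriv β (w p) * frameDeriv i w p) +
      β (w p) * (χ τ * frameDerivFst Φ i (p, G τ)) := fun i p => by
    have d1 : HasFDerivAt (fun p => χ τ * Φ (p, G τ))
        (χ τ • fderiv ℝ (fun p => Φ (p, G τ)) p) p :=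
      ((hΦτ.differentiable (by simp)) p).hasFDerivAt.const_mul (χ τ)
    have d2 : HasFDerivAt (fun p => β (w p)) (deriv β (w p) • fderiv ℝ w p) p :=
      ((hβ.differentiable (by simp)) (w p)).hasDerivAt.comp_hasFDerivAt p
        ((hwc.differentiable (by simp)) p).hasFDerivAt
    rw [frameDeriv, hφdef, (d1.fun_mul d2).fderiv, ← frameDeriv_fst hw.smooth]
    simp only [add_apply, smul_apply, smul_eq_mul, frameDeriv]
  have i1 : Integrable fun p => ∑ i, a i p * frameDeriv i φ p :=
    integrable_finsetSum _ fun i _ => integrable_mul_of_hasCompactSupport (ha i)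
      (continuous_frameDeriv (hφ.of_le (by simp)) i) (hasCompactSupport_frameDeriv hφc i)
  have i2 : Integrable fun p => φ p * d p :=
    (integrable_mul_of_hasCompactSupport (hb.memLp_div.locallyIntegrable le_top) hφ.continuous
      hφc).congr (.of_forall fun p => by simp only [mul_comm])
  have e : ∀ p, χ τ * Φ (p, G τ) * (deriv β (w p) * ∑ i, a i p * frameDeriv i w p) +
      β (w p) * (∑ i, a i p * (χ τ * frameDerivFst Φ i (p, G τ)) +
        d p * (χ τ * Φ (p, G τ))) = (∑ i, a i p * frameDeriv i φ p) + φ p * d p := fun p => by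
    simp only [hder, mul_add, Finset.sum_add_distrib, Finset.mul_sum]
    rw [← add_assoc, show φ p = χ τ * Φ (p, G τ) * β (w p) from rfl]
    congr 1
    · congr 1 <;> exact Finset.sum_congr rfl fun i _ => by ring
    · ring
  simp only [e]
  rw [setIntegral_eq_integral_of_forall_compl_eq_zero, integral_add i1 i2, h1, neg_add_cancel]
  intro p hp
  simp only [hder, hφ0 p hp, hw.support τ hτ p hp, hw.frameDerivFst_eq_zero hτ hp]
  simp

end Renorm

/-- The kernel of the derivative of the mollification. -/
def heisKerGrad {n : ℕ} (ρ : Heis n → ℝ) (ε : ℝ) (i : FrameIdx n) (p q : Heis n) : ℝ :=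
  (dilJac n ε)⁻¹ * (fun w => -(frameScale ε i * frameDeriv i ρ w +
    ε⁻¹ * rightCorr i w * frameDeriv (Sum.inr ()) ρ w)) (heisDil ε⁻¹ (heisMul (-p) q))

/-! ### The commutator as a function of time and space -/

section Commutator

variable {n : ℕ} {T : EReal} {s s' : ℝ≥0∞} {b : HeisField n} {D c u : ℝ → Heis n → ℝ}
  {u₀ : Heis n → ℝ} {ρ : Heis n → ℝ} {ε : ℝ} {T₁ : ℝ} {K : Set (Heis n)}
  {χ χ' G G' : ℝ → ℝ} {Φ : Heis n × ℝ → ℝ} {β : ℝ → ℝ} {B : ℝ}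

theorem frameDeriv_heisMoll_eq_integral (hρ : ContDiff ℝ (⊤ : ℕ∞) ρ) (hρc : HasCompactSupport ρ)
    (hε : ε ≠ 0) {v : Heis n → ℝ} (hv : LocallyIntegrable v volume) (i : FrameIdx n)
    (p : Heis n) : frameDeriv i (heisMoll ρ ε v) p = ∫ q, v q * heisKerGrad ρ ε i p q := by
  rw [frameDeriv_heisMoll hρ hρc hε hv]
  unfold heisKerGrad
  rw [integral_mul_dil hε p v fun w => -(frameScale ε i * frameDeriv i ρ w +
    ε⁻¹ * rightCorr i w * frameDeriv (Sum.inr ()) ρ w), ← integral_neg]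
  exact integral_congr_ae (.of_forall fun w => by simp only; ring)

theorem continuous_heisKerGrad (hρ : ContDiff ℝ (⊤ : ℕ∞) ρ) (ε : ℝ) (i : FrameIdx n) :
    Continuous (Function.uncurry (heisKerGrad ρ ε i)) := by
  have h1 := fun i => continuous_frameDeriv (hρ.of_le (by simp) : ContDiff ℝ 1 ρ) i
  have h2 : Continuous fun z : Heis n × Heis n => heisDil ε⁻¹ (heisMul (-z.1) z.2) :=
    (contDiff_heisDil (k := 0) _).continuous.comp
      (continuous_heisMul continuous_fst.neg continuous_snd)
  have h3 : Continuous fun w : Heis n => -(frameScale ε i * frameDeriv i ρ w +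
      ε⁻¹ * rightCorr i w * frameDeriv (Sum.inr ()) ρ w) :=
    ((continuous_const.mul (h1 i)).add
      ((continuous_const.mul (continuous_rightCorr i)).mul (h1 _))).neg
  exact continuous_const.mul (h3.comp h2)

theorem heisKerGrad_eq_zero (hε : ε ≠ 0) {p q : Heis n} (hp : p ∈ K)
    (hq : q ∉ heisEnlarge ρ ε K) (i : FrameIdx n) : heisKerGrad ρ ε i p q = 0 := by
  have h : heisDil ε⁻¹ (heisMul (-p) q) ∉ tsupport ρ := fun h =>
    hq ⟨(p, heisMul (-p) q), ⟨hp, _, h, heisDil_cancel_inv hε _⟩, by simp⟩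
  simp [heisKerGrad, frameDeriv_eq_zero_of_notMem h]

theorem memMixedLoc_one : MemMixedLoc T ∞ s fun _ (_ : Heis n) => (1 : ℝ) := by
  refine ⟨aestronglyMeasurable_const, fun K hK => ?_⟩
  have : IsFiniteMeasure ((volume : Measure (Heis n)).restrict K) :=
    ⟨by simpa using hK.measure_lt_top⟩
  have h : MemLp (fun _ : Heis n => (1 : ℝ)) s (volume.restrict K) := memLp_const 1
  rw [eLpNorm_exponent_top]
  exact (essSup_le_of_ae_le _ (.of_forall fun _ => le_rfl)).trans_lt (by simpa using h.2)

/-- The commutator at the time `τ`. -/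
abbrev commAt (ρ : Heis n → ℝ) (ε : ℝ) (b : HeisField n) (D u : ℝ → Heis n → ℝ) (τ : ℝ)
    (p : Heis n) : ℝ :=
  heisComm ρ ε (fun i p => b τ p i) (D τ) (u τ) p

theorem integrable_slab_coeff (s : ℝ≥0∞) [ENNReal.HolderConjugate s s']
    (hd : IsTransportData T s' b D c) (hK : IsCompact K) (hT : (T₁ : EReal) < T)
    (i : FrameIdx n) : Integrable (fun z : ℝ × Heis n => b z.1 z.2 i) (slab T₁ K) := by
  have := integrable_slab_mul_coeff (s := s) hd memMixedLoc_one hK hT i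
  simp only [one_mul] at this
  exact this

theorem integrable_slab_of_memMixed_top {f : ℝ → Heis n → ℝ} (hf : MemMixed T 1 ∞ f)
    (hK : IsCompact K) (hT : (T₁ : EReal) < T) :
    Integrable (fun z : ℝ × Heis n => f z.1 z.2) (slab T₁ K) := by
  have := integrable_slab_of_timeMeasure hT
    (MemMixedLoc.integrable_mul (s := 1) (s' := ∞) memMixedLoc_one hf hK)
  simp only [one_mul] at this
  exact this

variable [hss : ENNReal.HolderConjugate s s']

/-- This is the mollified equation: `u_ε` solves the transport equation classically in space, with
the commutator and the mollification of `u c` as source terms. -/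
theorem mollRate_eq_commAt (hρ : ContDiff ℝ (⊤ : ℕ∞) ρ) (hρc : HasCompactSupport ρ) (hε : ε ≠ 0)
    {τ : ℝ} (h : IsRegularTime b D c u τ) (p : Heis n) :
    mollRate ρ ε b D c u τ p = commAt ρ ε b D u τ p -
      ∑ i, b τ p i * frameDeriv i (heisMoll ρ ε (u τ)) p +
        heisMoll ρ ε (fun q => u τ q * c τ q) p := by
  obtain ⟨h1, h2, h3, -⟩ := h.integrable_rate (contDiff_heisKer (ε := ε) hρ p)
    (hasCompactSupport_heisKer hρc hε p)
  rw [mollRate_eq hρ hρc hε h, commAt, heisComm, heisMoll_eq_integral_heisKer hε]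
  have e : ∫ q, u τ q * (∑ i, b τ q i * frameDeriv i (heisKer ρ ε p) q + D τ q * heisKer ρ ε p q) =
      (∑ i, ∫ q, u τ q * b τ q i * frameDeriv i (heisKer ρ ε p) q) +
        ∫ q, u τ q * D τ q * heisKer ρ ε p q := by
    rw [← integral_finsetSum _ fun i _ => h1 i,
      ← integral_add (integrable_finsetSum _ fun i _ => h1 i) h3]
    refine integral_congr_ae (.of_forall fun q => ?_)
    simp only [mul_add, Finset.mul_sum, mul_assoc]
  rw [e]
  ring

theorem ae_slab_of_time {P : ℝ → Prop} (h : ∀ᵐ τ ∂(volume.restrict (Ioc 0 T₁)), P τ) :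
    ∀ᵐ z ∂(slab T₁ K), P z.1 :=
  (Measure.quasiMeasurePreserving_fst (μ := volume.restrict (Ioc 0 T₁))
    (ν := (volume : Measure (Heis n)).restrict K)).ae h

theorem ae_isRegularTime_Ioc (hd : IsTransportData T s' b D c) (hu : MemMixedLoc T ∞ s u)
    (hT : (T₁ : EReal) < T) :
    ∀ᵐ τ ∂(volume.restrict (Ioc 0 T₁)), IsRegularTime b D c u τ :=
  ae_mono (restrict_Ioc_le_timeMeasure hT) (ae_isRegularTime hd hu)

theorem aestronglyMeasurable_commAt (hd : IsTransportData T s' b D c) (hu : MemMixedLoc T ∞ s u)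
    (hρ : ContDiff ℝ (⊤ : ℕ∞) ρ) (hρc : HasCompactSupport ρ) (hε : ε ∈ Ioc (0 : ℝ) 1)
    (hK : IsCompact K) (hT : (T₁ : EReal) < T) :
    AEStronglyMeasurable (Function.uncurry (commAt ρ ε b D u)) (slab T₁ K) := by
  have hs1 := ENNReal.HolderConjugate.one_le s s'
  have hh := isCompact_heisHull hρc hK
  have m1 := (integrable_mollRate hd hu hρ hρc hε hK hT).1
  have m2 := (integrable_heisMoll hρ hρc hK (integrable_slab_mul_zeroth hd hu hh hT) hε).1
  have m3 := fun i => (integrable_integral_kernel hK hh (hu.integrable hs1 hh hT)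
    (continuous_heisKerGrad hρ ε i) fun p hp q hq =>
      heisKerGrad_eq_zero hε.1.ne' hp (notMem_heisEnlarge_of_notMem_heisHull hε hq) i).1
  have m4 := fun i => (integrable_slab_coeff s hd hK hT i).1
  refine ((m1.add (Finset.aestronglyMeasurable_fun_sum Finset.univ fun i _ =>
    (m4 i).mul (m3 i))).sub m2).congr ?_
  filter_upwards [ae_slab_of_time (ae_isRegularTime_Ioc hd hu hT)] with z hz
  simp only [Function.uncurry_def, Pi.add_apply, Pi.sub_apply, Pi.mul_apply,
    mollRate_eq_commAt hρ hρc hε.1.ne' hz, frameDeriv_heisMoll_eq_integral hρ hρc hε.1.ne' hz.1]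
  ring

/-- The uniform bound at a fixed time, multiplied by the essential bound of `u`, is integrable in
time because the second derivatives and the divergence lie in `L¹` in time. One null set of times
serves all scales. -/
theorem exists_commAt_bound (hn : 1 ≤ n) (hd : IsTransportData T s' b D c)
    (hu : MemMixedLoc T ∞ s u) (hρ : ContDiff ℝ (⊤ : ℕ∞) ρ) (hρc : HasCompactSupport ρ)
    (hK : IsCompact K) (hT : (T₁ : EReal) < T) :
    ∃ m : ℝ → ℝ≥0∞, ∫⁻ τ in Ioc 0 T₁, m τ ≠ ∞ ∧ ∀ᵐ τ ∂(volume.restrict (Ioc 0 T₁)),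
      ∀ ε ∈ Ioc (0 : ℝ) 1, ∫⁻ p in K, ‖commAt ρ ε b D u τ p‖ₑ ≤ m τ := by
  obtain ⟨C, hC, hCb⟩ := exists_lintegral_heisComm_le s s' hn hρ hρc hK
  obtain ⟨ψ, g, H, hH, hslice⟩ := hd.slice
  obtain ⟨M, hM, hMb⟩ := hu.exists_bound (isCompact_heisHull hρc hK)
  have hle := restrict_Ioc_le_timeMeasure hT
  have hm := fun k j => aemeasurable_eLpNorm_section (hH k j).1 s'
  refine ⟨fun τ => C * (M * ((∑ k, ∑ j, eLpNorm (H k j τ) s' volume) + eLpNorm (D τ) ∞ volume)),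
    ?_, ?_⟩
  · refine ne_top_of_le_ne_top ?_ (lintegral_mono' hle le_rfl)
    rw [lintegral_const_mul' _ _ hC, lintegral_const_mul' _ _ hM,
      lintegral_add_left' (Finset.aemeasurable_fun_sum _ fun k _ =>
        Finset.aemeasurable_fun_sum _ fun j _ => hm k j),
      lintegral_finsetSum' _ fun k _ => Finset.aemeasurable_fun_sum _ fun j _ => hm k j]
    refine ENNReal.mul_ne_top hC (ENNReal.mul_ne_top hM (ENNReal.add_ne_top.2
      ⟨ENNReal.sum_ne_top.2 fun k _ => ?_, hd.div.lintegral_lt_top.ne⟩))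
    rw [lintegral_finsetSum' _ fun j _ => hm k j]
    exact ENNReal.sum_ne_top.2 fun j _ => (hH k j).lintegral_lt_top.ne
  · refine ae_mono hle ?_
    filter_upwards [hslice, hMb, hu.ae_memLpLoc] with τ h1 h2 h3 ε hε
    refine (hCb _ _ _ _ _ _ h1 h3 ε hε).trans ?_
    gcongr

theorem integrable_commAt (hn : 1 ≤ n) (hd : IsTransportData T s' b D c)
    (hu : MemMixedLoc T ∞ s u) (hρ : ContDiff ℝ (⊤ : ℕ∞) ρ) (hρc : HasCompactSupport ρ)
    (hε : ε ∈ Ioc (0 : ℝ) 1) (hK : IsCompact K) (hT : (T₁ : EReal) < T) :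
    Integrable (Function.uncurry (commAt ρ ε b D u)) (slab T₁ K) := by
  obtain ⟨m, hm, hb⟩ := exists_commAt_bound hn hd hu hρ hρc hK hT
  refine integrable_prod_of_lintegral (aestronglyMeasurable_commAt hd hu hρ hρc hε hK hT)
    (ne_top_of_le_ne_top hm (lintegral_mono_ae ?_))
  filter_upwards [hb] with τ hτ using hτ ε hε

theorem tendsto_lintegral_commAt (hn : 1 ≤ n) (hd : IsTransportData T s' b D c)
    (hu : MemMixedLoc T ∞ s u) (hρ : ContDiff ℝ (⊤ : ℕ∞) ρ) (hρc : HasCompactSupport ρ)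
    (hK : IsCompact K) (hT : (T₁ : EReal) < T) {ε : ℕ → ℝ} (hε : ∀ k, ε k ∈ Ioc (0 : ℝ) 1)
    (hε0 : Tendsto ε atTop (𝓝 0)) :
    Tendsto (fun m => ∫⁻ z, ‖commAt ρ (ε m) b D u z.1 z.2‖ₑ ∂(slab T₁ K)) atTop (𝓝 0) := by
  obtain ⟨m, hm, hb⟩ := exists_commAt_bound hn hd hu hρ hρc hK hT
  obtain ⟨ψ, g, H, -, hslice⟩ := hd.slice
  have hmeas := fun k => (aestronglyMeasurable_commAt hd hu hρ hρc (hε k) hK hT).enorm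
  have h1 : ∀ k, ∫⁻ z, ‖commAt ρ (ε k) b D u z.1 z.2‖ₑ ∂(slab T₁ K) =
      ∫⁻ τ in Ioc 0 T₁, (∫⁻ p in K, ‖commAt ρ (ε k) b D u τ p‖ₑ) :=
    fun k => lintegral_prod _ (hmeas k)
  simp only [h1]
  rw [← lintegral_zero (μ := volume.restrict (Ioc 0 T₁))]
  refine tendsto_lintegral_of_dominated_convergence' m
    (fun k => (hmeas k).lintegral_prod_right')
    (fun k => hb.mono fun τ hτ => hτ _ (hε k)) hm ?_
  have hle := restrict_Ioc_le_timeMeasure hT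
  refine ae_mono hle ?_
  filter_upwards [hslice, hu.ae_memLpLoc] with τ h2 h3
  exact tendsto_lintegral_heisComm_zero hn hρ hρc h2 h3 hK hε hε0

end Commutator

/-! ## Renormalization -/

/-- The transport operator applied to a weight, without the zeroth order term. -/
def weightTransport {n : ℕ} (b : HeisField n) (D : ℝ → Heis n → ℝ) (χ χ' G G' : ℝ → ℝ)
    (Φ : Heis n × ℝ → ℝ) (τ : ℝ) (p : Heis n) : ℝ :=
  weightRate χ χ' G G' Φ τ p - (∑ i, b τ p i * (χ τ * frameDerivFst Φ i (p, G τ)) +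
    D τ p * (χ τ * Φ (p, G τ)))

section Limit

variable {α : Type*} [MeasurableSpace α] {μ : Measure α}

theorem tendsto_integral_bounded_mul_zero {g F : ℕ → α → ℝ} {C : ℝ}
    (hg : ∀ k, AEStronglyMeasurable (g k) μ) (hgb : ∀ k, ∀ᵐ x ∂μ, ‖g k x‖ ≤ C)
    (hF : ∀ k, Integrable (F k) μ) (hF0 : Tendsto (fun k => ∫⁻ x, ‖F k x‖ₑ ∂μ) atTop (𝓝 0)) :
    Tendsto (fun k => ∫ x, g k x * F k x ∂μ) atTop (𝓝 0) := by
  have h1 : Tendsto (fun k => ENNReal.ofReal C * ∫⁻ x, ‖F k x‖ₑ ∂μ) atTop (𝓝 0) := by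
    simpa using ENNReal.Tendsto.const_mul hF0 (.inr (ENNReal.ofReal_ne_top (r := C)))
  have h2 := tendsto_integral_of_L1 (fun _ : α => (0 : ℝ)) aestronglyMeasurable_const
    (.of_forall fun k => (hF k).bdd_mul (hg k) (hgb k))
    (tendsto_of_tendsto_of_tendsto_of_le_of_le tendsto_const_nhds h1 (fun _ => zero_le)
      fun k => ?_)
  · simpa using h2
  · simp only [sub_zero]
    rw [← lintegral_const_mul' _ _ ENNReal.ofReal_ne_top]
    refine lintegral_mono_ae ((hgb k).mono fun x hx => ?_)
    rw [enorm_mul, ← ofReal_norm (g k x)]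
    gcongr

theorem integral_sub_add_add {f g h k : α → ℝ} (hf : Integrable f μ) (hg : Integrable g μ)
    (hh : Integrable h μ) (hk : Integrable k μ) :
    ∫ x, f x ∂μ - (∫ x, g x ∂μ + (∫ x, h x ∂μ + ∫ x, k x ∂μ)) =
      ∫ x, (f x - (g x + (h x + k x))) ∂μ := by
  have h1 : Integrable (fun x => h x + k x) μ := hh.add hk
  have h2 : Integrable (fun x => g x + (h x + k x)) μ := hg.add h1
  rw [integral_sub hf h2, integral_add hg h1, integral_add hh hk]

end Limit

section Renorm

variable {n : ℕ} {T : EReal} {s s' : ℝ≥0∞} {b : HeisField n} {D c u : ℝ → Heis n → ℝ}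
  {u₀ : Heis n → ℝ} {ρ : Heis n → ℝ} {ε : ℝ} {T₁ : ℝ} {K : Set (Heis n)}
  {χ χ' G G' : ℝ → ℝ} {Φ : Heis n × ℝ → ℝ} {β : ℝ → ℝ} {B : ℝ}

theorem IsWeight.integrable_transport (s : ℝ≥0∞) [hss : ENNReal.HolderConjugate s s']
    (hw : IsWeight T₁ K χ χ' G G' Φ)
    (hd : IsTransportData T s' b D c) (hT : (T₁ : EReal) < T) :
    Integrable (fun z : ℝ × Heis n => weightTransport b D χ χ' G G' Φ z.1 z.2) (slab T₁ K) := by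
  have i1 := fun i => hw.integrable_mul (continuous_frameDerivFst hw.smooth i)
    (integrable_slab_coeff s hd hw.compact hT i)
  have i2 := hw.integrable_mul hw.smooth.continuous
    (integrable_slab_of_memMixed_top hd.div hw.compact hT)
  refine (hw.integrable_rate.sub
    ((integrable_finsetSum Finset.univ fun i _ => i1 i).add i2)).congr (.of_forall fun z => ?_)
  simp only [Function.uncurry_def, Pi.sub_apply, Pi.add_apply, weightTransport]
  congr 2
  · exact Finset.sum_congr rfl fun i _ => by ring
  · ring

variable [hss : ENNReal.HolderConjugate s s']

/-- At almost every time the term `β'(u_ε) b·∇u_ε`, multiplied by the weight, is integrated by parts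
with the smooth function `weight · β(u_ε)` tested against the divergence of `b`. No derivative of
`u_ε` remains, so `ε → 0` is possible. -/
theorem integral_slab_commAt (hn : 1 ≤ n) (hd : IsTransportData T s' b D c)
    (hu : MemMixedLoc T ∞ s u) (hsol : IsWeakSolution T b D c u₀ u)
    (hρ : ContDiff ℝ (⊤ : ℕ∞) ρ) (hρc : HasCompactSupport ρ)
    (hε : ε ∈ Ioc (0 : ℝ) 1) (hT : (T₁ : EReal) < T) (hw : IsWeight T₁ K χ χ' G G' Φ)
    (hβ : ContDiff ℝ (⊤ : ℕ∞) β) (hB : ∀ x, |β x| ≤ B) (hB' : ∀ x, |deriv β x| ≤ B) :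
    ∫ z, (β (heisMoll ρ ε (u z.1) z.2) * weightTransport b D χ χ' G G' Φ z.1 z.2 -
      χ z.1 * Φ (z.2, G z.1) * deriv β (heisMoll ρ ε (u z.1) z.2) * (commAt ρ ε b D u z.1 z.2 +
        heisMoll ρ ε (fun q => u z.1 q * c z.1 q) z.2)) ∂(slab T₁ K) =
      -∫ p in K, χ 0 * Φ (p, G 0) * β (heisMoll ρ ε u₀ p) := by
  have hs1 := ENNReal.HolderConjugate.one_le s s'
  have hh := isCompact_heisHull hρc hw.compact
  have mU := (integrable_heisMoll hρ hρc hw.compact (hu.integrable hs1 hh hT) hε).1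
  rw [← integral_slab_mollRate hd hu hsol hρ hρc hε hT hw hβ hB hB']
  have I1 := integrable_weight_mollRate hd hu hρ hρc hε hT hw hβ hB hB'
  have I2 : Integrable (fun z : ℝ × Heis n => β (heisMoll ρ ε (u z.1) z.2) *
      weightTransport b D χ χ' G G' Φ z.1 z.2 -
      χ z.1 * Φ (z.2, G z.1) * deriv β (heisMoll ρ ε (u z.1) z.2) * (commAt ρ ε b D u z.1 z.2 +
        heisMoll ρ ε (fun q => u z.1 q * c z.1 q) z.2)) (slab T₁ K) := by
    have i1 := Integrable.bounded_comp (hw.integrable_transport s hd hT) mU hβ.continuous hB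
    have i2 := hw.integrable_mul hw.smooth.continuous (Integrable.bounded_comp
      ((integrable_commAt hn hd hu hρ hρc hε hw.compact hT).add
        (integrable_heisMoll hρ hρc hw.compact (integrable_slab_mul_zeroth hd hu hh hT) hε)) mU
          (hβ.continuous_deriv (by simp)) hB')
    refine (i1.sub i2).congr (.of_forall fun z => ?_)
    simp only [Function.uncurry_def, Pi.sub_apply, Pi.add_apply]
    ring
  rw [← sub_eq_zero, ← integral_sub I2 I1]
  refine (integral_prod _ (I2.sub I1)).trans ?_
  obtain ⟨ψ, g, H, -, hslice⟩ := hd.slice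
  have hle := restrict_Ioc_le_timeMeasure hT
  have hs1' : 1 ≤ s' := by
    have : ENNReal.HolderConjugate s' s := ENNReal.HolderConjugate.symm
    exact ENNReal.HolderConjugate.one_le s' s
  refine (integral_congr_ae ?_).trans (integral_zero _ _)
  filter_upwards [ae_mono hle hslice, ae_isRegularTime_Ioc hd hu hT,
    ae_restrict_mem measurableSet_Ioc] with τ h1 h2 h3
  have h4 := integral_div_weight hw (Ioc_subset_Icc_self h3) h1
    (fun i => (h1.memLp_coeff i).locallyIntegrable hs1') (contDiff_heisMoll hρ hρc hε.1.ne' h2.1) hβ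
  rw [← neg_eq_zero, ← integral_neg] at h4
  rw [← h4]
  refine integral_congr_ae (.of_forall fun p => ?_)
  simp only [Pi.sub_apply, mollRate_eq_commAt hρ hρc hε.1.ne' h2, weightTransport]
  ring

/-- Solutions are renormalized. -/
theorem renormalized (hn : 1 ≤ n) (hd : IsTransportData T s' b D c)
    (hu : MemMixedLoc T ∞ s u) (hu₀ : MemLpLoc u₀ s) (hsol : IsWeakSolution T b D c u₀ u)
    (hT : (T₁ : EReal) < T) (hw : IsWeight T₁ K χ χ' G G' Φ)
    (hβ : ContDiff ℝ (⊤ : ℕ∞) β) (hB : ∀ x, |β x| ≤ B) (hB' : ∀ x, |deriv β x| ≤ B) :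
    Integrable (fun z : ℝ × Heis n => β (u z.1 z.2) * weightTransport b D χ χ' G G' Φ z.1 z.2)
      (slab T₁ K) ∧
    Integrable (fun z : ℝ × Heis n => χ z.1 * Φ (z.2, G z.1) * deriv β (u z.1 z.2) *
      (u z.1 z.2 * c z.1 z.2)) (slab T₁ K) ∧
    (∫ z, β (u z.1 z.2) * weightTransport b D χ χ' G G' Φ z.1 z.2 ∂(slab T₁ K)) -
      (∫ z, χ z.1 * Φ (z.2, G z.1) * deriv β (u z.1 z.2) * (u z.1 z.2 * c z.1 z.2)
        ∂(slab T₁ K)) = -∫ p in K, χ 0 * Φ (p, G 0) * β (u₀ p) := by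
  have hs1 := ENNReal.HolderConjugate.one_le s s'
  have hK := hw.compact
  have hβ' : Continuous (deriv β) := hβ.continuous_deriv (by simp)
  -- a mollifier
  let κ : ContDiffBump (0 : Heis n) := ⟨1, 2, one_pos, one_lt_two⟩
  set ρ : Heis n → ℝ := κ.normed volume with hρdef
  have hρ : ContDiff ℝ (⊤ : ℕ∞) ρ := κ.contDiff_normed
  have hρc : HasCompactSupport ρ := κ.hasCompactSupport_normed
  have hρ1 : ∫ w, ρ w = 1 := κ.integral_normed
  have hh := isCompact_heisHull hρc hK
  have iu := hu.integrable hs1 hh hT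
  have iuK := hu.integrable hs1 hK hT
  have iuc := integrable_slab_mul_zeroth hd hu hh hT
  have iucK := integrable_slab_mul_zeroth hd hu hK hT
  -- a sequence of scales
  let ε₀ : ℕ → ℝ := fun m => 1 / ((m : ℝ) + 1)
  have hε₀ : ∀ m, ε₀ m ∈ Ioc (0 : ℝ) 1 := fun m =>
    ⟨by positivity, by
      have : (0 : ℝ) ≤ m := m.cast_nonneg
      exact (div_le_one (by positivity)).2 (by linarith)⟩
  have hε₀0 : Tendsto ε₀ atTop (𝓝 0) := tendsto_one_div_add_atTop_nhds_zero_nat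
  have mU₀ : ∀ m, AEStronglyMeasurable (fun z : ℝ × Heis n => heisMoll ρ (ε₀ m) (u z.1) z.2)
      (slab T₁ K) := fun m => (integrable_heisMoll hρ hρc hK iu (hε₀ m)).1
  -- Nonlinear functions of `u_ε` require convergence a.e., which `L¹` convergence provides along a
  -- subsequence; a further subsequence is taken for the initial values. The source terms need only
  -- convergence in `L¹`.
  have t1 : TendstoInMeasure (slab T₁ K) (fun m (z : ℝ × Heis n) =>
      heisMoll ρ (ε₀ m) (u z.1) z.2) atTop fun z => u z.1 z.2 := by
    refine tendstoInMeasure_of_tendsto_eLpNorm one_ne_zero mU₀ iuK.1 ?_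
    simp only [eLpNorm_one_eq_lintegral_enorm]
    exact tendsto_lintegral_heisMoll_prod hρ hρc hρ1 hK iu hε₀ hε₀0
  obtain ⟨ns, hns, hns'⟩ := t1.exists_seq_tendsto_ae
  have hu₀l := hu₀.locallyIntegrable hs1
  have mV₀ : ∀ m, Continuous (heisMoll ρ (ε₀ m) u₀) := fun m =>
    (contDiff_heisMoll hρ hρc (hε₀ m).1.ne' hu₀l).continuous
  have t2 : TendstoInMeasure (volume.restrict K) (fun m => heisMoll ρ (ε₀ (ns m)) u₀) atTop u₀ := by
    refine tendstoInMeasure_of_tendsto_eLpNorm one_ne_zero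
      (fun m => (mV₀ _).aestronglyMeasurable) hu₀l.aestronglyMeasurable.restrict ?_
    simp only [eLpNorm_one_eq_lintegral_enorm]
    exact tendsto_lintegral_heisMoll hρ.continuous hρc hρ1 hK (hu₀l.integrableOn_isCompact hh)
      (fun m => hε₀ _) (hε₀0.comp hns.tendsto_atTop)
  obtain ⟨ms, hms, hms'⟩ := t2.exists_seq_tendsto_ae
  let ε : ℕ → ℝ := fun k => ε₀ (ns (ms k))
  have hε : ∀ k, ε k ∈ Ioc (0 : ℝ) 1 := fun k => hε₀ _
  have hε0 : Tendsto ε atTop (𝓝 0) := hε₀0.comp (hns.tendsto_atTop.comp hms.tendsto_atTop)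
  have mU : ∀ k, AEStronglyMeasurable (fun z : ℝ × Heis n => heisMoll ρ (ε k) (u z.1) z.2)
      (slab T₁ K) := fun k => mU₀ _
  have hae : ∀ᵐ z ∂(slab T₁ K), Tendsto (fun k => heisMoll ρ (ε k) (u z.1) z.2) atTop
      (𝓝 (u z.1 z.2)) := hns'.mono fun z hz => hz.comp hms.tendsto_atTop
  have iW := hw.integrable_transport s hd hT
  obtain ⟨⟨C, hC⟩, mΦ⟩ := hw.bounded hw.smooth.continuous
  have hCs : ∀ᵐ z ∂(slab T₁ K), ‖χ z.1 * Φ (z.2, G z.1)‖ ≤ C := ae_slab hK fun τ hτ p hp =>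
    hC τ (Ioc_subset_Icc_self hτ) p hp
  have J1 := Integrable.bounded_comp iW iuK.1 hβ.continuous hB
  have J2 : Integrable (fun z : ℝ × Heis n => χ z.1 * Φ (z.2, G z.1) * deriv β (u z.1 z.2) *
      (u z.1 z.2 * c z.1 z.2)) (slab T₁ K) :=
    (hw.integrable_mul hw.smooth.continuous (Integrable.bounded_comp iucK iuK.1 hβ' hB')).congr
      (.of_forall fun z => by simp only [Function.uncurry_def]; ring)
  refine ⟨J1, J2, ?_⟩
  -- the four limits
  have L1 : Tendsto (fun k => ∫ z, β (heisMoll ρ (ε k) (u z.1) z.2) *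
      weightTransport b D χ χ' G G' Φ z.1 z.2 ∂(slab T₁ K)) atTop
      (𝓝 (∫ z, β (u z.1 z.2) * weightTransport b D χ χ' G G' Φ z.1 z.2 ∂(slab T₁ K))) := by
    refine tendsto_integral_of_dominated_convergence
      (fun z => B * ‖weightTransport b D χ χ' G G' Φ z.1 z.2‖)
      (fun k => (Integrable.bounded_comp iW (mU k) hβ.continuous hB).1)
      (iW.norm.const_mul B) (fun k => .of_forall fun z => ?_) (hae.mono fun z hz =>
        ((hβ.continuous.tendsto _).comp hz).mul_const _)
    rw [norm_mul]
    exact mul_le_mul_of_nonneg_right (hB _) (norm_nonneg _)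
  have mg : ∀ k, AEStronglyMeasurable (fun z : ℝ × Heis n => χ z.1 * Φ (z.2, G z.1) *
      deriv β (heisMoll ρ (ε k) (u z.1) z.2)) (slab T₁ K) := fun k =>
    mΦ.mul (hβ'.comp_aestronglyMeasurable (mU k))
  have hB0 : 0 ≤ B := (abs_nonneg _).trans (hB 0)
  have bg : ∀ k, ∀ᵐ z ∂(slab T₁ K), ‖χ z.1 * Φ (z.2, G z.1) *
      deriv β (heisMoll ρ (ε k) (u z.1) z.2)‖ ≤ C * B := fun k => hCs.mono fun z hz => by
    rw [norm_mul]
    exact mul_le_mul hz (hB' _) (norm_nonneg _) ((norm_nonneg _).trans hz)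
  have iR := fun k => integrable_commAt hn hd hu hρ hρc (hε k) hK hT
  have iM := fun k => integrable_heisMoll hρ hρc hK iuc (hε k)
  have L2 := tendsto_integral_bounded_mul_zero mg bg iR
    (tendsto_lintegral_commAt hn hd hu hρ hρc hK hT hε hε0)
  have L3 := tendsto_integral_bounded_mul_zero mg bg (fun k => (iM k).sub iucK)
    (tendsto_lintegral_heisMoll_prod hρ hρc hρ1 hK iuc hε hε0)
  have iG : ∀ k, Integrable (fun z : ℝ × Heis n => χ z.1 * Φ (z.2, G z.1) *
      deriv β (heisMoll ρ (ε k) (u z.1) z.2) * (u z.1 z.2 * c z.1 z.2)) (slab T₁ K) := fun k =>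
    Integrable.bdd_mul iucK (mg k) (bg k)
  have L4 : Tendsto (fun k => ∫ z, χ z.1 * Φ (z.2, G z.1) *
      deriv β (heisMoll ρ (ε k) (u z.1) z.2) * (u z.1 z.2 * c z.1 z.2) ∂(slab T₁ K)) atTop
      (𝓝 (∫ z, χ z.1 * Φ (z.2, G z.1) * deriv β (u z.1 z.2) * (u z.1 z.2 * c z.1 z.2)
        ∂(slab T₁ K))) := by
    refine tendsto_integral_of_dominated_convergence
      (fun z => C * B * ‖u z.1 z.2 * c z.1 z.2‖) (fun k => (iG k).1)
      (iucK.norm.const_mul (C * B)) (fun k => (bg k).mono fun z hz => ?_) (hae.mono fun z hz =>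
        (((hβ'.tendsto _).comp hz).const_mul _).mul_const _)
    rw [norm_mul]
    exact mul_le_mul_of_nonneg_right hz (norm_nonneg _)
  have L5 : Tendsto (fun k => -∫ p in K, χ 0 * Φ (p, G 0) * β (heisMoll ρ (ε k) u₀ p)) atTop
      (𝓝 (-∫ p in K, χ 0 * Φ (p, G 0) * β (u₀ p))) := by
    have : IsFiniteMeasure ((volume : Measure (Heis n)).restrict K) :=
      ⟨by simpa using hK.measure_lt_top⟩
    have hΦ0 : Continuous fun p : Heis n => χ 0 * Φ (p, G 0) := continuous_const.mul
      (hw.smooth.continuous.comp (continuous_id.prodMk continuous_const))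
    refine (tendsto_integral_of_dominated_convergence (fun _ => C * B)
      (fun k => (hΦ0.mul (hβ.continuous.comp (mV₀ _))).aestronglyMeasurable)
      (integrable_const _) (fun k => ?_) (hms'.mono fun p hp =>
        ((hβ.continuous.tendsto _).comp hp).const_mul _)).neg
    filter_upwards [ae_restrict_mem hK.measurableSet] with p hp
    have h1 := hC 0 ⟨le_rfl, hw.pos.le⟩ p hp
    change ‖χ 0 * Φ (p, G 0) * β (heisMoll ρ (ε k) u₀ p)‖ ≤ C * B
    rw [norm_mul]
    exact mul_le_mul h1 (hB _) (norm_nonneg _) ((norm_nonneg _).trans h1)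
  refine tendsto_nhds_unique ?_ L5
  have L := L1.sub (L2.add (L3.add L4))
  simp only [zero_add] at L
  refine L.congr fun k => ?_
  rw [← integral_slab_commAt hn hd hu hsol hρ hρc (hε k) hT hw hβ hB hB']
  have i1 := Integrable.bounded_comp iW (mU k) hβ.continuous hB
  have i2 := (iR k).bdd_mul (mg k) (bg k)
  have i3 := Integrable.bdd_mul ((iM k).sub iucK) (mg k) (bg k)
  refine (integral_sub_add_add i1 i2 i3 (iG k)).trans ?_
  refine integral_congr_ae (.of_forall fun z => ?_)
  simp only [Function.uncurry_def, Pi.sub_apply]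
  ring

end Renorm

/-! ## The weights of the stability estimate -/

section Cutoff

theorem exists_deriv_smoothTransition_le :
    ∃ B : ℝ, (∀ x, deriv Real.smoothTransition x ∈ Icc 0 B) ∧
      ∀ x, 1 < x → deriv Real.smoothTransition x = 0 := by
  have h1 : Continuous (deriv Real.smoothTransition) :=
    (Real.smoothTransition.contDiff (n := 1)).continuous_deriv le_rfl
  have h0 : ∀ x ∉ Icc (0 : ℝ) 1, deriv Real.smoothTransition x = 0 := fun x hx => by
    rw [mem_Icc, not_and_or, not_le, not_le] at hx
    rcases hx with hx | hx
    · have : Real.smoothTransition =ᶠ[𝓝 x] fun _ => 0 := by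
        filter_upwards [Iio_mem_nhds hx] with y hy
        exact Real.smoothTransition.zero_of_nonpos (le_of_lt hy)
      rw [this.deriv_eq, deriv_const]
    · have : Real.smoothTransition =ᶠ[𝓝 x] fun _ => 1 := by
        filter_upwards [Ioi_mem_nhds hx] with y hy
        exact Real.smoothTransition.one_of_one_le (le_of_lt hy)
      rw [this.deriv_eq, deriv_const]
  obtain ⟨B, hB⟩ := (HasCompactSupport.intro isCompact_Icc h0).exists_bound_of_continuous h1
  exact ⟨B, fun x => ⟨Real.smoothTransition.monotone.deriv_nonneg,
    (le_abs_self _).trans (hB x)⟩, fun x hx => h0 x fun h => h.2.not_gt hx⟩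

/-- A cutoff function at logarithmic distance `R + 1 - r` of the origin. -/
def heisCutoff {n : ℕ} (R : ℝ) (z : Heis n × ℝ) : ℝ :=
  Real.smoothTransition (R + 1 - (heisLog z.1 + z.2))

variable {n : ℕ}

theorem contDiff_heisCutoff (R : ℝ) : ContDiff ℝ (⊤ : ℕ∞) (heisCutoff (n := n) R) :=
  Real.smoothTransition.contDiff.comp
    (contDiff_const.sub ((contDiff_heisLog.comp contDiff_fst).add contDiff_snd))

theorem hasFDerivAt_heisCutoff (R : ℝ) (z : Heis n × ℝ) :
    HasFDerivAt (heisCutoff R) (-(deriv Real.smoothTransition (R + 1 - (heisLog z.1 + z.2))) •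
      ((fderiv ℝ heisLog z.1).comp (ContinuousLinearMap.fst ℝ (Heis n) ℝ) +
        ContinuousLinearMap.snd ℝ (Heis n) ℝ)) z := by
  have h1 : HasFDerivAt (fun z : Heis n × ℝ => heisLog z.1)
      ((fderiv ℝ heisLog z.1).comp (ContinuousLinearMap.fst ℝ (Heis n) ℝ)) z :=
    (((contDiff_heisLog (k := 1)).differentiable one_ne_zero) z.1).hasFDerivAt.comp z hasFDerivAt_fst
  have h2 := ((h1.fun_add hasFDerivAt_snd).const_sub (R + 1))
  have h3 : HasDerivAt Real.smoothTransition
      (deriv Real.smoothTransition (R + 1 - (heisLog z.1 + z.2)))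
      (R + 1 - (heisLog z.1 + z.2)) :=
    (((Real.smoothTransition.contDiff (n := 1)).differentiable one_ne_zero) _).hasDerivAt
  have h4 := h3.comp_hasFDerivAt z h2
  rw [smul_neg, ← neg_smul] at h4
  exact h4

theorem shiftDeriv_heisCutoff (R : ℝ) (z : Heis n × ℝ) : shiftDeriv (heisCutoff R) z =
    -deriv Real.smoothTransition (R + 1 - (heisLog z.1 + z.2)) := by
  rw [shiftDeriv, (hasFDerivAt_heisCutoff R z).fderiv]
  simp

theorem frameDerivFst_heisCutoff (R : ℝ) (i : FrameIdx n) (z : Heis n × ℝ) :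
    frameDerivFst (heisCutoff R) i z =
      -deriv Real.smoothTransition (R + 1 - (heisLog z.1 + z.2)) * frameDeriv i heisLog z.1 := by
  rw [frameDerivFst, (hasFDerivAt_heisCutoff R z).fderiv]
  simp [frameDeriv]

end Cutoff

/-! ### Sup norms of the coefficients as functions of time -/

section Data

theorem ae_prod_of_ae_ae {α β : Type*} [MeasurableSpace α] [MeasurableSpace β] {μ : Measure α}
    {ν : Measure β} [SFinite ν] {P : α × β → Prop}
    (hP : NullMeasurableSet {z | P z} (μ.prod ν)) (h : ∀ᵐ x ∂μ, ∀ᵐ y ∂ν, P (x, y)) :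
    ∀ᵐ z ∂(μ.prod ν), P z := by
  obtain ⟨S, hS, hSP⟩ := hP
  have h1 : ∀ᵐ z ∂(μ.prod ν), z ∈ S := by
    rw [Measure.ae_prod_mem_iff_ae_ae_mem hS]
    filter_upwards [h, Measure.ae_ae_of_ae_prod hSP] with x hx hx'
    filter_upwards [hx, hx'] with y hy hy'
    exact hy'.mp hy
  filter_upwards [h1, hSP] with z hz hz' using hz'.mpr hz

variable {n : ℕ} {T : EReal} {f : ℝ → Heis n → ℝ} {T₁ : ℝ}

/-- The function `τ ↦ ‖f(τ,·)‖_{L^∞}`. -/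
def supNorm {n : ℕ} (f : ℝ → Heis n → ℝ) (τ : ℝ) : ℝ := (eLpNorm (f τ) ∞ volume).toReal

theorem supNorm_nonneg (f : ℝ → Heis n → ℝ) (τ : ℝ) : 0 ≤ supNorm f τ := ENNReal.toReal_nonneg

theorem MemMixed.integrable_supNorm (hf : MemMixed T 1 ∞ f) :
    Integrable (supNorm f) (timeMeasure T) :=
  integrable_toReal_of_lintegral_ne_top (aemeasurable_eLpNorm_section hf.1 ∞)
    hf.lintegral_lt_top.ne

theorem MemMixed.ae_le_supNorm (hf : MemMixed T 1 ∞ f) :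
    ∀ᵐ z ∂(spaceTimeMeasure n T), |f z.1 z.2| ≤ supNorm f z.1 := by
  have h1 : ∀ᵐ τ ∂(timeMeasure T), ∀ᵐ p, |f τ p| ≤ supNorm f τ := by
    filter_upwards [hf.ae_memLp] with τ hτ
    have h := hτ.2.ne
    filter_upwards [enorm_ae_le_eLpNormEssSup (f τ) volume] with p hp
    have := ENNReal.toReal_mono (by rwa [eLpNorm_exponent_top] at h) hp
    rw [toReal_enorm, Real.norm_eq_abs] at this
    rwa [supNorm, eLpNorm_exponent_top]
  have h2 : AEMeasurable (fun z : ℝ × Heis n => supNorm f z.1) (spaceTimeMeasure n T) :=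
    (aemeasurable_eLpNorm_section hf.1 ∞).ennreal_toReal.comp_fst
  have h3 : AEMeasurable (fun z : ℝ × Heis n => |f z.1 z.2|) (spaceTimeMeasure n T) :=
    hf.1.aemeasurable.norm
  exact ae_prod_of_ae_ae (nullMeasurableSet_le h3 h2) h1

theorem MemMixed.integrable (hf : MemMixed T 1 1 f) :
    Integrable (Function.uncurry f) (spaceTimeMeasure n T) := by
  refine integrable_prod_of_lintegral hf.1 ?_
  have := hf.lintegral_lt_top.ne
  simpa only [eLpNorm_one_eq_lintegral_enorm] using this

end Data

/-! ## The stability estimate -/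

section Stability

variable {n : ℕ} {T : EReal} {s s' : ℝ≥0∞} {b : HeisField n} {D c u : ℝ → Heis n → ℝ}
  {f g : ℝ → Heis n → ℝ} {u₀ : Heis n → ℝ} {T₁ : ℝ} {β : ℝ → ℝ} {B C Cβ R : ℝ}

/-- The primitive of `a` which vanishes at `0`. -/
def timePrim (a : ℝ → ℝ) (τ : ℝ) : ℝ := 0 + ∫ x in (0 : ℝ)..τ, a x

theorem timePrim_mem_Icc {a : ℝ → ℝ} (ha : Integrable a (timeMeasure T)) (ha0 : ∀ τ, 0 ≤ a τ)
    (hT : (T₁ : EReal) < T) {τ : ℝ} (hτ : τ ∈ Icc 0 T₁) :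
    timePrim a τ ∈ Icc 0 (∫ x, a x ∂(timeMeasure T)) := by
  rw [timePrim, zero_add, intervalIntegral.integral_of_le hτ.1]
  refine ⟨setIntegral_nonneg measurableSet_Ioc fun x _ => ha0 x, ?_⟩
  refine integral_mono_measure ?_ (.of_forall ha0) ha
  exact Measure.restrict_mono ((Ioc_subset_Ioc_right hτ.2).trans (Ioc_subset_timeInterval hT)) le_rfl

theorem hasACDeriv_timePrim {a : ℝ → ℝ} (ha : Integrable a (timeMeasure T)) (h0 : 0 < T₁)
    (hT : (T₁ : EReal) < T) : HasACDeriv T₁ (timePrim a) a :=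
  .of_integral 0 ((intervalIntegrable_iff_integrableOn_Ioc_of_le h0.le).2
    (ha.mono_measure (restrict_Ioc_le_timeMeasure hT)))

/-- The time factor of the weights. -/
def stabTime (T₁ : ℝ) (S : Set ℝ) (a : ℝ → ℝ) (τ : ℝ) : ℝ :=
  (timePrim (S.indicator 1) T₁ - timePrim (S.indicator 1) τ) * Real.exp (-timePrim a τ)

/-- The derivative of `stabTime`. -/
def stabRate (T₁ : ℝ) (S : Set ℝ) (a : ℝ → ℝ) (τ : ℝ) : ℝ :=
  -(S.indicator 1 τ * Real.exp (-timePrim a τ)) - a τ * stabTime T₁ S a τ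

theorem intervalIntegrable_indicator_one {S : Set ℝ} (hS : MeasurableSet S) (x y : ℝ) :
    IntervalIntegrable (S.indicator (1 : ℝ → ℝ)) volume x y := by
  rw [intervalIntegrable_iff]
  refine Integrable.indicator ?_ hS
  exact integrableOn_const (by simp [uIoc])

theorem timePrim_indicator_mem_Icc {S : Set ℝ} (hS : MeasurableSet S) {τ : ℝ}
    (hτ : τ ∈ Icc 0 T₁) : timePrim (S.indicator 1) T₁ - timePrim (S.indicator 1) τ ∈
      Icc 0 (timePrim (S.indicator 1) T₁) := by
  have h0 : ∀ x, 0 ≤ S.indicator (1 : ℝ → ℝ) x := fun x => indicator_nonneg (fun _ _ => zero_le_one) x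
  have hi := intervalIntegrable_indicator_one hS
  have h1 := intervalIntegral.integral_add_adjacent_intervals (hi 0 τ) (hi τ T₁)
  have h2 := intervalIntegral.integral_nonneg hτ.1 (μ := volume) fun x _ => h0 x
  have h3 := intervalIntegral.integral_nonneg hτ.2 (μ := volume) fun x _ => h0 x
  simp only [timePrim, zero_add]
  constructor <;> linarith

/-- The time factor solves `χ' = -1_S e^{-A} - a χ` with `A' = a` and `χ(T₁) = 0`. The term `-a χ`
is Gronwall's inequality built into the weight, and `-1_S e^{-A}` restricts the estimate to an
arbitrary measurable set `S` of times. -/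
theorem hasACDeriv_stabTime {a : ℝ → ℝ} (ha : Integrable a (timeMeasure T)) (h0 : 0 < T₁)
    (hT : (T₁ : EReal) < T) {S : Set ℝ} (hS : MeasurableSet S) :
    HasACDeriv T₁ (stabTime T₁ S a) (stabRate T₁ S a) := by
  have h1 : HasACDeriv T₁ (fun τ => timePrim (S.indicator 1) T₁ - timePrim (S.indicator 1) τ)
      (fun τ => -S.indicator 1 τ) := by
    have := HasACDeriv.of_integral (timePrim (S.indicator 1) T₁)
      (intervalIntegrable_indicator_one hS 0 T₁).neg
    simp only [timePrim, zero_add, Pi.neg_apply, intervalIntegral.integral_neg,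
      ← sub_eq_add_neg] at this ⊢
    exact this
  have h2 := (hasACDeriv_timePrim ha h0 hT).comp (F := fun x => Real.exp (-x)) (by fun_prop)
  have h3 := h1.mul h2
  have h4 : ∀ x : ℝ, deriv (fun x : ℝ => Real.exp (-x)) x = -Real.exp (-x) := fun x => by
    rw [(hasDerivAt_neg x).exp.deriv]; ring
  have h5 : stabRate T₁ S a = _ := funext fun τ => show _ = -S.indicator 1 τ *
      Real.exp (-timePrim a τ) + (timePrim (S.indicator 1) T₁ - timePrim (S.indicator 1) τ) *
        (deriv (fun x => Real.exp (-x)) (timePrim a τ) * a τ) by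
    rw [h4, stabRate, stabTime]
    ring
  rw [h5]
  exact h3

/-- The primitive of `γ` is nonnegative, so the shrinking cutoff never leaves the sublevel set that
contains its support at time zero. -/
theorem heisCutoff_weight {a γ : ℝ → ℝ} (ha : Integrable a (timeMeasure T))
    (hγ : Integrable γ (timeMeasure T)) (hγ0 : ∀ τ, 0 ≤ γ τ) (h0 : 0 < T₁)
    (hT : (T₁ : EReal) < T) {S : Set ℝ} (hS : MeasurableSet S) (R : ℝ) :
    IsWeight T₁ {p : Heis n | heisLog p ≤ R + 1} (stabTime T₁ S a) (stabRate T₁ S a)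
      (timePrim γ) γ (heisCutoff R) where
  pos := h0
  compact := isCompact_heisLog_le _
  time := hasACDeriv_stabTime ha h0 hT hS
  shift := hasACDeriv_timePrim hγ h0 hT
  final := by simp [stabTime]
  smooth := contDiff_heisCutoff R
  support := fun τ hτ p hp => by
    have h1 := (timePrim_mem_Icc hγ hγ0 hT hτ).1
    rw [mem_ofPred_eq, not_le] at hp
    exact Real.smoothTransition.zero_of_nonpos (by simp only; linarith)

/-- Three terms are compared: `a χ` pays for the divergence and the zeroth order term, the motion `σ
γ` of the cutoff pays for the bounded part of the drift `L` of `heisLog`, and the integrable part `C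
φ` of the drift survives as an error with the factor `σ`, the slope of the cutoff. -/
theorem weight_estimate {x χ η e a Φ σ γ L d y N B C φ : ℝ} {S : ℝ} (hx : x ∈ Icc 0 B)
    (hχ : χ ∈ Icc 0 N) (hΦ : 0 ≤ Φ) (hσ : 0 ≤ σ) (hL : L ≤ C * φ + γ) (hCφ : 0 ≤ C * φ)
    (hy : -(d * x) - y ≤ a * x) (hS : S = -(L * (χ * σ))) :
    x * (η * e * Φ) ≤ -(x * ((-(η * e) - a * χ) * Φ + χ * (-σ * γ) - (S + d * (χ * Φ))) -
      χ * Φ * y) + N * B * C * (σ * φ) := by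
  have h1 : 0 ≤ χ * Φ * (a * x + d * x + y) :=
    mul_nonneg (mul_nonneg hχ.1 hΦ) (by linarith)
  have h2 : 0 ≤ χ * σ * x * (C * φ + γ - L) :=
    mul_nonneg (mul_nonneg (mul_nonneg hχ.1 hσ) hx.1) (by linarith)
  have h3 : χ * σ * x * (C * φ) ≤ N * σ * B * (C * φ) := by
    refine mul_le_mul_of_nonneg_right ?_ hCφ
    exact mul_le_mul (mul_le_mul_of_nonneg_right hχ.2 hσ) hx.2 hx.1
      (mul_nonneg (hχ.1.trans hχ.2) hσ)
  rw [hS]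
  linarith

variable [hss : ENNReal.HolderConjugate s s']

/-- The renormalized identity with the moving cutoff, combined with the pointwise inequality
`weight_estimate`. Here `a` and `γ` are exactly the rates that inequality requires. The error lives
where the cutoff is neither `0` nor `1`. -/
theorem lintegral_slab_weight_le (hn : 1 ≤ n) (hd : IsTransportData T s' b D c)
    (hu : MemMixedLoc T ∞ s u) (hu₀ : MemLpLoc u₀ s) (hsol : IsWeakSolution T b D c u₀ u)
    (hf : MemMixed T 1 1 f) (hg : MemMixed T 1 ∞ g)
    (hb : ∀ᵐ z ∂(spaceTimeMeasure n T), ‖b z.1 z.2‖ / (1 + ccDist z.2 0) = f z.1 z.2 + g z.1 z.2)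
    (hC0 : 0 ≤ C) (hC : ∀ (p : Heis n) (v : EuclideanSpace ℝ (FrameIdx n)),
      |∑ i, v i * frameDeriv i heisLog p| ≤ C * (‖v‖ / (1 + ccDist p 0)))
    (hβ : ContDiff ℝ (⊤ : ℕ∞) β) (hB : ∀ x, β x ∈ Icc 0 B) (hB' : ∀ x, |deriv β x| ≤ B)
    (hβ' : ∀ x, |x * deriv β x| ≤ Cβ * β x) (hCβ : 0 ≤ Cβ)
    (h0 : 0 < T₁) (hT : (T₁ : EReal) < T) {S : Set ℝ} (hS : MeasurableSet S)
    {a γ : ℝ → ℝ} (ha : a = fun τ => supNorm D τ + Cβ * supNorm c τ)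
    (hγ : γ = fun τ => C * supNorm g τ) (R : ℝ) :
    ∫⁻ z, ENNReal.ofReal (β (u z.1 z.2) * (S.indicator 1 z.1 * Real.exp (-timePrim a z.1) *
        heisCutoff R (z.2, timePrim γ z.1))) ∂(slab T₁ {p : Heis n | heisLog p ≤ R + 1}) ≤
      ENNReal.ofReal (timePrim (S.indicator 1) T₁ *
        (∫ p in {p : Heis n | heisLog p ≤ R + 1}, heisCutoff R (p, 0) * β (u₀ p)) +
        timePrim (S.indicator 1) T₁ * B * C * ∫ z, deriv Real.smoothTransition
          (R + 1 - (heisLog z.2 + timePrim γ z.1)) * |f z.1 z.2|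
            ∂((volume.restrict (Ioc 0 T₁)).prod volume)) := by
  have ha1 : Integrable a (timeMeasure T) := by
    rw [ha]; exact hd.div.integrable_supNorm.add (hd.zeroth.integrable_supNorm.const_mul Cβ)
  have hγ1 : Integrable γ (timeMeasure T) := by rw [hγ]; exact hg.integrable_supNorm.const_mul C
  have hγ0 : ∀ τ, 0 ≤ γ τ := fun τ => by rw [hγ]; exact mul_nonneg hC0 (supNorm_nonneg g τ)
  have hw := heisCutoff_weight (n := n) ha1 hγ1 hγ0 h0 hT hS R
  set K : Set (Heis n) := {p : Heis n | heisLog p ≤ R + 1} with hK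
  set N := timePrim (S.indicator 1) T₁ with hN
  have hle0 : (volume.restrict (Ioc 0 T₁)).prod (volume : Measure (Heis n)) ≤
      spaceTimeMeasure n T := Measure.prod_mono (restrict_Ioc_le_timeMeasure hT) le_rfl
  have hle1 : slab T₁ K ≤ (volume.restrict (Ioc 0 T₁)).prod (volume : Measure (Heis n)) :=
    Measure.prod_mono le_rfl Measure.restrict_le_self
  obtain ⟨J1, J2, J3⟩ := renormalized hn hd hu hu₀ hsol hT hw hβ
    (fun x => by rw [abs_of_nonneg (hB x).1]; exact (hB x).2) hB'
  obtain ⟨Bσ, hσ, -⟩ := exists_deriv_smoothTransition_le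
  have hG1 : AEMeasurable (timePrim γ) (volume.restrict (Ioc 0 T₁)) := by
    have := hw.shift.continuousOn
    rw [uIcc_of_le h0.le] at this
    exact (this.mono Ioc_subset_Icc_self).aemeasurable measurableSet_Ioc
  have I0 : Integrable (fun z : ℝ × Heis n => deriv Real.smoothTransition
      (R + 1 - (heisLog z.2 + timePrim γ z.1)) * |f z.1 z.2|)
        ((volume.restrict (Ioc 0 T₁)).prod volume) := by
    refine Integrable.bdd_mul (hf.integrable.mono_measure hle0).norm (c := Bσ) ?_
      (.of_forall fun z => ?_)
    · refine ((Real.smoothTransition.contDiff (n := 1)).continuous_deriv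
        le_rfl).comp_aestronglyMeasurable ?_
      refine aestronglyMeasurable_const.sub (AEStronglyMeasurable.add ?_ ?_)
      · exact ((contDiff_heisLog (k := 0)).continuous.comp continuous_snd).aestronglyMeasurable
      · exact hG1.comp_fst.aestronglyMeasurable
    · rw [Real.norm_of_nonneg (hσ _).1]
      exact (hσ _).2
  have IP := (J1.sub J2).neg.add ((I0.mono_measure hle1).const_mul (N * B * C))
  have hest : ∀ᵐ z ∂(slab T₁ K), β (u z.1 z.2) * (S.indicator 1 z.1 *
      Real.exp (-timePrim a z.1) * heisCutoff R (z.2, timePrim γ z.1)) ≤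
      -(β (u z.1 z.2) * weightTransport b D (stabTime T₁ S a) (stabRate T₁ S a) (timePrim γ) γ
          (heisCutoff R) z.1 z.2 - stabTime T₁ S a z.1 * heisCutoff R (z.2, timePrim γ z.1) *
            deriv β (u z.1 z.2) * (u z.1 z.2 * c z.1 z.2)) +
        N * B * C * (deriv Real.smoothTransition
      (R + 1 - (heisLog z.2 + timePrim γ z.1)) * |f z.1 z.2|) := by
    have hτ : ∀ᵐ z ∂(slab T₁ K), z.1 ∈ Ioc 0 T₁ := ae_slab hw.compact fun τ hτ p hp => hτ
    have h1 : ∀ᵐ z ∂(slab T₁ K), |g z.1 z.2| ≤ supNorm g z.1 :=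
      ae_mono (hle1.trans hle0) hg.ae_le_supNorm
    have h2 : ∀ᵐ z ∂(slab T₁ K), |D z.1 z.2| ≤ supNorm D z.1 :=
      ae_mono (hle1.trans hle0) hd.div.ae_le_supNorm
    have h3 : ∀ᵐ z ∂(slab T₁ K), |c z.1 z.2| ≤ supNorm c z.1 :=
      ae_mono (hle1.trans hle0) hd.zeroth.ae_le_supNorm
    have h4 : ∀ᵐ z ∂(slab T₁ K), ‖b z.1 z.2‖ / (1 + ccDist z.2 0) = f z.1 z.2 + g z.1 z.2 :=
      ae_mono (hle1.trans hle0) hb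
    filter_upwards [hτ, h1, h2, h3, h4] with ⟨τ, p⟩ hτ h1 h2 h3 h4
    simp only at hτ h1 h2 h3 h4 ⊢
    have hN1 := timePrim_indicator_mem_Icc hS (Ioc_subset_Icc_self hτ)
    have hA0 := (timePrim_mem_Icc ha1 (fun τ => by
      rw [ha]; exact add_nonneg (supNorm_nonneg _ _) (mul_nonneg hCβ (supNorm_nonneg _ _)))
        hT (Ioc_subset_Icc_self hτ)).1
    have hχ : stabTime T₁ S a τ ∈ Icc 0 N :=
      ⟨mul_nonneg hN1.1 (Real.exp_pos _).le, (mul_le_of_le_one_right hN1.1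
        (Real.exp_le_one_iff.2 (by linarith))).trans hN1.2⟩
    have hL : ∑ i, b τ p i * frameDeriv i heisLog p ≤ C * |f τ p| + γ τ := by
      have h5 := (le_abs_self _).trans (hC p (b τ p))
      rw [h4] at h5
      have h6 : f τ p + g τ p ≤ |f τ p| + supNorm g τ :=
        add_le_add (le_abs_self _) ((le_abs_self _).trans h1)
      rw [hγ]
      have := mul_le_mul_of_nonneg_left h6 hC0
      linarith
    have hy : -(D τ p * β (u τ p)) - deriv β (u τ p) * (u τ p * c τ p) ≤ a τ * β (u τ p) := by
      have h5 : -(D τ p * β (u τ p)) ≤ supNorm D τ * β (u τ p) := by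
        rw [← neg_mul]
        exact mul_le_mul_of_nonneg_right ((neg_le_abs _).trans h2) (hB _).1
      have h6 : -(deriv β (u τ p) * (u τ p * c τ p)) ≤ Cβ * β (u τ p) * supNorm c τ := by
        refine (neg_le_abs _).trans ?_
        rw [show deriv β (u τ p) * (u τ p * c τ p) = (u τ p * deriv β (u τ p)) * c τ p by ring,
          abs_mul]
        exact mul_le_mul (hβ' _) h3 (abs_nonneg _) (mul_nonneg hCβ (hB _).1)
      rw [ha]
      simp only
      linarith
    have h7 := weight_estimate (η := S.indicator 1 τ) (e := Real.exp (-timePrim a τ))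
      (Φ := heisCutoff R (p, timePrim γ τ)) (hB (u τ p)) hχ (Real.smoothTransition.nonneg _)
      (hσ (R + 1 - (heisLog p + timePrim γ τ))).1 hL (mul_nonneg hC0 (abs_nonneg _)) hy
      (S := ∑ i, b τ p i * (stabTime T₁ S a τ * frameDerivFst (heisCutoff R) i (p, timePrim γ τ)))
      (by
        rw [Finset.sum_mul, ← Finset.sum_neg_distrib]
        refine Finset.sum_congr rfl fun i _ => ?_
        rw [frameDerivFst_heisCutoff]; ring)
    simp only [weightTransport, weightRate, shiftDeriv_heisCutoff, stabRate]
    refine h7.trans (le_of_eq ?_)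
    ring
  refine (lintegral_mono_ae (hest.mono fun z hz => ENNReal.ofReal_le_ofReal hz)).trans ?_
  have hnn : 0 ≤ᵐ[slab T₁ K] fun z => -(β (u z.1 z.2) * weightTransport b D (stabTime T₁ S a)
      (stabRate T₁ S a) (timePrim γ) γ (heisCutoff R) z.1 z.2 - stabTime T₁ S a z.1 *
        heisCutoff R (z.2, timePrim γ z.1) * deriv β (u z.1 z.2) * (u z.1 z.2 * c z.1 z.2)) +
        N * B * C * (deriv Real.smoothTransition
          (R + 1 - (heisLog z.2 + timePrim γ z.1)) * |f z.1 z.2|) := by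
    refine hest.mono fun z hz => le_trans ?_ hz
    exact mul_nonneg (hB _).1 (mul_nonneg (mul_nonneg (indicator_nonneg (fun _ _ => zero_le_one) _)
      (Real.exp_pos _).le) (Real.smoothTransition.nonneg _))
  refine (ofReal_integral_eq_lintegral_ofReal IP hnn).symm.trans_le ?_
  refine ENNReal.ofReal_le_ofReal ?_
  have e1 := integral_add (J1.sub J2).neg ((I0.mono_measure hle1).const_mul (N * B * C))
  refine (e1.trans (congrArg₂ (· + ·) (integral_neg _) (integral_const_mul _ _))).trans_le ?_
  rw [integral_sub' J1 J2, J3, neg_neg]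
  have hst0 : stabTime T₁ S a 0 = N := by simp [stabTime, timePrim, hN]
  have hG0 : timePrim γ 0 = 0 := by simp [timePrim]
  have hN0 : 0 ≤ N := by
    have := timePrim_indicator_mem_Icc hS (T₁ := T₁) ⟨le_rfl, h0.le⟩
    exact this.1.trans this.2
  refine add_le_add (le_of_eq ?_) (mul_le_mul_of_nonneg_left (integral_mono_measure hle1
    (.of_forall fun z => mul_nonneg (hσ _).1 (abs_nonneg _)) I0)
      (mul_nonneg (mul_nonneg hN0 ((hB 0).1.trans (hB 0).2)) hC0))
  rw [← integral_const_mul, hst0, hG0]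
  exact integral_congr_ae (.of_forall fun p => by ring)

end Stability

/-! ### Removal of the cutoff and the estimate at almost every time -/

section StabilityLimit

variable {n : ℕ} {T : EReal} {s s' : ℝ≥0∞} {b : HeisField n} {D c u : ℝ → Heis n → ℝ}
  {f g : ℝ → Heis n → ℝ} {u₀ : Heis n → ℝ} {T₁ : ℝ} {β : ℝ → ℝ} {B C Cβ R : ℝ}

/-- Rational end points `T₁ < T` exhaust the time interval, also when `T = ∞`, so countably many
null sets are discarded. -/
theorem ae_timeMeasure_of_forall_Ioc {P : ℝ → Prop}
    (h : ∀ T₁ : ℝ, 0 < T₁ → (T₁ : EReal) < T → ∀ᵐ τ ∂(volume.restrict (Ioc 0 T₁)), P τ) :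
    ∀ᵐ τ ∂(timeMeasure T), P τ := by
  have h1 : ∀ᵐ τ, ∀ q : ℚ, 0 < (q : ℝ) → ((q : ℝ) : EReal) < T → τ ∈ Ioc 0 (q : ℝ) → P τ :=
    ae_all_iff.2 fun q => by
      by_cases hq : 0 < (q : ℝ) ∧ ((q : ℝ) : EReal) < T
      · filter_upwards [(ae_restrict_iff' measurableSet_Ioc).1 (h q hq.1 hq.2)] with τ hτ _ _
          using hτ
      · exact .of_forall fun τ h1 h2 => (hq ⟨h1, h2⟩).elim
  rw [timeMeasure, ae_restrict_iff' (measurableSet_timeInterval T)]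
  filter_upwards [h1] with τ h1 hτ
  obtain ⟨q, hq, hq'⟩ := EReal.lt_iff_exists_rat_btwn.1 hτ.2
  have hq1 : τ < q := EReal.coe_lt_coe_iff.1 hq
  exact h1 q (hτ.1.trans hq1) hq' ⟨hτ.1, hq1.le⟩

/-- At each point the slope of the cutoff is zero once `k` is large. As it is bounded and `F` is
integrable, the error of the cutoff tends to zero; this is why an `L¹` part of `|b|/(1+d)` is
harmless. -/
theorem tendsto_integral_deriv_smoothTransition {μ : Measure (ℝ × Heis n)}
    {F : ℝ × Heis n → ℝ} (hF : Integrable F μ) {G : ℝ × Heis n → ℝ} (hG : AEMeasurable G μ) :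
    Tendsto (fun k : ℕ => ∫ z, deriv Real.smoothTransition ((k : ℝ) + 1 - (heisLog z.2 + G z)) *
      |F z| ∂μ) atTop (𝓝 0) := by
  obtain ⟨Bσ, hσ, hσ0⟩ := exists_deriv_smoothTransition_le
  rw [← integral_zero (ℝ × Heis n) ℝ (μ := μ)]
  refine tendsto_integral_of_dominated_convergence (fun z => Bσ * |F z|) (fun k => ?_)
    (hF.norm.const_mul Bσ) (fun k => .of_forall fun z => ?_) (.of_forall fun z => ?_)
  · refine AEStronglyMeasurable.mul (((Real.smoothTransition.contDiff (n := 1)).continuous_deriv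
        le_rfl).comp_aestronglyMeasurable ?_) hF.norm.1
    refine aestronglyMeasurable_const.sub (AEStronglyMeasurable.add ?_ hG.aestronglyMeasurable)
    exact ((contDiff_heisLog (k := 0)).continuous.comp continuous_snd).aestronglyMeasurable
  · rw [norm_mul, norm_abs_eq_norm, Real.norm_of_nonneg (hσ _).1]
    exact mul_le_mul_of_nonneg_right (hσ _).2 (abs_nonneg _)
  · refine tendsto_const_nhds.congr' ?_
    obtain ⟨m, hm⟩ := exists_nat_gt (heisLog z.2 + G z)
    filter_upwards [eventually_ge_atTop m] with k hk
    have : (m : ℝ) ≤ k := by exact_mod_cast hk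
    rw [hσ0 _ (by linarith), zero_mul]

theorem toReal_volume_inter_Ioc {S : Set ℝ} (hS : MeasurableSet S) (h0 : 0 ≤ T₁) :
    ENNReal.ofReal (timePrim (S.indicator 1) T₁) = volume.restrict (Ioc 0 T₁) S := by
  rw [timePrim, zero_add, intervalIntegral.integral_of_le h0, integral_indicator_one hS,
    measureReal_def, ENNReal.ofReal_toReal]
  rw [Measure.restrict_apply hS]
  exact ((measure_mono inter_subset_right).trans_lt (by simp)).ne

variable [hss : ENNReal.HolderConjugate s s']

/-- The region `{heisLog ≤ m}` stays fixed while the level `k` of the cutoff tends to infinity. The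
exponential weight is at least `e^{-A}`, which becomes the constant in front. -/
theorem setLIntegral_stability (hn : 1 ≤ n) (hd : IsTransportData T s' b D c)
    (hu : MemMixedLoc T ∞ s u) (hu₀ : MemLpLoc u₀ s) (hsol : IsWeakSolution T b D c u₀ u)
    (hf : MemMixed T 1 1 f) (hg : MemMixed T 1 ∞ g)
    (hb : ∀ᵐ z ∂(spaceTimeMeasure n T), ‖b z.1 z.2‖ / (1 + ccDist z.2 0) = f z.1 z.2 + g z.1 z.2)
    (hβ : ContDiff ℝ (⊤ : ℕ∞) β) (hB : ∀ x, β x ∈ Icc 0 B) (hB' : ∀ x, |deriv β x| ≤ B)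
    (hβ' : ∀ x, |x * deriv β x| ≤ Cβ * β x) (hCβ : 0 ≤ Cβ)
    (h0 : 0 < T₁) (hT : (T₁ : EReal) < T) {S : Set ℝ} (hS : MeasurableSet S) (m : ℝ) :
    ∫⁻ z, ENNReal.ofReal (β (u z.1 z.2)) ∂(((volume.restrict (Ioc 0 T₁)).restrict S).prod
        (volume.restrict {p : Heis n | heisLog p ≤ m})) ≤
      ENNReal.ofReal (Real.exp (∫ τ, (supNorm D τ + Cβ * supNorm c τ) ∂(timeMeasure T))) *
        (volume.restrict (Ioc 0 T₁) S * ∫⁻ p, ENNReal.ofReal (β (u₀ p))) := by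
  obtain ⟨C, hC0, hC⟩ := abs_sum_mul_frameDeriv_heisLog_le hn
  set a : ℝ → ℝ := fun τ => supNorm D τ + Cβ * supNorm c τ with ha
  set γ : ℝ → ℝ := fun τ => C * supNorm g τ with hγ
  set A := ∫ τ, a τ ∂(timeMeasure T) with hA
  set N := timePrim (S.indicator 1) T₁ with hN
  have ha1 : Integrable a (timeMeasure T) :=
    hd.div.integrable_supNorm.add (hd.zeroth.integrable_supNorm.const_mul Cβ)
  have ha0 : ∀ τ, 0 ≤ a τ := fun τ =>
    add_nonneg (supNorm_nonneg _ _) (mul_nonneg hCβ (supNorm_nonneg _ _))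
  have hγ1 : Integrable γ (timeMeasure T) := hg.integrable_supNorm.const_mul C
  have hγ0 : ∀ τ, 0 ≤ γ τ := fun τ => mul_nonneg hC0 (supNorm_nonneg g τ)
  have hN0 : 0 ≤ N := by
    have := timePrim_indicator_mem_Icc hS (T₁ := T₁) ⟨le_rfl, h0.le⟩
    exact this.1.trans this.2
  set I₀ := ∫⁻ p, ENNReal.ofReal (β (u₀ p)) with hI₀
  -- If the initial integral is infinite the bound is trivial, except that `0 · ∞ = 0`; for a null
  -- set `S` the left-hand side vanishes as well.
  by_cases hI : I₀ = ∞
  · rcases eq_or_ne (volume.restrict (Ioc 0 T₁) S) 0 with h | h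
    · rw [Measure.restrict_zero_set h, Measure.zero_prod, lintegral_zero_measure]
      exact zero_le
    · rw [hI, ENNReal.mul_top h, ENNReal.mul_top (by simp [Real.exp_pos])]
      exact le_top
  have hle0 : (volume.restrict (Ioc 0 T₁)).prod (volume : Measure (Heis n)) ≤
      spaceTimeMeasure n T := Measure.prod_mono (restrict_Ioc_le_timeMeasure hT) le_rfl
  have hG1 : AEMeasurable (timePrim γ) (volume.restrict (Ioc 0 T₁)) := by
    have := (hasACDeriv_timePrim hγ1 h0 hT).continuousOn
    rw [uIcc_of_le h0.le] at this
    exact (this.mono Ioc_subset_Icc_self).aemeasurable measurableSet_Ioc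
  set δ : ℕ → ℝ := fun k => ∫ z, deriv Real.smoothTransition ((k : ℝ) + 1 -
    (heisLog z.2 + timePrim γ z.1)) * |f z.1 z.2| ∂((volume.restrict (Ioc 0 T₁)).prod
      (volume : Measure (Heis n))) with hδ
  have hδ0 : Tendsto δ atTop (𝓝 0) := tendsto_integral_deriv_smoothTransition
    (hf.integrable.mono_measure hle0) (G := fun z => timePrim γ z.1) hG1.comp_fst
  have hu₀l := hu₀.locallyIntegrable (ENNReal.HolderConjugate.one_le s s')
  -- the estimate at scale `k`
  have key : ∀ᶠ k : ℕ in atTop, ENNReal.ofReal (Real.exp (-A)) *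
      ∫⁻ z, ENNReal.ofReal (β (u z.1 z.2)) ∂(((volume.restrict (Ioc 0 T₁)).restrict S).prod
        (volume.restrict {p : Heis n | heisLog p ≤ m})) ≤
      ENNReal.ofReal (N * I₀.toReal + N * B * C * δ k) := by
    -- The cutoff moves inwards by at most `∫ γ` in total, so from this level on it equals `1` on
    -- `{heisLog ≤ m}` at all times.
    obtain ⟨k₀, hk₀⟩ := exists_nat_ge (m + ∫ τ, γ τ ∂(timeMeasure T))
    filter_upwards [eventually_ge_atTop k₀] with k hk
    have hk' : m + ∫ τ, γ τ ∂(timeMeasure T) ≤ k := hk₀.trans (by exact_mod_cast hk)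
    have hGm : 0 ≤ ∫ τ, γ τ ∂(timeMeasure T) := integral_nonneg hγ0
    have h1 := lintegral_slab_weight_le hn hd hu hu₀ hsol hf hg hb hC0 hC hβ hB hB' hβ' hCβ h0 hT
      hS ha hγ (k : ℝ)
    have hK : MeasurableSet {p : Heis n | heisLog p ≤ m} :=
      (isCompact_heisLog_le m).measurableSet
    refine le_trans ?_ (h1.trans (ENNReal.ofReal_le_ofReal (add_le_add
      (mul_le_mul_of_nonneg_left ?_ hN0) le_rfl)))
    · rw [← lintegral_const_mul' _ _ ENNReal.ofReal_ne_top]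
      have hle : ((volume.restrict (Ioc 0 T₁)).restrict S).prod
          (volume.restrict {p : Heis n | heisLog p ≤ m}) ≤
          slab T₁ {p : Heis n | heisLog p ≤ k + 1} :=
        Measure.prod_mono Measure.restrict_le_self (Measure.restrict_mono
          (fun p (hp : heisLog p ≤ m) => show heisLog p ≤ k + 1 by linarith) le_rfl)
      refine le_trans (lintegral_mono_ae ?_) (lintegral_mono' hle le_rfl)
      rw [Measure.restrict_restrict hS, Measure.prod_restrict]
      filter_upwards [ae_restrict_mem ((hS.inter measurableSet_Ioc).prod hK)] with z hz
      have hz1 : z.1 ∈ Icc 0 T₁ := Ioc_subset_Icc_self hz.1.2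
      have hz2 : heisLog z.2 ≤ m := hz.2
      have h2 := timePrim_mem_Icc hγ1 hγ0 hT hz1
      have h3 := timePrim_mem_Icc ha1 ha0 hT hz1
      have h4 : heisCutoff k (z.2, timePrim γ z.1) = 1 :=
        Real.smoothTransition.one_of_one_le (by simp only; linarith [h2.2])
      rw [h4, indicator_of_mem hz.1.1, Pi.one_apply, one_mul, mul_one,
        ← ENNReal.ofReal_mul (Real.exp_pos _).le, mul_comm]
      exact ENNReal.ofReal_le_ofReal (mul_le_mul_of_nonneg_left
        (Real.exp_le_exp.2 (neg_le_neg h3.2)) (hB _).1)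
    · have hm : AEStronglyMeasurable (fun p => β (u₀ p)) volume :=
        hβ.continuous.comp_aestronglyMeasurable hu₀l.aestronglyMeasurable
      have hi : Integrable (fun p => β (u₀ p)) volume :=
        lintegral_ofReal_ne_top_iff_integrable hm (.of_forall fun p => (hB _).1) |>.1 hI
      rw [← integral_eq_lintegral_of_nonneg_ae (.of_forall fun p => (hB _).1) hm]
      refine le_trans ?_ (setIntegral_le_integral (s := {p : Heis n | heisLog p ≤ k + 1})
        hi (.of_forall fun p => (hB _).1))
      refine integral_mono_of_nonneg (.of_forall fun p => mul_nonneg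
        (Real.smoothTransition.nonneg _) (hB _).1) hi.integrableOn (.of_forall fun p => ?_)
      exact mul_le_of_le_one_left (hB _).1 (Real.smoothTransition.le_one _)
  have lim : Tendsto (fun k => ENNReal.ofReal (N * I₀.toReal + N * B * C * δ k)) atTop
      (𝓝 (ENNReal.ofReal (N * I₀.toReal + N * B * C * 0))) :=
    ENNReal.tendsto_ofReal ((hδ0.const_mul _).const_add _)
  have := ge_of_tendsto lim key
  rw [mul_zero, add_zero, ENNReal.ofReal_mul hN0, ENNReal.ofReal_toReal hI,
    toReal_volume_inter_Ioc hS h0.le] at this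
  refine le_trans (le_of_eq ?_) (mul_le_mul_right this _)
  rw [← mul_assoc, ← ENNReal.ofReal_mul (Real.exp_pos _).le, ← Real.exp_add, add_neg_cancel,
    Real.exp_zero, ENNReal.ofReal_one, one_mul]

/-- The stability estimate. -/
theorem ae_lintegral_stability (hn : 1 ≤ n) (hd : IsTransportData T s' b D c)
    (hgrowth : HasGrowth T b)
    (hu : MemMixedLoc T ∞ s u) (hu₀ : MemLpLoc u₀ s) (hsol : IsWeakSolution T b D c u₀ u)
    (hβ : ContDiff ℝ (⊤ : ℕ∞) β) (hB : ∀ x, β x ∈ Icc 0 B) (hB' : ∀ x, |deriv β x| ≤ B)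
    (hβ' : ∀ x, |x * deriv β x| ≤ Cβ * β x) (hCβ : 0 ≤ Cβ) :
    ∀ᵐ τ ∂(timeMeasure T), ∫⁻ p, ENNReal.ofReal (β (u τ p)) ≤
      ENNReal.ofReal (Real.exp (∫ τ, (supNorm D τ + Cβ * supNorm c τ) ∂(timeMeasure T))) *
        ∫⁻ p, ENNReal.ofReal (β (u₀ p)) := by
  obtain ⟨f, g, hf, hg, hb⟩ := hgrowth
  refine ae_timeMeasure_of_forall_Ioc fun T₁ h0 hT => ?_
  have hle0 : (volume.restrict (Ioc 0 T₁)).prod (volume : Measure (Heis n)) ≤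
      spaceTimeMeasure n T := Measure.prod_mono (restrict_Ioc_le_timeMeasure hT) le_rfl
  have hm : AEMeasurable (fun z : ℝ × Heis n => ENNReal.ofReal (β (u z.1 z.2)))
      ((volume.restrict (Ioc 0 T₁)).prod (volume : Measure (Heis n))) :=
    (hβ.continuous.comp_aestronglyMeasurable
      (hu.1.mono_measure hle0)).aemeasurable.ennreal_ofReal
  have hmK : ∀ m : ℕ, AEMeasurable (fun z : ℝ × Heis n => ENNReal.ofReal (β (u z.1 z.2)))
      ((volume.restrict (Ioc 0 T₁)).prod (volume.restrict {p : Heis n | heisLog p ≤ m})) :=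
    fun m => hm.mono_measure (Measure.prod_mono le_rfl Measure.restrict_le_self)
  have h1 : ∀ m : ℕ, ∀ᵐ τ ∂(volume.restrict (Ioc 0 T₁)),
      ∫⁻ p in {p : Heis n | heisLog p ≤ m}, ENNReal.ofReal (β (u τ p)) ≤
      ENNReal.ofReal (Real.exp (∫ τ, (supNorm D τ + Cβ * supNorm c τ) ∂(timeMeasure T))) *
        ∫⁻ p, ENNReal.ofReal (β (u₀ p)) := fun m => by
    -- Arbitrary sets of times turn the integrated bound into a bound at almost every time.
    refine ae_le_of_forall_setLIntegral_le_of_sigmaFinite₀ (hmK m).lintegral_prod_right'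
      fun S hS _ => ?_
    rw [setLIntegral_const]
    have h2 := setLIntegral_stability hn hd hu hu₀ hsol hf hg hb hβ hB hB' hβ' hCβ h0 hT hS m
    rw [lintegral_prod _ ((hmK m).mono_measure (Measure.prod_mono Measure.restrict_le_self
      le_rfl))] at h2
    refine h2.trans (le_of_eq ?_)
    ring
  filter_upwards [ae_all_iff.2 h1] with τ hτ
  have hU : ⋃ m : ℕ, {p : Heis n | heisLog p ≤ m} = univ := by
    refine eq_univ_of_forall fun p => mem_iUnion.2 ?_
    exact exists_nat_ge (heisLog p)
  rw [← setLIntegral_univ, ← hU, setLIntegral_iUnion_of_directed]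
  · exact iSup_le hτ
  · refine Monotone.directed_le fun i j hij p (hp : heisLog p ≤ i) => ?_
    have : (i : ℝ) ≤ j := by exact_mod_cast hij
    exact hp.trans this

end StabilityLimit

/-! ## The weak formulation -/

section MixedNorm

variable {n : ℕ} {T : EReal} {s s' q : ℝ≥0∞} {f g F : ℝ → Heis n → ℝ}

theorem memMixed_one_of_le {k : ℝ → ℝ≥0∞} (hf : AEStronglyMeasurable (Function.uncurry f)
    (spaceTimeMeasure n T)) (hk : ∫⁻ τ, k τ ∂(timeMeasure T) ≠ ∞)
    (h : ∀ᵐ τ ∂(timeMeasure T), eLpNorm (f τ) q volume ≤ k τ) : MemMixed T 1 q f := by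
  refine ⟨hf, ?_⟩
  simp only [eLpNorm_one_eq_lintegral_enorm, enorm_eq_self]
  exact (lintegral_mono_ae h).trans_lt hk.lt_top

theorem MemMixed.add_one (hq : 1 ≤ q) (hf : MemMixed T 1 q f) (hg : MemMixed T 1 q g) :
    MemMixed T 1 q fun τ p => f τ p + g τ p := by
  refine memMixed_one_of_le (hf.1.add hg.1) (k := fun τ => eLpNorm (f τ) q volume +
    eLpNorm (g τ) q volume) ?_ ?_
  · rw [lintegral_add_left' (aemeasurable_eLpNorm_section hf.1 q)]
    exact ENNReal.add_ne_top.2 ⟨hf.lintegral_lt_top.ne, hg.lintegral_lt_top.ne⟩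
  · filter_upwards [hf.1.prodMk_left, hg.1.prodMk_left] with τ h1 h2
    exact eLpNorm_add_le h1 h2 hq

theorem memMixed_zero : MemMixed (n := n) T 1 q fun _ _ => 0 :=
  memMixed_one_of_le (k := fun _ => 0) aestronglyMeasurable_const (by simp)
    (.of_forall fun _ => by simp)

theorem MemMixed.sum_one {ι : Type*} (t : Finset ι) {f : ι → ℝ → Heis n → ℝ} (hq : 1 ≤ q)
    (hf : ∀ i, MemMixed T 1 q (f i)) : MemMixed T 1 q fun τ p => ∑ i ∈ t, f i τ p := by
  classical
  induction t using Finset.induction_on with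
  | empty => simpa using memMixed_zero
  | insert i t hi ih => simpa only [Finset.sum_insert hi] using (hf i).add_one hq ih

theorem MemMixed.mul_bounded (hf : MemMixed T 1 q f)
    (hF : AEStronglyMeasurable (Function.uncurry F) (spaceTimeMeasure n T)) {B : ℝ}
    (hB : ∀ τ p, |F τ p| ≤ B) : MemMixed T 1 q fun τ p => f τ p * F τ p := by
  refine memMixed_one_of_le (hf.1.mul hF) (k := fun τ => ENNReal.ofReal B *
    eLpNorm (f τ) q volume) ?_ (.of_forall fun τ => ?_)
  · rw [lintegral_const_mul' _ _ ENNReal.ofReal_ne_top]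
    exact ENNReal.mul_ne_top ENNReal.ofReal_ne_top hf.lintegral_lt_top.ne
  · refine eLpNorm_le_mul_eLpNorm_of_ae_le_mul (.of_forall fun p => ?_) q
    rw [norm_mul, mul_comm]
    exact mul_le_mul_of_nonneg_right (hB τ p) (norm_nonneg _)

theorem eLpNorm_le_of_bounded_of_support {K : Set (Heis n)} (hK : IsCompact K) {w : Heis n → ℝ}
    {B : ℝ} (hB : ∀ p, |w p| ≤ B) (h0 : ∀ p ∉ K, w p = 0) :
    eLpNorm w q volume ≤ volume K ^ q.toReal⁻¹ * ENNReal.ofReal B := by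
  have h1 : w = K.indicator w := by
    ext p
    by_cases hp : p ∈ K
    · rw [indicator_of_mem hp]
    · rw [indicator_of_notMem hp, h0 p hp]
  rw [h1, eLpNorm_indicator_eq_eLpNorm_restrict hK.measurableSet]
  simpa using eLpNorm_le_of_ae_bound (p := q) (μ := volume.restrict K) (f := w) (C := B)
    (.of_forall hB)

theorem volume_rpow_ne_top {K : Set (Heis n)} (hK : IsCompact K) (q : ℝ≥0∞) :
    volume K ^ q.toReal⁻¹ ≠ ∞ :=
  ENNReal.rpow_ne_top_of_nonneg (inv_nonneg.2 ENNReal.toReal_nonneg) hK.measure_lt_top.ne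

theorem MemMixed.mul_of_support (hf : MemMixed T 1 ∞ f)
    (hF : AEStronglyMeasurable (Function.uncurry F) (spaceTimeMeasure n T)) {B : ℝ}
    (hB : ∀ τ p, |F τ p| ≤ B) {K : Set (Heis n)} (hK : IsCompact K) (h0 : ∀ τ, ∀ p ∉ K, F τ p = 0)
    (q : ℝ≥0∞) : MemMixed T 1 q fun τ p => f τ p * F τ p := by
  refine memMixed_one_of_le (hf.1.mul hF) (k := fun τ => eLpNorm (f τ) ∞ volume *
    (volume K ^ q.toReal⁻¹ * ENNReal.ofReal B)) ?_ ?_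
  · have h1 : volume K ^ q.toReal⁻¹ * ENNReal.ofReal B ≠ ∞ :=
      ENNReal.mul_ne_top (volume_rpow_ne_top hK q) ENNReal.ofReal_ne_top
    rw [lintegral_mul_const' _ _ h1]
    exact ENNReal.mul_ne_top hf.lintegral_lt_top.ne h1
  · filter_upwards [hF.prodMk_left] with τ h2
    refine (eLpNorm_smul_le_eLpNorm_top_mul_eLpNorm q h2 (f τ)).trans ?_
    gcongr
    exact eLpNorm_le_of_bounded_of_support hK (hB τ) (h0 τ)

theorem memMixed_of_bounded_of_support
    (hF : AEStronglyMeasurable (Function.uncurry F) (spaceTimeMeasure n T)) {B : ℝ}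
    (hB : ∀ τ p, |F τ p| ≤ B) {K : Set (Heis n)} (hK : IsCompact K) {T₁ : ℝ}
    (h0 : ∀ τ p, (τ, p) ∉ Iic T₁ ×ˢ K → F τ p = 0) (q : ℝ≥0∞) : MemMixed T 1 q F := by
  refine memMixed_one_of_le hF (k := (Iic T₁).indicator fun _ =>
    volume K ^ q.toReal⁻¹ * ENNReal.ofReal B) ?_ (.of_forall fun τ => ?_)
  · rw [lintegral_indicator measurableSet_Iic, setLIntegral_const]
    refine ENNReal.mul_ne_top (ENNReal.mul_ne_top (volume_rpow_ne_top hK q)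
      ENNReal.ofReal_ne_top) ?_
    rw [timeMeasure, Measure.restrict_apply measurableSet_Iic]
    refine ((measure_mono (fun τ hτ => ?_ : Iic T₁ ∩ timeInterval T ⊆ Icc 0 T₁)).trans_lt
      (by simp)).ne
    exact ⟨hτ.2.1.le, hτ.1⟩
  · by_cases hτ : τ ∈ Iic T₁
    · rw [indicator_of_mem hτ]
      exact eLpNorm_le_of_bounded_of_support hK (hB τ) fun p hp => h0 τ p fun h => hp h.2
    · rw [indicator_of_notMem hτ, show F τ = 0 from funext fun p => h0 τ p fun h => hτ h.1]
      simp

end MixedNorm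

/-- The operator that is applied to test functions in the weak formulation. -/
def testRate {n : ℕ} (b : HeisField n) (D c : ℝ → Heis n → ℝ) (φ : ℝ × Heis n → ℝ) (τ : ℝ)
    (p : Heis n) : ℝ :=
  -(fderiv ℝ φ (τ, p) (1, 0)) + ∑ i, b τ p i * frameDeriv i (fun q => φ (τ, q)) p +
    (c τ p + D τ p) * φ (τ, p)

section TestRate

variable {n : ℕ} {T : EReal} {s s' : ℝ≥0∞} {b : HeisField n} {D c u : ℝ → Heis n → ℝ}
  {u₀ : Heis n → ℝ} {φ : ℝ × Heis n → ℝ}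

theorem IsTestFunction.exists_support (hφ : IsTestFunction T φ) (hT : 0 < T) :
    ∃ T₁ : ℝ, 0 < T₁ ∧ (T₁ : EReal) < T ∧ ∃ K : Set (Heis n), IsCompact K ∧
      tsupport φ ⊆ Iio T₁ ×ˢ K := by
  obtain ⟨r, hr0, hrT⟩ := EReal.lt_iff_exists_real_btwn.1 hT
  have hr : 0 < r := by exact_mod_cast hr0
  have hK : IsCompact (Prod.snd '' tsupport φ) := hφ.2.1.image continuous_snd
  by_cases he : (tsupport φ).Nonempty
  · obtain ⟨z, hz, hmax⟩ := hφ.2.1.exists_isMaxOn he continuous_fst.continuousOn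
    have h1 : ((max r z.1 : ℝ) : EReal) < T := by
      rcases max_choice r z.1 with h | h <;> rw [h]
      exacts [hrT, hφ.2.2 hz]
    obtain ⟨t, ht, htT⟩ := EReal.lt_iff_exists_real_btwn.1 h1
    have ht' : max r z.1 < t := EReal.coe_lt_coe_iff.1 ht
    exact ⟨t, hr.trans ((le_max_left _ _).trans_lt ht'), htT, _, hK, fun y hy =>
      ⟨(show y.1 ≤ z.1 from hmax hy).trans_lt ((le_max_right _ _).trans_lt ht'),
        mem_image_of_mem _ hy⟩⟩
  · rw [not_nonempty_iff_eq_empty] at he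
    exact ⟨r, hr, hrT, _, hK, by rw [he]; exact empty_subset _⟩

theorem frameDeriv_section (hφ : ContDiff ℝ (⊤ : ℕ∞) φ) (τ : ℝ) (p : Heis n) (i : FrameIdx n) :
    frameDeriv i (fun q => φ (τ, q)) p = fderiv ℝ φ (τ, p) (0, heisZ i p) := by
  have h1 : HasFDerivAt (fun q : Heis n => (τ, q)) (ContinuousLinearMap.inr ℝ ℝ (Heis n)) p :=
    hasFDerivAt_prodMk_right τ p
  have h2 := ((hφ.differentiable (by simp)) (τ, p)).hasFDerivAt.comp p h1
  rw [frameDeriv]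
  erw [h2.fderiv]
  simp

theorem continuous_frameDeriv_section (hφ : ContDiff ℝ (⊤ : ℕ∞) φ) (i : FrameIdx n) :
    Continuous fun z : ℝ × Heis n => frameDeriv i (fun q => φ (z.1, q)) z.2 := by
  simp only [frameDeriv_section hφ]
  exact (hφ.continuous_fderiv (by simp)).clm_apply
    (continuous_const.prodMk ((heisZ_continuous i).comp continuous_snd))

theorem fderiv_eq_zero_of_notMem_tsupport {z : ℝ × Heis n} (hz : z ∉ tsupport φ) :
    fderiv ℝ φ z = 0 := by
  rw [(notMem_tsupport_iff_eventuallyEq.1 hz).fderiv_eq]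
  simp

theorem testRate_eq_zero (hφ : ContDiff ℝ (⊤ : ℕ∞) φ) {τ : ℝ} {p : Heis n}
    (hz : (τ, p) ∉ tsupport φ) : testRate b D c φ τ p = 0 := by
  simp [testRate, frameDeriv_section hφ, fderiv_eq_zero_of_notMem_tsupport hz,
    image_eq_zero_of_notMem_tsupport hz]

/-- The test function and its derivatives are bounded with compact support, so each term inherits
its mixed norm from a coefficient. Hölder against `u` in `L^∞(L^s_loc)` then makes the weak
formulation an absolutely convergent integral over space-time. -/
theorem memMixed_testRate (hs' : 1 ≤ s') (hd : IsTransportData T s' b D c) (hT : 0 < T)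
    (hφ : IsTestFunction T φ) : MemMixed T 1 s' (testRate b D c φ) := by
  obtain ⟨T₁, -, -, K, hK, hsupp⟩ := hφ.exists_support hT
  have bound : ∀ F : ℝ × Heis n → ℝ, Continuous F → (∀ z ∉ tsupport φ, F z = 0) →
      ∃ B : ℝ, ∀ τ p, |F (τ, p)| ≤ B := fun F hF h0 => by
    obtain ⟨B, hB⟩ := (HasCompactSupport.intro hφ.2.1 h0).exists_bound_of_continuous hF
    exact ⟨B, fun τ p => hB _⟩
  have c0 : Continuous fun z : ℝ × Heis n => -(fderiv ℝ φ z (1, 0)) :=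
    ((hφ.1.continuous_fderiv (by simp)).clm_apply continuous_const).neg
  have c1 := fun i => continuous_frameDeriv_section hφ.1 i
  obtain ⟨B0, h0⟩ := bound _ c0 fun z hz => by
    simp [fderiv_eq_zero_of_notMem_tsupport hz]
  have z1 : ∀ i, ∀ z : ℝ × Heis n, z ∉ tsupport φ →
    frameDeriv i (fun q => φ (z.1, q)) z.2 = 0 := fun i z hz => by
      simp [frameDeriv_section hφ.1, fderiv_eq_zero_of_notMem_tsupport hz]
  choose B1 h1 using fun i => bound _ (c1 i) (z1 i)
  obtain ⟨B2, h2⟩ := bound φ hφ.1.continuous fun z hz => image_eq_zero_of_notMem_tsupport hz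
  have m0 : MemMixed T 1 s' fun τ (p : Heis n) => -(fderiv ℝ φ (τ, p) (1, 0)) :=
    memMixed_of_bounded_of_support c0.aestronglyMeasurable h0 hK (T₁ := T₁) (fun τ p hz => by
      rw [fderiv_eq_zero_of_notMem_tsupport fun h => hz ⟨Iio_subset_Iic_self (hsupp h).1, (hsupp h).2⟩]
      simp) s'
  have m1 := MemMixed.sum_one Finset.univ hs' fun i => (hd.coeff i).mul_bounded
    (F := fun τ p => frameDeriv i (fun q => φ (τ, q)) p) (c1 i).aestronglyMeasurable (h1 i)
  have z2 : ∀ τ, ∀ p ∉ K, φ (τ, p) = 0 := fun τ p hp =>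
    image_eq_zero_of_notMem_tsupport fun h => hp (hsupp h).2
  have m2 := hd.zeroth.mul_of_support (F := fun τ p => φ (τ, p))
    hφ.1.continuous.aestronglyMeasurable h2 hK z2 s'
  have m3 := hd.div.mul_of_support (F := fun τ p => φ (τ, p))
    hφ.1.continuous.aestronglyMeasurable h2 hK z2 s'
  have := (m0.add_one hs' m1).add_one hs' (m2.add_one hs' m3)
  simp only [← add_mul] at this
  exact this

variable [hss : ENNReal.HolderConjugate s s']

theorem integrable_mul_testRate (hd : IsTransportData T s' b D c) (hT : 0 < T)
    (hu : MemMixedLoc T ∞ s u) (hφ : IsTestFunction T φ) :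
    Integrable (fun z : ℝ × Heis n => u z.1 z.2 * testRate b D c φ z.1 z.2)
      (spaceTimeMeasure n T) := by
  have hs' : 1 ≤ s' := by
    have : ENNReal.HolderConjugate s' s := ENNReal.HolderConjugate.symm
    exact ENNReal.HolderConjugate.one_le s' s
  obtain ⟨T₁, -, -, K, hK, hsupp⟩ := hφ.exists_support hT
  have h1 := hu.integrable_mul (memMixed_testRate hs' hd hT hφ) hK
  have h2 : (timeMeasure T).prod ((volume : Measure (Heis n)).restrict K) =
      (spaceTimeMeasure n T).restrict (univ ×ˢ K) := by
    rw [spaceTimeMeasure, ← Measure.prod_restrict, Measure.restrict_univ]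
  rw [h2] at h1
  refine (integrableOn_iff_integrable_of_support_subset fun z hz => ?_).1 h1
  by_contra h
  refine hz ?_
  show u z.1 z.2 * testRate b D c φ z.1 z.2 = 0
  rw [testRate_eq_zero hφ.1 fun h' => h ⟨mem_univ _, (hsupp h').2⟩, mul_zero]

theorem isWeakSolution_iff (hd : IsTransportData T s' b D c) (hT : 0 < T)
    (hu : MemMixedLoc T ∞ s u) : IsWeakSolution T b D c u₀ u ↔ ∀ φ : ℝ × Heis n → ℝ,
      IsTestFunction T φ → ∫ z, u z.1 z.2 * testRate b D c φ z.1 z.2 ∂(spaceTimeMeasure n T) =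
        ∫ p, u₀ p * φ (0, p) := by
  refine forall₂_congr fun φ hφ => ?_
  rw [spaceTimeMeasure, integral_prod _ (integrable_mul_testRate hd hT hu hφ), neg_add_eq_zero,
    eq_comm]
  rfl

end TestRate

/-! ## Renormalization functions -/

/-- A smooth approximation of `|z|^(2a)`, bounded if `κ > 0`. -/
def renormFun (a δ κ z : ℝ) : ℝ :=
  z ^ 2 / (1 + κ * z ^ 2) * (z ^ 2 / (1 + κ * z ^ 2) + δ) ^ (a - 1)

section RenormFun

variable {a δ κ : ℝ}

theorem renormFun_nonneg (a : ℝ) (hδ : 0 < δ) (hκ : 0 ≤ κ) (z : ℝ) : 0 ≤ renormFun a δ κ z := by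
  unfold renormFun; positivity

theorem contDiff_renormFun (a : ℝ) (hδ : 0 < δ) (hκ : 0 ≤ κ) :
    ContDiff ℝ (⊤ : ℕ∞) (renormFun a δ κ) := by
  have h1 : ContDiff ℝ (⊤ : ℕ∞) fun z : ℝ => z ^ 2 / (1 + κ * z ^ 2) :=
    (contDiff_id.pow 2).div (contDiff_const.add (contDiff_const.mul (contDiff_id.pow 2)))
      fun z => by positivity
  exact h1.mul ((h1.add contDiff_const).rpow_const_of_ne fun z => by positivity)

theorem hasDerivAt_renormFun (a : ℝ) (hδ : 0 < δ) (hκ : 0 ≤ κ) (z : ℝ) :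
    HasDerivAt (renormFun a δ κ) (2 * z / (1 + κ * z ^ 2) ^ 2 *
      ((z ^ 2 / (1 + κ * z ^ 2) + δ) ^ (a - 1) *
        (1 + (a - 1) * ((z ^ 2 / (1 + κ * z ^ 2)) / (z ^ 2 / (1 + κ * z ^ 2) + δ))))) z := by
  have hd : 0 < 1 + κ * z ^ 2 := by positivity
  have h1 : HasDerivAt (fun z : ℝ => z ^ 2 / (1 + κ * z ^ 2)) (2 * z / (1 + κ * z ^ 2) ^ 2) z := by
    have h2 : HasDerivAt (fun z : ℝ => z ^ 2) (2 * z) z := by simpa using hasDerivAt_pow 2 z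
    refine (h2.fun_div ((h2.const_mul κ).const_add 1) hd.ne').congr_deriv ?_
    congr 1
    ring
  have hp : 0 < z ^ 2 / (1 + κ * z ^ 2) + δ := by positivity
  have h3 := (h1.add_const δ).rpow_const (p := a - 1) (.inl hp.ne')
  refine (h1.fun_mul h3).congr_deriv ?_
  rw [Real.rpow_sub_one hp.ne' (a - 1)]
  field_simp

/-- The constant does not depend on `δ` and `κ`. It enters the exponent of the stability estimate,
which therefore survives the limit to `|z|^{2a}`. -/
theorem abs_mul_deriv_renormFun_le (a : ℝ) (hδ : 0 < δ) (hκ : 0 ≤ κ) (z : ℝ) :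
    |z * deriv (renormFun a δ κ) z| ≤ 2 * (1 + |a - 1|) * renormFun a δ κ z := by
  rw [(hasDerivAt_renormFun a hδ hκ z).deriv, renormFun]
  have hd : 0 < 1 + κ * z ^ 2 := by positivity
  have hd1 : 1 ≤ 1 + κ * z ^ 2 := le_add_of_nonneg_right (by positivity)
  set θ := z ^ 2 / (1 + κ * z ^ 2) with hθ
  have hθ0 : 0 ≤ θ := by positivity
  have hp : 0 < θ + δ := by positivity
  have hr : 0 ≤ (θ + δ) ^ (a - 1) := by positivity
  have e : z * (2 * z / (1 + κ * z ^ 2) ^ 2 * ((θ + δ) ^ (a - 1) *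
      (1 + (a - 1) * (θ / (θ + δ))))) =
      2 * (θ * (θ + δ) ^ (a - 1)) * ((1 + κ * z ^ 2)⁻¹ * (1 + (a - 1) * (θ / (θ + δ)))) := by
    rw [hθ]; field_simp
  have h1 : |(1 + κ * z ^ 2)⁻¹ * (1 + (a - 1) * (θ / (θ + δ)))| ≤ 1 + |a - 1| := by
    rw [abs_mul, abs_of_nonneg (inv_nonneg.2 hd.le)]
    have h2 : |1 + (a - 1) * (θ / (θ + δ))| ≤ 1 + |a - 1| := by
      refine (abs_add_le _ _).trans ?_
      rw [abs_one, abs_mul, abs_of_nonneg (by positivity : 0 ≤ θ / (θ + δ))]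
      have : θ / (θ + δ) ≤ 1 := (div_le_one hp).2 (by linarith)
      linarith [mul_le_of_le_one_right (abs_nonneg (a - 1)) this]
    exact (mul_le_of_le_one_left (abs_nonneg _) (inv_le_one_of_one_le₀ hd1)).trans h2
  rw [e, abs_mul, abs_of_nonneg (by positivity)]
  calc _ ≤ 2 * (θ * (θ + δ) ^ (a - 1)) * (1 + |a - 1|) :=
        mul_le_mul_of_nonneg_left h1 (by positivity)
    _ = _ := by ring

/-- For `κ > 0` the quotient `z²/(1+κz²)` stays in `[0, κ⁻¹]`, which bounds the function. Its
derivative is bounded by compactness on `[-1, 1]`, and elsewhere by `|β'| ≤ |z β'| ≤ C β`. -/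
theorem exists_bound_renormFun (a : ℝ) (hδ : 0 < δ) (hκ : 0 < κ) :
    ∃ B : ℝ, (∀ z, renormFun a δ κ z ∈ Icc 0 B) ∧ ∀ z, |deriv (renormFun a δ κ) z| ≤ B := by
  have h1 : ContinuousOn (fun y : ℝ => y * (y + δ) ^ (a - 1)) (Icc 0 κ⁻¹) := by
    refine continuousOn_id.mul ((continuousOn_id.add continuousOn_const).rpow_const
      fun y hy => .inl ?_)
    have : (0 : ℝ) ≤ y := hy.1
    exact (by positivity : 0 < y + δ).ne'
  obtain ⟨B₁, hB₁⟩ := isCompact_Icc.exists_bound_of_continuousOn h1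
  have h2 : ∀ z, renormFun a δ κ z ≤ B₁ := fun z => by
    have hz : z ^ 2 / (1 + κ * z ^ 2) ∈ Icc 0 κ⁻¹ := by
      refine ⟨by positivity, (div_le_iff₀ (by positivity)).2 ?_⟩
      rw [mul_add, inv_mul_cancel_left₀ hκ.ne']
      linarith [inv_pos.2 hκ]
    exact (le_abs_self _).trans (hB₁ _ hz)
  obtain ⟨B₂, hB₂⟩ := (isCompact_Icc (a := (-1 : ℝ)) (b := 1)).exists_bound_of_continuousOn
    ((contDiff_renormFun a hδ hκ.le).continuous_deriv (by simp)).continuousOn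
  have hB0 : 0 ≤ B₁ := (renormFun_nonneg a hδ hκ.le 0).trans (h2 0)
  have hC : 0 ≤ 2 * (1 + |a - 1|) * B₁ := by positivity
  refine ⟨max B₁ (max B₂ (2 * (1 + |a - 1|) * B₁)), fun z =>
    ⟨renormFun_nonneg a hδ hκ.le z, (h2 z).trans (le_max_left _ _)⟩, fun z => ?_⟩
  by_cases hz : z ∈ Icc (-1 : ℝ) 1
  · exact (hB₂ z hz).trans ((le_max_left _ _).trans (le_max_right _ _))
  · have hz1 : 1 ≤ |z| := by
      rw [mem_Icc, ← abs_le, not_le] at hz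
      exact hz.le
    refine le_trans ?_ ((le_max_right _ _).trans (le_max_right _ _))
    have h3 := abs_mul_deriv_renormFun_le a hδ hκ.le z
    rw [abs_mul] at h3
    calc _ ≤ |z| * |deriv (renormFun a δ κ) z| := le_mul_of_one_le_left (abs_nonneg _) hz1
      _ ≤ _ := h3
      _ ≤ _ := mul_le_mul_of_nonneg_left (h2 z) (by positivity)

theorem renormFun_pos (a : ℝ) (hδ : 0 < δ) (hκ : 0 ≤ κ) {z : ℝ} (hz : z ≠ 0) :
    0 < renormFun a δ κ z := by
  have : 0 < z ^ 2 := by positivity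
  unfold renormFun; positivity

theorem tendsto_renormFun (a z : ℝ) (ha : 0 < a) {δ κ : ℕ → ℝ} (hδ : Tendsto δ atTop (𝓝 0))
    (hκ : Tendsto κ atTop (𝓝 0)) :
    Tendsto (fun k => renormFun a (δ k) (κ k) z) atTop (𝓝 (|z| ^ (2 * a))) := by
  by_cases hz : z = 0
  · simp only [renormFun, hz]
    simp [Real.zero_rpow (mul_pos two_pos ha).ne']
  · have hz2 : 0 < z ^ 2 := by positivity
    have h1 : Tendsto (fun k => z ^ 2 / (1 + κ k * z ^ 2)) atTop (𝓝 (z ^ 2)) := by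
      have : Tendsto (fun k => z ^ 2 / (1 + κ k * z ^ 2)) atTop
          (𝓝 (z ^ 2 / (1 + 0 * z ^ 2))) :=
        (tendsto_const_nhds (x := z ^ 2)).div ((hκ.mul_const (z ^ 2)).const_add 1) (by simp)
      simpa using this
    have h2 := (h1.add hδ).rpow_const (p := a - 1) (.inl (by simpa using hz2.ne'))
    have h3 := h1.mul h2
    rw [add_zero] at h3
    have e : z ^ 2 * (z ^ 2) ^ (a - 1) = |z| ^ (2 * a) := by
      rw [Real.rpow_sub_one hz2.ne', mul_div_cancel₀ _ hz2.ne', ← sq_abs,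
        ← Real.rpow_natCast, ← Real.rpow_mul (abs_nonneg z)]
      norm_num
    rw [← e]
    exact h3

end RenormFun

/-! ## Uniqueness -/

section Uniqueness

variable {n : ℕ} {T : EReal} {s s' : ℝ≥0∞} {b : HeisField n} {D c u v : ℝ → Heis n → ℝ}
  {u₀ v₀ : Heis n → ℝ} {φ : ℝ × Heis n → ℝ}

theorem MemMixedLoc.sub (hs : 1 ≤ s) (hu : MemMixedLoc T ∞ s u) (hv : MemMixedLoc T ∞ s v) :
    MemMixedLoc T ∞ s fun τ p => u τ p - v τ p := by
  refine ⟨hu.1.sub hv.1, fun K hK => ?_⟩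
  obtain ⟨M, hM, h1⟩ := hu.exists_bound hK
  obtain ⟨N, hN, h2⟩ := hv.exists_bound hK
  rw [eLpNorm_exponent_top]
  refine (essSup_le_of_ae_le (M + N) ?_).trans_lt (ENNReal.add_lt_top.2 ⟨hM.lt_top, hN.lt_top⟩)
  filter_upwards [h1, h2, hu.1.prodMk_left, hv.1.prodMk_left] with τ h1 h2 m1 m2
  rw [enorm_eq_self]
  exact (eLpNorm_sub_le m1.restrict m2.restrict hs).trans (add_le_add h1 h2)

variable [hss : ENNReal.HolderConjugate s s']

theorem IsWeakSolution.sub (hd : IsTransportData T s' b D c) (hT : 0 < T)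
    (hu : MemMixedLoc T ∞ s u) (hv : MemMixedLoc T ∞ s v) (hu₀ : LocallyIntegrable u₀ volume)
    (hv₀ : LocallyIntegrable v₀ volume) (h1 : IsWeakSolution T b D c u₀ u)
    (h2 : IsWeakSolution T b D c v₀ v) :
    IsWeakSolution T b D c (fun p => u₀ p - v₀ p) fun τ p => u τ p - v τ p := by
  rw [isWeakSolution_iff hd hT (hu.sub (ENNReal.HolderConjugate.one_le s s') hv)]
  rw [isWeakSolution_iff hd hT hu] at h1
  rw [isWeakSolution_iff hd hT hv] at h2
  intro φ hφ
  have hφ0 : Continuous fun p : Heis n => φ (0, p) :=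
    hφ.1.continuous.comp (continuous_const.prodMk continuous_id)
  have hφc : HasCompactSupport fun p : Heis n => φ (0, p) :=
    HasCompactSupport.intro (hφ.2.1.image continuous_snd) fun p hp =>
      image_eq_zero_of_notMem_tsupport fun h => hp (mem_image_of_mem Prod.snd h)
  simp only [sub_mul]
  rw [integral_sub (integrable_mul_testRate hd hT hu hφ) (integrable_mul_testRate hd hT hv hφ),
    integral_sub (integrable_mul_of_hasCompactSupport hu₀ hφ0 hφc)
      (integrable_mul_of_hasCompactSupport hv₀ hφ0 hφc), h1 φ hφ, h2 φ hφ]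

/-- The difference of two solutions has initial value zero. With `β(z) = z²/(1+z²)`, which is
bounded and vanishes only at `0`, the stability estimate forces the difference to vanish. -/
theorem weakSolution_ae_eq (hn : 1 ≤ n) (hd : IsTransportData T s' b D c) (hT : 0 < T)
    (hgrowth : HasGrowth T b) (hu : MemMixedLoc T ∞ s u) (hv : MemMixedLoc T ∞ s v)
    (hu₀ : MemLpLoc u₀ s) (h1 : IsWeakSolution T b D c u₀ u) (h2 : IsWeakSolution T b D c u₀ v) :
    Function.uncurry u =ᵐ[spaceTimeMeasure n T] Function.uncurry v := by
  have hs := ENNReal.HolderConjugate.one_le s s'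
  have hw := hu.sub hs hv
  have h0l := hu₀.locallyIntegrable hs
  have h3 := IsWeakSolution.sub hd hT hu hv h0l h0l h1 h2
  simp only [sub_self] at h3
  have h00 : MemLpLoc (fun _ : Heis n => (0 : ℝ)) s := fun K _ => MemLp.zero'
  obtain ⟨B, hB, hB'⟩ := exists_bound_renormFun 1 one_pos one_pos
  have h4 := ae_lintegral_stability hn hd hgrowth hw h00 h3
    (contDiff_renormFun 1 one_pos zero_le_one) hB hB'
    (abs_mul_deriv_renormFun_le 1 one_pos zero_le_one) (by positivity)
  have e0 : renormFun 1 1 1 0 = 0 := by simp [renormFun]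
  simp only [e0, ENNReal.ofReal_zero, lintegral_zero, mul_zero, nonpos_iff_eq_zero] at h4
  have m : AEStronglyMeasurable (fun z : ℝ × Heis n => renormFun 1 1 1 (u z.1 z.2 - v z.1 z.2))
      (spaceTimeMeasure n T) :=
    (contDiff_renormFun 1 one_pos zero_le_one).continuous.comp_aestronglyMeasurable
      (hu.1.sub hv.1)
  have h5 : ∫⁻ z, ENNReal.ofReal (renormFun 1 1 1 (u z.1 z.2 - v z.1 z.2))
      ∂(spaceTimeMeasure n T) = 0 := by
    rw [spaceTimeMeasure, lintegral_prod _ m.aemeasurable.ennreal_ofReal,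
      lintegral_congr_ae h4, lintegral_zero]
  rw [lintegral_eq_zero_iff' m.aemeasurable.ennreal_ofReal] at h5
  filter_upwards [h5] with z hz
  by_contra h
  have h6 := renormFun_pos (a := 1) one_pos zero_le_one (sub_ne_zero.2 h)
  rw [Pi.zero_apply, ENNReal.ofReal_eq_zero] at hz
  exact hz.not_gt h6

end Uniqueness

/-! ## The a priori estimate for the dual problem -/

section APriori

variable {n : ℕ} {T : EReal} {s s' : ℝ≥0∞} {b : HeisField n} {D c : ℝ → Heis n → ℝ}
  {φ : ℝ × Heis n → ℝ} {T₁ δ : ℝ}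

/-- For `a = 1/2` and `κ = 0` the function `z² (z²+δ)^{-1/2}` approximates `|z|`. No truncation is
needed, since it is applied to compactly supported test functions, and the bound `2` is uniform in
`δ`. -/
theorem abs_deriv_renormFun_half_le (hδ : 0 < δ) (z : ℝ) :
    |deriv (renormFun (1 / 2) δ 0) z| ≤ 2 := by
  rw [(hasDerivAt_renormFun (1 / 2) hδ le_rfl z).deriv]
  simp only [zero_mul, add_zero, one_pow, div_one]
  have hp : 0 < z ^ 2 + δ := by positivity
  have e1 : (z ^ 2 + δ) ^ ((1 : ℝ) / 2 - 1) = (Real.sqrt (z ^ 2 + δ))⁻¹ := by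
    rw [Real.sqrt_eq_rpow, ← Real.rpow_neg hp.le]; norm_num
  have h1 : |z| ≤ Real.sqrt (z ^ 2 + δ) := Real.abs_le_sqrt (by linarith)
  have h2 : z ^ 2 / (z ^ 2 + δ) ∈ Icc (0 : ℝ) 1 :=
    ⟨by positivity, (div_le_one hp).2 (by linarith)⟩
  have hs : 0 < Real.sqrt (z ^ 2 + δ) := Real.sqrt_pos.2 hp
  have h3 : |1 + (1 / 2 - 1) * (z ^ 2 / (z ^ 2 + δ))| ≤ 1 :=
    abs_le.2 ⟨by linarith [h2.1, h2.2], by linarith [h2.1]⟩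
  have h4 : |z| * (Real.sqrt (z ^ 2 + δ))⁻¹ ≤ 1 := by
    rw [← div_eq_mul_inv]; exact (div_le_one hs).2 h1
  rw [e1, abs_mul, abs_mul, abs_mul, abs_two, abs_of_pos (inv_pos.2 hs)]
  calc _ = 2 * ((|z| * (Real.sqrt (z ^ 2 + δ))⁻¹) *
        |1 + (1 / 2 - 1) * (z ^ 2 / (z ^ 2 + δ))|) := by ring
    _ ≤ 2 * (1 * 1) := by gcongr
    _ = 2 := by norm_num

theorem integral_comp_of_isContactSlice {ψ : Heis n → ℝ} {g : HorIdx n → Heis n → ℝ}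
    {H : HorIdx n → HorIdx n → Heis n → ℝ} {a : FrameIdx n → Heis n → ℝ} {d : Heis n → ℝ}
    (hb : IsContactSlice s' ψ g H a d) (ha : ∀ i, LocallyIntegrable (a i) volume)
    {w : Heis n → ℝ} (hw : ContDiff ℝ (⊤ : ℕ∞) w) {K : Set (Heis n)} (hK : IsCompact K)
    (hwK : ∀ p ∉ K, w p = 0) {β : ℝ → ℝ} (hβ : ContDiff ℝ (⊤ : ℕ∞) β) (hβ0 : β 0 = 0) :
    ∫ p in K, (deriv β (w p) * ∑ i, a i p * frameDeriv i w p + d p * β (w p)) = 0 := by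
  have hφ : ContDiff ℝ (⊤ : ℕ∞) fun p => β (w p) := hβ.comp hw
  have hφ0 : ∀ p ∉ K, β (w p) = 0 := fun p hp => by rw [hwK p hp, hβ0]
  have hφc : HasCompactSupport fun p => β (w p) := HasCompactSupport.intro hK hφ0
  have h1 := hb.integral_div _ hφ hφc
  have hder : ∀ i p, frameDeriv i (fun p => β (w p)) p = deriv β (w p) * frameDeriv i w p :=
    fun i p => by
      have d2 : HasFDerivAt (fun p => β (w p)) (deriv β (w p) • fderiv ℝ w p) p :=
        ((hβ.differentiable (by simp)) (w p)).hasDerivAt.comp_hasFDerivAt p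
          ((hw.differentiable (by simp)) p).hasFDerivAt
      rw [frameDeriv, d2.fderiv]
      rfl
  have i1 : Integrable fun p => ∑ i, a i p * frameDeriv i (fun p => β (w p)) p :=
    integrable_finsetSum _ fun i _ => integrable_mul_of_hasCompactSupport (ha i)
      (continuous_frameDeriv (hφ.of_le (by simp)) i) (hasCompactSupport_frameDeriv hφc i)
  have i2 : Integrable fun p => β (w p) * d p :=
    (integrable_mul_of_hasCompactSupport (hb.memLp_div.locallyIntegrable le_top) hφ.continuous
      hφc).congr (.of_forall fun p => by simp only [mul_comm])
  have e : ∀ p, deriv β (w p) * ∑ i, a i p * frameDeriv i w p + d p * β (w p) =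
      (∑ i, a i p * frameDeriv i (fun p => β (w p)) p) + β (w p) * d p := fun p => by
    simp only [hder, Finset.mul_sum]
    congr 1
    · exact Finset.sum_congr rfl fun i _ => by ring
    · ring
  simp only [e]
  rw [setIntegral_eq_integral_of_forall_compl_eq_zero, integral_add i1 i2, h1, neg_add_cancel]
  intro p hp
  have : w =ᶠ[𝓝 p] fun _ => 0 := by
    filter_upwards [hK.isClosed.isOpen_compl.mem_nhds hp] with q hq using hwK q hq
  have h2 : ∀ i, frameDeriv i w p = 0 := fun i => by rw [frameDeriv, this.fderiv_eq]; simp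
  simp only [hder, h2, hφ0 p hp]
  simp

/-- With `x = β(φ)` and `y = φ`, the bound `|φ β'(φ)| ≤ 3 β(φ)` makes `c` cost `3 |c| β`, and `D`
cost `3 |D| β` besides the `|D| β` of the divergence identity. This explains the rate `4 |D| + 3
|c|`. -/
theorem apriori_pointwise {E M a x x' d e y L S : ℝ} (hE : E ∈ Icc 0 M)
    (hx' : |x'| ≤ 2) (hy : |y * x'| ≤ 3 * x) (ha : a = 4 * |d| + 3 * |e|)
    {A : ℝ} (haA : a ≤ A) (hx : 0 ≤ x) :
    -(2 * M * |L|) ≤ E * (A * x) + E * (x' * (S + (e + d) * y - L)) - E * (x' * S + d * x) := by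
  have h1 : -(d * x) ≥ -(|d| * x) := by
    nlinarith [le_abs_self d]
  have h2 : (e + d) * (y * x') ≥ -((|e| + |d|) * (3 * x)) := by
    have h3 : |(e + d) * (y * x')| ≤ (|e| + |d|) * (3 * x) := by
      rw [abs_mul]
      exact mul_le_mul (abs_add_le e d) hy (abs_nonneg _) (by positivity)
    linarith [neg_abs_le ((e + d) * (y * x'))]
  have h4 : x' * L ≤ 2 * |L| := by
    refine (le_abs_self _).trans ?_
    rw [abs_mul]
    exact mul_le_mul_of_nonneg_right hx' (abs_nonneg _)
  have h5 : a * x ≤ A * x := mul_le_mul_of_nonneg_right haA hx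
  have h6 : 0 ≤ E * (A * x + x' * ((e + d) * y) - d * x - x' * L + 2 * |L|) := by
    refine mul_nonneg hE.1 ?_
    have e1 : a * x = 4 * |d| * x + 3 * |e| * x := by rw [ha]; ring
    linarith
  have h7 : E * (2 * |L|) ≤ M * (2 * |L|) := mul_le_mul_of_nonneg_right hE.2 (by positivity)
  linarith

variable [hss : ENNReal.HolderConjugate s s']

theorem integrable_testRate (s : ℝ≥0∞) [hss : ENNReal.HolderConjugate s s']
    (hd : IsTransportData T s' b D c) (hT : 0 < T) (hφ : IsTestFunction T φ) :
    Integrable (fun z : ℝ × Heis n => testRate b D c φ z.1 z.2) (spaceTimeMeasure n T) := by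
  have := integrable_mul_testRate (s := s) hd hT memMixedLoc_one hφ
  simpa only [one_mul] using this

/-- The derivative of `e^{A(τ)} β(φ(τ,p))` is integrated over time and space; its integral is `-∫
β(φ(0,·))` because `φ` vanishes at `T₁`. Inserting the operator for `∂_τ φ` and subtracting the
divergence identity for `β(φ)` leaves zeroth order terms, absorbed by `A`, and the operator itself
with the factor `β'`. Test functions are smooth with compact support, so neither mollification nor
the growth condition is involved. -/
theorem integral_renormFun_initial_le (s : ℝ≥0∞) [hss : ENNReal.HolderConjugate s s']
    (hd : IsTransportData T s' b D c) (hT : 0 < T) (hφ : IsTestFunction T φ) (hδ : 0 < δ) :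
    Integrable (fun p : Heis n => renormFun (1 / 2) δ 0 (φ (0, p))) ∧
    ∫ p, renormFun (1 / 2) δ 0 (φ (0, p)) ≤
      2 * Real.exp (∫ τ, (4 * supNorm D τ + 3 * supNorm c τ) ∂(timeMeasure T)) *
        ∫ z, |testRate b D c φ z.1 z.2| ∂(spaceTimeMeasure n T) := by
  obtain ⟨T₁, h0, hT₁, K, hK, hsupp⟩ := hφ.exists_support hT
  set β := renormFun (1 / 2) δ 0 with hβdef
  set a : ℝ → ℝ := fun τ => 4 * supNorm D τ + 3 * supNorm c τ with ha
  set A := ∫ τ, a τ ∂(timeMeasure T) with hA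
  have hβ : ContDiff ℝ (⊤ : ℕ∞) β := contDiff_renormFun _ hδ le_rfl
  have hβ1 : Continuous (deriv β) := hβ.continuous_deriv (by simp)
  have hβ0 : β 0 = 0 := by simp [hβdef, renormFun]
  have hβn := renormFun_nonneg (1 / 2) hδ le_rfl
  have ha1 : Integrable a (timeMeasure T) :=
    (hd.div.integrable_supNorm.const_mul 4).add (hd.zeroth.integrable_supNorm.const_mul 3)
  have ha0 : ∀ τ, 0 ≤ a τ := fun τ =>
    add_nonneg (mul_nonneg (by norm_num) (supNorm_nonneg _ _))
      (mul_nonneg (by norm_num) (supNorm_nonneg _ _))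
  have hφK : ∀ τ, ∀ p ∉ K, φ (τ, p) = 0 := fun τ p hp =>
    image_eq_zero_of_notMem_tsupport fun h => hp (hsupp h).2
  have hφT : ∀ p, φ (T₁, p) = 0 := fun p =>
    image_eq_zero_of_notMem_tsupport fun h => lt_irrefl T₁ (hsupp h).1
  have hb : ∀ F : ℝ × Heis n → ℝ, Continuous F → (∀ z ∉ tsupport φ, F z = 0) →
      ∃ B : ℝ, ∀ z, ‖F z‖ ≤ B := fun F hF hF0 =>
    (HasCompactSupport.intro hφ.2.1 hF0).exists_bound_of_continuous hF
  -- the exponential factor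
  set E : ℝ → ℝ := fun τ => Real.exp (timePrim a τ) with hE
  have hEac : HasACDeriv T₁ E fun τ => E τ * a τ := by
    have := (hasACDeriv_timePrim ha1 h0 hT₁).comp Real.contDiff_exp
    simpa only [Real.deriv_exp] using this
  have hEb : ∀ τ ∈ Icc 0 T₁, E τ ∈ Icc 0 (Real.exp A) := fun τ hτ =>
    ⟨(Real.exp_pos _).le, Real.exp_le_exp.2 (timePrim_mem_Icc ha1 ha0 hT₁ hτ).2⟩
  have hEm : AEStronglyMeasurable (fun z : ℝ × Heis n => E z.1) (slab T₁ K) :=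
    (hEac.bounded_slab h0 hK (Ψ := fun z : Heis n × ℝ => z.2) continuous_snd).2
  have hEn : ∀ᵐ z ∂(slab T₁ K), ‖E z.1‖ ≤ Real.exp A := ae_slab hK fun τ hτ p _ => by
    have := hEb τ (Ioc_subset_Icc_self hτ)
    rw [Real.norm_of_nonneg this.1]
    exact this.2
  -- continuity
  have c0 : Continuous fun z : ℝ × Heis n => fderiv ℝ φ z (1, 0) :=
    (hφ.1.continuous_fderiv (by simp)).clm_apply continuous_const
  have c1 := fun i => continuous_frameDeriv_section hφ.1 i
  have cβ : Continuous fun z : ℝ × Heis n => β (φ z) := hβ.continuous.comp hφ.1.continuous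
  have cβ' : Continuous fun z : ℝ × Heis n => deriv β (φ z) := hβ1.comp hφ.1.continuous
  have s0 : ∀ z ∉ tsupport φ, fderiv ℝ φ z (1, 0) = 0 := fun z hz => by
    simp [fderiv_eq_zero_of_notMem_tsupport hz]
  have s1 : ∀ i, ∀ z ∉ tsupport φ, frameDeriv i (fun q => φ (z.1, q)) z.2 = 0 := fun i z hz => by
    simp [frameDeriv_section hφ.1, fderiv_eq_zero_of_notMem_tsupport hz]
  have sβ : ∀ z ∉ tsupport φ, β (φ z) = 0 := fun z hz => by
    rw [image_eq_zero_of_notMem_tsupport hz, hβ0]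
  -- the derivative of the weighted integrand
  let F : ℝ × Heis n → ℝ := fun z => E z.1 * (a z.1 * β (φ z)) +
    E z.1 * (deriv β (φ z) * fderiv ℝ φ z (1, 0))
  let H : ℝ × Heis n → ℝ := fun z => E z.1 * (deriv β (φ z) *
    ∑ i, b z.1 z.2 i * frameDeriv i (fun q => φ (z.1, q)) z.2 + D z.1 z.2 * β (φ z))
  have iF : Integrable F (slab T₁ K) := by
    refine Integrable.add ?_ ?_
    · obtain ⟨B, hB⟩ := hb _ cβ sβ
      have h1 := integrable_slab_time (K := K) (ha1.mono_measure (restrict_Ioc_le_timeMeasure hT₁))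
        hK
      exact (h1.mul_bdd cβ.aestronglyMeasurable (.of_forall hB)).bdd_mul hEm hEn
    · have hc : Integrable (fun z : ℝ × Heis n => deriv β (φ z) * fderiv ℝ φ z (1, 0)) volume :=
        (cβ'.mul c0).integrable_of_hasCompactSupport
          (HasCompactSupport.intro hφ.2.1 fun z hz => by simp [s0 z hz])
      exact (hc.mono_measure (Measure.prod_mono Measure.restrict_le_self
        Measure.restrict_le_self)).bdd_mul hEm hEn
  have iH : Integrable H (slab T₁ K) := by
    refine Integrable.bdd_mul (Integrable.add ?_ ?_) hEm hEn
    · simp only [Finset.mul_sum]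
      refine integrable_finsetSum _ fun i _ => ?_
      obtain ⟨B, hB⟩ := hb (fun z => deriv β (φ z) * frameDeriv i (fun q => φ (z.1, q)) z.2)
        (cβ'.mul (c1 i)) fun z hz => by rw [s1 i z hz, mul_zero]
      refine ((integrable_slab_coeff s hd hK hT₁ i).bdd_mul
        (cβ'.mul (c1 i)).aestronglyMeasurable (.of_forall hB)).congr (.of_forall fun z => ?_)
      simp only [Pi.mul_apply]
      ring
    · obtain ⟨B, hB⟩ := hb _ cβ sβ
      exact (integrable_slab_of_memMixed_top hd.div hK hT₁).mul_bdd cβ.aestronglyMeasurable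
        (.of_forall hB)
  have eF : ∫ z, F z ∂(slab T₁ K) = -∫ p in K, β (φ (0, p)) := by
    rw [integral_prod_symm _ iF, ← integral_neg]
    refine integral_congr_ae (.of_forall fun p => ?_)
    have hφp : ContDiff ℝ 1 fun τ => β (φ (τ, p)) :=
      (hβ.comp (hφ.1.comp (contDiff_id.prodMk contDiff_const))).of_le (by simp)
    have h1 := (hEac.mul (HasACDeriv.of_contDiff (T₀ := T₁) hφp)).integral_eq
    have h2 : ∀ τ, deriv (fun τ => β (φ (τ, p))) τ =
        deriv β (φ (τ, p)) * fderiv ℝ φ (τ, p) (1, 0) := fun τ => by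
      have d1 : HasDerivAt (fun τ => φ (τ, p)) (fderiv ℝ φ (τ, p) (1, 0)) τ :=
        ((hφ.1.differentiable (by simp)) (τ, p)).hasFDerivAt.comp_hasDerivAt τ
          ((hasDerivAt_id τ).prodMk (hasDerivAt_const τ p))
      exact ((((hβ.differentiable (by simp)) (φ (τ, p))).hasDerivAt).comp τ d1).deriv
    have hE0 : E 0 = 1 := by simp [hE, timePrim]
    simp only [h2, hφT, hβ0, hE0, mul_zero, one_mul, zero_sub,
      intervalIntegral.integral_of_le h0.le] at h1
    refine Eq.trans ?_ h1
    refine integral_congr_ae (.of_forall fun τ => ?_)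
    simp only [F]
    ring
  have hle : slab T₁ K ≤ spaceTimeMeasure n T :=
    Measure.prod_mono (restrict_Ioc_le_timeMeasure hT₁) Measure.restrict_le_self
  have eH : ∫ z, H z ∂(slab T₁ K) = 0 := by
    obtain ⟨ψ, g, H', -, hslice⟩ := hd.slice
    have hs1' : 1 ≤ s' := by
      have : ENNReal.HolderConjugate s' s := ENNReal.HolderConjugate.symm
      exact ENNReal.HolderConjugate.one_le s' s
    rw [integral_prod _ iH]
    refine (integral_congr_ae ?_).trans (integral_zero _ _)
    filter_upwards [ae_mono (restrict_Ioc_le_timeMeasure hT₁) hslice] with τ h1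
    simp only [H]
    rw [integral_const_mul, integral_comp_of_isContactSlice h1
      (fun i => (h1.memLp_coeff i).locallyIntegrable hs1')
      (w := fun p => φ (τ, p)) (hφ.1.comp (contDiff_const.prodMk contDiff_id)) hK (hφK τ) hβ hβ0,
      mul_zero]
  have iL := integrable_testRate s hd hT hφ
  have hest : ∀ᵐ z ∂(slab T₁ K), -(2 * Real.exp A * |testRate b D c φ z.1 z.2|) ≤ F z - H z := by
    have h2 : ∀ᵐ z ∂(slab T₁ K), |D z.1 z.2| ≤ supNorm D z.1 := ae_mono hle hd.div.ae_le_supNorm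
    have h3 : ∀ᵐ z ∂(slab T₁ K), |c z.1 z.2| ≤ supNorm c z.1 :=
      ae_mono hle hd.zeroth.ae_le_supNorm
    have hτ : ∀ᵐ z ∂(slab T₁ K), z.1 ∈ Ioc 0 T₁ := ae_slab hK fun τ hτ p hp => hτ
    filter_upwards [h2, h3, hτ] with ⟨τ, p⟩ h2 h3 hτ
    have h5 := abs_mul_deriv_renormFun_le (1 / 2) hδ le_rfl (φ (τ, p))
    have e5 : 2 * (1 + |(1 : ℝ) / 2 - 1|) = 3 := by
      rw [show (1 : ℝ) / 2 - 1 = -(1 / 2) by norm_num, abs_neg, abs_of_pos (by norm_num)]; norm_num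
    rw [e5] at h5
    have h4 := apriori_pointwise (E := E τ) (L := testRate b D c φ τ p)
      (S := ∑ i, b τ p i * frameDeriv i (fun q => φ (τ, q)) p)
      (hEb τ (Ioc_subset_Icc_self hτ)) (abs_deriv_renormFun_half_le hδ (φ (τ, p))) h5
      (d := D τ p) (e := c τ p) rfl (A := a τ) (by simp only [ha]; linarith) (hβn (φ (τ, p)))
    refine h4.trans (le_of_eq ?_)
    simp only [F, H, testRate]
    ring
  have hint := integral_mono_ae (((iL.mono_measure hle).abs.const_mul (2 * Real.exp A)).neg)
    (iF.sub iH) hest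
  rw [integral_sub' iF iH, eF, eH] at hint
  have e2 : ∫ z, -(2 * Real.exp A * |testRate b D c φ z.1 z.2|) ∂(slab T₁ K) =
      -(2 * Real.exp A * ∫ z, |testRate b D c φ z.1 z.2| ∂(slab T₁ K)) := by
    rw [integral_neg, integral_const_mul]
  have h7 : ∫ z, |testRate b D c φ z.1 z.2| ∂(slab T₁ K) ≤
      ∫ z, |testRate b D c φ z.1 z.2| ∂(spaceTimeMeasure n T) :=
    integral_mono_measure hle (.of_forall fun z => abs_nonneg _) iL.abs
  have hcont : Continuous fun p : Heis n => β (φ (0, p)) :=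
    cβ.comp (continuous_const.prodMk continuous_id)
  refine ⟨hcont.integrable_of_hasCompactSupport (HasCompactSupport.intro hK fun p hp => by
    rw [hφK 0 p hp, hβ0]), ?_⟩
  rw [← setIntegral_eq_integral_of_forall_compl_eq_zero (s := K) fun p hp => by
    rw [hφK 0 p hp, hβ0]]
  have h8 := mul_le_mul_of_nonneg_left h7 (by positivity : 0 ≤ 2 * Real.exp A)
  have h9 : -(2 * Real.exp A * ∫ z, |testRate b D c φ z.1 z.2| ∂(slab T₁ K)) ≤
      -(∫ p in K, β (φ (0, p))) - 0 := e2.symm.le.trans hint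
  linarith

/-- The `L¹` norm of the initial values of a test function is controlled by the transport
operator. -/
theorem integral_abs_initial_le (s : ℝ≥0∞) [hss : ENNReal.HolderConjugate s s']
    (hd : IsTransportData T s' b D c) (hT : 0 < T) (hφ : IsTestFunction T φ) :
    ∫ p, |φ (0, p)| ≤
      2 * Real.exp (∫ τ, (4 * supNorm D τ + 3 * supNorm c τ) ∂(timeMeasure T)) *
        ∫ z, |testRate b D c φ z.1 z.2| ∂(spaceTimeMeasure n T) := by
  have hφ0 : Continuous fun p : Heis n => φ (0, p) :=
    hφ.1.continuous.comp (continuous_const.prodMk continuous_id)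
  have hφc : HasCompactSupport fun p : Heis n => φ (0, p) :=
    HasCompactSupport.intro (hφ.2.1.image continuous_snd) fun p hp =>
      image_eq_zero_of_notMem_tsupport fun h => hp (mem_image_of_mem Prod.snd h)
  have hi : Integrable (fun p : Heis n => |φ (0, p)|) :=
    (hφ0.integrable_of_hasCompactSupport hφc).abs
  have hk : ∀ k : ℕ, 0 < 1 / ((k : ℝ) + 1) := fun k => by positivity
  have lim : Tendsto (fun k : ℕ => ∫ p, renormFun (1 / 2) (1 / ((k : ℝ) + 1)) 0 (φ (0, p))) atTop
      (𝓝 (∫ p, |φ (0, p)|)) := by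
    refine tendsto_integral_of_dominated_convergence (fun p => |φ (0, p)|)
      (fun k => ((contDiff_renormFun _ (hk k) le_rfl).continuous.comp hφ0).aestronglyMeasurable)
      hi (fun k => .of_forall fun p => ?_) (.of_forall fun p => ?_)
    · rw [Real.norm_of_nonneg (renormFun_nonneg _ (hk k) le_rfl _), renormFun]
      simp only [zero_mul, add_zero, div_one]
      set z := φ (0, p)
      have hp : 0 < z ^ 2 + 1 / ((k : ℝ) + 1) := by have := hk k; positivity
      have e1 : (z ^ 2 + 1 / ((k : ℝ) + 1)) ^ ((1 : ℝ) / 2 - 1) =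
          (Real.sqrt (z ^ 2 + 1 / ((k : ℝ) + 1)))⁻¹ := by
        rw [Real.sqrt_eq_rpow, ← Real.rpow_neg hp.le]; norm_num
      have h1 : |z| ≤ Real.sqrt (z ^ 2 + 1 / ((k : ℝ) + 1)) :=
        Real.abs_le_sqrt (by linarith [hk k])
      rw [e1, ← div_eq_mul_inv, div_le_iff₀ (Real.sqrt_pos.2 hp)]
      refine (show z ^ 2 = |z| * |z| by rw [← sq, sq_abs]).trans_le ?_
      exact mul_le_mul_of_nonneg_left h1 (abs_nonneg z)
    · have := tendsto_renormFun (1 / 2) (φ (0, p)) (by norm_num)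
        tendsto_one_div_add_atTop_nhds_zero_nat (tendsto_const_nhds (x := (0 : ℝ)))
      simpa using this
  exact le_of_tendsto' lim fun k => (integral_renormFun_initial_le s hd hT hφ (hk k)).2

end APriori

/-! ## Functionals on integrable functions -/

section Duality

variable {α : Type*} [MeasurableSpace α] {μ : Measure α}

/-- The space of integrable functions. -/
def integrableSubmodule (μ : Measure α) : Submodule ℝ (α → ℝ) where
  carrier := {F | Integrable F μ}
  add_mem' := fun h1 h2 => h1.add h2
  zero_mem' := integrable_zero _ _ _
  smul_mem' := fun a _ h => h.smul a

/-- This is the duality of `L¹` and `L^∞`, stated for a functional on genuine functions so that it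
can follow Hahn–Banach directly. The one-sided bound suffices because `F` may be replaced by `-F`,
and it implies that the functional respects equality a.e. -/
theorem exists_bounded_density [SigmaFinite μ] (g : integrableSubmodule μ →ₗ[ℝ] ℝ) {C : ℝ}
    (hg : ∀ F : integrableSubmodule μ, g F ≤ C * ∫ x, |F.1 x| ∂μ) :
    ∃ u : α → ℝ, StronglyMeasurable u ∧ (∀ᵐ x ∂μ, |u x| ≤ C) ∧
      ∀ F : integrableSubmodule μ, g F = ∫ x, u x * F.1 x ∂μ := by
  have habs : ∀ F, |g F| ≤ C * ∫ x, |F.1 x| ∂μ := fun F => by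
    refine abs_le'.2 ⟨hg F, ?_⟩
    have := hg (-F)
    simpa using this
  have hcongr : ∀ F F' : integrableSubmodule μ, F.1 =ᵐ[μ] F'.1 → g F = g F' := fun F F' h => by
    rw [← sub_eq_zero, ← map_sub, ← abs_nonpos_iff]
    refine (habs _).trans (le_of_eq ?_)
    rw [integral_eq_zero_of_ae, mul_zero]
    filter_upwards [h] with x hx
    simp [hx]
  -- A strictly positive integrable density replaces `μ` by an equivalent finite measure `ν`. Then
  -- `L²(ν) ⊂ L¹(ν)`, and writing `F = w h` reduces the representation to the theorem of Riesz in
  -- `L²(ν)`.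
  obtain ⟨w, hw0, hwm, hw1⟩ := exists_pos_lintegral_lt_of_sigmaFinite μ one_ne_zero
  set ν := μ.withDensity fun x => (w x : ℝ≥0∞) with hν
  have : IsFiniteMeasure ν := isFiniteMeasure_withDensity (hw1.trans_le le_top).ne
  let J : ∀ h : α → ℝ, Integrable h ν → integrableSubmodule μ := fun h hh =>
    ⟨fun x => w x • h x, (integrable_withDensity_iff_integrable_smul hwm).1 hh⟩
  have hJ : ∀ h hh, |g (J h hh)| ≤ C * ∫ x, |h x| ∂ν := fun h hh => by
    refine (habs _).trans (le_of_eq ?_)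
    rw [hν, integral_withDensity_eq_integral_smul hwm]
    congr 2 with x
    simp only [J, NNReal.smul_def, smul_eq_mul, abs_mul, NNReal.abs_eq]
  have hae : ∀ {P : α → Prop}, (∀ᵐ x ∂ν, P x) → ∀ᵐ x ∂μ, P x := fun h => by
    rw [hν, ae_withDensity_iff hwm.coe_nnreal_ennreal] at h
    exact h.mono fun x hx => hx (by simpa using (hw0 x).ne')
  have hJcongr : ∀ h hh h' hh', h =ᵐ[ν] h' → g (J h hh) = g (J h' hh') := fun h hh h' hh' e =>
    hcongr _ _ ((hae e).mono fun x hx => by simp only [J, hx])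
  have h21 : ∀ h : Lp ℝ 2 ν, Integrable h ν := fun h =>
    (Lp.memLp h).integrable one_le_two
  let Λ₀ : Lp ℝ 2 ν →ₗ[ℝ] ℝ :=
    { toFun := fun h => g (J h (h21 h))
      map_add' := fun h h' => by
        rw [← map_add, hJcongr _ (h21 _) _ ((h21 h).add (h21 h')) (Lp.coeFn_add h h')]
        congr 1
        ext x
        simp [J, smul_add]
      map_smul' := fun r h => by
        rw [RingHom.id_apply, ← map_smul, hJcongr _ (h21 _) _ ((h21 h).smul r) (Lp.coeFn_smul r h)]
        congr 1
        ext x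
        simp only [J, Pi.smul_apply, smul_eq_mul, NNReal.smul_def, SetLike.val_smul]
        ring }
  have hΛ : ∀ h : Lp ℝ 2 ν, ‖Λ₀ h‖ ≤
      |C| * (ν univ ^ (1 / (1 : ℝ≥0∞).toReal - 1 / (2 : ℝ≥0∞).toReal)).toReal * ‖h‖ := fun h => by
    have h1 : eLpNorm h 1 ν ≤ eLpNorm h 2 ν *
        ν univ ^ (1 / (1 : ℝ≥0∞).toReal - 1 / (2 : ℝ≥0∞).toReal) :=
      eLpNorm_le_eLpNorm_mul_rpow_measure_univ one_le_two (Lp.aestronglyMeasurable h)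
    have h2 : eLpNorm h 2 ν * ν univ ^ (1 / (1 : ℝ≥0∞).toReal - 1 / (2 : ℝ≥0∞).toReal) ≠ ∞ :=
      ENNReal.mul_ne_top (Lp.eLpNorm_ne_top h)
        (ENNReal.rpow_ne_top_of_nonneg (by norm_num) (measure_ne_top ν _))
    have h3 := ENNReal.toReal_mono h2 h1
    rw [eLpNorm_one_eq_lintegral_enorm, ← integral_norm_eq_lintegral_enorm (h21 h).1,
      ENNReal.toReal_mul, ← Lp.norm_def] at h3
    refine (hJ _ (h21 h)).trans ((mul_le_mul (le_abs_self C) h3 (integral_nonneg fun x => abs_nonneg _)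
      (abs_nonneg C)).trans (le_of_eq ?_))
    ring
  let Λ : StrongDual ℝ (Lp ℝ 2 ν) := Λ₀.mkContinuous _ hΛ
  set v : Lp ℝ 2 ν := (InnerProductSpace.toDual ℝ (Lp ℝ 2 ν)).symm Λ with hv
  have hrep : ∀ h (hh : Integrable h ν), MemLp h 2 ν → g (J h hh) = ∫ x, v x * h x ∂ν :=
    fun h hh hm => by
      have h1 : inner ℝ v (hm.toLp h) = Λ (hm.toLp h) := by
        rw [hv, InnerProductSpace.toDual_symm_apply]
      have h2 : Λ (hm.toLp h) = g (J h hh) :=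
        hJcongr _ (h21 _) _ hh hm.coeFn_toLp
      rw [← h2, ← h1, L2.inner_def]
      refine integral_congr_ae (hm.coeFn_toLp.mono fun x hx => ?_)
      simp only [hx]
      simp [mul_comm]
  -- Indicators as test functions bound the averages of `v` over all sets by `C`, hence `v` itself
  -- a.e.
  have hset : ∀ S, MeasurableSet S → |∫ x in S, v x ∂ν| ≤ ∫ _ in S, C ∂ν := fun S hS => by
    have hi : Integrable (S.indicator fun _ => (1 : ℝ)) ν := (integrable_const 1).indicator hS
    have h1 := hrep _ hi ((memLp_const (1 : ℝ)).indicator hS)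
    have h2 := hJ _ hi
    have e1 : ∫ x, v x * S.indicator (fun _ => (1 : ℝ)) x ∂ν = ∫ x in S, v x ∂ν := by
      rw [← integral_indicator hS]
      congr 1 with x
      by_cases hx : x ∈ S <;> simp [hx]
    have e2 : ∫ x, |S.indicator (fun _ => (1 : ℝ)) x| ∂ν = ν.real S := by
      rw [← integral_indicator_one hS]
      congr 1 with x
      by_cases hx : x ∈ S <;> simp [hx]
    rw [h1, e1, e2] at h2
    rw [setIntegral_const, smul_eq_mul, mul_comm]
    exact h2
  have hb1 : ∀ᵐ x ∂ν, v x ≤ C := ae_le_of_forall_setIntegral_le (h21 v) (integrable_const C)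
    fun S hS _ => (le_abs_self _).trans (hset S hS)
  have hb2 : ∀ᵐ x ∂ν, -v x ≤ C := ae_le_of_forall_setIntegral_le (h21 v).neg (integrable_const C)
    fun S hS _ => by
      rw [integral_neg]
      exact (neg_le_abs _).trans (hset S hS)
  have hb : ∀ᵐ x ∂μ, |v x| ≤ C := hae (by
    filter_upwards [hb1, hb2] with x h1 h2 using abs_le'.2 ⟨h1, h2⟩)
  refine ⟨v, Lp.stronglyMeasurable v, hb, fun F => ?_⟩
  -- truncation
  have hF : Integrable F.1 μ := F.2
  have hw' : Measurable fun x => (w x : ℝ) := measurable_coe_nnreal_real.comp hwm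
  let h : ℕ → α → ℝ := fun k x => max (-(k : ℝ)) (min k (F.1 x / w x))
  have hhk : ∀ k x, ‖h k x‖ ≤ k := fun k x =>
    abs_le.2 ⟨le_max_left _ _, max_le (by linarith [(k.cast_nonneg : (0 : ℝ) ≤ k)])
      (min_le_left _ _)⟩
  have hm : ∀ k, AEStronglyMeasurable (h k) μ := fun k =>
    (aemeasurable_const.max (aemeasurable_const.min
      (hF.aemeasurable.div hw'.aemeasurable))).aestronglyMeasurable
  have hm' : ∀ k, AEStronglyMeasurable (h k) ν := fun k =>
    (hm k).mono_ac (withDensity_absolutelyContinuous _ _)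
  have hM : ∀ k, MemLp (h k) 2 ν := fun k => .of_bound (hm' k) k (.of_forall (hhk k))
  have hI : ∀ k, Integrable (h k) ν := fun k => (hM k).integrable one_le_two
  have hle : ∀ k x, |w x • h k x| ≤ |F.1 x| := fun k x => by
    have hwx : (0 : ℝ) < w x := hw0 x
    have h1 : |h k x| ≤ |F.1 x / w x| := by
      have hk : (0 : ℝ) ≤ k := k.cast_nonneg
      refine abs_le.2 ⟨?_, ?_⟩
      · refine le_max_of_le_right (le_min ?_ (neg_abs_le _))
        linarith [abs_nonneg (F.1 x / w x)]
      · exact max_le (by linarith [abs_nonneg (F.1 x / w x)])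
          ((min_le_right _ _).trans (le_abs_self _))
    rw [NNReal.smul_def, smul_eq_mul, abs_mul, abs_of_pos hwx]
    rw [abs_div, abs_of_pos hwx, le_div_iff₀ hwx] at h1
    linarith
  have hlim : ∀ x, Tendsto (fun k => w x • h k x) atTop (𝓝 (F.1 x)) := fun x => by
    have hwx : (0 : ℝ) < w x := hw0 x
    refine tendsto_const_nhds.congr' ?_
    obtain ⟨m, hm⟩ := exists_nat_ge |F.1 x / w x|
    filter_upwards [eventually_ge_atTop m] with k hk
    have h1 : |F.1 x / w x| ≤ k := hm.trans (by exact_mod_cast hk)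
    simp only [h]
    rw [min_eq_right (abs_le.1 h1).2, max_eq_right (abs_le.1 h1).1, NNReal.smul_def, smul_eq_mul,
      mul_div_cancel₀ _ hwx.ne']
  have hsm : ∀ k, AEStronglyMeasurable (fun x => w x • h k x) μ := fun k => (J (h k) (hI k)).2.1
  have l1 : Tendsto (fun k => g (J (h k) (hI k))) atTop (𝓝 (g F)) := by
    rw [tendsto_iff_dist_tendsto_zero]
    have l0 : Tendsto (fun k => C * ∫ x, |w x • h k x - F.1 x| ∂μ) atTop (𝓝 (C * 0)) := by
      refine Tendsto.const_mul C ?_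
      rw [← integral_zero α ℝ (μ := μ)]
      refine tendsto_integral_of_dominated_convergence (fun x => |F.1 x| + |F.1 x|)
        (fun k => ((hsm k).sub hF.1).norm) (hF.abs.add hF.abs) (fun k => .of_forall fun x => ?_)
        (.of_forall fun x => ?_)
      · rw [Real.norm_eq_abs, abs_abs]
        exact (abs_sub _ _).trans (add_le_add (hle k x) le_rfl)
      · simpa using ((hlim x).sub_const (F.1 x)).abs
    rw [mul_zero] at l0
    refine squeeze_zero (fun _ => dist_nonneg) (fun k => ?_) l0
    rw [Real.dist_eq, ← map_sub]
    exact habs _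
  refine tendsto_nhds_unique l1 ?_
  have e : ∀ k, g (J (h k) (hI k)) = ∫ x, v x * (w x • h k x) ∂μ := fun k => by
    refine (hrep _ (hI k) (hM k)).trans ((integral_withDensity_eq_integral_smul hwm
      (fun x => v x * h k x)).trans ?_)
    congr 1 with x
    simp only [NNReal.smul_def, smul_eq_mul]
    ring
  simp only [e]
  have hvm : AEStronglyMeasurable v μ := (Lp.stronglyMeasurable v).aestronglyMeasurable
  refine tendsto_integral_of_dominated_convergence (fun x => C * |F.1 x|)
    (fun k => hvm.mul (hsm k)) (hF.abs.const_mul C) (fun k => hb.mono fun x hx => ?_)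
    (.of_forall fun x => (hlim x).const_mul _)
  rw [norm_mul]
  exact mul_le_mul hx (hle k x) (norm_nonneg _) ((abs_nonneg _).trans hx)

end Duality

/-! ## Existence of bounded solutions -/

section BoundedExistence

variable {n : ℕ} {T : EReal} {s s' : ℝ≥0∞} {b : HeisField n} {D c : ℝ → Heis n → ℝ}
  {u₀ : Heis n → ℝ} {φ φ' : ℝ × Heis n → ℝ}

/-- The space of test functions. -/
def testSubmodule (n : ℕ) (T : EReal) : Submodule ℝ (ℝ × Heis n → ℝ) where
  carrier := {φ | IsTestFunction T φ}
  add_mem' := fun h1 h2 => ⟨h1.1.add h2.1, h1.2.1.add h2.2.1, fun _ hz =>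
    (tsupport_add _ _ hz).elim (fun h => h1.2.2 h) fun h => h2.2.2 h⟩
  zero_mem' := ⟨contDiff_const, HasCompactSupport.zero, by simp⟩
  smul_mem' := fun a _ h => ⟨contDiff_const.smul h.1, h.2.1.smul_left, fun _ hz =>
    h.2.2 (tsupport_smul_subset_right (fun _ => a) _ hz)⟩

theorem testRate_add (hφ : ContDiff ℝ (⊤ : ℕ∞) φ) (hφ' : ContDiff ℝ (⊤ : ℕ∞) φ') (τ : ℝ)
    (p : Heis n) : testRate b D c (φ + φ') τ p = testRate b D c φ τ p + testRate b D c φ' τ p := by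
  have e : ∀ i, frameDeriv i (fun q => (φ + φ') (τ, q)) p =
      fderiv ℝ (φ + φ') (τ, p) (0, heisZ i p) := frameDeriv_section (hφ.add hφ') τ p
  rw [testRate]
  simp only [testRate, e, frameDeriv_section hφ, frameDeriv_section hφ']
  rw [fderiv_add ((hφ.differentiable (by simp)) _) ((hφ'.differentiable (by simp)) _)]
  simp only [add_apply, Pi.add_apply, mul_add, Finset.sum_add_distrib]
  ring

theorem testRate_smul (a : ℝ) (hφ : ContDiff ℝ (⊤ : ℕ∞) φ) (τ : ℝ) (p : Heis n) :
    testRate b D c (a • φ) τ p = a * testRate b D c φ τ p := by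
  have h1 : ContDiff ℝ (⊤ : ℕ∞) (a • φ) := contDiff_const.smul hφ
  simp only [testRate, frameDeriv_section hφ, frameDeriv_section h1]
  rw [fderiv_const_smul ((hφ.differentiable (by simp)) _)]
  simp only [smul_apply, Pi.smul_apply, smul_eq_mul, mul_add, Finset.mul_sum]
  congr 1
  · congr 1
    · ring
    · exact Finset.sum_congr rfl fun i _ => by ring
  · ring

theorem memMixed_top_of_ae_le {u : ℝ → Heis n → ℝ} {C : ℝ}
    (hm : AEStronglyMeasurable (Function.uncurry u) (spaceTimeMeasure n T))
    (hC : ∀ᵐ z ∂(spaceTimeMeasure n T), |u z.1 z.2| ≤ C) : MemMixed T ∞ ∞ u := by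
  refine ⟨hm, ?_⟩
  rw [eLpNorm_exponent_top]
  refine (essSup_le_of_ae_le (ENNReal.ofReal C) ?_).trans_lt ENNReal.ofReal_lt_top
  filter_upwards [Measure.ae_ae_of_ae_prod hC] with τ hτ
  rw [enorm_eq_self]
  exact eLpNormEssSup_le_of_ae_bound hτ

theorem memMixedLoc_of_ae_le {u : ℝ → Heis n → ℝ} {C : ℝ}
    (hm : AEStronglyMeasurable (Function.uncurry u) (spaceTimeMeasure n T))
    (hC : ∀ᵐ z ∂(spaceTimeMeasure n T), |u z.1 z.2| ≤ C) (s : ℝ≥0∞) : MemMixedLoc T ∞ s u := by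
  refine ⟨hm, fun K hK => ?_⟩
  rw [eLpNorm_exponent_top]
  refine (essSup_le_of_ae_le (volume K ^ s.toReal⁻¹ * ENNReal.ofReal C) ?_).trans_lt
    (ENNReal.mul_lt_top (volume_rpow_ne_top hK s).lt_top ENNReal.ofReal_lt_top)
  filter_upwards [Measure.ae_ae_of_ae_prod hC] with τ hτ
  rw [enorm_eq_self]
  simpa using eLpNorm_le_of_ae_bound (p := s) (μ := volume.restrict K) (ae_restrict_of_ae hτ)

variable [hss : ENNReal.HolderConjugate s s']

theorem exists_linear_section {V W : Type*} [AddCommGroup V] [Module ℝ V] [AddCommGroup W]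
    [Module ℝ W] (L : V →ₗ[ℝ] W) : ∃ σ : LinearMap.range L →ₗ[ℝ] V, ∀ F, L (σ F) = F.1 := by
  obtain ⟨σ, hσ⟩ := L.rangeRestrict.exists_rightInverse_of_surjective L.range_rangeRestrict
  exact ⟨σ, fun F => congrArg Subtype.val (LinearMap.congr_fun hσ F)⟩

/-- Bounded initial values have bounded solutions. -/
theorem exists_bounded_solution (hd : IsTransportData T s' b D c) (hT : 0 < T) {B : ℝ} (hB0 : 0 ≤ B)
    (hu₀ : AEStronglyMeasurable u₀ volume) (hB : ∀ᵐ p, |u₀ p| ≤ B) :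
    ∃ u : ℝ → Heis n → ℝ, MemMixed T ∞ ∞ u ∧ MemMixedLoc T ∞ s u ∧
      IsWeakSolution T b D c u₀ u := by
  set M := 2 * Real.exp (∫ τ, (4 * supNorm D τ + 3 * supNorm c τ) ∂(timeMeasure T)) with hM
  have hu₀l : LocallyIntegrable u₀ volume := by
    refine locallyIntegrable_iff.2 fun K hK => ?_
    exact Measure.integrableOn_of_bounded hK.measure_lt_top.ne hu₀ (ae_restrict_of_ae hB)
  have hφ0 : ∀ φ : testSubmodule n T, Continuous fun p : Heis n => φ.1 (0, p) := fun φ =>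
    φ.2.1.continuous.comp (continuous_const.prodMk continuous_id)
  have hφc : ∀ φ : testSubmodule n T, HasCompactSupport fun p : Heis n => φ.1 (0, p) := fun φ =>
    HasCompactSupport.intro (φ.2.2.1.image continuous_snd) fun p hp =>
      image_eq_zero_of_notMem_tsupport fun h => hp (mem_image_of_mem Prod.snd h)
  have hi : ∀ φ : testSubmodule n T, Integrable fun p => u₀ p * φ.1 (0, p) := fun φ =>
    integrable_mul_of_hasCompactSupport hu₀l (hφ0 φ) (hφc φ)
  let L : testSubmodule n T →ₗ[ℝ] integrableSubmodule (spaceTimeMeasure n T) :=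
    { toFun := fun φ => ⟨fun z => testRate b D c φ.1 z.1 z.2, integrable_testRate s hd hT φ.2⟩
      map_add' := fun φ φ' => Subtype.ext (funext fun z => testRate_add φ.2.1 φ'.2.1 z.1 z.2)
      map_smul' := fun a φ => Subtype.ext (funext fun z => testRate_smul a φ.2.1 z.1 z.2) }
  let ℓ : testSubmodule n T →ₗ[ℝ] ℝ :=
    { toFun := fun φ => ∫ p, u₀ p * φ.1 (0, p)
      map_add' := fun φ φ' => by
        rw [← integral_add (hi φ) (hi φ')]
        exact integral_congr_ae (.of_forall fun p => mul_add _ _ _)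
      map_smul' := fun a φ => by
        rw [RingHom.id_apply, smul_eq_mul, ← integral_const_mul]
        exact integral_congr_ae (.of_forall fun p => mul_left_comm _ _ _) }
  have hℓ : ∀ φ, ℓ φ ≤ B * M * ∫ z, |(L φ).1 z| ∂(spaceTimeMeasure n T) := fun φ => by
    have h1 := integral_abs_initial_le s hd hT φ.2
    have hφi := ((hφ0 φ).integrable_of_hasCompactSupport (hφc φ)).abs (μ := volume)
    calc ∫ p, u₀ p * φ.1 (0, p) ≤ ∫ p, B * |φ.1 (0, p)| := by
          refine integral_mono_ae (hi φ) (hφi.const_mul B) (hB.mono fun p hp => ?_)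
          refine (le_abs_self _).trans ?_
          rw [abs_mul]
          exact mul_le_mul_of_nonneg_right hp (abs_nonneg _)
      _ = B * ∫ p, |φ.1 (0, p)| := integral_const_mul _ _
      _ ≤ B * (M * ∫ z, |(L φ).1 z| ∂(spaceTimeMeasure n T)) := mul_le_mul_of_nonneg_left h1 hB0
      _ = _ := by ring
  obtain ⟨σ, hLσ⟩ := exists_linear_section L
  -- By the a priori estimate `ℓ` vanishes on the kernel of `L`. The functional `ℓ ∘ σ` on the range
  -- of `L` is thus independent of the linear section chosen.
  have hσL : ∀ φ, ℓ (σ ⟨L φ, φ, rfl⟩) = ℓ φ := fun φ => by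
    have h0 : ∀ χ, L χ = 0 → ℓ χ ≤ 0 := fun χ hχ => by
      have := hℓ χ
      rw [hχ] at this
      simpa using this
    have h1 : L (σ ⟨L φ, φ, rfl⟩ - φ) = 0 := by rw [map_sub, hLσ, sub_self]
    have h2 := h0 _ h1
    have h3 := h0 (-(σ ⟨L φ, φ, rfl⟩ - φ)) (by rw [map_neg, h1, neg_zero])
    rw [map_neg, map_sub] at h3
    rw [map_sub] at h2
    linarith
  -- Hahn–Banach with a multiple of the `L¹` seminorm. The bounded density `u` of the extension
  -- satisfies `∫ u (Lφ) = ∫ u₀ φ(0,·)`, which is the weak formulation.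
  obtain ⟨g, hg, hgN⟩ := exists_extension_of_le_sublinear
    (⟨LinearMap.range L, ℓ ∘ₗ σ⟩ : integrableSubmodule (spaceTimeMeasure n T) →ₗ.[ℝ] ℝ)
    (fun F => B * M * ∫ z, |F.1 z| ∂(spaceTimeMeasure n T))
    (fun a ha F => by
      have : ∀ z, |(a • F).1 z| = a * |F.1 z| := fun z => by
        rw [SetLike.val_smul, Pi.smul_apply, smul_eq_mul, abs_mul, abs_of_pos ha]
      simp only [this, integral_const_mul]
      ring)
    (fun F F' => by
      rw [← mul_add, ← integral_add (Integrable.abs F.2) (Integrable.abs F'.2)]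
      refine mul_le_mul_of_nonneg_left (integral_mono (Integrable.abs (F + F').2)
        ((Integrable.abs F.2).add (Integrable.abs F'.2)) fun z => abs_add_le _ _) (by positivity))
    (fun F => by
      have := hℓ (σ F)
      rw [hLσ] at this
      exact this)
  have : SigmaFinite (timeMeasure T) := by unfold timeMeasure; infer_instance
  have : SigmaFinite (spaceTimeMeasure n T) := by unfold spaceTimeMeasure; infer_instance
  obtain ⟨u, hum, hub, hu⟩ := exists_bounded_density g hgN
  have hm : AEStronglyMeasurable (Function.uncurry fun τ p => u (τ, p)) (spaceTimeMeasure n T) :=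
    hum.aestronglyMeasurable
  have huL := memMixedLoc_of_ae_le hm hub s
  refine ⟨fun τ p => u (τ, p), memMixed_top_of_ae_le hm hub, huL,
    (isWeakSolution_iff hd hT huL).2 fun φ hφ => ?_⟩
  have h1 := hu (L ⟨φ, hφ⟩)
  have h2 := hg ⟨L ⟨φ, hφ⟩, ⟨φ, hφ⟩, rfl⟩
  exact h1.symm.trans (h2.trans (hσL ⟨φ, hφ⟩))

end BoundedExistence

/-! ## Existence of solutions -/

section Existence

variable {n : ℕ} {T : EReal} {s s' : ℝ≥0∞} {b : HeisField n} {D c u : ℝ → Heis n → ℝ}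
  {u₀ : Heis n → ℝ}

theorem renormFun_le {a δ κ B z : ℝ} (ha : 0 < a) (hδ : 0 < δ) (hδ1 : δ ≤ 1) (hκ : 0 ≤ κ)
    (hz : |z| ≤ B) : renormFun a δ κ z ≤ (B ^ 2 + 1) ^ a := by
  have hd : 1 ≤ 1 + κ * z ^ 2 := le_add_of_nonneg_right (by positivity)
  rw [renormFun]
  set θ := z ^ 2 / (1 + κ * z ^ 2) with hθ
  have hθ0 : 0 ≤ θ := by positivity
  have hθB : θ ≤ B ^ 2 := by
    refine (div_le_self (sq_nonneg z) hd).trans ?_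
    rw [← sq_abs]
    exact pow_le_pow_left₀ (abs_nonneg z) hz 2
  have hp : 0 < θ + δ := by positivity
  calc θ * (θ + δ) ^ (a - 1) ≤ (θ + δ) * (θ + δ) ^ (a - 1) := by gcongr; linarith
    _ = (θ + δ) ^ a := by rw [Real.rpow_sub_one hp.ne', mul_div_cancel₀ _ hp.ne']
    _ ≤ _ := Real.rpow_le_rpow hp.le (by linarith) ha.le

theorem tendsto_lintegral_renormFun {a B : ℝ} (ha : 0 < a) {K : Set (Heis n)} (hK : IsCompact K)
    (hm : AEStronglyMeasurable u₀ volume) (hB : ∀ p, |u₀ p| ≤ B) (h0 : ∀ p ∉ K, u₀ p = 0) :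
    Tendsto (fun k : ℕ => ∫⁻ p, ENNReal.ofReal
      (renormFun a (1 / ((k : ℝ) + 1)) (1 / ((k : ℝ) + 1)) (u₀ p))) atTop
      (𝓝 (∫⁻ p, ENNReal.ofReal (|u₀ p| ^ (2 * a)))) := by
  have hk : ∀ k : ℕ, 0 < 1 / ((k : ℝ) + 1) := fun k => by positivity
  refine tendsto_lintegral_of_dominated_convergence'
    (K.indicator fun _ => ENNReal.ofReal ((B ^ 2 + 1) ^ a))
    (fun k => ((contDiff_renormFun a (hk k) (hk k).le).continuous.comp_aestronglyMeasurable
      hm).aemeasurable.ennreal_ofReal) (fun k => .of_forall fun p => ?_) ?_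
    (.of_forall fun p => ENNReal.tendsto_ofReal (tendsto_renormFun a (u₀ p) ha
      tendsto_one_div_add_atTop_nhds_zero_nat tendsto_one_div_add_atTop_nhds_zero_nat))
  · by_cases hp : p ∈ K
    · rw [indicator_of_mem hp]
      refine ENNReal.ofReal_le_ofReal (renormFun_le ha (hk k) ?_ (hk k).le (hB p))
      exact (div_le_one (by positivity)).2 (by linarith [(k.cast_nonneg : (0 : ℝ) ≤ k)])
    · simp only [h0 p hp]
      simp [renormFun]
  · rw [lintegral_indicator hK.measurableSet, setLIntegral_const]
    exact ENNReal.mul_ne_top ENNReal.ofReal_ne_top hK.measure_lt_top.ne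

theorem eLpNorm_eq_lintegral_abs_rpow (h0 : s ≠ 0) (htop : s ≠ ∞) (w : Heis n → ℝ) :
    eLpNorm w s volume = (∫⁻ p, ENNReal.ofReal (|w p| ^ s.toReal)) ^ (1 / s.toReal) := by
  rw [eLpNorm_eq_lintegral_rpow_enorm_toReal h0 htop]
  congr 2 with p
  rw [← ENNReal.ofReal_rpow_of_nonneg (abs_nonneg _) ENNReal.toReal_nonneg,
    ← Real.norm_eq_abs, ofReal_norm]

variable [hss : ENNReal.HolderConjugate s s']

/-- The stability estimate is applied with `renormFun (s/2) δ κ` and `δ = κ → 0`. On the initial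
side dominated convergence is available because the data are bounded with compact support; on the
side of the solution Fatou suffices. The constant depends only on `s` and the coefficients. -/
theorem exists_eLpNorm_stability (hn : 1 ≤ n) (hd : IsTransportData T s' b D c)
    (hgrowth : HasGrowth T b) (htop : s ≠ ∞) : ∃ M : ℝ≥0∞, M ≠ ∞ ∧
    ∀ (u : ℝ → Heis n → ℝ) (u₀ : Heis n → ℝ), MemMixedLoc T ∞ s u → IsWeakSolution T b D c u₀ u →
      Continuous u₀ → HasCompactSupport u₀ →
      ∀ᵐ τ ∂(timeMeasure T), eLpNorm (u τ) s volume ≤ M * eLpNorm u₀ s volume := by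
  have hs1 := ENNReal.HolderConjugate.one_le s s'
  have hs0 : s ≠ 0 := (zero_lt_one.trans_le hs1).ne'
  set r := s.toReal with hr
  have hr0 : 0 < r := ENNReal.toReal_pos hs0 htop
  set M₀ := ENNReal.ofReal (Real.exp (∫ τ, (supNorm D τ +
    2 * (1 + |r / 2 - 1|) * supNorm c τ) ∂(timeMeasure T))) with hM₀
  refine ⟨M₀ ^ (1 / r), ENNReal.rpow_ne_top_of_nonneg (by positivity) ENNReal.ofReal_ne_top,
    fun u u₀ hu hsol hc hcs => ?_⟩
  have hk : ∀ k : ℕ, 0 < 1 / ((k : ℝ) + 1) := fun k => by positivity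
  have hu₀ : MemLpLoc u₀ s := memLpLoc_of_memLp (hc.memLp_of_hasCompactSupport hcs)
  have h1 : ∀ k : ℕ, ∀ᵐ τ ∂(timeMeasure T), ∫⁻ p, ENNReal.ofReal
      (renormFun (r / 2) (1 / ((k : ℝ) + 1)) (1 / ((k : ℝ) + 1)) (u τ p)) ≤
      M₀ * ∫⁻ p, ENNReal.ofReal
        (renormFun (r / 2) (1 / ((k : ℝ) + 1)) (1 / ((k : ℝ) + 1)) (u₀ p)) := fun k => by
    obtain ⟨B, hB, hB'⟩ := exists_bound_renormFun (r / 2) (hk k) (hk k)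
    exact ae_lintegral_stability hn hd hgrowth hu hu₀ hsol
      (contDiff_renormFun _ (hk k) (hk k).le) hB hB'
      (abs_mul_deriv_renormFun_le _ (hk k) (hk k).le) (by positivity)
  obtain ⟨B, hB⟩ := hcs.exists_bound_of_continuous hc
  have lim := (ENNReal.Tendsto.const_mul (tendsto_lintegral_renormFun (half_pos hr0) hcs
    hc.aestronglyMeasurable hB fun p hp => image_eq_zero_of_notMem_tsupport hp)
      (.inr (ENNReal.ofReal_ne_top : M₀ ≠ ∞)))
  filter_upwards [ae_all_iff.2 h1, hu.1.prodMk_left] with τ h2 h3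
  have h4 : ∫⁻ p, ENNReal.ofReal (|u τ p| ^ (2 * (r / 2))) ≤
      M₀ * ∫⁻ p, ENNReal.ofReal (|u₀ p| ^ (2 * (r / 2))) := by
    have h5 : ∀ p, ENNReal.ofReal (|u τ p| ^ (2 * (r / 2))) = liminf (fun k : ℕ => ENNReal.ofReal
        (renormFun (r / 2) (1 / ((k : ℝ) + 1)) (1 / ((k : ℝ) + 1)) (u τ p))) atTop := fun p =>
      (ENNReal.tendsto_ofReal (tendsto_renormFun (r / 2) (u τ p) (half_pos hr0)
        tendsto_one_div_add_atTop_nhds_zero_nat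
        tendsto_one_div_add_atTop_nhds_zero_nat)).liminf_eq.symm
    refine (lintegral_congr h5).trans_le ((lintegral_liminf_le' fun k => ((contDiff_renormFun _ (hk k)
      (hk k).le).continuous.comp_aestronglyMeasurable h3).aemeasurable.ennreal_ofReal).trans
        ((liminf_le_liminf (.of_forall h2)).trans_eq lim.liminf_eq))
  rw [mul_div_cancel₀ _ two_ne_zero] at h4
  rw [eLpNorm_eq_lintegral_abs_rpow hs0 htop, eLpNorm_eq_lintegral_abs_rpow hs0 htop,
    ← ENNReal.mul_rpow_of_nonneg _ _ (by positivity)]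
  exact ENNReal.rpow_le_rpow h4 (by positivity)

/-- Completeness of `L^s` at each time would not give a function measurable in `(τ, p)`. Summability
of the bounds yields convergence at almost every point of space-time, so the pointwise limit is
measurable, and Fatou transfers the bounds to it. -/
theorem exists_limit_of_cauchy {U : ℕ → ℝ → Heis n → ℝ} (hs : 1 ≤ s)
    (hm : ∀ k, AEStronglyMeasurable (Function.uncurry (U k)) (spaceTimeMeasure n T))
    {B : ℕ → ℝ≥0∞} (hB : ∑' k, B k ≠ ∞)
    (hU : ∀ N k m, N ≤ k → N ≤ m → ∀ᵐ τ ∂(timeMeasure T),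
      eLpNorm (fun p => U k τ p - U m τ p) s volume < B N) :
    ∃ u : ℝ → Heis n → ℝ, AEStronglyMeasurable (Function.uncurry u) (spaceTimeMeasure n T) ∧
      ∀ k, ∀ᵐ τ ∂(timeMeasure T), eLpNorm (fun p => U k τ p - u τ p) s volume ≤ B k := by
  have hU' : ∀ᵐ τ ∂(timeMeasure T), ∀ N k m, N ≤ k → N ≤ m →
      eLpNorm (fun p => U k τ p - U m τ p) s volume < B N := by
    simp only [ae_all_iff]
    exact hU
  have hms : ∀ᵐ τ ∂(timeMeasure T), ∀ k, AEStronglyMeasurable (U k τ) volume :=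
    ae_all_iff.2 fun k => (hm k).prodMk_left
  have hlim : ∀ᵐ z ∂(spaceTimeMeasure n T), ∃ l : ℝ,
      Tendsto (fun k => Function.uncurry (U k) z) atTop (𝓝 l) := by
    refine ae_prod_of_ae_ae ?_ ?_
    · have h1 : MeasurableSet {z | ∃ l : ℝ, Tendsto (fun k => (hm k).mk _ z) atTop (𝓝 l)} :=
        measurableSet_exists_tendsto fun k => (hm k).stronglyMeasurable_mk.measurable
      refine h1.nullMeasurableSet.congr ?_
      filter_upwards [ae_all_iff.2 fun k => (hm k).ae_eq_mk] with z hz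
      refine propext (exists_congr fun l => ?_)
      simp only [hz]
    · filter_upwards [hU', hms] with τ h1 h2
      exact Lp.ae_tendsto_of_cauchy_eLpNorm h2 hs hB h1
  obtain ⟨f, hf, hft⟩ := exists_stronglyMeasurable_limit_of_tendsto_ae hm hlim
  refine ⟨fun τ p => f (τ, p), hf.aestronglyMeasurable, fun k => ?_⟩
  filter_upwards [hU', hms, Measure.ae_ae_of_ae_prod hft] with τ h1 h2 h3
  refine (Lp.eLpNorm_lim_le_liminf_eLpNorm (f := fun m p => U k τ p - U m τ p)
    (fun m => (h2 k).sub (h2 m)) _ (h3.mono fun p hp => hp.const_sub _)).trans ?_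
  refine le_trans liminf_le_limsup (limsup_le_of_le (by isBoundedDefault) ?_)
  filter_upwards [eventually_ge_atTop k] with m hkm
  exact (h1 k k m le_rfl hkm).le

/-- Continuous data with compact support are dense in `L^s` and have bounded solutions. By linearity
and stability, geometric approximation of the data gives solutions that are Cauchy in `L^∞(L^s)`,
and the weak formulation passes to the limit because the operator applied to a test function lies in
`L¹(L^{s'})`. -/
theorem exists_solution (hn : 1 ≤ n) (hd : IsTransportData T s' b D c) (hT : 0 < T)
    (hgrowth : HasGrowth T b) (htop : s ≠ ∞) (hu₀ : MemLp u₀ s volume) :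
    ∃ u : ℝ → Heis n → ℝ, MemMixed T ∞ s u ∧ MemMixedLoc T ∞ s u ∧
      IsWeakSolution T b D c u₀ u := by
  have hs1 := ENNReal.HolderConjugate.one_le s s'
  have hs1' : 1 ≤ s' := by
    have : ENNReal.HolderConjugate s' s := ENNReal.HolderConjugate.symm
    exact ENNReal.HolderConjugate.one_le s' s
  obtain ⟨M, hM, hstab⟩ := exists_eLpNorm_stability hn hd hgrowth htop
  let ε : ℕ → ℝ≥0∞ := fun k => (2⁻¹ : ℝ≥0∞) ^ k
  have h2 : (2⁻¹ : ℝ≥0∞) < 1 := by simp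
  have hε0 : ∀ k, ε k ≠ 0 := fun k => pow_ne_zero _ (by simp)
  have hεt : Tendsto ε atTop (𝓝 0) :=
    ENNReal.tendsto_pow_atTop_nhds_zero_of_lt_one h2
  have hεtop : ∀ k, ε k ≠ ∞ := fun k => ENNReal.pow_ne_top (by simp)
  have hεa : Antitone ε := pow_right_anti₀ zero_le h2.le
  have : (volume : Measure (Heis n)).Regular := .of_sigmaCompactSpace_of_isLocallyFiniteMeasure _
  choose w hwc hwe hw hwm using fun k => hu₀.exists_hasCompactSupport_eLpNorm_sub_le htop (hε0 k)
  have hB : ∀ k, ∃ B : ℝ, 0 ≤ B ∧ ∀ᵐ p, |w k p| ≤ B := fun k => by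
    obtain ⟨B, hB⟩ := (hwc k).exists_bound_of_continuous (hw k)
    exact ⟨B, (norm_nonneg _).trans (hB 0), .of_forall hB⟩
  choose B hB0 hB using hB
  choose U _ hUl hUs using fun k => exists_bounded_solution (s := s) hd hT (hB0 k)
    (hw k).aestronglyMeasurable (hB k)
  -- The factor `2 M + 1` in place of `2 M` makes the inequality strict, as the Cauchy criterion
  -- demands.
  have hdiff : ∀ N k m, N ≤ k → N ≤ m → ∀ᵐ τ ∂(timeMeasure T),
      eLpNorm (fun p => U k τ p - U m τ p) s volume < (2 * M + 1) * ε N := fun N k m hk hm => by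
    have h1 := IsWeakSolution.sub hd hT (hUl k) (hUl m) (hw k).locallyIntegrable
      (hw m).locallyIntegrable (hUs k) (hUs m)
    have h2 := hstab _ _ ((hUl k).sub hs1 (hUl m)) h1 ((hw k).sub (hw m)) ((hwc k).sub (hwc m))
    have h3 : eLpNorm (fun p => w k p - w m p) s volume ≤ 2 * ε N := by
      have e : (fun p => w k p - w m p) = (u₀ - w m) - (u₀ - w k) := by ext p; simp
      rw [e, two_mul]
      exact (eLpNorm_sub_le (hu₀.1.sub (hwm m).1) (hu₀.1.sub (hwm k).1) hs1).trans
        (add_le_add ((hwe m).trans (hεa hm)) ((hwe k).trans (hεa hk)))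
    filter_upwards [h2] with τ h2
    calc _ ≤ M * (2 * ε N) := h2.trans (mul_le_mul_right h3 M)
      _ = 2 * M * ε N := by ring
      _ < 2 * M * ε N + ε N := ENNReal.lt_add_right
          (ENNReal.mul_ne_top (ENNReal.mul_ne_top (by simp) hM) (hεtop N)) (hε0 N)
      _ = (2 * M + 1) * ε N := by ring
  have hC : 2 * M + 1 ≠ ∞ := ENNReal.add_ne_top.2 ⟨ENNReal.mul_ne_top (by simp) hM, by simp⟩
  obtain ⟨u, hum, hu⟩ := exists_limit_of_cauchy hs1 (fun k => (hUl k).1)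
    (B := fun k => (2 * M + 1) * ε k) (by
      rw [ENNReal.tsum_mul_left, ENNReal.tsum_geometric]
      exact ENNReal.mul_ne_top hC (by simp)) hdiff
  have huM : MemMixed T ∞ s u := by
    refine ⟨hum, ?_⟩
    rw [eLpNorm_exponent_top]
    refine (essSup_le_of_ae_le (M * eLpNorm (w 0) s volume + (2 * M + 1) * ε 0) ?_).trans_lt
      (ENNReal.add_lt_top.2 ⟨ENNReal.mul_lt_top hM.lt_top (hwm 0).2,
        ENNReal.mul_lt_top hC.lt_top (hεtop 0).lt_top⟩)
    filter_upwards [hu 0, hstab _ _ (hUl 0) (hUs 0) (hw 0) (hwc 0), hum.prodMk_left,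
      (hUl 0).1.prodMk_left] with τ h1 h2 h3 h4
    rw [enorm_eq_self]
    have e : u τ = U 0 τ - fun p => U 0 τ p - u τ p := by ext p; simp
    rw [e]
    exact (eLpNorm_sub_le h4 (h4.sub h3) hs1).trans (add_le_add h2 h1)
  have huL : MemMixedLoc T ∞ s u := by
    refine ⟨hum, fun K hK => lt_of_le_of_lt ?_ huM.2⟩
    rw [eLpNorm_exponent_top, eLpNorm_exponent_top]
    refine essSup_mono_ae (.of_forall fun τ => ?_)
    simp only [enorm_eq_self]
    exact eLpNorm_mono_measure _ Measure.restrict_le_self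
  refine ⟨u, huM, huL, (isWeakSolution_iff hd hT huL).2 fun φ hφ => ?_⟩
  have hL := memMixed_testRate hs1' hd hT hφ
  have lim1 : Tendsto (fun k => ∫ z, U k z.1 z.2 * testRate b D c φ z.1 z.2
      ∂(spaceTimeMeasure n T)) atTop
      (𝓝 (∫ z, u z.1 z.2 * testRate b D c φ z.1 z.2 ∂(spaceTimeMeasure n T))) := by
    refine tendsto_integral_of_L1 _ (integrable_mul_testRate hd hT huL hφ).1
      (.of_forall fun k => integrable_mul_testRate hd hT (hUl k) hφ) ?_
    have l0 : Tendsto (fun k => (2 * M + 1) * ε k * ∫⁻ τ, eLpNorm (testRate b D c φ τ) s' volume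
        ∂(timeMeasure T)) atTop (𝓝 0) := by
      have := (ENNReal.Tendsto.mul_const (ENNReal.Tendsto.const_mul hεt (.inr hC))
        (.inr hL.lintegral_lt_top.ne) : Tendsto _ _ _)
      simpa using this
    refine tendsto_of_tendsto_of_tendsto_of_le_of_le tendsto_const_nhds l0 (fun _ => zero_le)
      fun k => ?_
    have hm : AEMeasurable (fun z : ℝ × Heis n => ‖U k z.1 z.2 * testRate b D c φ z.1 z.2 -
        u z.1 z.2 * testRate b D c φ z.1 z.2‖ₑ) (spaceTimeMeasure n T) :=
      ((integrable_mul_testRate hd hT (hUl k) hφ).1.sub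
        (integrable_mul_testRate hd hT huL hφ).1).enorm
    simp only
    rw [spaceTimeMeasure, lintegral_prod _ hm, ← lintegral_const_mul' _ _
      (ENNReal.mul_ne_top hC (hεtop k))]
    refine lintegral_mono_ae ?_
    filter_upwards [hu k, hum.prodMk_left, (hUl k).1.prodMk_left, hL.1.prodMk_left]
      with τ h1 h2 h3 h4
    simp only [← sub_mul]
    exact (lintegral_enorm_mul_le (h3.sub h2) h4).trans (mul_le_mul_left h1 _)
  have hφ0 : Continuous fun p : Heis n => φ (0, p) :=
    hφ.1.continuous.comp (continuous_const.prodMk continuous_id)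
  have hφc : HasCompactSupport fun p : Heis n => φ (0, p) :=
    HasCompactSupport.intro (hφ.2.1.image continuous_snd) fun p hp =>
      image_eq_zero_of_notMem_tsupport fun h => hp (mem_image_of_mem Prod.snd h)
  have hφL : MemLp (fun p : Heis n => φ (0, p)) s' volume := hφ0.memLp_of_hasCompactSupport hφc
  have i0 := fun (f : Heis n → ℝ) (hf : LocallyIntegrable f volume) =>
    integrable_mul_of_hasCompactSupport hf hφ0 hφc
  have lim2 : Tendsto (fun k => ∫ p, w k p * φ (0, p)) atTop (𝓝 (∫ p, u₀ p * φ (0, p))) := by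
    refine tendsto_integral_of_L1 _ (i0 _ (hu₀.locallyIntegrable hs1)).1
      (.of_forall fun k => i0 _ (hw k).locallyIntegrable) ?_
    have l0 : Tendsto (fun k => ε k * eLpNorm (fun p : Heis n => φ (0, p)) s' volume) atTop
        (𝓝 0) := by
      simpa using ENNReal.Tendsto.mul_const hεt (.inr hφL.2.ne)
    refine tendsto_of_tendsto_of_tendsto_of_le_of_le tendsto_const_nhds l0 (fun _ => zero_le)
      fun k => ?_
    simp only [← sub_mul]
    refine (lintegral_enorm_mul_le (s := s) (s' := s') ((hwm k).1.sub hu₀.1) hφL.1).trans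
      (mul_le_mul_left ?_ _)
    rw [← eLpNorm_neg]
    refine le_trans (le_of_eq ?_) (hwe k)
    congr 1
    ext p
    simp
  refine tendsto_nhds_unique lim1 (lim2.congr fun k => ?_)
  exact ((isWeakSolution_iff hd hT (hUl k)).1 (hUs k) φ hφ).symm

end Existence

/-! ## Well-posedness -/

variable {n : ℕ} {T : EReal} {s s' : ℝ≥0∞} {b : HeisField n} {D c ψ : ℝ → Heis n → ℝ}

theorem IsWeakFrameDeriv.ae_unique {i : FrameIdx n} {u g g' : Heis n → ℝ}
    (h : IsWeakFrameDeriv i u g) (h' : IsWeakFrameDeriv i u g') : g =ᵐ[volume] g' := by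
  refine ae_eq_of_integral_contDiff_smul_eq h.2.1 h'.2.1 fun φ hφ hφc => ?_
  have := (h.2.2 φ hφ hφc).symm.trans (h'.2.2 φ hφ hφc)
  simp only [smul_eq_mul, mul_comm (φ _)]
  exact neg_injective this

theorem memMixed_of_ae_eq_const_mul {q : ℝ≥0∞} {F f : ℝ → Heis n → ℝ} (a : ℝ)
    (hF : AEStronglyMeasurable (Function.uncurry F) (spaceTimeMeasure n T))
    (hf : MemMixed T 1 q f) (h : ∀ᵐ τ ∂(timeMeasure T), F τ =ᵐ[volume] fun p => a * f τ p) :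
    MemMixed T 1 q F := by
  refine memMixed_one_of_le (k := fun τ => ‖a‖ₑ * eLpNorm (f τ) q volume) hF ?_ ?_
  · rw [lintegral_const_mul' _ _ enorm_ne_top]
    exact ENNReal.mul_ne_top enorm_ne_top hf.lintegral_lt_top.ne
  · filter_upwards [h] with τ h1
    rw [eLpNorm_congr_ae h1]
    exact (eLpNorm_const_smul a (f τ) q volume).le

/-- Weak derivatives are unique, so the coefficients of `b` agree a.e. with those built from the
given derivatives of `ψ` and inherit their mixed norms. -/
theorem isTransportData_of_contact (hψ : MemL1HorSobolev2 T s' ψ) (hb : IsContactFieldOf T b ψ)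
    (hc : MemMixed T 1 ∞ c) (hD : IsDivergence T b D) (hD' : MemMixed T 1 ∞ D) :
    IsTransportData T s' b D c := by
  obtain ⟨hψm, g, H, hg, hH, hder⟩ := hψ
  have hbm : ∀ i, AEStronglyMeasurable (Function.uncurry fun τ p => b τ p i)
      (spaceTimeMeasure n T) := fun i =>
    (EuclideanSpace.proj (𝕜 := ℝ) i).continuous.comp_aestronglyMeasurable hb.1
  have hcoeff : ∀ᵐ τ ∂(timeMeasure T), ∀ i,
      (fun p => b τ p i) =ᵐ[volume] contactCoeff (ψ τ) (fun i => g i τ) i := by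
    filter_upwards [hder, hb.2] with τ h1 h2
    rintro ((j | j) | j)
    · exact (h2.1 j).ae_unique (h1.1 _)
    · filter_upwards [(h2.2.1 j).ae_unique (h1.1 _)] with p hp
      simp [contactCoeff, ← hp]
    · exact h2.2.2
  refine ⟨⟨ψ, g, H, hH, ?_⟩, ?_, hD', hc⟩
  · filter_upwards [hder, hcoeff, hψm.ae_memLp, ae_all_iff.2 fun i => (hg i).ae_memLp,
      ae_all_iff.2 fun i => ae_all_iff.2 fun j => (hH i j).ae_memLp, hD'.ae_memLp, hD]
      with τ h1 h2 h3 h4 h5 h6 h7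
    exact ⟨h1.1, h1.2, h3, h4, h5, h2, h6, h7.2.2⟩
  · rintro ((j | j) | j)
    · refine memMixed_of_ae_eq_const_mul 1 (hbm _) (hg (Sum.inr j)) ?_
      filter_upwards [hcoeff] with τ h
      filter_upwards [h (Sum.inl (Sum.inl j))] with p hp
      simpa [contactCoeff] using hp
    · refine memMixed_of_ae_eq_const_mul (-1) (hbm _) (hg (Sum.inl j)) ?_
      filter_upwards [hcoeff] with τ h
      filter_upwards [h (Sum.inl (Sum.inr j))] with p hp
      simpa [contactCoeff] using hp
    · refine memMixed_of_ae_eq_const_mul (-4) (hbm _) hψm ?_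
      filter_upwards [hcoeff] with τ h
      exact h (Sum.inr j)

theorem exists_distributionalSolution [ENNReal.HolderConjugate s s'] (hn : 1 ≤ n)
    (hd : IsTransportData T s' b D c) (hT : 0 < T) (hgrowth : HasGrowth T b) {u₀ : Heis n → ℝ}
    (hu₀ : MemLp u₀ s volume) :
    ∃ u : ℝ → Heis n → ℝ, MemMixed T ∞ s u ∧ IsDistributionalSolution T s b D c u₀ u := by
  rcases eq_or_ne s ∞ with rfl | hs
  -- For `s = ∞` compactly supported continuous functions are not dense, but the duality argument
  -- yields the solution directly.
  · have hB : ∀ᵐ p, |u₀ p| ≤ (eLpNorm u₀ ∞ volume).toReal := by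
      rw [eLpNorm_exponent_top]
      filter_upwards [enorm_ae_le_eLpNormEssSup u₀ volume] with p hp
      have := ENNReal.toReal_mono (by simpa using hu₀.eLpNorm_ne_top) hp
      simpa using this
    obtain ⟨u, h1, h2, h3⟩ := exists_bounded_solution (s := ∞) hd hT ENNReal.toReal_nonneg
      hu₀.1 hB
    exact ⟨u, h1, h2, fun _ => h1, h3⟩
  · obtain ⟨u, h1, h2, h3⟩ := exists_solution hn hd hT hgrowth hs hu₀
    exact ⟨u, h1, h2, fun h => absurd h hs, h3⟩

end

theorem mainTheorem2 (n : ℕ) (hn : 1 ≤ n) (T : EReal) (hT : 0 < T)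
    (s s' : ℝ≥0∞) (hs : 1 ≤ s) (hss' : s⁻¹ + s'⁻¹ = 1)
    (u₀ : Heis n → ℝ) (hu₀ : MemLp u₀ s volume)
    (ψ : ℝ → Heis n → ℝ) (hψ : MemL1HorSobolev2 T s' ψ)
    (b : HeisField n) (hb : IsContactFieldOf T b ψ)
    (c : ℝ → Heis n → ℝ) (hc : MemMixed T 1 ∞ c)
    (D : ℝ → Heis n → ℝ) (hD : IsDivergence T b D) (hD' : MemMixed T 1 ∞ D)
    (hgrowth : HasGrowth T b) :
    ∃ u : ℝ → Heis n → ℝ,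
      (MemMixed T ∞ s u ∧ IsDistributionalSolution T s b D c u₀ u) ∧
      ∀ v : ℝ → Heis n → ℝ,
        MemMixed T ∞ s v → IsDistributionalSolution T s b D c u₀ v →
          Function.uncurry v =ᵐ[spaceTimeMeasure n T] Function.uncurry u := by
  have : ENNReal.HolderConjugate s s' := ENNReal.holderConjugate_iff.2 hss'
  have hd := isTransportData_of_contact hψ hb hc hD hD'
  obtain ⟨u, hu, hsol⟩ := exists_distributionalSolution hn hd hT hgrowth hu₀
  exact ⟨u, ⟨hu, hsol⟩, fun v _ hv => weakSolution_ae_eq hn hd hT hgrowth hv.1 hsol.1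
    (memLpLoc_of_memLp hu₀) hv.2.2 hsol.2.2⟩
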